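/- **Setting.** Let $n\in\{2,3\}$, $\Omega\subset\mathbb R^n$ a bounded Lipschitz domain, $\Gamma_{\mathrm{Dir}}$ a relatively open subset of $\partial\Omega$, $\frac n2<m<2$, $T,\mu,\nu,\kappa>0$. $\mathbb M_{\rm sym}$ denotes the symmetric $n\times n$ matrices, $\mathbb M_{D}$ those with null trace, $\xi_D$ the deviatoric part of $\xi$, $E(u)=\frac12(\nabla u+\nabla u^{T})$. Let $H^1_{\rm Dir}$ be the space of $u\in H^1(\Omega;\mathbb R^n)$ with null trace on $\Gamma_{\rm Dir}$, and $H^m(\Omega)$ the Hilbert space with inner product $\int_\Omega z_1z_2\,dx+a_m(z_1,z_2)$, $$a_m(z_1,z_2)=\int_\Omega\int_\Omega\frac{(\nabla z_1(x)-\nabla z_1(y))\cdot(\nabla z_2(x)-\nabla z_2(y))}{|x-y|^{n+2(m-1)}}\,dx\,dy .$$ Set $\mathbf Q=H^1_{\rm Dir}\times H^m(\Omega)\times L^2(\Omega;\mathbb M_D)$ and write $q=(u,z,p)$. *Data.* (i) $\mathbb C:[0,\infty)\to \mathrm{Lin}(\mathbb M_{\rm sym};\mathbb M_{\rm sym})$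 is of class $C^{1}$ with locally Lipschitz derivative, $\mathbb C(z)$ is symmetric, $z\mapsto\mathbb C(z)\xi:\xi$ is nondecreasing, and $\gamma_1|\xi|^2\le\mathbb C(z)\xi:\xi\le\gamma_2|\xi|^2$ with $\gamma_1,\gamma_2>0$. (ii) $\mathbb D\in C^0(\overline\Omega;\mathrm{Lin}(\mathbb M_{\rm sym};\mathbb M_{\rm sym}))$ is symmetric with $\delta_1|A|^2\le\mathbb D(x)A:A\le\delta_2|A|^2$, $\delta_1,\delta_2>0$. (iii) $W\in C^2((0,\infty);[0,\infty))$ with $s^{2n}W(s)\to+\infty$ as $s\to0^+$. (iv) $K(z)\subset\mathbb M_D$, $z\ge0$, are closed convex sets with $B_{\bar r}(0)\subset K(z_1)\subset K(z_2)\subset B_{\bar R}(0)$ for $0\le z_1\le z_2$ (for some $0<\bar r<\bar R$), Lipschitz in $z$ for the Hausdorff distance. (v) The Dirichlet loading $w:[0,T]\to H^1(\Omega;\mathbb R^n)$ and the total load $F:[0,T]\to H^1(\Omega;\mathbb R^n)^*$ are absolutely continuous. *Energy.* With $e=E(u+w(t))-p$ and $\sigma=\mathbb C(z)e$, $$\mathcal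 E_\mu(t,q)=\tfrac12\int_\Omega\mathbb C(z)e:e\,dx+\int_\Omega\big(W(z)+\tfrac\mu2|p|^2\big)dx+\tfrac12a_m(z,z)-\langle F(t),u+w(t)\rangle$$ if $z>0$ in $\overline\Omega$, and $\mathcal E_\mu(t,q)=+\infty$ otherwise. $\mathrm D_u,\mathrm D_z,\mathrm D_p$ denote its partial Fréchet derivatives. *Dissipation.* $\mathcal R(\zeta)=\int_\Omega(-\kappa\zeta)\,dx$ if $\zeta\le0$ a.e. and $+\infty$ otherwise; $H(z,\pi)=\sup_{\sigma\in K(z)}\sigma:\pi$, $\mathcal H(z,\pi)=\int_\Omega H(z,\pi)\,dx$; $\mathcal V_{2,\nu}(v)=\frac\nu2\|v\|_{H^1,\mathbb D}^2$ with $\|v\|^2_{H^1,\mathbb D}=\int_\Omega\mathbb D E(v):E(v)\,dx$; $\mathcal R_2(\zeta)=\frac12\|\zeta\|_{L^2}^2$; $\mathcal H_{2,\nu}(\pi)=\frac\nu2\|\pi\|_{L^2}^2$. $\partial$ denotes convex subdifferentials, $\partial\mathcal R(\cdot)\subset H^m(\Omega)^*$, $\partial_\pi\mathcal H(z,\cdot)\subset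 L^2(\Omega;\mathbb M_D)$. *Contact potential.* Let $\|\eta\|_{(H^1,\mathbb D)^*}=\sup\{\langle\eta,v\rangle: v\in H^1_{\rm Dir},\ \|v\|_{H^1,\mathbb D}\le1\}$; let $\widetilde d(\chi,\partial\mathcal R(0))$ be the infimum of $\|\chi-\gamma\|_{L^2}$ over the $\gamma\in\partial\mathcal R(0)$ with $\chi-\gamma\in L^2(\Omega)$ ($+\infty$ if there is none); let $d$ be the $L^2$-distance. Put $$\mathcal D_\nu(q')=\big(\nu\|u'\|_{H^1,\mathbb D}^2+\|z'\|_{L^2}^2+\nu\|p'\|_{L^2}^2\big)^{1/2},$$ $$\mathcal D^{*,\mu}_\nu(t,q)=\big(\tfrac1\nu\|{-}\mathrm D_u\mathcal E_\mu\|^2_{(H^1,\mathbb D)^*}+\widetilde d({-}\mathrm D_z\mathcal E_\mu,\partial\mathcal R(0))^2+\tfrac1\nu d({-}\mathrm D_p\mathcal E_\mu,\partial_\pi\mathcal H(z,0))^2\big)^{1/2}$$ (derivatives at $(t,q)$), and $\mathcal M(t,q,t',q')=\mathcal R(z')+\mathcal H(z,p')+\mathcal M^{\rm red}(t,q,t',q')$,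 where for $t'>0$ $\mathcal M^{\rm red}=0$ if $\mathrm D_u\mathcal E_\mu(t,q)=0$, $-\mathrm D_z\mathcal E_\mu(t,q)\in\partial\mathcal R(0)$, $-\mathrm D_p\mathcal E_\mu(t,q)\in\partial_\pi\mathcal H(z,0)$, and $+\infty$ otherwise, while for $t'=0$ $\mathcal M^{\rm red}=\mathcal D_\nu(q')\,\mathcal D^{*,\mu}_\nu(t,q)$, with the convention $0\cdot\infty=+\infty$ if $\mathcal D_\nu(q')=0$, $\mathcal D^{*,\mu}_\nu(t,q)=+\infty$. *Curves and BV solutions.* A parameterized curve is a pair $(\mathsf t,\mathsf q)\in AC([0,S];[0,T]\times\mathbf Q)$, $S>0$, with $\mathsf t$ nondecreasing. It is a (parameterized) BV solution to the rate-independent system with hardening if $\mathcal E_\mu(\mathsf t(s),\mathsf q(s))<\infty$ and $$\mathcal E_\mu(\mathsf t(s),\mathsf q(s))+\int_0^s\mathcal M(\mathsf t,\mathsf q,\mathsf t',\mathsf q')\,dr=\mathcal E_\mu(\mathsf t(0),\mathsf q(0))+\int_0^s\partial_t\mathcal E_\mu(\mathsf t,\mathsf q)\,\mathsf t'\,dr\qquad\text{for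 all }s\in[0,S].$$ **Proposition.** 1. If $(\mathsf t,\mathsf q)=(\mathsf t,\mathsf u,\mathsf z,\mathsf p)$ is a BV solution, then there is a measurable $\lambda:[0,S]\to[0,1]$ with $\mathsf t'(s)\lambda(s)=0$ for a.a. $s\in(0,S)$ such that for a.a. $s\in(0,S)$ $$\begin{aligned} &\lambda\,\mathrm D\mathcal V_{2,\nu}(\mathsf u')+(1-\lambda)\,\mathrm D_u\mathcal E_\mu(\mathsf t,\mathsf q)=0&&\text{in }(H^1_{\rm Dir})^*,\\ &(1-\lambda)\,\partial\mathcal R(\mathsf z')+\lambda\,\mathrm D\mathcal R_2(\mathsf z')+(1-\lambda)\,\mathrm D_z\mathcal E_\mu(\mathsf t,\mathsf q)\ni0&&\text{in }H^m(\Omega)^*,\\ &(1-\lambda)\,\partial_\pi\mathcal H(\mathsf z,\mathsf p')+\lambda\,\mathrm D\mathcal H_{2,\nu}(\mathsf p')+(1-\lambda)\,\mathrm D_p\mathcal E_\mu(\mathsf t,\mathsf q)\ni0&&\text{in }L^2(\Omega;\mathbb M_D). \end{aligned}\tag{$*$}$$ Moreover, at each $t\in[0,T]$, each $q=(u,z,p)$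 with $z>0$ in $\overline\Omega$, each rate $q'=(u',z',p')\in\mathbf Q$ and each $\lambda\in[0,1]$, the system $(*)$ is equivalent to $$\begin{aligned} &-\lambda\,\mathrm{Div}(\nu\mathbb D E(u'))-(1-\lambda)\big(\mathrm{Div}\,\sigma+F(t)\big)=0&&\text{in }(H^1_{\rm Dir})^*,\\ &(1-\lambda)\,\partial\mathcal R(z')+\lambda z'+(1-\lambda)\big(A_m z+W'(z)+\tfrac12\mathbb C'(z)e:e\big)\ni0&&\text{in }H^m(\Omega)^*,\\ &(1-\lambda)\,\partial_\pi H(z,p')+\lambda\nu p'+(1-\lambda)\big(\mu p-\sigma_D\big)\ni0&&\text{a.e. in }\Omega, \end{aligned}$$ where $\langle-\mathrm{Div}\,\tau,v\rangle=\int_\Omega\tau:E(v)\,dx$ and $\langle A_mz,\eta\rangle=a_m(z,\eta)$. 2. Conversely, let $(\mathsf t,\mathsf q)$ be a parameterized curve that satisfies $(*)$ for a.a. $s\in(0,S)$ with a measurable $\lambda:[0,S]\to[0,1]$ such that $\mathsf t'\lambda=0$ a.e., let $s\mapsto\mathcal E_\mu(\mathsf t(s),\mathsf q(s))$ be (finite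 and) absolutely continuous on $[0,S]$, and let $\mathcal D^{*,\mu}_\nu(\mathsf t(s),\mathsf q(s))<+\infty$ for a.a. $s\in(0,S)$ at which $\mathsf t'(s)=0$ and $\mathcal D_\nu(\mathsf q'(s))=0$. Then $(\mathsf t,\mathsf q)$ is a BV solution. -/

import Mathlib

open MeasureTheory Set Filter Topology
open scoped ENNReal NNReal ContDiff InnerProductSpace

noncomputable section

namespace DamagePlasticity

/-! ### Vectors and matrices -/

/-- The Euclidean space `ℝⁿ`. -/
abbrev Vec (n : ℕ) := EuclideanSpace ℝ (Fin n)

/-- The space of `n × n` matrices with the Frobenius inner product `A : B`. -/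
abbrev Mat (n : ℕ) := EuclideanSpace ℝ (Fin n × Fin n)

/-- The space of symmetric matrices. -/
def Sym (n : ℕ) : Submodule ℝ (Mat n) where
  carrier := {A | ∀ i j, A (i, j) = A (j, i)}
  zero_mem' := by intro i j; rfl
  add_mem' := by
    intro A B hA hB i j
    simp [hA i j, hB i j]
  smul_mem' := by
    intro c A hA i j
    simp [hA i j]

/-- The space of deviatoric matrices: symmetric with null trace. -/
def Dev (n : ℕ) : Submodule ℝ (Mat n) where
  carrier := {A | A ∈ Sym n ∧ ∑ i, A (i, i) = 0}
  zero_mem' := ⟨(Sym n).zero_mem, by simp⟩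
  add_mem' := by
    rintro A B ⟨hA, hA'⟩ ⟨hB, hB'⟩
    refine ⟨(Sym n).add_mem hA hB, ?_⟩
    simp [Finset.sum_add_distrib, hA', hB']
  smul_mem' := by
    rintro c A ⟨hA, hA'⟩
    refine ⟨(Sym n).smul_mem c hA, ?_⟩
    simp [← Finset.mul_sum, hA']

theorem dev_le_sym (n : ℕ) : Dev n ≤ Sym n := fun _ h => h.1

/-- The inclusion of the deviatoric into the symmetric matrices. -/
def devIncl (n : ℕ) : Dev n →L[ℝ] Sym n :=
  LinearMap.toContinuousLinearMap (Submodule.inclusion (dev_le_sym n))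

/-- The deviatoric part of a symmetric matrix: its orthogonal projection onto `Dev n`. -/
def devPart (n : ℕ) : Sym n →L[ℝ] Dev n :=
  (Dev n).orthogonalProjectionOnto ∘L (Sym n).subtypeL

/-- The symmetric part `(A + Aᵀ) / 2`. -/
def symPart (n : ℕ) : Mat n →L[ℝ] Sym n :=
  LinearMap.toContinuousLinearMap
    { toFun := fun A => ⟨WithLp.toLp 2 fun ij => (A (ij.1, ij.2) + A (ij.2, ij.1)) / 2, by
        intro i j
        change (A (i, j) + A (j, i)) / 2 = (A (j, i) + A (i, j)) / 2
        ring⟩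
      map_add' := by
        intro A B
        ext ij
        change ((A + B) (ij.1, ij.2) + (A + B) (ij.2, ij.1)) / 2 =
          (A (ij.1, ij.2) + A (ij.2, ij.1)) / 2 + (B (ij.1, ij.2) + B (ij.2, ij.1)) / 2
        simp only [PiLp.add_apply]
        ring
      map_smul' := by
        intro c A
        ext ij
        change ((c • A) (ij.1, ij.2) + (c • A) (ij.2, ij.1)) / 2 =
          c * ((A (ij.1, ij.2) + A (ij.2, ij.1)) / 2)
        simp only [PiLp.smul_apply, smul_eq_mul]
        ring }

/-! ### Domains and function spaces -/

/-- Bounded Lipschitz domain: bounded, open, connected, and near each boundary point the set of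
points strictly below a Lipschitz graph over the hyperplane orthogonal to some unit vector. -/
structure IsLipschitzDomain {n : ℕ} (Ω : Set (Vec n)) : Prop where
  isOpen : IsOpen Ω
  connected : IsConnected Ω
  bounded : Bornology.IsBounded Ω
  graph : ∀ x₀ ∈ frontier Ω, ∃ (a : Vec n) (g : Vec n → ℝ) (L : ℝ≥0) (r : ℝ),
    ‖a‖ = 1 ∧ LipschitzWith L g ∧ 0 < r ∧
      ∀ y ∈ Metric.ball x₀ r, (y ∈ Ω ↔ ⟪y, a⟫_ℝ < g (y - ⟪y, a⟫_ℝ • a))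

/-- `L²(Ω; X)`. -/
abbrev L2 {n : ℕ} (Ω : Set (Vec n)) (X : Type*) [NormedAddCommGroup X] :=
  Lp X 2 (volume.restrict Ω)

/-- Integration by parts on `Ω` against all test functions in `C_c^∞(ℝⁿ)` supported in `O`:
`∫_Ω f ∂ⱼφ = - ∫_Ω gⱼ φ`. For `O = Ω` it says that `g` is the weak gradient of `f` in `Ω`. -/
def WeakGradOn {n : ℕ} (Ω O : Set (Vec n)) (f : Vec n → ℝ) (g : Vec n → Fin n → ℝ) : Prop :=
  ∀ φ : Vec n → ℝ, ContDiff ℝ ∞ φ → HasCompactSupport φ → tsupport φ ⊆ O → ∀ j,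
    ∫ x in Ω, f x * fderiv ℝ φ x (EuclideanSpace.single j 1) = - ∫ x in Ω, g x j * φ x

section WeakGrad

variable {n : ℕ} {Ω O : Set (Vec n)}

theorem integrable_mul_test {f φ : Vec n → ℝ} (hf : MemLp f 2 (volume.restrict Ω))
    (hc : Continuous φ) (hs : HasCompactSupport φ) :
    Integrable (fun x => f x * φ x) (volume.restrict Ω) :=
  hf.integrable_mul ((hc.memLp_of_hasCompactSupport hs (p := 2) (μ := volume)).restrict Ω)

theorem integrable_mul_dtest {f φ : Vec n → ℝ} (hf : MemLp f 2 (volume.restrict Ω))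
    (hc : ContDiff ℝ ∞ φ) (hs : HasCompactSupport φ) (v : Vec n) :
    Integrable (fun x => f x * fderiv ℝ φ x v) (volume.restrict Ω) := by
  refine integrable_mul_test hf ?_ ?_
  · exact (hc.continuous_fderiv (by simp)).clm_apply continuous_const
  · exact (hs.fderiv ℝ).comp_left (g := fun L : Vec n →L[ℝ] ℝ => L v) (by simp)

theorem WeakGradOn.congr {f f' : Vec n → ℝ} {g g' : Vec n → Fin n → ℝ}
    (h : WeakGradOn Ω O f g) (hf : f =ᵐ[volume.restrict Ω] f')
    (hg : g =ᵐ[volume.restrict Ω] g') : WeakGradOn Ω O f' g' := by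
  intro φ h1 h2 h3 j
  have e1 : ∫ x in Ω, f' x * fderiv ℝ φ x (EuclideanSpace.single j 1) =
      ∫ x in Ω, f x * fderiv ℝ φ x (EuclideanSpace.single j 1) :=
    integral_congr_ae (by filter_upwards [hf] with x hx; rw [hx])
  have e2 : ∫ x in Ω, g' x j * φ x = ∫ x in Ω, g x j * φ x :=
    integral_congr_ae (by filter_upwards [hg] with x hx; rw [hx])
  rw [e1, e2]
  exact h φ h1 h2 h3 j

theorem WeakGradOn.zero : WeakGradOn Ω O (fun _ => 0) (fun _ _ => 0) := by
  intro φ _ _ _ j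
  simp

theorem WeakGradOn.add {f f' : Vec n → ℝ} {g g' : Vec n → Fin n → ℝ}
    (h : WeakGradOn Ω O f g) (h' : WeakGradOn Ω O f' g')
    (hf : MemLp f 2 (volume.restrict Ω)) (hf' : MemLp f' 2 (volume.restrict Ω))
    (hg : ∀ j, MemLp (fun x => g x j) 2 (volume.restrict Ω))
    (hg' : ∀ j, MemLp (fun x => g' x j) 2 (volume.restrict Ω)) :
    WeakGradOn Ω O (fun x => f x + f' x) (fun x j => g x j + g' x j) := by
  intro φ h1 h2 h3 j
  simp only [add_mul]
  rw [integral_add (integrable_mul_dtest hf h1 h2 _) (integrable_mul_dtest hf' h1 h2 _),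
    integral_add (integrable_mul_test (hg j) h1.continuous h2)
      (integrable_mul_test (hg' j) h1.continuous h2), h φ h1 h2 h3 j, h' φ h1 h2 h3 j]
  ring

theorem WeakGradOn.smul {f : Vec n → ℝ} {g : Vec n → Fin n → ℝ} (c : ℝ)
    (h : WeakGradOn Ω O f g) :
    WeakGradOn Ω O (fun x => c * f x) (fun x j => c * g x j) := by
  intro φ h1 h2 h3 j
  simp only [mul_assoc]
  rw [integral_const_mul, integral_const_mul, h φ h1 h2 h3 j]
  ring

theorem memLp_coord {ι : Type*} [Fintype ι] (u : L2 Ω (EuclideanSpace ℝ ι)) (i : ι) :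
    MemLp (fun x => u x i) 2 (volume.restrict Ω) :=
  (Lp.memLp u).continuousLinearMap_comp (EuclideanSpace.proj i : EuclideanSpace ℝ ι →L[ℝ] ℝ)

end WeakGrad

/-- The pairs `(u, G) ∈ L²(Ω; ℝⁿ) × L²(Ω; Mat)` for which integration by parts holds, in each
component, against all test functions supported in `O`. -/
def gradPairs {n : ℕ} (Ω O : Set (Vec n)) :
    Submodule ℝ (WithLp 2 (L2 Ω (Vec n) × L2 Ω (Mat n))) where
  carrier := {v | ∀ i, WeakGradOn Ω O (fun x => v.fst x i) (fun x j => v.snd x (i, j))}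
  zero_mem' := by
    intro i
    refine WeakGradOn.zero.congr ?_ ?_
    · filter_upwards [Lp.coeFn_zero (Vec n) 2 (volume.restrict Ω)] with x hx
      simp only [WithLp.zero_fst, hx, Pi.zero_apply, PiLp.zero_apply]
    · filter_upwards [Lp.coeFn_zero (Mat n) 2 (volume.restrict Ω)] with x hx
      funext j
      simp only [WithLp.zero_snd, hx, Pi.zero_apply, PiLp.zero_apply]
  add_mem' := by
    intro v w hv hw i
    refine ((hv i).add (hw i) (memLp_coord _ i) (memLp_coord _ i) (fun j => memLp_coord _ (i, j))
      (fun j => memLp_coord _ (i, j))).congr ?_ ?_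
    · filter_upwards [Lp.coeFn_add v.fst w.fst] with x hx
      simp only [WithLp.add_fst, hx, Pi.add_apply, PiLp.add_apply]
    · filter_upwards [Lp.coeFn_add v.snd w.snd] with x hx
      funext j
      simp only [WithLp.add_snd, hx, Pi.add_apply, PiLp.add_apply]
  smul_mem' := by
    intro c v hv i
    refine ((hv i).smul c).congr ?_ ?_
    · filter_upwards [Lp.coeFn_smul c v.fst] with x hx
      simp [hx]
    · filter_upwards [Lp.coeFn_smul c v.snd] with x hx
      funext j
      simp [hx]

/-- `H¹(Ω; ℝⁿ)`, as the Hilbert space of pairs `(u, ∇u)`; `(∇u) (i, j) = ∂ⱼ uᵢ`. -/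
abbrev H1 {n : ℕ} (Ω : Set (Vec n)) := gradPairs Ω Ω

/-- `H¹_Dir(Ω; ℝⁿ)`, the functions of `H¹(Ω; ℝⁿ)` with null trace on the relatively open part `Γ`
of the boundary. By Green's formula `∫_Ω (uᵢ ∂ⱼφ + ∂ⱼuᵢ φ) = ∫_∂Ω uᵢ φ νⱼ`, the trace vanishes on
`Γ` exactly if the left-hand side vanishes for the test functions whose support does not meet
`∂Ω \ Γ`. -/
def H1Dir {n : ℕ} (Ω Γ : Set (Vec n)) : Submodule ℝ (H1 Ω) :=
  (gradPairs Ω (frontier Ω \ Γ)ᶜ).comap (H1 Ω).subtype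

/-- The linearized strain `E(u) = (∇u + ∇uᵀ) / 2`. -/
def strain {n : ℕ} {Ω : Set (Vec n)} (u : H1 Ω) : L2 Ω (Sym n) :=
  (symPart n).compLp (u : WithLp 2 (L2 Ω (Vec n) × L2 Ω (Mat n))).snd

/-- `K` is the fractional difference quotient `(G(x) - G(y)) / |x - y|^(n/2 + m - 1)` of the weak
gradient `G ∈ L²(Ω; ℝⁿ)` of `z`. -/
def IsFracGrad {n : ℕ} (Ω : Set (Vec n)) (m : ℝ) (z : L2 Ω ℝ)
    (K : Lp (Vec n) 2 ((volume.restrict Ω).prod (volume.restrict Ω))) : Prop :=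
  ∃ G : L2 Ω (Vec n), WeakGradOn Ω Ω z (fun x j => G x j) ∧
    ∀ᵐ xy ∂((volume.restrict Ω).prod (volume.restrict Ω)),
      K xy = (‖xy.1 - xy.2‖ ^ (-((n : ℝ) / 2 + (m - 1)))) • (G xy.1 - G xy.2)

/-- `H^m(Ω)` for `1 < m < 2`, as the space of pairs `(z, K)`, with `K` the fractional difference
quotient of `∇z`. Its inner product is `∫_Ω z₁ z₂ + a_m(z₁, z₂)`, where
`a_m(z₁, z₂) = ∫_Ω ∫_Ω (∇z₁(x) - ∇z₁(y)) · (∇z₂(x) - ∇z₂(y)) / |x - y|^(n + 2(m - 1))`. -/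
def Hm {n : ℕ} (Ω : Set (Vec n)) (m : ℝ) :
    Submodule ℝ
      (WithLp 2 (L2 Ω ℝ × Lp (Vec n) 2 ((volume.restrict Ω).prod (volume.restrict Ω)))) where
  carrier := {z | IsFracGrad Ω m z.fst z.snd}
  zero_mem' := by
    refine ⟨0, ?_, ?_⟩
    · refine WeakGradOn.zero.congr ?_ ?_
      · filter_upwards [Lp.coeFn_zero ℝ 2 (volume.restrict Ω)] with x hx
        simp only [WithLp.zero_fst, hx, Pi.zero_apply]
      · filter_upwards [Lp.coeFn_zero (Vec n) 2 (volume.restrict Ω)] with x hx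
        funext j
        simp only [hx, Pi.zero_apply, PiLp.zero_apply]
    · have h := Lp.coeFn_zero (Vec n) 2 (volume.restrict Ω)
      filter_upwards [Lp.coeFn_zero (Vec n) 2 ((volume.restrict Ω).prod (volume.restrict Ω)),
        Measure.quasiMeasurePreserving_fst.ae h, Measure.quasiMeasurePreserving_snd.ae h]
        with xy h0 h1 h2
      simp only [WithLp.zero_snd, h0, h1, h2, Pi.zero_apply, sub_self, smul_zero]
  add_mem' := by
    rintro v w ⟨G, hG, hv⟩ ⟨G', hG', hw⟩
    refine ⟨G + G', ?_, ?_⟩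
    · refine (hG.add hG' (Lp.memLp _) (Lp.memLp _) (fun j => memLp_coord _ j)
        (fun j => memLp_coord _ j)).congr ?_ ?_
      · filter_upwards [Lp.coeFn_add v.fst w.fst] with x hx
        simp only [WithLp.add_fst, hx, Pi.add_apply]
      · filter_upwards [Lp.coeFn_add G G'] with x hx
        funext j
        simp only [hx, Pi.add_apply, PiLp.add_apply]
    · have h := Lp.coeFn_add G G'
      filter_upwards [Lp.coeFn_add v.snd w.snd, hv, hw,
        Measure.quasiMeasurePreserving_fst.ae h, Measure.quasiMeasurePreserving_snd.ae h]
        with xy h0 hv hw h1 h2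
      simp only [WithLp.add_snd, h0, h1, h2, Pi.add_apply, hv, hw, ← smul_add]
      congr 1
      abel
  smul_mem' := by
    rintro c v ⟨G, hG, hv⟩
    refine ⟨c • G, ?_, ?_⟩
    · refine (hG.smul c).congr ?_ ?_
      · filter_upwards [Lp.coeFn_smul c v.fst] with x hx
        simp [hx]
      · filter_upwards [Lp.coeFn_smul c G] with x hx
        funext j
        simp [hx]
    · have h := Lp.coeFn_smul c G
      filter_upwards [Lp.coeFn_smul c v.snd, hv,
        Measure.quasiMeasurePreserving_fst.ae h, Measure.quasiMeasurePreserving_snd.ae h]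
        with xy h0 hv h1 h2
      simp only [WithLp.smul_snd, h0, h1, h2, Pi.smul_apply, hv, ← smul_sub]
      rw [smul_comm]

/-- The function underlying an element of `H^m(Ω)`. -/
def field {n : ℕ} {Ω : Set (Vec n)} {m : ℝ} (z : Hm Ω m) : L2 Ω ℝ :=
  (z : WithLp 2 (L2 Ω ℝ × Lp (Vec n) 2 ((volume.restrict Ω).prod (volume.restrict Ω)))).fst

/-- The bilinear form `a_m` on `H^m(Ω)`. -/
def aForm {n : ℕ} {Ω : Set (Vec n)} {m : ℝ} (z₁ z₂ : Hm Ω m) : ℝ :=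
  ⟪(z₁ : WithLp 2 (L2 Ω ℝ × Lp (Vec n) 2 ((volume.restrict Ω).prod (volume.restrict Ω)))).snd,
    (z₂ : WithLp 2 (L2 Ω ℝ × Lp (Vec n) 2 ((volume.restrict Ω).prod (volume.restrict Ω)))).snd⟫_ℝ

/-! ### The data of the problem -/

/-- The data: the reference configuration `Ω` with the Dirichlet part `Γ` of its boundary, the
order `m`, the final time `T`, the hardening parameter `μ`, the rate parameter `ν`, the damage
threshold `κ`, the elasticity tensor `elast`, the viscosity tensor `visc`, the damage energy density `W`
on `(0, ∞)`, the plastic constraint sets `K`, the Dirichlet loading `w`, and the total load `F`. -/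
structure Data (n : ℕ) where
  Ω : Set (Vec n)
  Γ : Set (Vec n)
  m : ℝ
  T : ℝ
  μ : ℝ
  ν : ℝ
  κ : ℝ
  elast : ℝ → (Sym n →L[ℝ] Sym n)
  visc : Vec n → (Sym n →L[ℝ] Sym n)
  W : ℝ → ℝ
  K : ℝ → Set (Dev n)
  w : ℝ → H1 Ω
  F : ℝ → (H1 Ω →L[ℝ] ℝ)

/-- The standing assumptions on the data. -/
structure Data.Admissible {n : ℕ} (d : Data n) : Prop where
  dim : n = 2 ∨ n = 3
  lipschitz : IsLipschitzDomain d.Ω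
  dirichlet : ∃ U, IsOpen U ∧ d.Γ = U ∩ frontier d.Ω
  order : (n : ℝ) / 2 < d.m ∧ d.m < 2
  pos_T : 0 < d.T
  pos_μ : 0 < d.μ
  pos_ν : 0 < d.ν
  pos_κ : 0 < d.κ
  elast_smooth : ContDiffOn ℝ 1 d.elast (Ici 0) ∧ LocallyLipschitzOn (Ici 0) (derivWithin d.elast (Ici 0))
  elast_symm : ∀ z, 0 ≤ z → ∀ ξ η, ⟪d.elast z ξ, η⟫_ℝ = ⟪ξ, d.elast z η⟫_ℝ
  elast_mono : ∀ ξ, MonotoneOn (fun z => ⟪d.elast z ξ, ξ⟫_ℝ) (Ici 0)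
  elast_bounds : ∃ γ₁ γ₂ : ℝ, 0 < γ₁ ∧ 0 < γ₂ ∧ ∀ z, 0 ≤ z → ∀ ξ,
    γ₁ * ‖ξ‖ ^ 2 ≤ ⟪d.elast z ξ, ξ⟫_ℝ ∧ ⟪d.elast z ξ, ξ⟫_ℝ ≤ γ₂ * ‖ξ‖ ^ 2
  visc_cont : ContinuousOn d.visc (closure d.Ω)
  visc_symm : ∀ x ∈ closure d.Ω, ∀ ξ η, ⟪d.visc x ξ, η⟫_ℝ = ⟪ξ, d.visc x η⟫_ℝ
  visc_bounds : ∃ δ₁ δ₂ : ℝ, 0 < δ₁ ∧ 0 < δ₂ ∧ ∀ x ∈ d.Ω, ∀ ξ,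
    δ₁ * ‖ξ‖ ^ 2 ≤ ⟪d.visc x ξ, ξ⟫_ℝ ∧ ⟪d.visc x ξ, ξ⟫_ℝ ≤ δ₂ * ‖ξ‖ ^ 2
  W_smooth : ContDiffOn ℝ 2 d.W (Ioi 0)
  W_nonneg : ∀ s, 0 < s → 0 ≤ d.W s
  W_blowup : Tendsto (fun s => s ^ (2 * n) * d.W s) (𝓝[>] 0) atTop
  K_closed : ∀ z, 0 ≤ z → IsClosed (d.K z)
  K_convex : ∀ z, 0 ≤ z → Convex ℝ (d.K z)
  K_balls : ∃ r R : ℝ, 0 < r ∧ r < R ∧ ∀ z₁ z₂, 0 ≤ z₁ → z₁ ≤ z₂ →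
    Metric.ball 0 r ⊆ d.K z₁ ∧ d.K z₁ ⊆ d.K z₂ ∧ d.K z₂ ⊆ Metric.ball 0 R
  K_lipschitz : ∃ C : ℝ, 0 < C ∧ ∀ z₁ z₂, 0 ≤ z₁ → 0 ≤ z₂ →
    Metric.hausdorffDist (d.K z₁) (d.K z₂) ≤ C * |z₁ - z₂|
  w_ac : AbsolutelyContinuousOnInterval d.w 0 d.T
  F_ac : AbsolutelyContinuousOnInterval d.F 0 d.T

namespace Data

variable {n : ℕ} (d : Data n)

/-- The space `H¹_Dir(Ω; ℝⁿ)` of the displacements. -/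
abbrev U := H1Dir d.Ω d.Γ

/-- The space `H^m(Ω)` of the damage variables. -/
abbrev Z := Hm d.Ω d.m

/-- The space `L²(Ω; Dev)` of the plastic strains. -/
abbrev P := L2 d.Ω (Dev n)

/-- The state space; a state is a triple `q = (u, z, p)`. -/
abbrev Q := d.U × d.Z × d.P

/-! ### The energy -/

/-- The elastic strain `e = E(u + w(t)) - p`. -/
def elasticStrain (t : ℝ) (u : d.U) (p : d.P) : L2 d.Ω (Sym n) :=
  strain ((u : H1 d.Ω) + d.w t) - (devIncl n).compLp p

/-- The stress `σ = elast(z) e`. -/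
def stress (t : ℝ) (u : d.U) (z : d.Z) (p : d.P) (x : Vec n) : Sym n :=
  d.elast (field z x) (d.elasticStrain t u p x)

/-- The value of the energy on its domain. -/
def energyValue (t : ℝ) (u : d.U) (z : d.Z) (p : d.P) : ℝ :=
  (1 / 2) * (∫ x in d.Ω, ⟪d.stress t u z p x, d.elasticStrain t u p x⟫_ℝ)
    + (∫ x in d.Ω, (d.W (field z x) + d.μ / 2 * ‖p x‖ ^ 2))
    + (1 / 2) * aForm z z - d.F t ((u : H1 d.Ω) + d.w t)

/-- The domain of the energy: `z > 0` in the closure of `Ω`. As `z` has a continuous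
representative on this compact set, it means that `z` is bounded below by a positive constant. -/
def InDomain (q : d.Q) : Prop :=
  ∃ c : ℝ, 0 < c ∧ ∀ᵐ x ∂(volume.restrict d.Ω), c ≤ field q.2.1 x

open Classical in
/-- The energy `𝓔_μ(t, q)`, with value `+∞` off its domain. -/
def energy (t : ℝ) (q : d.Q) : EReal :=
  if d.InDomain q then (d.energyValue t q.1 q.2.1 q.2.2 : EReal) else ⊤

/-- The Fréchet derivative `D_u 𝓔_μ(t, q)`. -/
def DuE (t : ℝ) (q : d.Q) : d.U →L[ℝ] ℝ :=
  fderiv ℝ (fun u : d.U => (d.energy t (u, q.2.1, q.2.2)).toReal) q.1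

/-- The Fréchet derivative `D_z 𝓔_μ(t, q)`. -/
def DzE (t : ℝ) (q : d.Q) : d.Z →L[ℝ] ℝ :=
  fderiv ℝ (fun z : d.Z => (d.energy t (q.1, z, q.2.2)).toReal) q.2.1

/-- The derivative `D_p 𝓔_μ(t, q)`, as an element of `L²(Ω; Dev)`. -/
def DpE (t : ℝ) (q : d.Q) : d.P :=
  gradient (fun p : d.P => (d.energy t (q.1, q.2.1, p)).toReal) q.2.2

/-- The partial time derivative of the energy. -/
def dtE (t : ℝ) (q : d.Q) : ℝ :=
  deriv (fun τ => (d.energy τ q).toReal) t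

/-! ### The dissipation potentials -/

/-- `∫_Ω 𝔻 E(v) : E(v)`, the square of the norm `‖v‖_{H¹,𝔻}`. -/
def viscSq (v : d.U) : ℝ :=
  ∫ x in d.Ω, ⟪d.visc x (strain (v : H1 d.Ω) x), strain (v : H1 d.Ω) x⟫_ℝ

/-- `𝓥_{2,ν}(v) = ν/2 ∫_Ω 𝔻 E(v) : E(v)`. -/
def V2 (v : d.U) : ℝ := d.ν / 2 * d.viscSq v

/-- The dual norm of `‖·‖_{H¹,𝔻}`. -/
def dualNorm (η : d.U →L[ℝ] ℝ) : ℝ≥0∞ :=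
  ⨆ (v : d.U) (_ : d.viscSq v ≤ 1), ENNReal.ofReal (η v)

open Classical in
/-- The density `R(ζ) = -κ ζ` if `ζ ≤ 0`, and `+∞` otherwise. -/
def rDensity (ζ : ℝ) : ℝ≥0∞ := if ζ ≤ 0 then ENNReal.ofReal (-d.κ * ζ) else ⊤

/-- The damage dissipation potential `𝓡(ζ) = ∫_Ω R(ζ)`. -/
def damageDiss (ζ : d.Z) : ℝ≥0∞ := ∫⁻ x in d.Ω, d.rDensity (field ζ x)

/-- The convex subdifferential `∂𝓡(ζ) ⊆ H^m(Ω)*`. -/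
def damageSubdiff (ζ : d.Z) : Set (d.Z →L[ℝ] ℝ) :=
  {χ | ∀ η : d.Z,
    ((d.damageDiss ζ : ℝ≥0∞) : EReal) + ((χ (η - ζ) : ℝ) : EReal) ≤ (d.damageDiss η : EReal)}

/-- `𝓡_2(ζ) = 1/2 ‖ζ‖²_{L²}`. -/
def R2 (ζ : d.Z) : ℝ := 1 / 2 * ‖field ζ‖ ^ 2

/-- The support function `H(z, π) = sup {σ : π | σ ∈ K(z)}`. -/
def plastDensity (z : ℝ) (π : Dev n) : ℝ := sSup ((fun σ : Dev n => ⟪σ, π⟫_ℝ) '' d.K z)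

/-- The convex subdifferential `∂_π H(z, π)`. -/
def plastDensitySubdiff (z : ℝ) (π : Dev n) : Set (Dev n) :=
  {om | ∀ ρ : Dev n, ⟪om, ρ - π⟫_ℝ ≤ d.plastDensity z ρ - d.plastDensity z π}

/-- The plastic dissipation potential `𝓗(z, π) = ∫_Ω H(z, π)`. -/
def plastDiss (z : d.Z) (π : d.P) : ℝ := ∫ x in d.Ω, d.plastDensity (field z x) (π x)

/-- The convex subdifferential `∂_π 𝓗(z, π) ⊆ L²(Ω; Dev)`. -/
def plastSubdiff (z : d.Z) (π : d.P) : Set d.P :=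
  {om | ∀ ρ : d.P, ⟪om, ρ - π⟫_ℝ ≤ d.plastDiss z ρ - d.plastDiss z π}

/-- `𝓗_{2,ν}(π) = ν/2 ‖π‖²_{L²}`. -/
def H2 (π : d.P) : ℝ := d.ν / 2 * ‖π‖ ^ 2

/-! ### The contact potential -/

/-- The extended `L²` distance of `χ ∈ H^m(Ω)*` from `∂𝓡(0)`: the infimum of `‖h‖_{L²}` over the
`γ ∈ ∂𝓡(0)` such that `χ - γ` is represented by a function `h ∈ L²(Ω)`; `+∞` if there is none. -/
def damageDist (χ : d.Z →L[ℝ] ℝ) : ℝ≥0∞ :=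
  ⨅ (γ ∈ d.damageSubdiff 0) (h : L2 d.Ω ℝ)
    (_ : ∀ η : d.Z, χ η - γ η = ∫ x in d.Ω, h x * field η x), ‖h‖ₑ

/-- `𝓓_ν(q')`. -/
def slopeRate (q' : d.Q) : ℝ :=
  Real.sqrt (d.ν * d.viscSq q'.1 + ‖field q'.2.1‖ ^ 2 + d.ν * ‖q'.2.2‖ ^ 2)

/-- `𝓓_ν^{*,μ}(t, q)`. -/
def slope (t : ℝ) (q : d.Q) : ℝ≥0∞ :=
  (ENNReal.ofReal d.ν⁻¹ * d.dualNorm (-d.DuE t q) ^ 2 + d.damageDist (-d.DzE t q) ^ 2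
    + ENNReal.ofReal d.ν⁻¹ * Metric.infEDist (-d.DpE t q) (d.plastSubdiff q.2.1 0) ^ 2)
      ^ (1 / 2 : ℝ)

open Classical in
/-- The reduced contact potential. For `t' > 0` it is the indicator function of the stable states;
for `t' = 0` it is `𝓓_ν(q') 𝓓_ν^{*,μ}(t, q)`, with the convention `0 · ∞ = ∞`. -/
def contactRed (t : ℝ) (q : d.Q) (t' : ℝ) (q' : d.Q) : ℝ≥0∞ :=
  if 0 < t' then
    if -d.DuE t q = 0 ∧ -d.DzE t q ∈ d.damageSubdiff 0 ∧ -d.DpE t q ∈ d.plastSubdiff q.2.1 0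
    then 0 else ⊤
  else
    if d.slope t q = ⊤ then ⊤ else ENNReal.ofReal (d.slopeRate q') * d.slope t q

/-- The vanishing-viscosity contact potential `𝓜_{0,ν}^μ(t, q, t', q')`, for `t' ≥ 0`. -/
def contact (t : ℝ) (q : d.Q) (t' : ℝ) (q' : d.Q) : ℝ≥0∞ :=
  d.damageDiss q'.2.1 + ENNReal.ofReal (d.plastDiss q.2.1 q'.2.2) + d.contactRed t q t' q'

/-! ### Balanced Viscosity solutions -/

/-- Parameterized curves: `(t, q)` is absolutely continuous on `[0, S]` with values in `[0, T] × Q`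
and `t` is nondecreasing. -/
structure IsParamCurve (S : ℝ) (t : ℝ → ℝ) (q : ℝ → d.Q) : Prop where
  ac : AbsolutelyContinuousOnInterval (fun s => (t s, q s)) 0 S
  range : ∀ s ∈ Icc 0 S, t s ∈ Icc 0 d.T
  mono : MonotoneOn t (Icc 0 S)

/-- (Parameterized) Balanced Viscosity solutions to the rate-independent system with hardening:
parameterized curves of finite energy along which the integrands are measurable, respectively
integrable, and the energy-dissipation balance holds. -/
structure IsBVSolution (S : ℝ) (t : ℝ → ℝ) (q : ℝ → d.Q) : Prop where
  curve : d.IsParamCurve S t q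
  energy_finite : ∀ s ∈ Icc 0 S, d.energy (t s) (q s) ≠ ⊤
  contact_meas : AEMeasurable (fun s => d.contact (t s) (q s) (deriv t s) (deriv q s))
    (volume.restrict (Ioo 0 S))
  power_int : IntegrableOn (fun s => d.dtE (t s) (q s) * deriv t s) (Ioo 0 S)
  balance : ∀ s ∈ Icc 0 S,
    d.energy (t s) (q s)
        + ((∫⁻ r in Ioo 0 s, d.contact (t r) (q r) (deriv t r) (deriv q r) : ℝ≥0∞) : EReal)
      = d.energy (t 0) (q 0) + ((∫ r in Ioo 0 s, d.dtE (t r) (q r) * deriv t r : ℝ) : EReal)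

/-! ### The system of subdifferential inclusions -/

/-- The system of subdifferential inclusions at the state `(t, q)`, with rate `q'` and switching
coefficient `l`. -/
structure Inclusions (l t : ℝ) (q q' : d.Q) : Prop where
  u_eq : l • fderiv ℝ d.V2 q'.1 + (1 - l) • d.DuE t q = 0
  z_incl : ∃ χ ∈ d.damageSubdiff q'.2.1,
    (1 - l) • χ + l • fderiv ℝ d.R2 q'.2.1 + (1 - l) • d.DzE t q = 0
  p_incl : ∃ om ∈ d.plastSubdiff q.2.1 q'.2.2,
    (1 - l) • om + l • gradient d.H2 q'.2.2 + (1 - l) • d.DpE t q = 0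

/-- The concrete form of the system: in `H¹_Dir(Ω; ℝⁿ)*`, where `⟨-Div τ, v⟩ = ∫_Ω τ : E(v)`, in
`H^m(Ω)*`, and almost everywhere in `Ω`, respectively. -/
structure ConcreteInclusions (l t : ℝ) (q q' : d.Q) : Prop where
  u_eq : ∀ v : d.U,
    l * (∫ x in d.Ω, ⟪d.ν • d.visc x (strain (q'.1 : H1 d.Ω) x), strain (v : H1 d.Ω) x⟫_ℝ)
      + (1 - l) * ((∫ x in d.Ω, ⟪d.stress t q.1 q.2.1 q.2.2 x, strain (v : H1 d.Ω) x⟫_ℝ)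
        - d.F t (v : H1 d.Ω)) = 0
  z_incl : ∃ χ ∈ d.damageSubdiff q'.2.1, ∀ η : d.Z,
    (1 - l) * χ η + l * (∫ x in d.Ω, field q'.2.1 x * field η x)
      + (1 - l) * (aForm q.2.1 η + (∫ x in d.Ω, deriv d.W (field q.2.1 x) * field η x)
        + (∫ x in d.Ω, 1 / 2 * ⟪deriv d.elast (field q.2.1 x) (d.elasticStrain t q.1 q.2.2 x),
            d.elasticStrain t q.1 q.2.2 x⟫_ℝ * field η x)) = 0
  p_incl : ∀ᵐ x ∂(volume.restrict d.Ω),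
    ∃ om ∈ d.plastDensitySubdiff (field q.2.1 x) (q'.2.2 x),
      (1 - l) • om + (l * d.ν) • q'.2.2 x
        + (1 - l) • (d.μ • q.2.2 x - devPart n (d.stress t q.1 q.2.1 q.2.2 x)) = 0

/-- `l` is a switching function for `t`: it is measurable with values in `[0, 1]`, and `t' l = 0`
almost everywhere in `(0, S)`. -/
structure IsSwitching (S : ℝ) (t : ℝ → ℝ) (l : ℝ → ℝ) : Prop where
  meas : Measurable l
  range : ∀ s ∈ Icc 0 S, l s ∈ Icc (0 : ℝ) 1
  switch : ∀ᵐ s ∂(volume.restrict (Ioo 0 S)), deriv t s * l s = 0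

end Data

end DamagePlasticity

end

noncomputable section

namespace DamagePlasticity

section

/-! ### Absolutely continuous curves in Hilbert spaces -/

/-! The argument compares two expressions for the derivative of the energy along a curve. The
balance, differentiated, says `d/ds 𝓔 = ∂ₜ𝓔 t' - 𝓜` almost everywhere. The chain rule says `d/ds 𝓔 =
∂ₜ𝓔 t' + ⟨D𝓔, q'⟩`. For absolutely continuous energy the balance is therefore the pointwise identity
`𝓜 = -⟨D𝓔, q'⟩`, and everything reduces to showing that this identity, at a fixed state and rate, is
equivalent to the system of inclusions.

The pointwise part is convex analysis in the abstract `RateSystem`. A finite slope is attained: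
`-D_z𝓔 = γ + h` and `-D_p𝓔 = ω + ξ`, with `γ`, `ω` subgradients at zero and residuals `h`, `ξ` of
least norm. One-homogeneity bounds the pairings of `γ`, `ω` with the rates by the potentials, and
Cauchy-Schwarz bounds the rest by rate times slope; thus `-⟨D𝓔, q'⟩ ≤ 𝓜` always (`le_contact`).
Equality forces equality in both estimates: `γ`, `ω` are subgradients at the rates, and residuals
and rates are proportional, with ratio given by the slope `c` and the rate `D`. This is the system
with `λ = c / (D + c)` (`inclusions_of_contact_eq`); if `t' > 0`, finiteness of `𝓜` means stability
and `λ = 0`. Conversely, for `λ < 1` the system displays the residuals as `λ / (1 - λ)` times the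
rates, which bounds the slope and yields the opposite inequality; for `λ = 1` the dissipative rates
vanish, and the finiteness assumption on the slope excludes the convention `0 · ∞ = ∞`
(`contact_eq_of_inclusions`).

The analytic part is the chain rule (`IsParamCurve.chainRule`). Absolutely continuous curves in
separable Hilbert spaces are almost everywhere differentiable and are integrals of their
derivatives. The loads are only absolutely continuous in time and are composed with a nondecreasing
absolutely continuous `t`; the area formula handles the exceptional times. The energy is Fréchet
differentiable because `m > n / 2` embeds `H^m(Ω)` into the bounded functions
(`exists_field_bound`): positivity of `z` is then stable under small perturbations, and Taylor
remainders of `ℂ(z)` and `W(z)` are quadratic in the norm. The embedding is proved by averaging `z`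
over shrinking kernels supported in an interior cone, the change of scale being controlled by the
fractional difference quotient of the gradient. The same quotient controls the gradient itself,
whence the completeness of `H^m(Ω)` (`isClosed_Hm`).

Measurability of `λ` follows by writing it in terms of the rate and of `𝓜 - 𝓡 - 𝓗`, all measurable
along the curve. The concrete form of the system comes from the explicit partial derivatives and
from the localization of the subdifferential of the plastic potential to almost every point. -/

theorem absolutelyContinuous_lipschitz_comp {X Y : Type*} [PseudoMetricSpace X]
    [PseudoMetricSpace Y] {g : X → Y} {K : ℝ≥0} (hg : LipschitzWith K g) {f : ℝ → X} {a b : ℝ}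
    (hf : AbsolutelyContinuousOnInterval f a b) :
    AbsolutelyContinuousOnInterval (fun x => g (f x)) a b := by
  unfold AbsolutelyContinuousOnInterval at hf ⊢
  refine squeeze_zero (fun _ => Finset.sum_nonneg fun _ _ => dist_nonneg) (fun E => ?_)
    (by simpa using hf.const_mul (K : ℝ))
  rw [Finset.mul_sum]
  exact Finset.sum_le_sum fun i _ => hg.dist_le_mul _ _

/-- Distinct orthonormal vectors are `√2` apart, so the balls of radius `1 / 2` around them are
disjoint nonempty open sets, and a second countable space has only countably many of those. -/
theorem orthonormal_countable {X ι : Type*} [NormedAddCommGroup X] [InnerProductSpace ℝ X]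
    [SecondCountableTopology X] {b : ι → X} (hb : Orthonormal ℝ b) : Countable ι := by
  refine Pairwise.countable_of_isOpen_disjoint (s := fun i => Metric.ball (b i) (1 / 2)) ?_
    (fun i => Metric.isOpen_ball) (fun i => ⟨b i, Metric.mem_ball_self (by norm_num)⟩)
  intro i j hij
  refine Metric.ball_disjoint_ball ?_
  have h1 : ‖b i - b j‖ ^ 2 = 2 := by
    rw [@norm_sub_sq_real, hb.1 i, hb.1 j, hb.2 hij]
    norm_num
  rw [dist_eq_norm]
  nlinarith [norm_nonneg (b i - b j)]

/-- Replaces increments of the curve by increments of its real monotone variation function, whose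
integrable derivative will dominate all difference quotients. -/
theorem boundedVariation_dist_le {X : Type*} [PseudoMetricSpace X] {f : ℝ → X} {s : Set ℝ}
    (hf : BoundedVariationOn f s) {a x y : ℝ} (ha : a ∈ s) (hx : x ∈ s) (hy : y ∈ s) :
    dist (f x) (f y) ≤ |variationOnFromTo f s a y - variationOnFromTo f s a x| := by
  wlog hxy : x ≤ y generalizing x y
  · rw [dist_comm, abs_sub_comm]
    exact this hy hx (le_of_not_ge hxy)
  have h := variationOnFromTo.add hf.locallyBoundedVariationOn ha hx hy
  rw [← h, add_sub_cancel_left, variationOnFromTo.eq_of_le _ _ hxy, abs_of_nonneg (by positivity)]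
  rw [dist_edist]
  refine ENNReal.toReal_mono (hf.locallyBoundedVariationOn x y hx hy) ?_
  exact eVariationOn.edist_le f ⟨hx, le_rfl, hxy⟩ ⟨hy, hxy, le_rfl⟩

variable {X : Type*} [NormedAddCommGroup X] [InnerProductSpace ℝ X] [CompleteSpace X]
  [SecondCountableTopology X]

/-- An absolutely continuous curve in a separable Hilbert space is the integral of an integrable
function. -/
theorem absolutelyContinuous_exists_density {f : ℝ → X} {a b : ℝ} (hab : a < b)
    (hf : AbsolutelyContinuousOnInterval f a b) :
    ∃ g : ℝ → X, IntervalIntegrable g volume a b ∧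
      ∀ x ∈ Icc a b, f x - f a = ∫ r in a..x, g r := by
  obtain ⟨w, e, -⟩ := exists_hilbertBasis ℝ X
  have hcount : Countable w := orthonormal_countable e.orthonormal
  have hu : uIcc a b = Icc a b := uIcc_of_le hab.le
  have ha : a ∈ uIcc a b := left_mem_uIcc
  set V := variationOnFromTo f (uIcc a b) a with hV
  have hbv := hf.boundedVariationOn
  have hVmono : MonotoneOn V (uIcc a b) :=
    variationOnFromTo.monotoneOn hbv.locallyBoundedVariationOn ha
  have hVint := hVmono.intervalIntegrable_deriv
  set c : w → ℝ → ℝ := fun i => deriv (fun x => ⟪e i, f x⟫_ℝ) with hc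
  have hcac : ∀ i, AbsolutelyContinuousOnInterval (fun x => ⟪e i, f x⟫_ℝ) a b := fun i =>
    absolutelyContinuous_lipschitz_comp (innerSL ℝ (e i)).lipschitz hf
  -- The density is reassembled from the derivatives of the coordinates in a Hilbert basis. There
  -- are countably many of them, and each is a real absolutely continuous function.
  set g : ℝ → X := fun x => ∑' i, c i x • e i with hg
  have hIoo : ∀ᵐ x, x ∈ uIcc a b → x ∈ Ioo a b := by
    have h₁ : ∀ᵐ x : ℝ, x ≠ a := by simp [ae_iff, measure_singleton]
    have h₂ : ∀ᵐ x : ℝ, x ≠ b := by simp [ae_iff, measure_singleton]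
    filter_upwards [h₁, h₂] with x h1 h2 hx
    rw [hu] at hx
    exact ⟨lt_of_le_of_ne hx.1 (Ne.symm h1), lt_of_le_of_ne hx.2 h2⟩
  have hgood : ∀ᵐ x, x ∈ uIcc a b → ∀ F : Finset w, ∑ i ∈ F, c i x ^ 2 ≤ deriv V x ^ 2 := by
    have h1 : ∀ᵐ x, ∀ i, x ∈ uIcc a b → DifferentiableAt ℝ (fun x => ⟪e i, f x⟫_ℝ) x :=
      ae_all_iff.2 fun i => (hcac i).ae_differentiableAt
    filter_upwards [h1, hVmono.ae_differentiableWithinAt_of_mem, hIoo] with x h1 h2 h3 hx F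
    have hnhds : uIcc a b ∈ 𝓝 x := by
      rw [hu]
      exact Icc_mem_nhds (h3 hx).1 (h3 hx).2
    have hVd := ((h2 hx).differentiableAt hnhds).hasDerivAt.tendsto_slope
    have hcd : Tendsto (fun y => ∑ i ∈ F, slope (fun x => ⟪e i, f x⟫_ℝ) x y ^ 2) (𝓝[≠] x)
        (𝓝 (∑ i ∈ F, c i x ^ 2)) :=
      tendsto_finsetSum _ fun i _ => ((h1 i hx).hasDerivAt.tendsto_slope).pow 2
    refine le_of_tendsto_of_tendsto hcd (hVd.pow 2) ?_
    filter_upwards [mem_nhdsWithin_of_mem_nhds hnhds] with y hy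
    have hs : ∀ i, slope (fun x => ⟪e i, f x⟫_ℝ) x y = ⟪e i, (y - x)⁻¹ • (f y - f x)⟫_ℝ := by
      intro i
      simp [slope, inner_smul_right, inner_sub_right]
    -- Bessel's inequality for the difference quotient: finite sums of squared coordinate slopes
    -- stay below the squared slope of `V`, and in the limit the squared derivatives are summable,
    -- with sum at most `V'²`.
    have hB := e.orthonormal.sum_inner_products_le (x := (y - x)⁻¹ • (f y - f x)) (s := F)
    simp only [Real.norm_eq_abs, sq_abs] at hB
    simp only [hs]
    refine hB.trans ?_
    have hd := boundedVariation_dist_le hbv ha hx hy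
    rw [dist_comm, dist_eq_norm] at hd
    simp only [slope, vsub_eq_sub, smul_eq_mul, norm_smul, mul_pow]
    rw [Real.norm_eq_abs, sq_abs]
    refine mul_le_mul_of_nonneg_left ?_ (sq_nonneg _)
    rw [← sq_abs (V y - V x)]
    exact pow_le_pow_left₀ (norm_nonneg _) hd 2
  have hmem : ∀ᵐ x, x ∈ uIcc a b → ∃ hm : Memℓp (fun i => c i x) 2,
      HasSum (fun i => c i x • e i) (g x) ∧ e.repr (g x) = ⟨fun i => c i x, hm⟩ ∧
        ‖g x‖ ≤ |deriv V x| := by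
    filter_upwards [hgood] with x hx hxm
    have hs : Summable fun i => c i x ^ 2 :=
      summable_of_sum_le (fun i => sq_nonneg _) (hx hxm)
    have hm : Memℓp (fun i => c i x) 2 := by
      refine memℓp_gen ?_
      simpa using hs
    have hsum := e.hasSum_repr_symm ⟨fun i => c i x, hm⟩
    have hgx : g x = e.repr.symm ⟨fun i => c i x, hm⟩ := hsum.tsum_eq
    refine ⟨hm, by rw [hgx]; exact hsum, by rw [hgx]; simp, ?_⟩
    rw [hgx, LinearIsometryEquiv.norm_map]
    refine lp.norm_le_of_forall_sum_le (by norm_num) (abs_nonneg _) fun F => ?_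
    simpa using hx hxm F
  have hgm : AEStronglyMeasurable g (volume.restrict (uIoc a b)) := by
    refine aestronglyMeasurable_of_tendsto_ae (atTop : Filter (Finset w))
      (f := fun F x => ∑ i ∈ F, c i x • e i) (fun F => ?_) ?_
    · refine (Finset.stronglyMeasurable_fun_sum F fun i _ => ?_).aestronglyMeasurable
      exact (measurable_deriv _).stronglyMeasurable.smul_const _
    · rw [ae_restrict_iff' measurableSet_uIoc]
      filter_upwards [hmem] with x hx hxm
      obtain ⟨_, h, _⟩ := hx (uIoc_subset_uIcc hxm)
      exact h
  have hgi : IntervalIntegrable g volume a b := by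
    refine hVint.mono_fun hgm ?_
    rw [EventuallyLE, ae_restrict_iff' measurableSet_uIoc]
    filter_upwards [hmem] with x hx hxm
    obtain ⟨_, _, _, h⟩ := hx (uIoc_subset_uIcc hxm)
    exact h
  refine ⟨g, hgi, fun x hx => ?_⟩
  have hxu : uIcc a x ⊆ uIcc a b := by
    rw [hu, uIcc_of_le hx.1]
    exact Icc_subset_Icc_right hx.2
  have hgx := hgi.mono_set hxu
  have key : ∀ i, ⟪e i, f x - f a⟫_ℝ = ⟪e i, ∫ r in a..x, g r⟫_ℝ := by
    intro i
    have h1 := ((hcac i).mono hxu).integral_deriv_eq_sub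
    rw [inner_sub_right, ← h1]
    have h2 := (innerSL ℝ (e i)).intervalIntegral_comp_comm hgx
    simp only [innerSL_apply_apply] at h2
    rw [← h2]
    refine intervalIntegral.integral_congr_ae ?_
    filter_upwards [hmem] with r hr hrm
    obtain ⟨_, _, h, _⟩ := hr (hxu (uIoc_subset_uIcc hrm))
    rw [← e.repr_apply_apply, h]
  apply e.repr.injective
  ext i
  rw [e.repr_apply_apply, e.repr_apply_apply, key]

/-- An absolutely continuous curve in a separable Hilbert space is differentiable almost
everywhere, and it is the integral of its derivative. -/
theorem absolutelyContinuous_hilbert {f : ℝ → X} {a b : ℝ} (hab : a < b)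
    (hf : AbsolutelyContinuousOnInterval f a b) :
    (∀ᵐ x ∂(volume.restrict (Ioo a b)), DifferentiableAt ℝ f x) ∧
      IntegrableOn (deriv f) (Ioo a b) ∧
      ∀ x ∈ Icc a b, ∀ y ∈ Icc a b, x ≤ y → f y - f x = ∫ r in Ioo x y, deriv f r := by
  obtain ⟨g, hg, hfg⟩ := absolutelyContinuous_exists_density hab hf
  have hu : uIcc a b = Icc a b := uIcc_of_le hab.le
  have hder : ∀ᵐ x ∂(volume.restrict (Ioo a b)), HasDerivAt f (g x) x := by
    rw [ae_restrict_iff' measurableSet_Ioo]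
    filter_upwards [hg.ae_hasDerivAt_integral] with x hx hxm
    have h := hx (by rw [hu]; exact Ioo_subset_Icc_self hxm) a left_mem_uIcc
    have h' := h.add_const (f a)
    refine h'.congr_of_eventuallyEq ?_
    filter_upwards [Icc_mem_nhds hxm.1 hxm.2] with y hy
    rw [← hfg y hy]
    abel
  have hae : deriv f =ᵐ[volume.restrict (Ioo a b)] g := hder.mono fun x hx => hx.deriv
  have hgI : IntegrableOn g (Ioo a b) := by
    rw [intervalIntegrable_iff_integrableOn_Ioo_of_le hab.le] at hg
    exact hg
  refine ⟨hder.mono fun x hx => hx.differentiableAt, hgI.congr hae.symm, ?_⟩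
  intro x hx y hy hxy
  have hsub : Ioo x y ⊆ Ioo a b := Ioo_subset_Ioo hx.1 hy.2
  rw [integral_congr_ae (ae_restrict_of_ae_restrict_of_subset hsub hae),
    ← integral_Ioc_eq_integral_Ioo, ← intervalIntegral.integral_of_le hxy]
  have hax := hg.mono_set (c := a) (d := x)
    (by rw [hu, uIcc_of_le hx.1]; exact Icc_subset_Icc_right hx.2)
  have hay := hg.mono_set (c := a) (d := y)
    (by rw [hu, uIcc_of_le hy.1]; exact Icc_subset_Icc_right hy.2)
  rw [← intervalIntegral.integral_interval_sub_left hay hax, ← hfg x hx, ← hfg y hy]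
  abel

/-- The almost everywhere derivative of an indefinite integral. -/
theorem ae_hasDerivAt_of_eq_integral {E : Type*} [NormedAddCommGroup E] [NormedSpace ℝ E]
    [CompleteSpace E] {f g : ℝ → E} {a b : ℝ} (hab : a < b)
    (hg : IntegrableOn g (Ioo a b)) (hfg : ∀ x ∈ Icc a b, f x = f a + ∫ r in Ioo a x, g r) :
    ∀ᵐ x ∂(volume.restrict (Ioo a b)), HasDerivAt f (g x) x := by
  have hu : uIcc a b = Icc a b := uIcc_of_le hab.le
  have hg' : IntervalIntegrable g volume a b := by
    rwa [intervalIntegrable_iff_integrableOn_Ioo_of_le hab.le]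
  rw [ae_restrict_iff' measurableSet_Ioo]
  filter_upwards [hg'.ae_hasDerivAt_integral] with x hx hxm
  have h := hx (by rw [hu]; exact Ioo_subset_Icc_self hxm) a left_mem_uIcc
  refine (h.const_add (f a)).congr_of_eventuallyEq ?_
  filter_upwards [Icc_mem_nhds hxm.1 hxm.2] with y hy
  rw [hfg y hy, intervalIntegral.integral_of_le hy.1, integral_Ioc_eq_integral_Ioo]

end

/-! ### Monotone absolutely continuous changes of variables -/

section TimeChange

variable {S T : ℝ} {t : ℝ → ℝ}

theorem ae_deriv_nonneg (hmono : MonotoneOn t (Icc 0 S)) :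
    ∀ᵐ s ∂(volume.restrict (Ioo 0 S)), 0 ≤ deriv t s := by
  rw [ae_restrict_iff' measurableSet_Ioo]
  refine Eventually.of_forall fun s hs => ?_
  by_cases hd : DifferentiableAt ℝ t s
  · have h := hd.hasDerivAt.tendsto_slope
    refine ge_of_tendsto h ?_
    filter_upwards [mem_nhdsWithin_of_mem_nhds (Icc_mem_nhds hs.1 hs.2)] with y hy
    exact hmono.slope_nonneg (Ioo_subset_Icc_self hs) hy
  · rw [deriv_zero_of_not_differentiableAt hd]

/-- The points of `(x, y)` at which `t` is differentiable. -/
def diffSet (t : ℝ → ℝ) (x y : ℝ) : Set ℝ := {s | DifferentiableAt ℝ t s} ∩ Ioo x y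

theorem measurableSet_diffSet (x y : ℝ) : MeasurableSet (diffSet t x y) :=
  (measurableSet_of_differentiableAt ℝ t).inter measurableSet_Ioo

theorem diffSet_ae_eq (hS : 0 < S) (hac : AbsolutelyContinuousOnInterval t 0 S) {x y : ℝ}
    (hx : x ∈ Icc 0 S) (hy : y ∈ Icc 0 S) : diffSet t x y =ᵐ[volume] Ioo x y := by
  have h := (ae_restrict_iff' measurableSet_Ioo).1 (absolutelyContinuous_hilbert hS hac).1
  rw [eventuallyEq_set]
  filter_upwards [h] with s hs
  exact ⟨fun h => h.2, fun h => ⟨hs ⟨hx.1.trans_lt h.1, h.2.trans_le hy.2⟩, h⟩⟩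

theorem monotoneOn_diffSet (hmono : MonotoneOn t (Icc 0 S)) {x y : ℝ}
    (hx : x ∈ Icc 0 S) (hy : y ∈ Icc 0 S) : MonotoneOn t (diffSet t x y) :=
  hmono.mono fun _ hs => ⟨hx.1.trans hs.2.1.le, hs.2.2.le.trans hy.2⟩

theorem hasDerivWithinAt_diffSet (x y : ℝ) :
    ∀ s ∈ diffSet t x y, HasDerivWithinAt t (deriv t s) (diffSet t x y) s :=
  fun _ hs => hs.1.hasDerivAt.hasDerivWithinAt

/-- The area formula for monotone functions gives the image the measure `∫ t'`, which is `t y - t x`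
by absolute continuity. A subset of full measure is almost everywhere the whole interval. -/
theorem image_diffSet_ae_eq (hS : 0 < S) (hac : AbsolutelyContinuousOnInterval t 0 S)
    (hmono : MonotoneOn t (Icc 0 S)) {x y : ℝ} (hx : x ∈ Icc 0 S) (hy : y ∈ Icc 0 S)
    (hxy : x ≤ y) : t '' diffSet t x y =ᵐ[volume] Icc (t x) (t y) := by
  have hm := measurableSet_diffSet (t := t) x y
  have hmon := monotoneOn_diffSet hmono hx hy
  have hsub : t '' diffSet t x y ⊆ Icc (t x) (t y) := by
    rintro _ ⟨s, hs, rfl⟩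
    have hsS : s ∈ Icc 0 S := ⟨hx.1.trans hs.2.1.le, hs.2.2.le.trans hy.2⟩
    exact ⟨hmono hx hsS hs.2.1.le, hmono hsS hy hs.2.2.le⟩
  have hI := (absolutelyContinuous_hilbert hS hac).2.1
  have hIxy : IntegrableOn (deriv t) (Ioo x y) := hI.mono_set (Ioo_subset_Ioo hx.1 hy.2)
  have hnn : 0 ≤ᵐ[volume.restrict (Ioo x y)] deriv t :=
    ae_restrict_of_ae_restrict_of_subset (Ioo_subset_Ioo hx.1 hy.2) (ae_deriv_nonneg hmono)
  have hvol : volume (t '' diffSet t x y) = ENNReal.ofReal (t y - t x) := by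
    rw [← lintegral_deriv_eq_volume_image_of_monotoneOn hm (hasDerivWithinAt_diffSet x y) hmon,
      setLIntegral_congr (diffSet_ae_eq hS hac hx hy),
      ← ofReal_integral_eq_lintegral_ofReal hIxy hnn,
      (absolutelyContinuous_hilbert hS hac).2.2 x hx y hy hxy]
  refine ae_eq_of_subset_of_measure_ge hsub ?_ ?_ ?_
  · rw [hvol, Real.volume_Icc]
  · exact (hm.image_of_monotoneOn hmon).nullMeasurableSet
  · simp

/-- By the area formula, the integral of `t'` over the preimage of a null set is the measure of a
subset of that null set. This disposes of the times at which a load is not differentiable. -/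
theorem ae_deriv_eq_zero_of_mem_null (hS : 0 < S) (hac : AbsolutelyContinuousOnInterval t 0 S)
    (hmono : MonotoneOn t (Icc 0 S)) {N : Set ℝ} (hN : volume N = 0) :
    ∀ᵐ s ∂(volume.restrict (Ioo 0 S)), t s ∈ N → deriv t s = 0 := by
  set N' := toMeasurable volume N
  have hN' : volume N' = 0 := by rw [measure_toMeasurable, hN]
  have h0 : (0 : ℝ) ∈ Icc 0 S := ⟨le_rfl, hS.le⟩
  have h1 : S ∈ Icc 0 S := ⟨hS.le, le_rfl⟩
  have htm : AEMeasurable t (volume.restrict (Ioo 0 S)) :=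
    (hac.continuousOn.mono (by rw [uIcc_of_le hS.le]; exact Ioo_subset_Icc_self)).aemeasurable
      measurableSet_Ioo
  have hcont : ContinuousOn t (diffSet t 0 S) := fun s hs => hs.1.continuousAt.continuousWithinAt
  have hmE : MeasurableSet (diffSet t 0 S ∩ t ⁻¹' N') := by
    have hD := measurableSet_diffSet (t := t) 0 S
    have h := (continuousOn_iff_continuous_domRestrict.1 hcont).measurable
      (measurableSet_toMeasurable volume N)
    have := (MeasurableEmbedding.subtype_coe hD).measurableSet_image.2 h
    convert this using 1
    ext s
    simp [N', and_comm]
  have hlint := lintegral_deriv_eq_volume_image_of_monotoneOn hmE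
    (fun s hs => (hs.1.1.hasDerivAt.hasDerivWithinAt))
    ((monotoneOn_diffSet hmono h0 h1).mono inter_subset_left)
  have hz : volume (t '' (diffSet t 0 S ∩ t ⁻¹' N')) = 0 :=
    measure_mono_null (by rintro _ ⟨s, hs, rfl⟩; exact hs.2) hN'
  rw [hz, lintegral_eq_zero_iff (by fun_prop), EventuallyEq, ae_restrict_iff' hmE] at hlint
  have hD := (ae_restrict_iff' measurableSet_Ioo).1 (absolutelyContinuous_hilbert hS hac).1
  have hnn := (ae_restrict_iff' measurableSet_Ioo).1 (ae_deriv_nonneg hmono)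
  rw [ae_restrict_iff' measurableSet_Ioo]
  filter_upwards [hlint, hD, hnn] with s h1 h2 h3 hs hsN
  have := h1 ⟨⟨h2 hs, hs⟩, subset_toMeasurable _ _ hsN⟩
  simp only [Pi.zero_apply, ENNReal.ofReal_eq_zero] at this
  exact le_antisymm this (h3 hs)

variable {X : Type*} [NormedAddCommGroup X] [InnerProductSpace ℝ X] [CompleteSpace X]
  [SecondCountableTopology X]

/-- The chain rule for the composition of an absolutely continuous curve with an absolutely
continuous nondecreasing change of variables. -/
theorem ae_hasDerivAt_comp_timeChange {w : ℝ → X} (hS : 0 < S) (hT : 0 < T)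
    (hac : AbsolutelyContinuousOnInterval t 0 S) (hmono : MonotoneOn t (Icc 0 S))
    (hrange : ∀ s ∈ Icc 0 S, t s ∈ Icc 0 T) (hw : AbsolutelyContinuousOnInterval w 0 T) :
    IntegrableOn (fun s => deriv t s • deriv w (t s)) (Ioo 0 S) ∧
      (∀ᵐ s ∂(volume.restrict (Ioo 0 S)),
        HasDerivAt (fun s => w (t s)) (deriv t s • deriv w (t s)) s) ∧
      ∀ᵐ s ∂(volume.restrict (Ioo 0 S)), deriv t s ≠ 0 → DifferentiableAt ℝ w (t s) := by
  obtain ⟨hwd, hwi, hwf⟩ := absolutelyContinuous_hilbert hT hw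
  have h0 : (0 : ℝ) ∈ Icc 0 S := ⟨le_rfl, hS.le⟩
  have hIcc : IntegrableOn (deriv w) (Icc 0 T) :=
    (integrableOn_Icc_iff_integrableOn_Ioo (by simp) (by simp)).2 hwi
  have hint : IntegrableOn (fun s => deriv t s • deriv w (t s)) (Ioo 0 S) := by
    have h1 : S ∈ Icc 0 S := ⟨hS.le, le_rfl⟩
    -- Change of variables on the points of differentiability of `t`: they have full measure, and so
    -- has their image.
    rw [← integrableOn_congr_set_ae (diffSet_ae_eq hS hac h0 h1),
      ← integrableOn_image_iff_integrableOn_deriv_smul_of_monotoneOn (measurableSet_diffSet 0 S)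
        (hasDerivWithinAt_diffSet 0 S) (monotoneOn_diffSet hmono h0 h1)]
    rw [integrableOn_congr_set_ae (image_diffSet_ae_eq hS hac hmono h0 h1 hS.le)]
    exact hIcc.mono_set (Icc_subset_Icc (hrange 0 h0).1 (hrange S h1).2)
  refine ⟨hint, ae_hasDerivAt_of_eq_integral hS hint fun x hx => ?_, ?_⟩
  · rw [← sub_eq_iff_eq_add', ← setIntegral_congr_set (diffSet_ae_eq hS hac h0 hx),
      ← integral_image_eq_integral_deriv_smul_of_monotoneOn (measurableSet_diffSet 0 x)
        (hasDerivWithinAt_diffSet 0 x) (monotoneOn_diffSet hmono h0 hx),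
      setIntegral_congr_set (image_diffSet_ae_eq hS hac hmono h0 hx hx.1),
      hwf _ (hrange 0 h0) _ (hrange x hx) (hmono h0 hx hx.1), integral_Icc_eq_integral_Ioc,
      integral_Ioc_eq_integral_Ioo]
  -- The end points are added to the exceptional set because differentiability of `w` is known only
  -- inside `(0, T)`, while `t` may rest at `0` or `T`.
  · have hN : volume ({r | ¬ (r ∈ Ioo 0 T → DifferentiableAt ℝ w r)} ∪ {0, T}) = 0 := by
      refine measure_union_null ?_ (Set.Countable.measure_zero (by simp) _)
      exact (ae_restrict_iff' measurableSet_Ioo).1 hwd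
    have h := ae_deriv_eq_zero_of_mem_null hS hac hmono hN
    rw [ae_restrict_iff' measurableSet_Ioo] at h ⊢
    filter_upwards [h] with s hs hsm hne
    by_contra hnd
    apply hne
    apply hs hsm
    have hr := hrange s (Ioo_subset_Icc_self hsm)
    by_cases h : t s ∈ Ioo 0 T
    · exact Or.inl fun h' => hnd (h' h)
    · right
      by_contra hc
      simp only [mem_insert_iff, mem_singleton_iff, not_or] at hc
      exact h ⟨lt_of_le_of_ne hr.1 (Ne.symm hc.1), lt_of_le_of_ne hr.2 hc.2⟩

end TimeChange

/-! ### Preliminaries for the embedding of `H^m(Ω)` into the bounded functions -/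

theorem IsLipschitzDomain.isFiniteMeasure {n : ℕ} {Ω : Set (Vec n)} (hΩ : IsLipschitzDomain Ω) :
    IsFiniteMeasure (volume.restrict Ω) :=
  ⟨by rw [Measure.restrict_apply_univ]; exact hΩ.bounded.measure_lt_top⟩

/-- The uniform interior cone property of a Lipschitz domain, in local form. -/
theorem IsLipschitzDomain.exists_cone {n : ℕ} {Ω : Set (Vec n)} (hΩ : IsLipschitzDomain Ω)
    {x₀ : Vec n} (hx₀ : x₀ ∈ closure Ω) :
    ∃ r > 0, ∃ (v : Vec n), ∃ ρ > 0, ∀ x ∈ Metric.ball x₀ r ∩ Ω, ∀ τ ∈ Ioc (0 : ℝ) 1,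
      ∀ b ∈ Metric.ball v ρ, x + τ • b ∈ Ω := by
  by_cases hin : x₀ ∈ Ω
  · obtain ⟨r, hr, hball⟩ := Metric.isOpen_iff.1 hΩ.isOpen x₀ hin
    refine ⟨r / 2, by positivity, 0, r / 2, by positivity, ?_⟩
    rintro x ⟨hx, -⟩ τ ⟨hτ0, hτ1⟩ b hb
    apply hball
    rw [Metric.mem_ball, dist_eq_norm] at hx ⊢
    rw [mem_ball_zero_iff] at hb
    calc ‖x + τ • b - x₀‖ = ‖(x - x₀) + τ • b‖ := by congr 1; abel
      _ ≤ ‖x - x₀‖ + ‖τ • b‖ := norm_add_le _ _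
      _ < r / 2 + r / 2 := by
        refine add_lt_add hx ?_
        rw [norm_smul, Real.norm_of_nonneg hτ0.le]
        nlinarith [norm_nonneg b]
      _ = r := by ring
  · have hfr : x₀ ∈ frontier Ω := ⟨hx₀, by rwa [hΩ.isOpen.interior_eq]⟩
    obtain ⟨a, g, L, r, ha, hg, hr, hgr⟩ := hΩ.graph x₀ hfr
    have hL : (0 : ℝ) ≤ L := L.2
    -- The axis of the cone is `-(1 + L) ρ a`: a descent by `(1 + L) ρ` outweighs an error of at
    -- most `ρ` in height and of at most `L ρ` in the graph. The size of `ρ` gives `‖b‖ ≤ (2 + L) ρ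
    -- = r / 4`, so all points stay in the ball where the graph describes `Ω`.
    set ρ : ℝ := r / (4 * (2 + L)) with hρ
    have hρpos : 0 < ρ := by positivity
    have hρL : (2 + L) * ρ = r / 4 := by rw [hρ]; field_simp
    refine ⟨r / 2, by positivity, (-((1 + L) * ρ)) • a, ρ, hρpos, ?_⟩
    rintro x ⟨hx, hxΩ⟩ τ ⟨hτ0, hτ1⟩ b hb
    set b' : Vec n := b - (-((1 + L) * ρ)) • a with hb'
    have hb'n : ‖b'‖ < ρ := by rwa [Metric.mem_ball, dist_eq_norm] at hb
    have hbn : ‖b‖ ≤ r / 4 := by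
      have : b = b' + (-((1 + L) * ρ)) • a := by rw [hb']; abel
      rw [this]
      refine (norm_add_le _ _).trans ?_
      rw [norm_smul, ha, mul_one, norm_neg, Real.norm_of_nonneg (by positivity)]
      linarith
    have hxr : x ∈ Metric.ball x₀ r := Metric.ball_subset_ball (by linarith) hx
    have hyr : x + τ • b ∈ Metric.ball x₀ r := by
      rw [Metric.mem_ball, dist_eq_norm] at hx ⊢
      have : x + τ • b - x₀ = (x - x₀) + τ • b := by abel
      rw [this]
      refine (norm_add_le _ _).trans_lt ?_
      rw [norm_smul, Real.norm_of_nonneg hτ0.le]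
      nlinarith [norm_nonneg b]
    rw [hgr _ hyr]
    have hxg := (hgr _ hxr).1 hxΩ
    have haa : ⟪a, a⟫_ℝ = 1 := by rw [real_inner_self_eq_norm_sq, ha]; norm_num
    have hbb : b = b' + (-((1 + L) * ρ)) • a := by rw [hb']; abel
    have hbi : ⟪b, a⟫_ℝ = ⟪b', a⟫_ℝ - (1 + L) * ρ := by
      rw [hbb, inner_add_left, inner_smul_left, haa]
      simp
      ring
    have hperp : b - ⟪b, a⟫_ℝ • a = b' - ⟪b', a⟫_ℝ • a := by
      rw [hbi, hbb]
      module
    have hperpn : ‖b' - ⟪b', a⟫_ℝ • a‖ ≤ ρ := by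
      have h1 : ‖b' - ⟪b', a⟫_ℝ • a‖ ^ 2 = ‖b'‖ ^ 2 - ⟪b', a⟫_ℝ ^ 2 := by
        rw [@norm_sub_sq_real, norm_smul, inner_smul_right, ha, Real.norm_eq_abs, mul_one, sq_abs]
        ring
      refine abs_le_of_sq_le_sq' (a := ‖b' - ⟪b', a⟫_ℝ • a‖) ?_ hρpos.le |>.2
      rw [h1]
      nlinarith [norm_nonneg b', sq_nonneg ⟪b', a⟫_ℝ]
    have hb'a : ⟪b', a⟫_ℝ ≤ ρ := by
      refine (real_inner_le_norm _ _).trans ?_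
      rw [ha, mul_one]
      exact hb'n.le
    have harg : x + τ • b - ⟪x + τ • b, a⟫_ℝ • a =
        (x - ⟪x, a⟫_ℝ • a) + τ • (b' - ⟪b', a⟫_ℝ • a) := by
      rw [← hperp, inner_add_left, inner_smul_left]
      simp only [conj_trivial]
      module
    have hlip := hg.dist_le_mul (x - ⟪x, a⟫_ℝ • a) (x + τ • b - ⟪x + τ • b, a⟫_ℝ • a)
    rw [harg, dist_self_add_right, norm_smul, Real.norm_of_nonneg hτ0.le, Real.dist_eq] at hlip
    have hlip' := (abs_le.1 hlip).2
    have hlt : (L : ℝ) * (τ * ‖b' - ⟪b', a⟫_ℝ • a‖) ≤ L * (τ * ρ) := by gcongr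
    rw [harg, inner_add_left, inner_smul_left, hbi]
    simp only [conj_trivial]
    have hfin : τ * (⟪b', a⟫_ℝ - (1 + L) * ρ) ≤ - (L * (τ * ρ)) := by
      nlinarith
    linarith

/-- A smooth function supported in a given ball, with integral `1` and vanishing first moments. -/
theorem exists_moment_bump {n : ℕ} (v : Vec n) {ρ : ℝ} (hρ : 0 < ρ) :
    ∃ φ : Vec n → ℝ, ContDiff ℝ ∞ φ ∧ HasCompactSupport φ ∧ tsupport φ ⊆ Metric.ball v ρ ∧
      ∫ y, φ y = 1 ∧ ∀ j, ∫ y, φ y * y j = 0 := by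
  let f : ContDiffBump (0 : Vec n) := ⟨ρ / 4, ρ / 2, by positivity, by linarith⟩
  set φ₀ : Vec n → ℝ := f.normed volume with hφ₀
  have hs : ContDiff ℝ ∞ φ₀ := f.contDiff_normed
  have hcs : HasCompactSupport φ₀ := f.hasCompactSupport_normed
  have hts : tsupport φ₀ = Metric.closedBall 0 (ρ / 2) := f.tsupport_normed_eq
  have hint1 : ∫ y, φ₀ y = 1 := f.integral_normed
  have hsym : ∀ y, φ₀ (-y) = φ₀ y := fun y => f.normed_neg y
  have hdc : Continuous fun y => fderiv ℝ φ₀ y v :=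
    (hs.continuous_fderiv (by simp)).clm_apply continuous_const
  have hdcs : HasCompactSupport fun y => fderiv ℝ φ₀ y v :=
    (hcs.fderiv ℝ).comp_left (g := fun A : Vec n →L[ℝ] ℝ => A v) (by simp)
  have hdiff : Differentiable ℝ φ₀ := hs.differentiable (by simp)
  have hcoord : ∀ j, Continuous fun y : Vec n => y j := fun j =>
    (EuclideanSpace.proj j : Vec n →L[ℝ] ℝ).continuous
  have hd0 : ∫ y, fderiv ℝ φ₀ y v = 0 := by
    have h := integral_mul_fderiv_eq_neg_fderiv_mul_of_integrable (μ := (volume : Measure (Vec n)))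
      (f := fun _ => (1 : ℝ)) (g := φ₀) (v := v) (by simp)
      (by simpa using hdc.integrable_of_hasCompactSupport hdcs)
      (by simpa using hs.continuous.integrable_of_hasCompactSupport hcs)
      (fun x _ => differentiableAt_const _) (fun x _ => hdiff x)
    simpa using h
  have hd1 : ∀ j, ∫ y, fderiv ℝ φ₀ y v * y j = - v j := by
    intro j
    have hfd : ∀ x : Vec n, fderiv ℝ (fun y : Vec n => y j) x v = v j := by
      intro x
      have : HasFDerivAt (fun y : Vec n => y j) (EuclideanSpace.proj j : Vec n →L[ℝ] ℝ) x :=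
        (EuclideanSpace.proj j : Vec n →L[ℝ] ℝ).hasFDerivAt
      rw [this.fderiv]
      rfl
    have h := integral_mul_fderiv_eq_neg_fderiv_mul_of_integrable (μ := (volume : Measure (Vec n)))
      (f := fun y : Vec n => y j) (g := φ₀) (v := v)
      (by simp only [hfd]; exact (hs.continuous.integrable_of_hasCompactSupport hcs).const_mul _)
      (((hcoord j).mul hdc).integrable_of_hasCompactSupport hdcs.mul_left)
      (((hcoord j).mul hs.continuous).integrable_of_hasCompactSupport hcs.mul_left)
      (fun x _ => (EuclideanSpace.proj j : Vec n →L[ℝ] ℝ).differentiableAt) (fun x _ => hdiff x)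
    simp only [hfd] at h
    rw [integral_const_mul, hint1, mul_one] at h
    rw [← h]
    exact integral_congr_ae (Eventually.of_forall fun y => mul_comm _ _)
  have hm0 : ∀ j, ∫ y, φ₀ y * y j = 0 := by
    intro j
    have h := integral_neg_eq_self (fun y : Vec n => φ₀ y * y j) volume
    simp only [hsym, PiLp.neg_apply, mul_neg, integral_neg] at h
    linarith
  have hI0 := hs.continuous.integrable_of_hasCompactSupport hcs (μ := volume)
  have hI1 := hdc.integrable_of_hasCompactSupport hdcs (μ := volume)
  have hI2 : ∀ j, Integrable (fun y => φ₀ y * y j) volume := fun j =>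
    (hs.continuous.mul (hcoord j)).integrable_of_hasCompactSupport hcs.mul_right
  have hI3 : ∀ j, Integrable (fun y => fderiv ℝ φ₀ y v * y j) volume := fun j =>
    (hdc.mul (hcoord j)).integrable_of_hasCompactSupport hdcs.mul_right
  -- An even bump of integral one has first moments `v` after translation by `v`. Its derivative in
  -- direction `v` has integral zero and first moments `-v`, so adding it cancels them without
  -- changing the integral.
  refine ⟨fun y => φ₀ (y - v) + fderiv ℝ φ₀ (y - v) v, ?_, ?_, ?_, ?_, ?_⟩
  · refine (hs.comp (contDiff_id.sub contDiff_const)).add ?_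
    exact ((hs.fderiv_right (m := ∞) (by simp)).clm_apply contDiff_const).comp
      (contDiff_id.sub contDiff_const)
  · refine HasCompactSupport.add ?_ ?_
    · exact hcs.comp_homeomorph (Homeomorph.subRight v)
    · exact hdcs.comp_homeomorph (Homeomorph.subRight v)
  · have hsub : Function.support (fun y => φ₀ (y - v) + fderiv ℝ φ₀ (y - v) v) ⊆
        Metric.closedBall v (ρ / 2) := by
      intro y hy
      have : y - v ∈ tsupport φ₀ := by
        by_contra hc
        apply hy
        have h1 : φ₀ (y - v) = 0 := image_eq_zero_of_notMem_tsupport hc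
        have h2 : fderiv ℝ φ₀ (y - v) = 0 := by
          by_contra h
          exact hc (tsupport_fderiv_subset ℝ (subset_tsupport _ h))
        simp [h1, h2]
      rw [hts, mem_closedBall_zero_iff] at this
      rwa [Metric.mem_closedBall, dist_eq_norm]
    exact (closure_minimal hsub Metric.isClosed_closedBall).trans
      (Metric.closedBall_subset_ball (by linarith))
  · rw [integral_sub_right_eq_self (fun y => φ₀ y + fderiv ℝ φ₀ y v) v, integral_add hI0 hI1,
      hint1, hd0, add_zero]
  · intro j
    have h := integral_sub_right_eq_self (μ := (volume : Measure (Vec n)))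
      (fun y => (φ₀ y + fderiv ℝ φ₀ y v) * (y j + v j)) v
    have hj : ∀ y : Vec n, (y - v) j + v j = y j := fun y => by simp
    simp only [hj] at h
    rw [h]
    have : ∀ y : Vec n, (φ₀ y + fderiv ℝ φ₀ y v) * (y j + v j) =
        (φ₀ y * y j + fderiv ℝ φ₀ y v * y j) + (φ₀ y * v j + fderiv ℝ φ₀ y v * v j) := by
      intro y; ring
    simp only [this]
    have hA : Integrable (fun y => φ₀ y * y j + fderiv ℝ φ₀ y v * y j) volume := (hI2 j).add (hI3 j)
    have hB : Integrable (fun y => φ₀ y * v j + fderiv ℝ φ₀ y v * v j) volume :=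
      (hI0.mul_const _).add (hI1.mul_const _)
    rw [integral_add hA hB, integral_add (hI2 j) (hI3 j),
      integral_add (hI0.mul_const _) (hI1.mul_const _),
      integral_mul_const, integral_mul_const, hm0, hd1, hint1, hd0]
    ring

theorem integral_norm_le_sqrt_measure {α E : Type*} [MeasurableSpace α] [NormedAddCommGroup E]
    {μ : Measure α} [IsFiniteMeasure μ] {f : α → E} (hf : MemLp f 2 μ) :
    ∫ x, ‖f x‖ ∂μ ≤ (eLpNorm f 2 μ).toReal * Real.sqrt (μ.real univ) := by
  have h := eLpNorm_le_eLpNorm_mul_rpow_measure_univ (p := 1) (q := 2) (by norm_num)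
    hf.aestronglyMeasurable
  rw [eLpNorm_one_eq_lintegral_enorm] at h
  rw [integral_norm_eq_lintegral_enorm hf.aestronglyMeasurable]
  refine (ENNReal.toReal_mono ?_ h).trans ?_
  · exact ENNReal.mul_ne_top hf.2.ne (ENNReal.rpow_ne_top_of_nonneg (by norm_num) (by simp))
  · rw [ENNReal.toReal_mul, ← ENNReal.toReal_rpow, Real.sqrt_eq_rpow]
    norm_num [Measure.real]

/-! ### The embedding of `H^m(Ω)` into the bounded functions -/

section Embedding

variable {n : ℕ} {Ω : Set (Vec n)}

/-- The defining relation between a fractional difference quotient and the gradient. -/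
def IsFracQuot (Ω : Set (Vec n)) (m : ℝ) (G : L2 Ω (Vec n))
    (K : Lp (Vec n) 2 ((volume.restrict Ω).prod (volume.restrict Ω))) : Prop :=
  ∀ᵐ xy ∂((volume.restrict Ω).prod (volume.restrict Ω)),
    K xy = (‖xy.1 - xy.2‖ ^ (-((n : ℝ) / 2 + (m - 1)))) • (G xy.1 - G xy.2)

theorem IsFracQuot.norm_sub_le {m : ℝ} {G : L2 Ω (Vec n)}
    {K : Lp (Vec n) 2 ((volume.restrict Ω).prod (volume.restrict Ω))} (hK : IsFracQuot Ω m G K) :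
    ∀ᵐ xy ∂((volume.restrict Ω).prod (volume.restrict Ω)),
      ‖G xy.1 - G xy.2‖ ≤ ‖xy.1 - xy.2‖ ^ ((n : ℝ) / 2 + (m - 1)) * ‖K xy‖ := by
  filter_upwards [hK] with xy h
  rcases eq_or_ne xy.1 xy.2 with he | he
  · rw [he]
    simp only [sub_self, norm_zero]
    positivity
  · have hpos : 0 < ‖xy.1 - xy.2‖ := norm_pos_iff.2 (sub_ne_zero.2 he)
    rw [h, norm_smul, ← mul_assoc, Real.norm_of_nonneg (by positivity), ← Real.rpow_add hpos,
      add_neg_cancel, Real.rpow_zero, one_mul]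

/-- Since `χ` has mean zero on `B`, the value `G x` may be replaced by `G x - G y` and averaged over
`y ∈ B`. The difference is at most a power of `D` times `‖K (x, y)‖`, and Cauchy-Schwarz on `B × B`
produces a factor `|B|` that cancels the average. -/
theorem abs_integral_fracQuot_le {m : ℝ} {G : L2 Ω (Vec n)}
    {K : Lp (Vec n) 2 ((volume.restrict Ω).prod (volume.restrict Ω))}
    (hK : IsFracQuot Ω m G K)
    (hs : 0 ≤ (n : ℝ) / 2 + (m - 1)) {B : Set (Vec n)} (hB : B ⊆ Ω) (hBm : MeasurableSet B)
    (hvol : volume B ≠ ⊤) {D : ℝ} (hD0 : 0 ≤ D) (hD : ∀ x ∈ B, ∀ y ∈ B, ‖x - y‖ ≤ D)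
    {χ : Vec n → ℝ} (hχ : Continuous χ) {A : ℝ} (hA : ∀ x, |χ x| ≤ A)
    (h0 : ∫ x in B, χ x = 0) (j : Fin n) :
    |∫ x in B, G x j * χ x| ≤ A * D ^ ((n : ℝ) / 2 + (m - 1)) * ‖K‖ := by
  have hnorm := hK.norm_sub_le
  set s := (n : ℝ) / 2 + (m - 1)
  set μB := (volume.restrict B : Measure (Vec n)) with hμB
  have hfin : IsFiniteMeasure μB := ⟨by rw [hμB, Measure.restrict_apply_univ]; exact hvol.lt_top⟩
  have hA0 : 0 ≤ A := (abs_nonneg _).trans (hA 0)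
  rcases eq_or_ne (volume B) 0 with hz | hnz
  · have : μB = 0 := by rw [hμB]; exact Measure.restrict_eq_zero.2 hz
    rw [this]
    simp only [integral_zero_measure, abs_zero]
    positivity
  have hle : μB.prod μB ≤ (volume.restrict Ω).prod (volume.restrict Ω) := by
    rw [hμB, Measure.prod_restrict, Measure.prod_restrict]
    exact Measure.restrict_mono (Set.prod_mono hB hB) le_rfl
  have hleB : μB ≤ volume.restrict Ω := Measure.restrict_mono hB le_rfl
  have hGj : MemLp (fun x => G x j) 2 μB := (memLp_coord G j).mono_measure hleB
  have hχI : Integrable χ μB :=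
    Integrable.of_bound hχ.aestronglyMeasurable A (Eventually.of_forall fun x => by
      rw [Real.norm_eq_abs]; exact hA x)
  have hGI : Integrable (fun x => G x j) μB := hGj.integrable (by norm_num)
  have hGχ : Integrable (fun x => G x j * χ x) μB :=
    hGI.mul_bdd (c := A) hχ.aestronglyMeasurable (Eventually.of_forall fun x => by
      rw [Real.norm_eq_abs]; exact hA x)
  have hKB : MemLp K 2 (μB.prod μB) := (Lp.memLp K).mono_measure hle
  have hI1 : Integrable (fun xy : Vec n × Vec n => (G xy.1 j * χ xy.1) * (1 : ℝ)) (μB.prod μB) :=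
    hGχ.mul_prod (integrable_const (1 : ℝ))
  have hI2 : Integrable (fun xy : Vec n × Vec n => χ xy.1 * G xy.2 j) (μB.prod μB) :=
    hχI.mul_prod hGI
  have hF : ∫ xy, ((G xy.1 j * χ xy.1) * (1 : ℝ) - χ xy.1 * G xy.2 j) ∂(μB.prod μB) =
      (∫ x, G x j * χ x ∂μB) * μB.real univ := by
    rw [integral_sub hI1 hI2,
      integral_prod_mul (fun x => G x j * χ x) (fun _ => (1 : ℝ)),
      integral_prod_mul χ (fun x => G x j), h0, zero_mul, sub_zero, integral_const, smul_eq_mul,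
      mul_one]
  have hbound : |∫ xy, ((G xy.1 j * χ xy.1) * (1 : ℝ) - χ xy.1 * G xy.2 j) ∂(μB.prod μB)| ≤
      ∫ xy, (A * D ^ s) * ‖K xy‖ ∂(μB.prod μB) := by
    rw [← Real.norm_eq_abs]
    refine norm_integral_le_of_norm_le ((hKB.integrable (by norm_num)).norm.const_mul _) ?_
    have hin : ∀ᵐ xy ∂(μB.prod μB), xy ∈ B ×ˢ B := by
      rw [hμB, Measure.prod_restrict]
      exact ae_restrict_mem (hBm.prod hBm)
    filter_upwards [hle.absolutelyContinuous.ae_le hnorm, hin] with xy h hxy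
    have : (G xy.1 j * χ xy.1) * (1 : ℝ) - χ xy.1 * G xy.2 j = (G xy.1 - G xy.2) j * χ xy.1 := by
      rw [PiLp.sub_apply]; ring
    rw [this, norm_mul]
    have h1 : ‖(G xy.1 - G xy.2) j‖ ≤ ‖G xy.1 - G xy.2‖ := PiLp.norm_apply_le _ j
    have h2 : ‖xy.1 - xy.2‖ ^ s ≤ D ^ s :=
      Real.rpow_le_rpow (norm_nonneg _) (hD _ hxy.1 _ hxy.2) hs
    calc ‖(G xy.1 - G xy.2) j‖ * ‖χ xy.1‖ ≤ (D ^ s * ‖K xy‖) * A := by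
          refine mul_le_mul ?_ (by rw [Real.norm_eq_abs]; exact hA _) (norm_nonneg _)
            (by positivity)
          exact h1.trans (h.trans (by gcongr))
      _ = (A * D ^ s) * ‖K xy‖ := by ring
  have hKint : ∫ xy, ‖K xy‖ ∂(μB.prod μB) ≤ ‖K‖ * μB.real univ := by
    refine (integral_norm_le_sqrt_measure hKB).trans ?_
    have : (μB.prod μB).real univ = μB.real univ ^ 2 := by
      rw [← Set.univ_prod_univ, measureReal_prod_prod]
      ring
    rw [this, Real.sqrt_sq measureReal_nonneg]
    refine mul_le_mul_of_nonneg_right ?_ measureReal_nonneg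
    rw [Lp.norm_def]
    exact ENNReal.toReal_mono (Lp.eLpNorm_ne_top _) (eLpNorm_mono_measure _ hle)
  rw [hF, integral_const_mul, abs_mul, abs_of_nonneg (measureReal_nonneg (μ := μB))] at hbound
  have hpos : 0 < μB.real univ := by
    rw [measureReal_def]
    refine ENNReal.toReal_pos ?_ (measure_ne_top _ _)
    rwa [hμB, Measure.restrict_apply_univ]
  have hADs : 0 ≤ A * D ^ s := by positivity
  have := hbound.trans (mul_le_mul_of_nonneg_left hKint hADs)
  rw [← mul_assoc] at this
  exact le_of_mul_le_mul_right this hpos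

/-- The mean of `z` against the rescaled kernel `τ⁻ⁿ φ((y - x) / τ)`. -/
def kernelMean (Ω : Set (Vec n)) (φ : Vec n → ℝ) (z : Vec n → ℝ) (x : Vec n) (τ : ℝ) : ℝ :=
  ∫ y in Ω, z y * (τ ^ (-(n : ℤ)) * φ (τ⁻¹ • (y - x)))

theorem exists_bound_of_hasCompactSupport {E F : Type*} [TopologicalSpace E] [NormedAddCommGroup F]
    {f : E → F} (hf : Continuous f) (hs : HasCompactSupport f) : ∃ A, 0 ≤ A ∧ ∀ x, ‖f x‖ ≤ A := by
  obtain ⟨C, hC⟩ := hs.exists_bound_of_continuous hf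
  exact ⟨max C 0, le_max_right _ _, fun x => (hC x).trans (le_max_left _ _)⟩

theorem hasDerivAt_kernelMean [IsFiniteMeasure (volume.restrict Ω)] {φ : Vec n → ℝ}
    (hφ : ContDiff ℝ ∞ φ) (hφs : HasCompactSupport φ) (z : L2 Ω ℝ) (x : Vec n) {τ : ℝ}
    (hτ : 0 < τ) :
    HasDerivAt (kernelMean Ω φ z x)
      (∫ y in Ω, z y * (-(τ ^ (-(n : ℤ)) * τ⁻¹ * (fderiv ℝ φ (τ⁻¹ • (y - x)) (τ⁻¹ • (y - x)) +
        n * φ (τ⁻¹ • (y - x)))))) τ := by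
  set θ : Vec n → ℝ := fun η => fderiv ℝ φ η η + n * φ η with hθ
  have hθc : Continuous θ :=
    ((hφ.continuous_fderiv (by simp)).clm_apply continuous_id).add
      (continuous_const.mul hφ.continuous)
  have hθs : HasCompactSupport θ := by
    refine HasCompactSupport.add ?_ hφs.mul_left
    refine (hφs.fderiv ℝ).mono fun y hy => ?_
    intro h
    apply hy
    simp [h]
  obtain ⟨A, hA0, hA⟩ := exists_bound_of_hasCompactSupport hθc hθs
  have hzI : Integrable z (volume.restrict Ω) := (Lp.memLp z).integrable (by norm_num)
  obtain ⟨Aφ, hAφ0, hAφ⟩ := exists_bound_of_hasCompactSupport hφ.continuous hφs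
  have hτ2 : 0 < τ / 2 := by positivity
  -- Near `τ` the scale stays above `τ / 2`, which bounds the differentiated kernel uniformly.
  refine (hasDerivAt_integral_of_dominated_loc_of_deriv_le (s := Ioi (τ / 2))
    (F := fun τ y => z y * (τ ^ (-(n : ℤ)) * φ (τ⁻¹ • (y - x))))
    (F' := fun τ y => z y * (-(τ ^ (-(n : ℤ)) * τ⁻¹ * θ (τ⁻¹ • (y - x)))))
    (bound := fun y => ‖z y‖ * ((τ / 2) ^ (-(n : ℤ)) * (τ / 2)⁻¹ * A))
    (Ioi_mem_nhds (by linarith)) ?_ ?_ ?_ ?_ ?_ ?_).2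
  · refine Eventually.of_forall fun σ => hzI.aestronglyMeasurable.mul ?_
    exact (continuous_const.mul (hφ.continuous.comp (by fun_prop))).aestronglyMeasurable
  · refine hzI.mul_bdd (c := |τ ^ (-(n : ℤ))| * Aφ) ?_ (Eventually.of_forall fun y => ?_)
    · exact (continuous_const.mul (hφ.continuous.comp (by fun_prop))).aestronglyMeasurable
    · rw [norm_mul, Real.norm_eq_abs]
      gcongr
      exact hAφ _
  · refine hzI.aestronglyMeasurable.mul ?_
    exact (continuous_const.mul (hθc.comp (by fun_prop))).neg.aestronglyMeasurable
  · refine Eventually.of_forall fun y σ hσ => ?_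
    have hσ' : τ / 2 < σ := hσ
    have hσ0 : 0 < σ := hτ2.trans hσ'
    rw [norm_mul, norm_neg, norm_mul, norm_mul]
    have e1 : ‖σ ^ (-(n : ℤ))‖ ≤ (τ / 2) ^ (-(n : ℤ)) := by
      rw [Real.norm_of_nonneg (by positivity), zpow_neg, zpow_neg, zpow_natCast, zpow_natCast]
      gcongr
    have e2 : ‖σ⁻¹‖ ≤ (τ / 2)⁻¹ := by
      rw [Real.norm_of_nonneg (by positivity)]
      gcongr
    gcongr
    exact hA _
  · exact hzI.norm.mul_const _
  · refine Eventually.of_forall fun y σ hσ => ?_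
    have hσ0 : 0 < σ := hτ2.trans hσ
    have h1 : HasDerivAt (fun σ : ℝ => σ⁻¹ • (y - x)) ((-(σ ^ 2)⁻¹) • (y - x)) σ :=
      (hasDerivAt_inv hσ0.ne').smul_const _
    have h2 : HasDerivAt (fun σ : ℝ => φ (σ⁻¹ • (y - x)))
        (fderiv ℝ φ (σ⁻¹ • (y - x)) ((-(σ ^ 2)⁻¹) • (y - x))) σ :=
      ((hφ.differentiable (by simp)) _).hasFDerivAt.comp_hasDerivAt σ h1
    have h3 := hasDerivAt_zpow (-(n : ℤ)) σ (Or.inl hσ0.ne')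
    refine ((h3.mul h2).const_mul (z y)).congr_deriv ?_
    have e3 : (-(σ ^ 2)⁻¹) • (y - x) = (-σ⁻¹) • (σ⁻¹ • (y - x)) := by
      rw [smul_smul]
      congr 1
      field_simp
    rw [e3, map_smul, zpow_sub_one₀ hσ0.ne']
    simp only [hθ, smul_eq_mul]
    push_cast
    ring

end Embedding

section Embedding

variable {n : ℕ} {Ω : Set (Vec n)}

/-- Up to a factor, the scale derivative of the kernel is the divergence of the field `φ(η) η` with
`η = (y - x) / τ`. In this form it can be moved onto `z` by integration by parts. -/
theorem sum_fderiv_scaled {φ : Vec n → ℝ} (hφ : ContDiff ℝ ∞ φ) (x : Vec n) (τ : ℝ) (y : Vec n) :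
    ∑ j, fderiv ℝ (fun y : Vec n => φ (τ⁻¹ • (y - x)) * (τ⁻¹ • (y - x)) j) y
      (EuclideanSpace.single j 1) =
    τ⁻¹ * (fderiv ℝ φ (τ⁻¹ • (y - x)) (τ⁻¹ • (y - x)) + n * φ (τ⁻¹ • (y - x))) := by
  set η := τ⁻¹ • (y - x) with hη
  have hlin : HasFDerivAt (fun y : Vec n => τ⁻¹ • (y - x)) (τ⁻¹ • ContinuousLinearMap.id ℝ (Vec n))
      y := ((hasFDerivAt_id y).sub_const x).const_smul τ⁻¹
  have hterm : ∀ j, fderiv ℝ (fun y : Vec n => φ (τ⁻¹ • (y - x)) * (τ⁻¹ • (y - x)) j) y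
      (EuclideanSpace.single j 1) =
      τ⁻¹ * (η j * fderiv ℝ φ η (EuclideanSpace.single j 1)) + τ⁻¹ * φ η := by
    intro j
    have h1 := (((hφ.differentiable (by simp)) η).hasFDerivAt).comp y hlin
    have h2 := ((EuclideanSpace.proj j : Vec n →L[ℝ] ℝ).hasFDerivAt (x := η)).comp y hlin
    have h3 := (h1.mul h2).fderiv
    have h4 : fderiv ℝ (fun y : Vec n => φ (τ⁻¹ • (y - x)) * (τ⁻¹ • (y - x)) j) y = _ := h3
    rw [h4]
    simp [← hη]
    ring
  simp only [hterm]
  rw [Finset.sum_add_distrib, ← Finset.mul_sum]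
  have hsum : ∑ j, η j * fderiv ℝ φ η (EuclideanSpace.single j 1) = fderiv ℝ φ η η := by
    conv_rhs => rw [show fderiv ℝ φ η η = fderiv ℝ φ η (∑ j, η j • EuclideanSpace.single j (1 : ℝ))
      from by
        congr 1
        have := (EuclideanSpace.basisFun (Fin n) ℝ).sum_repr η
        simpa using this.symm]
    rw [map_sum]
    simp
  rw [hsum]
  simp
  ring

/-- Integration by parts turns the scale derivative into integrals of the weak gradient against the
components of `φ(η) η`, which have mean zero by the moment condition. The fractional quotient then
bounds it by a multiple of `τ ^ (m - n / 2 - 1)`, a power integrable at `0` since `m > n / 2`. -/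
theorem norm_deriv_kernelMean_le {m : ℝ} (hΩ : IsLipschitzDomain Ω) {φ : Vec n → ℝ}
    (hφ : ContDiff ℝ ∞ φ) (hφs : HasCompactSupport φ) {v : Vec n} {ρ : ℝ} (hρ : 0 < ρ)
    (hsub : tsupport φ ⊆ Metric.ball v ρ) (hmom : ∀ j, ∫ y, φ y * y j = 0)
    (hs : 0 ≤ (n : ℝ) / 2 + (m - 1)) {A : ℝ} (hA : ∀ j y, |φ y * y j| ≤ A)
    {z : L2 Ω ℝ} {G : L2 Ω (Vec n)}
    {K : Lp (Vec n) 2 ((volume.restrict Ω).prod (volume.restrict Ω))}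
    (hG : WeakGradOn Ω Ω z (fun x j => G x j)) (hK : IsFracQuot Ω m G K)
    {x : Vec n} {τ : ℝ} (hτ : 0 < τ) (hcone : ∀ b ∈ Metric.ball v ρ, x + τ • b ∈ Ω) :
    |deriv (kernelMean Ω φ z x) τ| ≤
      τ ^ (-(n : ℤ)) * (n * (A * (2 * ρ * τ) ^ ((n : ℝ) / 2 + (m - 1)) * ‖K‖)) := by
  have hfin := hΩ.isFiniteMeasure
  rw [(hasDerivAt_kernelMean hφ hφs z x hτ).deriv]
  set χ : Fin n → Vec n → ℝ := fun j y => φ (τ⁻¹ • (y - x)) * (τ⁻¹ • (y - x)) j with hχ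
  have hχsm : ∀ j, ContDiff ℝ ∞ (χ j) := by
    intro j
    have hl : ContDiff ℝ ∞ fun y : Vec n => τ⁻¹ • (y - x) :=
      (contDiff_id.sub contDiff_const).const_smul τ⁻¹
    exact (hφ.comp hl).mul ((EuclideanSpace.proj j : Vec n →L[ℝ] ℝ).contDiff.comp hl)
  -- A compact subset of `Ω`, by the cone condition, that carries all the fields and makes them
  -- admissible test functions.
  set C : Set (Vec n) := (fun b : Vec n => x + τ • b) '' tsupport φ with hC
  have hCc : IsCompact C := hφs.isCompact.image (by fun_prop)
  have hCΩ : C ⊆ Ω := by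
    rintro _ ⟨b, hb, rfl⟩
    exact hcone b (hsub hb)
  have hback : ∀ y, x + τ • (τ⁻¹ • (y - x)) = y := fun y => by
    rw [smul_inv_smul₀ hτ.ne']; abel
  have hχsupp : ∀ j, Function.support (χ j) ⊆ C := by
    intro j y hy
    refine ⟨τ⁻¹ • (y - x), ?_, hback y⟩
    refine subset_tsupport _ fun h => hy ?_
    simp [hχ, h]
  have hχcs : ∀ j, HasCompactSupport (χ j) := fun j =>
    HasCompactSupport.of_support_subset_isCompact hCc (hχsupp j)
  have hχt : ∀ j, tsupport (χ j) ⊆ Ω := fun j =>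
    (closure_minimal (hχsupp j) hCc.isClosed).trans hCΩ
  have hW := fun j => hG (χ j) (hχsm j) (hχcs j) (hχt j) j
  have hderiv : ∫ y in Ω, z y * (-(τ ^ (-(n : ℤ)) * τ⁻¹ *
      (fderiv ℝ φ (τ⁻¹ • (y - x)) (τ⁻¹ • (y - x)) + n * φ (τ⁻¹ • (y - x))))) =
      τ ^ (-(n : ℤ)) * ∑ j, ∫ y in Ω, G y j * χ j y := by
    have : ∀ y, z y * (-(τ ^ (-(n : ℤ)) * τ⁻¹ *
      (fderiv ℝ φ (τ⁻¹ • (y - x)) (τ⁻¹ • (y - x)) + n * φ (τ⁻¹ • (y - x))))) =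
      -τ ^ (-(n : ℤ)) * ∑ j, z y * fderiv ℝ (χ j) y (EuclideanSpace.single j 1) := by
      intro y
      rw [← Finset.mul_sum, sum_fderiv_scaled hφ]
      ring
    simp only [this]
    rw [integral_const_mul, integral_finsetSum _ fun j _ =>
      integrable_mul_dtest (Lp.memLp z) (hχsm j) (hχcs j) _]
    simp only [hW, Finset.sum_neg_distrib]
    ring
  rw [hderiv, abs_mul, abs_of_pos (by positivity)]
  refine mul_le_mul_of_nonneg_left ?_ (by positivity)
  refine (Finset.abs_sum_le_sum_abs _ _).trans ?_
  set B : Set (Vec n) := Metric.ball (x + τ • v) (τ * ρ) with hBdef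
  have hCB : C ⊆ B := by
    rintro _ ⟨b, hb, rfl⟩
    have := hsub hb
    rw [Metric.mem_ball, dist_eq_norm] at this ⊢
    have e : x + τ • b - (x + τ • v) = τ • (b - v) := by rw [smul_sub]; abel
    rw [e, norm_smul, Real.norm_of_nonneg hτ.le]
    gcongr
  have hBΩ : B ⊆ Ω := by
    intro y hy
    rw [← hback y]
    apply hcone
    rw [hBdef, Metric.mem_ball, dist_eq_norm] at hy
    rw [Metric.mem_ball, dist_eq_norm]
    have e : y - (x + τ • v) = τ • (τ⁻¹ • (y - x) - v) := by
      rw [smul_sub, smul_inv_smul₀ hτ.ne']; abel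
    rw [e, norm_smul, Real.norm_of_nonneg hτ.le] at hy
    exact lt_of_mul_lt_mul_left hy hτ.le
  have hterm : ∀ j, |∫ y in Ω, G y j * χ j y| ≤
      A * (2 * ρ * τ) ^ ((n : ℝ) / 2 + (m - 1)) * ‖K‖ := by
    intro j
    have hzero : ∀ y, y ∉ B → χ j y = 0 := fun y hy => by
      by_contra h
      exact hy (hCB (hχsupp j h))
    have e1 : ∫ y in Ω, G y j * χ j y = ∫ y in B, G y j * χ j y :=
      setIntegral_eq_of_subset_of_forall_sdiff_eq_zero hΩ.isOpen.measurableSet hBΩ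
        fun y hy => by rw [hzero y hy.2, mul_zero]
    have e2 : ∫ y in B, χ j y = 0 := by
      rw [setIntegral_eq_integral_of_forall_compl_eq_zero hzero]
      have h1 := integral_sub_right_eq_self (μ := (volume : Measure (Vec n)))
        (fun y : Vec n => φ (τ⁻¹ • y) * (τ⁻¹ • y) j) x
      have h2 := Measure.integral_comp_inv_smul (volume : Measure (Vec n))
        (fun y : Vec n => φ y * y j) τ
      rw [hmom j, smul_zero] at h2
      exact h1.trans h2
    rw [e1]
    refine abs_integral_fracQuot_le hK hs hBΩ measurableSet_ball measure_ball_lt_top.ne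
      (by positivity) ?_ (hχsm j).continuous (fun y => hA j _) e2 j
    intro y hy y' hy'
    rw [hBdef, Metric.mem_ball] at hy hy'
    rw [← dist_eq_norm]
    have := dist_triangle_right y y' (x + τ • v)
    linarith
  calc ∑ j, |∫ y in Ω, G y j * χ j y| ≤
      ∑ _j : Fin n, A * (2 * ρ * τ) ^ ((n : ℝ) / 2 + (m - 1)) * ‖K‖ :=
        Finset.sum_le_sum fun j _ => hterm j
    _ = n * (A * (2 * ρ * τ) ^ ((n : ℝ) / 2 + (m - 1)) * ‖K‖) := by simp

/-- The kernel at scale `τ` is at most `A τ⁻ⁿ` and lives in the ball of radius `τ R` around `x`, so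
Lebesgue's differentiation theorem applies although its support is off centre. The cone condition
keeps the support in `Ω`, so no part of its unit mass is lost. -/
theorem tendsto_kernelMean (hΩ : IsLipschitzDomain Ω) {φ : Vec n → ℝ}
    (hφ : ContDiff ℝ ∞ φ) (hφs : HasCompactSupport φ) (hint : ∫ y, φ y = 1) {v : Vec n} {ρ : ℝ}
    (hρ : 0 < ρ) (hsub : tsupport φ ⊆ Metric.ball v ρ) (z : L2 Ω ℝ) :
    ∀ᵐ x ∂(volume.restrict Ω),
      (∀ τ ∈ Ioc (0 : ℝ) 1, ∀ b ∈ Metric.ball v ρ, x + τ • b ∈ Ω) →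
      Tendsto (kernelMean Ω φ z x) (𝓝[>] 0) (𝓝 (z x)) := by
  have hfin := hΩ.isFiniteMeasure
  have hΩm := hΩ.isOpen.measurableSet
  set f : Vec n → ℝ := Ω.indicator z with hf
  have hzI : Integrable z (volume.restrict Ω) := (Lp.memLp z).integrable (by norm_num)
  have hfI : Integrable f volume := (integrable_indicator_iff hΩm).2 hzI
  obtain ⟨A, hA0, hA⟩ := exists_bound_of_hasCompactSupport hφ.continuous hφs
  set R : ℝ := ‖v‖ + ρ with hR
  have hRpos : 0 < R := by positivity
  have hL := IsUnifLocDoublingMeasure.ae_tendsto_average_norm_sub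
    (μ := (volume : Measure (Vec n))) hfI.locallyIntegrable 1
  rw [ae_restrict_iff' hΩm]
  filter_upwards [hL] with x hx hxΩ hcone
  have hδ : Tendsto (fun τ : ℝ => τ * R) (𝓝[>] 0) (𝓝[>] 0) := by
    refine tendsto_nhdsWithin_iff.2 ⟨?_, ?_⟩
    · have : Tendsto (fun τ : ℝ => τ * R) (𝓝 0) (𝓝 (0 * R)) := by
        exact (continuous_id.mul continuous_const).tendsto 0
      rw [zero_mul] at this
      exact this.mono_left nhdsWithin_le_nhds
    · filter_upwards [self_mem_nhdsWithin] with τ hτ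
      exact mul_pos hτ hRpos
  have hav := hx (fun _ => x) (fun τ : ℝ => τ * R) hδ (by
    filter_upwards [self_mem_nhdsWithin] with τ hτ
    have hτ' : 0 < τ := hτ
    exact Metric.mem_closedBall_self (by positivity))
  rw [tendsto_iff_norm_sub_tendsto_zero]
  set V : ℝ := (volume : Measure (Vec n)).real (Metric.closedBall 0 R) with hV
  have hlim : Tendsto (fun τ : ℝ => A * V *
      ⨍ y in Metric.closedBall x (τ * R), ‖f y - f x‖) (𝓝[>] 0) (𝓝 0) := by
    simpa using hav.const_mul (A * V)
  refine squeeze_zero' (Eventually.of_forall fun _ => norm_nonneg _) ?_ hlim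
  filter_upwards [Ioc_mem_nhdsGT (zero_lt_one' ℝ)] with τ hτ
  have hτ0 : 0 < τ := hτ.1
  set ψ : Vec n → ℝ := fun y => τ ^ (-(n : ℤ)) * φ (τ⁻¹ • (y - x)) with hψ
  set B := Metric.closedBall x (τ * R) with hB
  have hback : ∀ y, x + τ • (τ⁻¹ • (y - x)) = y := fun y => by
    rw [smul_inv_smul₀ hτ0.ne']; abel
  have hmem : ∀ y, ψ y ≠ 0 → τ⁻¹ • (y - x) ∈ Metric.ball v ρ := by
    intro y hy
    refine hsub (subset_tsupport _ fun h => hy ?_)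
    simp [hψ, h]
  have hψΩ : ∀ y, y ∉ Ω → ψ y = 0 := by
    intro y hy
    by_contra h
    apply hy
    rw [← hback y]
    exact hcone τ hτ _ (hmem y h)
  have hψB : ∀ y, y ∉ B → ψ y = 0 := by
    intro y hy
    by_contra h
    apply hy
    have h1 := hmem y h
    rw [Metric.mem_ball, dist_eq_norm] at h1
    rw [hB, Metric.mem_closedBall, dist_eq_norm]
    have h2 : ‖τ⁻¹ • (y - x)‖ ≤ R := by
      have : τ⁻¹ • (y - x) = (τ⁻¹ • (y - x) - v) + v := by abel
      rw [this]
      refine (norm_add_le _ _).trans ?_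
      rw [hR]
      linarith
    rw [norm_smul, norm_inv, Real.norm_of_nonneg hτ0.le, inv_mul_le_iff₀ hτ0] at h2
    exact h2
  have hψc : Continuous ψ := continuous_const.mul (hφ.continuous.comp (by fun_prop))
  have hψb : ∀ y, ‖ψ y‖ ≤ τ ^ (-(n : ℤ)) * A := fun y => by
    rw [hψ, norm_mul, Real.norm_of_nonneg (by positivity : (0 : ℝ) ≤ τ ^ (-(n : ℤ)))]
    exact mul_le_mul_of_nonneg_left (hA _) (by positivity)
  have hψI : ∫ y, ψ y = 1 := by
    rw [hψ, integral_const_mul]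
    have h1 := integral_sub_right_eq_self (μ := (volume : Measure (Vec n)))
        (fun y : Vec n => φ (τ⁻¹ • y)) x
    have h2 := Measure.integral_comp_inv_smul (volume : Measure (Vec n)) φ τ
    rw [h1, h2, hint, finrank_euclideanSpace_fin, abs_of_pos (by positivity), zpow_neg,
      zpow_natCast,
      smul_eq_mul, mul_one, inv_mul_cancel₀ (by positivity)]
  have hψint : Integrable ψ volume := by
    by_contra h
    rw [integral_undef h] at hψI
    exact zero_ne_one hψI
  have hM : kernelMean Ω φ z x τ = ∫ y, f y * ψ y := by
    unfold kernelMean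
    have : ∀ y, f y * ψ y = Ω.indicator (fun y => z y * ψ y) y := fun y => by
      by_cases hy : y ∈ Ω <;> simp [hf, hy]
    simp only [this]
    rw [integral_indicator hΩm]
  have hfψ : Integrable (fun y => f y * ψ y) volume :=
    hfI.mul_bdd hψc.aestronglyMeasurable (Eventually.of_forall hψb)
  have hfx : f x = z x := by simp [hf, hxΩ]
  have hdiff : kernelMean Ω φ z x τ - z x = ∫ y in B, (f y - f x) * ψ y := by
    rw [setIntegral_eq_integral_of_forall_compl_eq_zero (fun y hy => by rw [hψB y hy, mul_zero])]
    simp only [sub_mul]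
    rw [integral_sub hfψ (hψint.const_mul _), integral_const_mul, hψI, hM, hfx, mul_one]
  rw [hdiff]
  have hBfin : volume B ≠ ⊤ := measure_closedBall_lt_top.ne
  have hfB : IntegrableOn (fun y => ‖f y - f x‖) B :=
    (hfI.integrableOn.sub (integrableOn_const hBfin)).norm
  have hle : ‖∫ y in B, (f y - f x) * ψ y‖ ≤ ∫ y in B, ‖f y - f x‖ * (τ ^ (-(n : ℤ)) * A) := by
    refine norm_integral_le_of_norm_le (hfB.mul_const _) (Eventually.of_forall fun y => ?_)
    rw [norm_mul]
    exact mul_le_mul_of_nonneg_left (hψb y) (norm_nonneg _)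
  refine hle.trans (le_of_eq ?_)
  have hBvol : (volume : Measure (Vec n)).real B = τ ^ n * V := by
    rw [hB, hV, measureReal_def, Measure.addHaar_closedBall_mul_of_pos _ _ hτ0, ENNReal.toReal_mul,
      finrank_euclideanSpace_fin, ENNReal.toReal_ofReal (by positivity), measureReal_def]
  have hVpos : 0 < V := by
    rw [hV, measureReal_def]
    exact ENNReal.toReal_pos (Metric.measure_closedBall_pos _ _ hRpos).ne'
      measure_closedBall_lt_top.ne
  rw [integral_mul_const, setAverage_eq, hBvol, smul_eq_mul, zpow_neg, zpow_natCast]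
  field_simp

end Embedding

/-- Comparison with the primitive `(c / α) τ ^ α` of the bound: adding `M` to it or subtracting `M`
from it leaves a nondecreasing function. -/
theorem abs_sub_le_of_abs_deriv_le_rpow {M : ℝ → ℝ} {c α : ℝ} (hα : 0 < α) (hc : 0 ≤ c)
    (hd : ∀ τ ∈ Ioc (0 : ℝ) 1, DifferentiableAt ℝ M τ)
    (hb : ∀ τ ∈ Ioc (0 : ℝ) 1, |deriv M τ| ≤ c * τ ^ (α - 1)) {ε : ℝ} (hε : ε ∈ Ioc (0 : ℝ) 1) :
    |M 1 - M ε| ≤ c / α := by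
  have hsub : Icc ε 1 ⊆ Ioc (0 : ℝ) 1 := fun τ hτ => ⟨hε.1.trans_le hτ.1, hτ.2⟩
  have hpow : ∀ τ ∈ Ioc (0 : ℝ) 1, HasDerivAt (fun τ : ℝ => c / α * τ ^ α) (c * τ ^ (α - 1)) τ := by
    intro τ hτ
    refine ((Real.hasDerivAt_rpow_const (p := α) (Or.inl hτ.1.ne')).const_mul (c / α)).congr_deriv
      ?_
    field_simp
  have h1 : MonotoneOn (fun τ => c / α * τ ^ α + M τ) (Icc ε 1) := by
    refine monotoneOn_of_deriv_nonneg (convex_Icc _ _) (fun τ hτ => ?_) (fun τ hτ => ?_)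
      fun τ hτ => ?_
    · exact ((hpow τ (hsub hτ)).differentiableAt.add (hd τ
        (hsub hτ))).continuousAt.continuousWithinAt
    · have h := hsub (interior_subset hτ)
      exact ((hpow τ h).differentiableAt.add (hd τ h)).differentiableWithinAt
    · have h := hsub (interior_subset hτ)
      rw [((hpow τ h).fun_add (hd τ h).hasDerivAt).deriv]
      linarith [(abs_le.1 (hb τ h)).1]
  have h2 : MonotoneOn (fun τ => c / α * τ ^ α - M τ) (Icc ε 1) := by
    refine monotoneOn_of_deriv_nonneg (convex_Icc _ _) (fun τ hτ => ?_) (fun τ hτ => ?_)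
      fun τ hτ => ?_
    · exact ((hpow τ (hsub hτ)).differentiableAt.sub (hd τ
        (hsub hτ))).continuousAt.continuousWithinAt
    · have h := hsub (interior_subset hτ)
      exact ((hpow τ h).differentiableAt.sub (hd τ h)).differentiableWithinAt
    · have h := hsub (interior_subset hτ)
      rw [((hpow τ h).fun_sub (hd τ h).hasDerivAt).deriv]
      linarith [(abs_le.1 (hb τ h)).2]
  have hεm : ε ∈ Icc ε 1 := ⟨le_rfl, hε.2⟩
  have h1m : (1 : ℝ) ∈ Icc ε 1 := ⟨hε.2, le_rfl⟩
  have e1 := h1 hεm h1m hε.2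
  have e2 := h2 hεm h1m hε.2
  simp only [Real.one_rpow, mul_one] at e1 e2
  have hnn : 0 ≤ c / α * ε ^ α := mul_nonneg (by positivity) (Real.rpow_nonneg hε.1.le _)
  rw [abs_le]
  constructor <;> linarith

section Embedding

variable {n : ℕ} {Ω : Set (Vec n)}

theorem norm_field_le {m : ℝ} (z : Hm Ω m) : ‖field z‖ ≤ ‖z‖ := by
  have h := WithLp.prod_norm_sq_eq_of_L2
    (z : WithLp 2 (L2 Ω ℝ × Lp (Vec n) 2 ((volume.restrict Ω).prod (volume.restrict Ω))))
  refine abs_le_of_sq_le_sq' (a := ‖field z‖) ?_ (norm_nonneg z) |>.2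
  change _ ≤ ‖(z : WithLp 2 (L2 Ω ℝ × Lp (Vec n) 2
    ((volume.restrict Ω).prod (volume.restrict Ω))))‖ ^ 2
  rw [h]
  exact le_add_of_nonneg_right (sq_nonneg _)

theorem norm_quot_le {m : ℝ} (z : Hm Ω m) :
    ‖(z : WithLp 2 (L2 Ω ℝ × Lp (Vec n) 2 ((volume.restrict Ω).prod (volume.restrict Ω)))).snd‖
      ≤ ‖z‖ := by
  have h := WithLp.prod_norm_sq_eq_of_L2
    (z : WithLp 2 (L2 Ω ℝ × Lp (Vec n) 2 ((volume.restrict Ω).prod (volume.restrict Ω))))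
  refine abs_le_of_sq_le_sq' (b := ‖z‖) ?_ (norm_nonneg z) |>.2
  change _ ≤ ‖(z : WithLp 2 (L2 Ω ℝ × Lp (Vec n) 2
    ((volume.restrict Ω).prod (volume.restrict Ω))))‖ ^ 2
  rw [h]
  exact le_add_of_nonneg_left (sq_nonneg _)

set_option maxHeartbeats 1000000 in
-- One cone serves all points of `Ω` near `x₀`. The mean of `z` at scale `1` is bounded by the `L²`
-- norm, it varies by at most `C₁ ‖K‖ / α` between the scales `τ` and `1`, and it converges to `z x`
-- for almost every `x` as `τ → 0`.
theorem exists_local_field_bound {m : ℝ} (hΩ : IsLipschitzDomain Ω) (hm : (n : ℝ) / 2 < m)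
    (hs : 0 ≤ (n : ℝ) / 2 + (m - 1)) {x₀ : Vec n} (hx₀ : x₀ ∈ closure Ω) :
    ∃ r > 0, ∃ C ≥ 0, ∀ z : Hm Ω m, ∀ᵐ x ∂(volume.restrict Ω), x ∈ Metric.ball x₀ r →
      |field z x| ≤ C * ‖z‖ := by
  have hfin := hΩ.isFiniteMeasure
  obtain ⟨r, hr, v, ρ, hρ, hcone⟩ := hΩ.exists_cone hx₀
  obtain ⟨φ, hφ, hφs, hsub, hint, hmom⟩ := exists_moment_bump v hρ
  obtain ⟨A₀, hA₀0, hA₀⟩ := exists_bound_of_hasCompactSupport hφ.continuous hφs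
  have hAj : ∃ A, 0 ≤ A ∧ ∀ (j : Fin n) (y : Vec n), |φ y * y j| ≤ A := by
    obtain ⟨A, hA0, hA⟩ := exists_bound_of_hasCompactSupport
      (f := fun y : Vec n => φ y • y) (hφ.continuous.smul continuous_id) hφs.smul_right
    refine ⟨A, hA0, fun j y => ?_⟩
    rw [← Real.norm_eq_abs]
    exact (PiLp.norm_apply_le (φ y • y) j).trans (hA y)
  obtain ⟨A, hA0, hA⟩ := hAj
  set α := m - (n : ℝ) / 2 with hα
  have hαpos : 0 < α := by linarith
  set s := (n : ℝ) / 2 + (m - 1) with hsdef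
  set C₁ : ℝ := n * (A * (2 * ρ) ^ s) with hC₁
  have hC₁0 : 0 ≤ C₁ := by positivity
  refine ⟨r, hr, A₀ * Real.sqrt ((volume.restrict Ω).real univ) + C₁ / α, by positivity,
    fun z => ?_⟩
  obtain ⟨G, hG, hK⟩ := z.2
  filter_upwards [tendsto_kernelMean hΩ hφ hφs hint hρ hsub (field z),
    ae_restrict_mem hΩ.isOpen.measurableSet] with x hx hxΩ hxr
  have hcx : ∀ τ ∈ Ioc (0 : ℝ) 1, ∀ b ∈ Metric.ball v ρ, x + τ • b ∈ Ω := hcone x ⟨hxr, hxΩ⟩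
  have hlim := hx hcx
  set K := (z : WithLp 2 (L2 Ω ℝ × Lp (Vec n) 2 ((volume.restrict Ω).prod (volume.restrict Ω)))).snd
  set M := kernelMean Ω φ (field z) x with hM
  have hder : ∀ τ ∈ Ioc (0 : ℝ) 1, |deriv M τ| ≤ (C₁ * ‖K‖) * τ ^ (α - 1) := by
    intro τ hτ
    refine (norm_deriv_kernelMean_le hΩ hφ hφs hρ hsub hmom hs hA hG hK hτ.1 (hcx τ hτ)).trans
      (le_of_eq ?_)
    rw [Real.mul_rpow (by positivity) hτ.1.le]
    have e : τ ^ (α - 1) = τ ^ (-(n : ℤ)) * τ ^ s := by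
      rw [← Real.rpow_intCast, ← Real.rpow_add hτ.1]
      congr 1
      push_cast
      rw [hα, hsdef]
      ring
    rw [e, hC₁]
    ring
  have hM1 : |M 1| ≤ A₀ * Real.sqrt ((volume.restrict Ω).real univ) * ‖z‖ := by
    have hz2 := Lp.memLp (field z)
    have hzI : Integrable (field z) (volume.restrict Ω) := hz2.integrable (by norm_num)
    have h1 : |M 1| ≤ ∫ y in Ω, ‖field z y‖ * A₀ := by
      rw [← Real.norm_eq_abs]
      refine norm_integral_le_of_norm_le (hzI.norm.mul_const _) (Eventually.of_forall fun y => ?_)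
      simp only [one_zpow, one_mul, norm_mul]
      exact mul_le_mul_of_nonneg_left (hA₀ _) (norm_nonneg _)
    refine h1.trans ?_
    rw [integral_mul_const]
    have h2 := integral_norm_le_sqrt_measure hz2
    rw [← Lp.norm_def] at h2
    calc (∫ y in Ω, ‖field z y‖) * A₀
        ≤ (‖field z‖ * Real.sqrt ((volume.restrict Ω).real univ)) * A₀ := by gcongr
      _ ≤ (‖z‖ * Real.sqrt ((volume.restrict Ω).real univ)) * A₀ := by
          gcongr
          exact norm_field_le z
      _ = _ := by ring
  have hbound : ∀ᶠ τ in 𝓝[>] (0 : ℝ), |M τ| ≤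
      (A₀ * Real.sqrt ((volume.restrict Ω).real univ) + C₁ / α) * ‖z‖ := by
    filter_upwards [Ioc_mem_nhdsGT (zero_lt_one' ℝ)] with τ hτ
    have h := abs_sub_le_of_abs_deriv_le_rpow hαpos (mul_nonneg hC₁0 (norm_nonneg K))
      (fun τ hτ => (hasDerivAt_kernelMean hφ hφs (field z) x hτ.1).differentiableAt) hder hτ
    have hKz : ‖K‖ ≤ ‖z‖ := norm_quot_le z
    have h3 : C₁ * ‖K‖ / α ≤ C₁ / α * ‖z‖ := by
      rw [div_mul_eq_mul_div]
      gcongr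
    have h4 : |M τ| ≤ |M 1| + |M 1 - M τ| := by
      have := abs_sub (M 1) (M 1 - M τ)
      rwa [sub_sub_cancel] at this
    linarith
  exact le_of_tendsto hlim.abs hbound

/-- The embedding of `H^m(Ω)` into the bounded functions, for `m > n / 2`. -/
theorem exists_field_bound {m : ℝ} (hΩ : IsLipschitzDomain Ω) (hm : (n : ℝ) / 2 < m)
    (hs : 0 ≤ (n : ℝ) / 2 + (m - 1)) :
    ∃ C > 0, ∀ z : Hm Ω m, ∀ᵐ x ∂(volume.restrict Ω), |field z x| ≤ C * ‖z‖ := by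
  have hcomp : IsCompact (closure Ω) := hΩ.bounded.isCompact_closure
  have hmain : ∃ C ≥ 0, ∀ z : Hm Ω m, ∀ᵐ x ∂(volume.restrict Ω), x ∈ closure Ω →
      |field z x| ≤ C * ‖z‖ := by
    refine hcomp.induction_on (p := fun s => ∃ C ≥ 0, ∀ z : Hm Ω m, ∀ᵐ x ∂(volume.restrict Ω),
      x ∈ s → |field z x| ≤ C * ‖z‖) ⟨0, le_rfl, by simp⟩ ?_ ?_ ?_
    · rintro s t hst ⟨C, hC, h⟩
      exact ⟨C, hC, fun z => (h z).mono fun x hx hxs => hx (hst hxs)⟩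
    · rintro s t ⟨C, hC, h⟩ ⟨C', hC', h'⟩
      refine ⟨max C C', hC.trans (le_max_left _ _), fun z => ?_⟩
      filter_upwards [h z, h' z] with x hx hx' hst
      rcases hst with hst | hst
      · exact (hx hst).trans (by gcongr; exact le_max_left _ _)
      · exact (hx' hst).trans (by gcongr; exact le_max_right _ _)
    · intro x₀ hx₀
      obtain ⟨r, hr, C, hC, h⟩ := exists_local_field_bound hΩ hm hs hx₀
      exact ⟨Metric.ball x₀ r, mem_nhdsWithin_of_mem_nhds (Metric.ball_mem_nhds x₀ hr), C, hC, h⟩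
  obtain ⟨C, hC, h⟩ := hmain
  refine ⟨C + 1, by linarith, fun z => ?_⟩
  filter_upwards [h z, ae_restrict_mem hΩ.isOpen.measurableSet] with x hx hxΩ
  refine (hx (subset_closure hxΩ)).trans ?_
  gcongr
  linarith

end Embedding

/-! ### Integral inequalities in `L²` -/

instance fact_two_ne_top : Fact ((2 : ℝ≥0∞) ≠ ⊤) := ⟨by norm_num⟩

theorem norm_toLp_sq {α E : Type*} [MeasurableSpace α] [NormedAddCommGroup E]
    [InnerProductSpace ℝ E] {μ : Measure α} {f : α → E} (hf : MemLp f 2 μ) :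
    ‖hf.toLp f‖ ^ 2 = ∫ x, ‖f x‖ ^ 2 ∂μ := by
  rw [← real_inner_self_eq_norm_sq, L2.inner_def]
  refine integral_congr_ae ?_
  filter_upwards [hf.coeFn_toLp] with x hx
  rw [hx, real_inner_self_eq_norm_sq]

theorem norm_sq_L2 {α E : Type*} [MeasurableSpace α] [NormedAddCommGroup E]
    [InnerProductSpace ℝ E] {μ : Measure α} (f : Lp E 2 μ) :
    ‖f‖ ^ 2 = ∫ x, ‖f x‖ ^ 2 ∂μ := by
  rw [← real_inner_self_eq_norm_sq, L2.inner_def]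
  simp only [real_inner_self_eq_norm_sq]

theorem abs_integral_mul_le {α : Type*} [MeasurableSpace α] {μ : Measure α} {f g : α → ℝ}
    (hf : MemLp f 2 μ) (hg : MemLp g 2 μ) :
    |∫ x, f x * g x ∂μ| ≤ Real.sqrt (∫ x, f x ^ 2 ∂μ) * Real.sqrt (∫ x, g x ^ 2 ∂μ) := by
  have h := abs_real_inner_le_norm (hf.toLp f) (hg.toLp g)
  have e : ⟪hf.toLp f, hg.toLp g⟫_ℝ = ∫ x, f x * g x ∂μ := by
    rw [L2.inner_def]
    refine integral_congr_ae ?_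
    filter_upwards [hf.coeFn_toLp, hg.coeFn_toLp] with x h1 h2
    rw [h1, h2]
    simp [mul_comm]
  rw [e] at h
  have h1 := norm_toLp_sq hf
  have h2 := norm_toLp_sq hg
  simp only [Real.norm_eq_abs, sq_abs] at h1 h2
  rwa [← h1, ← h2, Real.sqrt_sq (norm_nonneg _), Real.sqrt_sq (norm_nonneg _)]

theorem integral_norm_mul_norm_le {α E F : Type*} [MeasurableSpace α] [NormedAddCommGroup E]
    [NormedAddCommGroup F] [InnerProductSpace ℝ E] [InnerProductSpace ℝ F] {μ : Measure α}
    (f : Lp E 2 μ) (g : Lp F 2 μ) : ∫ x, ‖f x‖ * ‖g x‖ ∂μ ≤ ‖f‖ * ‖g‖ := by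
  have h := (le_abs_self _).trans (abs_integral_mul_le (Lp.memLp f).norm (Lp.memLp g).norm)
  rwa [← norm_sq_L2, ← norm_sq_L2, Real.sqrt_sq (norm_nonneg _), Real.sqrt_sq (norm_nonneg _)] at h

/-! ### Completeness of the function spaces -/

section Complete

variable {n : ℕ} {Ω : Set (Vec n)}

theorem continuous_integral_clm_mul {E : Type*} [NormedAddCommGroup E] [InnerProductSpace ℝ E]
    (L : E →L[ℝ] ℝ) {ψ : Vec n → ℝ} (hψ : MemLp ψ 2 (volume.restrict Ω)) :
    Continuous fun f : L2 Ω E => ∫ x in Ω, L (f x) * ψ x := by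
  have : (fun f : L2 Ω E => ∫ x in Ω, L (f x) * ψ x) =
      fun f => ⟪hψ.toLp ψ, L.compLpL 2 (volume.restrict Ω) f⟫_ℝ := by
    funext f
    rw [L2.inner_def]
    refine integral_congr_ae ?_
    filter_upwards [hψ.coeFn_toLp, L.coeFn_compLpL (p := 2) f] with x h1 h2
    rw [h1, h2]
    simp
  rw [this]
  exact continuous_const.inner (L.compLpL 2 (volume.restrict Ω)).continuous

theorem memLp_test {φ : Vec n → ℝ} (h1 : Continuous φ) (h2 : HasCompactSupport φ) :
    MemLp φ 2 (volume.restrict Ω) :=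
  (h1.memLp_of_hasCompactSupport h2 (p := 2) (μ := volume)).restrict Ω

theorem memLp_dtest {φ : Vec n → ℝ} (h1 : ContDiff ℝ ∞ φ) (h2 : HasCompactSupport φ) (v : Vec n) :
    MemLp (fun x => fderiv ℝ φ x v) 2 (volume.restrict Ω) :=
  memLp_test ((h1.continuous_fderiv (by simp)).clm_apply continuous_const)
    ((h2.fderiv ℝ).comp_left (g := fun A : Vec n →L[ℝ] ℝ => A v) (by simp))

/-- For each fixed test function, integration by parts is an equation between two continuous
functionals. -/
theorem isClosed_weakGrad {E F X : Type*} [NormedAddCommGroup E] [InnerProductSpace ℝ E]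
    [NormedAddCommGroup F] [InnerProductSpace ℝ F] [TopologicalSpace X] (O : Set (Vec n))
    {a : X → L2 Ω E} {b : X → L2 Ω F} (ha : Continuous a) (hb : Continuous b)
    (L : E →L[ℝ] ℝ) (M : Fin n → F →L[ℝ] ℝ) :
    IsClosed {v : X | WeakGradOn Ω O (fun x => L (a v x)) (fun x j => M j (b v x))} := by
  simp only [WeakGradOn, ofPred_forall]
  refine isClosed_iInter fun φ => isClosed_iInter fun h1 => isClosed_iInter fun h2 =>
    isClosed_iInter fun _ => isClosed_iInter fun j => isClosed_eq ?_ ?_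
  · exact (continuous_integral_clm_mul L (memLp_dtest h1 h2 _)).comp ha
  · exact ((continuous_integral_clm_mul (M j) (memLp_test h1.continuous h2)).comp hb).neg

theorem isClosed_gradPairs (O : Set (Vec n)) :
    IsClosed (gradPairs Ω O : Set (WithLp 2 (L2 Ω (Vec n) × L2 Ω (Mat n)))) := by
  have : (gradPairs Ω O : Set (WithLp 2 (L2 Ω (Vec n) × L2 Ω (Mat n)))) =
      ⋂ i, {v | WeakGradOn Ω O (fun x => v.fst x i) (fun x j => v.snd x (i, j))} := by
    ext v
    simp [gradPairs]
  rw [this]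
  exact isClosed_iInter fun i => isClosed_weakGrad O
    (X := WithLp 2 (L2 Ω (Vec n) × L2 Ω (Mat n)))
    (a := fun v => v.fst) (b := fun v => v.snd)
    (WithLp.continuous_fst _ _ _) (WithLp.continuous_snd _ _ _) (EuclideanSpace.proj i)
    (fun j => EuclideanSpace.proj (i, j))

instance completeSpace_H1 : CompleteSpace (H1 Ω) :=
  (isClosed_gradPairs Ω).completeSpace_coe

instance completeSpace_H1Dir (Γ : Set (Vec n)) : CompleteSpace (H1Dir Ω Γ) := by
  have h : IsClosed (H1Dir Ω Γ : Set (H1 Ω)) :=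
    (isClosed_gradPairs (frontier Ω \ Γ)ᶜ).preimage continuous_subtype_val
  exact h.completeSpace_coe

instance secondCountable_H1 : SecondCountableTopology (H1 Ω) := by
  have : SecondCountableTopology (WithLp 2 (L2 Ω (Vec n) × L2 Ω (Mat n))) :=
    WithLp.secondCountableTopology 2 _ _
  exact TopologicalSpace.Subtype.secondCountableTopology _

instance secondCountable_H1Dir (Γ : Set (Vec n)) : SecondCountableTopology (H1Dir Ω Γ) :=
  TopologicalSpace.Subtype.secondCountableTopology _

instance secondCountable_Hm (m : ℝ) : SecondCountableTopology (Hm Ω m) := by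
  have hg : MeasurableSpace.CountablyGenerated (Vec n × Vec n) := inferInstance
  have hsf : SFinite ((volume.restrict Ω).prod (volume.restrict Ω)) := inferInstance
  have : IsSeparable ((volume.restrict Ω).prod (volume.restrict Ω)) :=
    instIsSeparableOfCountablyGeneratedOfSFinite _
  have : SecondCountableTopology (Lp (Vec n) 2 ((volume.restrict Ω).prod (volume.restrict Ω))) :=
    Lp.SecondCountableTopology
  have : SecondCountableTopology
      (WithLp 2 (L2 Ω ℝ × Lp (Vec n) 2 ((volume.restrict Ω).prod (volume.restrict Ω)))) :=
    WithLp.secondCountableTopology 2 _ _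
  exact TopologicalSpace.Subtype.secondCountableTopology _

/-- The gradient is controlled by the function and its fractional difference quotient. -/
theorem exists_grad_bound {m : ℝ} (hΩ : IsLipschitzDomain Ω) (hs : 0 ≤ (n : ℝ) / 2 + (m - 1)) :
    ∃ C, 0 ≤ C ∧ ∀ (z : L2 Ω ℝ) (G : L2 Ω (Vec n))
      (K : Lp (Vec n) 2 ((volume.restrict Ω).prod (volume.restrict Ω))),
      WeakGradOn Ω Ω z (fun x j => G x j) → IsFracQuot Ω m G K → ‖G‖ ≤ C * (‖z‖ + ‖K‖) := by
  have hfin := hΩ.isFiniteMeasure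
  obtain ⟨x₀, hx₀⟩ := hΩ.connected.nonempty
  obtain ⟨r, hr, hball⟩ := Metric.isOpen_iff.1 hΩ.isOpen x₀ hx₀
  obtain ⟨φ, hφ, hφs, hsub, hint, -⟩ := exists_moment_bump x₀ hr
  have hφΩ : tsupport φ ⊆ Ω := hsub.trans hball
  obtain ⟨A, hA0, hA⟩ := exists_bound_of_hasCompactSupport hφ.continuous hφs
  obtain ⟨D, hD⟩ := hΩ.bounded.exists_norm_le
  have hD0 : 0 ≤ D := (norm_nonneg _).trans (hD x₀ hx₀)
  set μ := (volume.restrict Ω : Measure (Vec n)) with hμ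
  set V := Real.sqrt (μ.real univ) with hV
  have hVsq : V ^ 2 = μ.real univ := Real.sq_sqrt measureReal_nonneg
  set s := (n : ℝ) / 2 + (m - 1)
  have hint' : ∫ x, φ x ∂μ = 1 := by
    rw [hμ, setIntegral_eq_integral_of_forall_compl_eq_zero, hint]
    intro x hx
    exact image_eq_zero_of_notMem_tsupport fun h => hx (hφΩ h)
  set P : Fin n → ℝ := fun j =>
    Real.sqrt (∫ x in Ω, (fderiv ℝ φ x (EuclideanSpace.single j 1)) ^ 2)
  have hcomp : ∀ (z : L2 Ω ℝ) (G : L2 Ω (Vec n))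
      (K : Lp (Vec n) 2 (μ.prod μ)),
      WeakGradOn Ω Ω z (fun x j => G x j) → IsFracQuot Ω m G K → ∀ j,
      Real.sqrt (∫ x, (G x j) ^ 2 ∂μ) ≤ ((2 * D) ^ s * A * V + V * P j) * (‖z‖ + ‖K‖) := by
    intro z G K hG hK j
    have hGj : MemLp (fun x => G x j) 2 μ := memLp_coord G j
    have hGI : Integrable (fun x => G x j) μ := hGj.integrable (by norm_num)
    have hφ2 : MemLp φ 2 μ := memLp_test hφ.continuous hφs
    have hφI : Integrable φ μ := hφ2.integrable (by norm_num)
    set N := Real.sqrt (∫ x, (G x j) ^ 2 ∂μ) with hN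
    have hN0 : 0 ≤ N := Real.sqrt_nonneg _
    have hNsq : N ^ 2 = ∫ x, (G x j) ^ 2 ∂μ :=
      Real.sq_sqrt (integral_nonneg fun x => sq_nonneg _)
    have hc : |∫ x, G x j * φ x ∂μ| ≤ ‖z‖ * P j := by
      have h := hG φ hφ hφs hφΩ j
      have h' := abs_integral_mul_le (Lp.memLp z) (memLp_dtest hφ hφs (EuclideanSpace.single j 1))
      rw [h, abs_neg] at h'
      have hz : Real.sqrt (∫ x, z x ^ 2 ∂μ) = ‖z‖ := by
        have := norm_sq_L2 z
        simp only [Real.norm_eq_abs, sq_abs] at this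
        rw [hμ, ← this, Real.sqrt_sq (norm_nonneg z)]
      rwa [hz] at h'
    have hGint : |∫ x, G x j ∂μ| ≤ N * V := by
      have h := abs_integral_mul_le hGj (memLp_const (1 : ℝ) (μ := μ) (p := 2))
      simpa [hN, hV] using h
    have hI1 : Integrable (fun xy : Vec n × Vec n => (G xy.1 j) ^ 2 * φ xy.2) (μ.prod μ) :=
      hGj.integrable_sq.mul_prod hφI
    have hI2 : Integrable (fun xy : Vec n × Vec n => G xy.1 j * (G xy.2 j * φ xy.2)) (μ.prod μ) :=
      hGI.mul_prod (hGj.integrable_mul hφ2)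
    -- This is `G(x) = ∫ (G(x) - G(y)) φ(y) dy + ∫ G φ`, multiplied by `G(x)` and integrated, in the
    -- component `j`. The difference is controlled by `K`, and the weighted mean `∫ G φ` by `z`
    -- through integration by parts.
    have hid : ∫ xy, ((G xy.1 j) ^ 2 * φ xy.2 - G xy.1 j * (G xy.2 j * φ xy.2)) ∂(μ.prod μ) =
        N ^ 2 - (∫ x, G x j ∂μ) * ∫ x, G x j * φ x ∂μ := by
      rw [integral_sub hI1 hI2, integral_prod_mul (fun x => (G x j) ^ 2) φ,
        integral_prod_mul (fun x => G x j) (fun x => G x j * φ x), hint', hNsq, mul_one]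
    have hfst : MemLp (fun xy : Vec n × Vec n => |G xy.1 j|) 2 (μ.prod μ) :=
      (hGj.comp_fst μ).abs
    have hK2 : MemLp (fun xy => ‖K xy‖) 2 (μ.prod μ) := (Lp.memLp K).norm
    have hb : |∫ xy, ((G xy.1 j) ^ 2 * φ xy.2 - G xy.1 j * (G xy.2 j * φ xy.2)) ∂(μ.prod μ)| ≤
        ∫ xy, ((2 * D) ^ s * A) * (‖K xy‖ * |G xy.1 j|) ∂(μ.prod μ) := by
      rw [← Real.norm_eq_abs]
      refine norm_integral_le_of_norm_le ((hK2.integrable_mul hfst).const_mul _) ?_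
      have hin : ∀ᵐ xy ∂(μ.prod μ), xy ∈ Ω ×ˢ Ω := by
        rw [hμ, Measure.prod_restrict]
        exact ae_restrict_mem (hΩ.isOpen.measurableSet.prod hΩ.isOpen.measurableSet)
      filter_upwards [hK.norm_sub_le, hin] with xy h hxy
      have e : (G xy.1 j) ^ 2 * φ xy.2 - G xy.1 j * (G xy.2 j * φ xy.2) =
          (G xy.1 - G xy.2) j * φ xy.2 * G xy.1 j := by
        rw [PiLp.sub_apply]; ring
      rw [e, norm_mul, norm_mul]
      have h1 : ‖(G xy.1 - G xy.2) j‖ ≤ ‖G xy.1 - G xy.2‖ := PiLp.norm_apply_le _ j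
      have hxyD : ‖xy.1 - xy.2‖ ≤ 2 * D := by
        refine (norm_sub_le _ _).trans ?_
        linarith [hD _ hxy.1, hD _ hxy.2]
      have h2 : ‖xy.1 - xy.2‖ ^ s ≤ (2 * D) ^ s := Real.rpow_le_rpow (norm_nonneg _) hxyD hs
      calc ‖(G xy.1 - G xy.2) j‖ * ‖φ xy.2‖ * ‖G xy.1 j‖
          ≤ ((2 * D) ^ s * ‖K xy‖) * A * |G xy.1 j| := by
            gcongr
            · exact h1.trans (h.trans (by gcongr))
            · exact hA _
            · exact le_rfl
        _ = ((2 * D) ^ s * A) * (‖K xy‖ * |G xy.1 j|) := by ring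
    have hKG : ∫ xy, ‖K xy‖ * |G xy.1 j| ∂(μ.prod μ) ≤ ‖K‖ * (N * V) := by
      have h := (le_abs_self _).trans (abs_integral_mul_le hK2 hfst)
      rw [← norm_sq_L2, Real.sqrt_sq (norm_nonneg _)] at h
      have e : Real.sqrt (∫ xy : Vec n × Vec n, |G xy.1 j| ^ 2 ∂(μ.prod μ)) = N * V := by
        simp only [sq_abs]
        have := integral_prod_mul (μ := μ) (ν := μ) (fun x => (G x j) ^ 2) (fun _ => (1 : ℝ))
        simp only [mul_one] at this
        rw [this, ← hNsq]
        simp only [integral_const, smul_eq_mul, mul_one]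
        rw [← hVsq, ← mul_pow, Real.sqrt_sq (by positivity)]
      rwa [e] at h
    rw [hid, integral_const_mul] at hb
    have hDA : 0 ≤ (2 * D) ^ s * A := by positivity
    have hP0 : 0 ≤ P j := Real.sqrt_nonneg _
    have hV0 : 0 ≤ V := Real.sqrt_nonneg _
    have hprod : |(∫ x, G x j ∂μ) * ∫ x, G x j * φ x ∂μ| ≤ (N * V) * (‖z‖ * P j) := by
      rw [abs_mul]
      exact mul_le_mul hGint hc (abs_nonneg _) (by positivity)
    have hmain : N * N ≤ N * ((2 * D) ^ s * A * V * ‖K‖ + V * P j * ‖z‖) := by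
      have h1 := (abs_le.1 hb).2
      have h2 := (abs_le.1 hprod).2
      have h3 := mul_le_mul_of_nonneg_left hKG hDA
      nlinarith
    have hle : N ≤ (2 * D) ^ s * A * V * ‖K‖ + V * P j * ‖z‖ := by
      rcases hN0.eq_or_lt with h | h
      · rw [← h]; positivity
      · exact le_of_mul_le_mul_left hmain h
    refine hle.trans ?_
    have hz0 := norm_nonneg z
    have hK0 := norm_nonneg K
    have : 0 ≤ (2 * D) ^ s * A * V * ‖z‖ + V * P j * ‖K‖ := by positivity
    linarith
  refine ⟨∑ j, ((2 * D) ^ s * A * V + V * P j), by positivity, fun z G K hG hK => ?_⟩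
  have hsum : ‖G‖ ≤ ∑ j, Real.sqrt (∫ x, (G x j) ^ 2 ∂μ) := by
    have h1 : ‖G‖ ^ 2 = ∑ j, ∫ x, (G x j) ^ 2 ∂μ := by
      rw [norm_sq_L2, ← integral_finsetSum _ fun j _ => (memLp_coord G j).integrable_sq]
      refine integral_congr_ae (Eventually.of_forall fun x => ?_)
      simp only [EuclideanSpace.norm_sq_eq, Real.norm_eq_abs, sq_abs]
    refine abs_le_of_sq_le_sq' (a := ‖G‖) ?_ (by positivity) |>.2
    rw [h1]
    refine le_trans (le_of_eq ?_)
      (Finset.sum_sq_le_sq_sum_of_nonneg fun j _ => Real.sqrt_nonneg (∫ x, (G x j) ^ 2 ∂μ))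
    exact Finset.sum_congr rfl fun j _ =>
      (Real.sq_sqrt (integral_nonneg fun x => sq_nonneg _)).symm
  refine hsum.trans ?_
  rw [Finset.sum_mul]
  exact Finset.sum_le_sum fun j _ => hcomp z G K hG hK j

/-- The gradient is not part of the pair `(z, K)`, so its convergence has to be derived: the
gradient bound, applied to differences, makes the gradients of a convergent sequence Cauchy. The
weak formulation passes to the limit in `L²`, the quotient relation along an almost everywhere
convergent subsequence. -/
theorem isClosed_Hm {m : ℝ} (hΩ : IsLipschitzDomain Ω) (hs : 0 ≤ (n : ℝ) / 2 + (m - 1)) :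
    IsClosed (Hm Ω m : Set
      (WithLp 2 (L2 Ω ℝ × Lp (Vec n) 2 ((volume.restrict Ω).prod (volume.restrict Ω))))) := by
  obtain ⟨C, hC0, hC⟩ := exists_grad_bound hΩ hs
  refine IsSeqClosed.isClosed fun v v₀ hv hlim => ?_
  choose G hG hK using hv
  have hfst := ((WithLp.continuous_fst 2 (L2 Ω ℝ)
    (Lp (Vec n) 2 ((volume.restrict Ω).prod (volume.restrict Ω)))).tendsto v₀).comp hlim
  have hsnd := ((WithLp.continuous_snd 2 (L2 Ω ℝ)
    (Lp (Vec n) 2 ((volume.restrict Ω).prod (volume.restrict Ω)))).tendsto v₀).comp hlim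
  have hdiff : ∀ k l, ‖G k - G l‖ ≤ C * (‖(v k).fst - (v l).fst‖ + ‖(v k).snd - (v l).snd‖) := by
    intro k l
    refine hC _ _ _ ?_ ?_
    · have h := (hG k).add ((hG l).smul (-1)) (Lp.memLp _) ((Lp.memLp _).const_mul _)
        (fun j => memLp_coord _ j) (fun j => (memLp_coord _ j).const_mul _)
      refine h.congr ?_ ?_
      · filter_upwards [Lp.coeFn_sub (v k).fst (v l).fst] with x hx
        rw [hx, Pi.sub_apply]
        ring
      · filter_upwards [Lp.coeFn_sub (G k) (G l)] with x hx
        funext j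
        rw [hx, Pi.sub_apply, PiLp.sub_apply]
        ring
    · have h := Lp.coeFn_sub (G k) (G l)
      unfold IsFracQuot
      filter_upwards [Lp.coeFn_sub (v k).snd (v l).snd, hK k, hK l,
        Measure.quasiMeasurePreserving_fst.ae h, Measure.quasiMeasurePreserving_snd.ae h]
        with xy h0 hv hw h1 h2
      simp only [h0, h1, h2, Pi.sub_apply, hv, hw, ← smul_sub]
      congr 1
      abel
  have hcauchy : CauchySeq G := by
    have h1 := hfst.cauchySeq
    have h2 := hsnd.cauchySeq
    rw [Metric.cauchySeq_iff] at h1 h2 ⊢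
    intro ε hε
    obtain ⟨N₁, hN₁⟩ := h1 (ε / (2 * (C + 1))) (by positivity)
    obtain ⟨N₂, hN₂⟩ := h2 (ε / (2 * (C + 1))) (by positivity)
    refine ⟨max N₁ N₂, fun k hk l hl => ?_⟩
    have e1 := hN₁ k (le_of_max_le_left hk) l (le_of_max_le_left hl)
    have e2 := hN₂ k (le_of_max_le_right hk) l (le_of_max_le_right hl)
    rw [dist_eq_norm] at e1 e2 ⊢
    simp only [Function.comp_apply] at e1 e2
    refine (hdiff k l).trans_lt ?_
    have e3 : ‖(v k).fst - (v l).fst‖ + ‖(v k).snd - (v l).snd‖ < ε / (C + 1) := by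
      refine (add_lt_add e1 e2).trans_le (le_of_eq ?_)
      field_simp
      ring
    have e4 : 0 ≤ ‖(v k).fst - (v l).fst‖ + ‖(v k).snd - (v l).snd‖ := by positivity
    rw [lt_div_iff₀ (by positivity)] at e3
    nlinarith
  obtain ⟨G₀, hG₀⟩ := cauchySeq_tendsto_of_complete hcauchy
  refine ⟨G₀, ?_, ?_⟩
  · have hcl := isClosed_weakGrad (Ω := Ω) (X := L2 Ω ℝ × L2 Ω (Vec n)) Ω (a := Prod.fst)
      (b := Prod.snd) continuous_fst continuous_snd (ContinuousLinearMap.id ℝ ℝ)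
      (fun j => EuclideanSpace.proj j)
    exact hcl.mem_of_tendsto (hfst.prodMk_nhds hG₀) (Eventually.of_forall fun k => hG k)
  · obtain ⟨a, ha, hGa⟩ := (tendstoInMeasure_of_tendsto_Lp hG₀).exists_seq_tendsto_ae
    have hsnd' := hsnd.comp ha.tendsto_atTop
    obtain ⟨b, hb, hKb⟩ := (tendstoInMeasure_of_tendsto_Lp hsnd').exists_seq_tendsto_ae
    have hall : ∀ᵐ xy ∂((volume.restrict Ω).prod (volume.restrict Ω)), ∀ k, (v k).snd xy =
        (‖xy.1 - xy.2‖ ^ (-((n : ℝ) / 2 + (m - 1)))) • (G k xy.1 - G k xy.2) :=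
      ae_all_iff.2 hK
    filter_upwards [hall, hKb, Measure.quasiMeasurePreserving_fst.ae hGa,
      Measure.quasiMeasurePreserving_snd.ae hGa] with xy h1 h2 h3 h4
    refine tendsto_nhds_unique h2 ?_
    simp only [Function.comp_apply, h1]
    exact ((h3.comp hb.tendsto_atTop).sub (h4.comp hb.tendsto_atTop)).const_smul _

theorem completeSpace_Hm {m : ℝ} (hΩ : IsLipschitzDomain Ω) (hs : 0 ≤ (n : ℝ) / 2 + (m - 1)) :
    CompleteSpace (Hm Ω m) :=
  (isClosed_Hm hΩ hs).completeSpace_coe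

end Complete

/-! ### Tools for differentiating integral functionals -/

theorem hasFDerivAt_of_quadratic {E F : Type*} [NormedAddCommGroup E] [NormedSpace ℝ E]
    [NormedAddCommGroup F] [NormedSpace ℝ F] {f : E → F} {f' : E →L[ℝ] F} {x : E} {δ C : ℝ}
    (hδ : 0 < δ) (h : ∀ y, ‖y‖ < δ → ‖f (x + y) - f x - f' y‖ ≤ C * ‖y‖ ^ 2) :
    HasFDerivAt f f' x := by
  rw [hasFDerivAt_iff_isLittleO_nhds_zero]
  refine Asymptotics.IsBigO.trans_isLittleO (g := fun y : E => ‖y‖ ^ 2) ?_ ?_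
  · refine Asymptotics.IsBigO.of_bound C ?_
    filter_upwards [Metric.ball_mem_nhds (0 : E) hδ] with y hy
    rw [mem_ball_zero_iff] at hy
    simpa using h y hy
  · exact (Asymptotics.isLittleO_norm_pow_id one_lt_two)

/-- Uniform first-order Taylor bounds on a compact interval. -/
theorem exists_taylor_bounds {E : Type*} [NormedAddCommGroup E] [NormedSpace ℝ E] {f f' : ℝ → E}
    {α β : ℝ} (hd : ∀ x ∈ Icc α β, HasDerivAt f (f' x) x) {L : ℝ≥0}
    (hL : LipschitzOnWith L f' (Icc α β)) :
    ∃ C : ℝ, 0 ≤ C ∧ ∀ a ∈ Icc α β, ‖f a‖ ≤ C ∧ ‖f' a‖ ≤ C ∧ ∀ b ∈ Icc α β,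
      ‖f b - f a‖ ≤ C * |b - a| ∧ ‖f b - f a - (b - a) • f' a‖ ≤ C * |b - a| ^ 2 := by
  obtain ⟨C₁, hC₁⟩ := isCompact_Icc.exists_bound_of_continuousOn
    (fun x hx => (hd x hx).continuousAt.continuousWithinAt : ContinuousOn f (Icc α β))
  obtain ⟨C₂, hC₂⟩ := isCompact_Icc.exists_bound_of_continuousOn hL.continuousOn
  refine ⟨max (max C₁ C₂) (max L 0), (le_max_right _ _).trans (le_max_right _ _), fun a ha =>
    ⟨(hC₁ a ha).trans ((le_max_left _ _).trans (le_max_left _ _)),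
      (hC₂ a ha).trans ((le_max_right _ _).trans (le_max_left _ _)), fun b hb => ⟨?_, ?_⟩⟩⟩
  · have h := (convex_Icc α β).norm_image_sub_le_of_norm_hasDerivWithin_le
      (fun x hx => (hd x hx).hasDerivWithinAt) hC₂ ha hb
    rw [Real.norm_eq_abs] at h
    refine h.trans ?_
    gcongr
    exact (le_max_right _ _).trans (le_max_left _ _)
  · have hsub : uIcc a b ⊆ Icc α β := (convex_Icc α β).ordConnected.uIcc_subset ha hb
    -- The mean value inequality is applied to `f` minus its linear part at `a`, whose derivative is
    -- at most `L |b - a|` on the segment.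
    have hg : ∀ x ∈ uIcc a b, HasDerivWithinAt (fun x => f x - (x - a) • f' a) (f' x - f' a)
        (uIcc a b) x := by
      intro x hx
      have h1 := ((hasDerivAt_id x).sub_const a).smul_const (f' a)
      simp only [one_smul] at h1
      exact ((hd x (hsub hx)).sub h1).hasDerivWithinAt
    have hb' : ∀ x ∈ uIcc a b, ‖f' x - f' a‖ ≤ L * |b - a| := by
      intro x hx
      refine (hL.norm_sub_le (hsub hx) ha).trans ?_
      gcongr
      rw [Real.norm_eq_abs]
      exact abs_sub_left_of_mem_uIcc hx
    have h := (convex_uIcc a b).norm_image_sub_le_of_norm_hasDerivWithin_le hg hb'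
      left_mem_uIcc right_mem_uIcc
    rw [Real.norm_eq_abs] at h
    have e : f b - (b - a) • f' a - (f a - (a - a) • f' a) = f b - f a - (b - a) • f' a := by
      simp; abel
    rw [e, mul_assoc, ← sq] at h
    refine h.trans ?_
    gcongr
    exact (le_max_left _ _).trans (le_max_right _ _)

/-- The hypothesis concerns the derivative within the closed half-line; at positive points this is
the ordinary derivative. -/
theorem exists_taylor_bounds_of_locallyLipschitz {E : Type*} [NormedAddCommGroup E]
    [NormedSpace ℝ E] {f : ℝ → E} (hd : ∀ x, 0 < x → HasDerivAt f (deriv f x) x)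
    (hL : LocallyLipschitzOn (Ici 0) (derivWithin f (Ici 0))) {α β : ℝ} (hα : 0 < α) :
    ∃ C : ℝ, 0 ≤ C ∧ ∀ a ∈ Icc α β, ‖f a‖ ≤ C ∧ ‖deriv f a‖ ≤ C ∧ ∀ b ∈ Icc α β,
      ‖f b - f a‖ ≤ C * |b - a| ∧ ‖f b - f a - (b - a) • deriv f a‖ ≤ C * |b - a| ^ 2 := by
  have hsub : Icc α β ⊆ Ici (0 : ℝ) := fun x hx => hα.le.trans hx.1
  obtain ⟨L, hL⟩ := (hL.mono hsub).exists_lipschitzOnWith_of_compact isCompact_Icc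
  refine exists_taylor_bounds (fun x hx => hd x (hα.trans_le hx.1)) (L := L) ?_
  intro x hx y hy
  have h := hL hx hy
  rwa [derivWithin_of_mem_nhds (Ici_mem_nhds (hα.trans_le hx.1)),
    derivWithin_of_mem_nhds (Ici_mem_nhds (hα.trans_le hy.1))] at h

theorem continuousOn_deriv_of_locallyLipschitz {E : Type*} [NormedAddCommGroup E]
    [NormedSpace ℝ E] {f : ℝ → E} (hL : LocallyLipschitzOn (Ici 0) (derivWithin f (Ici 0))) {c : ℝ}
    (hc : 0 < c) : ContinuousOn (deriv f) (Ici c) := by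
  refine (hL.continuousOn.mono (Ici_subset_Ici.2 hc.le)).congr fun x hx => ?_
  rw [derivWithin_of_mem_nhds (Ici_mem_nhds (hc.trans_le hx))]

/-- Continuity of `f` is available only above `c`, but `s ↦ f (max s c)` is continuous on the whole
line and gives almost everywhere the same composition. -/
theorem aestronglyMeasurable_comp_of_le {α E : Type*} [MeasurableSpace α] [NormedAddCommGroup E]
    {μ : Measure α} {f : ℝ → E} {c : ℝ} (hf : ContinuousOn f (Ici c)) {z : α → ℝ}
    (hz : AEStronglyMeasurable z μ) (hc : ∀ᵐ x ∂μ, c ≤ z x) :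
    AEStronglyMeasurable (fun x => f (z x)) μ := by
  have hcont : Continuous fun s : ℝ => f (max s c) :=
    hf.comp_continuous (by fun_prop) fun s => mem_Ici.2 (le_max_right _ _)
  refine (hcont.comp_aestronglyMeasurable hz).congr ?_
  filter_upwards [hc] with x hx
  rw [max_eq_left hx]

/-! ### Positive damage fields and the regularity of the data along them -/

namespace Data

variable {n : ℕ} {d : Data n}

theorem Admissible.exponent_nonneg (hd : d.Admissible) : 0 ≤ (n : ℝ) / 2 + (d.m - 1) := by
  have h1 := hd.order.1
  have h2 : (2 : ℝ) ≤ n := by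
    rcases hd.dim with h | h <;> subst h <;> norm_num
  linarith

theorem Admissible.exists_field_bound (hd : d.Admissible) :
    ∃ k > 0, ∀ z : d.Z, ∀ᵐ x ∂(volume.restrict d.Ω), |field z x| ≤ k * ‖z‖ :=
  DamagePlasticity.exists_field_bound hd.lipschitz hd.order.1 hd.exponent_nonneg

theorem Admissible.completeSpace_Z (hd : d.Admissible) : CompleteSpace d.Z :=
  completeSpace_Hm hd.lipschitz hd.exponent_nonneg

/-- `z` is bounded below by a positive constant. -/
def PosField (z : d.Z) : Prop := ∃ c : ℝ, 0 < c ∧ ∀ᵐ x ∂(volume.restrict d.Ω), c ≤ field z x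

/-- The function underlying an element of `H^m(Ω)`, as a continuous linear map. -/
def fieldL (d : Data n) : d.Z →L[ℝ] L2 d.Ω ℝ :=
  WithLp.fstL 2 ℝ (L2 d.Ω ℝ) (Lp (Vec n) 2 ((volume.restrict d.Ω).prod (volume.restrict d.Ω))) ∘L
    (Hm d.Ω d.m).subtypeL

/-- The fractional difference quotient, as a continuous linear map. -/
def quotL (d : Data n) :
    d.Z →L[ℝ] Lp (Vec n) 2 ((volume.restrict d.Ω).prod (volume.restrict d.Ω)) :=
  WithLp.sndL 2 ℝ (L2 d.Ω ℝ) (Lp (Vec n) 2 ((volume.restrict d.Ω).prod (volume.restrict d.Ω))) ∘L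
    (Hm d.Ω d.m).subtypeL

theorem fieldL_apply (z : d.Z) : d.fieldL z = field z := rfl

/-- The strain, as a continuous linear map. -/
def strainL (d : Data n) : H1 d.Ω →L[ℝ] L2 d.Ω (Sym n) :=
  (symPart n).compLpL 2 (volume.restrict d.Ω) ∘L
    WithLp.sndL 2 ℝ (L2 d.Ω (Vec n)) (L2 d.Ω (Mat n)) ∘L (H1 d.Ω).subtypeL

/-- The inclusion of the plastic strains into the symmetric matrix fields. -/
def devInclL (d : Data n) : d.P →L[ℝ] L2 d.Ω (Sym n) :=
  (devIncl n).compLpL 2 (volume.restrict d.Ω)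

theorem devInclL_apply (p : d.P) : d.devInclL p = (devIncl n).compLp p := rfl

theorem field_add_ae (z ζ : d.Z) :
    ∀ᵐ x ∂(volume.restrict d.Ω), field (z + ζ) x = field z x + field ζ x := by
  have h : field (z + ζ) = field z + field ζ := rfl
  rw [h]
  exact Lp.coeFn_add _ _

theorem field_smul_ae (c : ℝ) (z : d.Z) :
    ∀ᵐ x ∂(volume.restrict d.Ω), field (c • z) x = c * field z x := by
  have h : field (c • z) = c • field z := rfl
  rw [h]
  exact Lp.coeFn_smul _ _

/-- The elasticity tensor and the damage energy have uniform Taylor bounds along the values of a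
field bounded below by a positive constant, stable under small perturbations. -/
theorem PosField.exists_ball {z : d.Z} (hd : d.Admissible) (hz : PosField z) :
    ∃ α β : ℝ, 0 < α ∧ ∃ δ > 0, ∀ ζ : d.Z, ‖ζ‖ < δ →
      ∀ᵐ x ∂(volume.restrict d.Ω), field (z + ζ) x ∈ Icc α β := by
  obtain ⟨k, hk, hemb⟩ := hd.exists_field_bound
  obtain ⟨c, hc, hcz⟩ := hz
  -- With the embedding constant `k`, a perturbation of norm below `c / (2 k)` moves the field by at
  -- most `c / 2`.
  refine ⟨c / 2, k * ‖z‖ + c / 2, by positivity, c / (2 * k), by positivity, fun ζ hζ => ?_⟩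
  filter_upwards [hcz, hemb z, hemb ζ, field_add_ae z ζ] with x h1 h2 h3 h4
  have h5 : k * ‖ζ‖ ≤ c / 2 := by
    rw [lt_div_iff₀ (by positivity)] at hζ
    linarith
  rw [h4]
  have h6 := abs_le.1 h3
  have h7 := abs_le.1 h2
  constructor <;> linarith [h6.1, h6.2, h7.2]

theorem PosField.ae_mem_Icc {z : d.Z} {α β δ : ℝ} (hδ : 0 < δ)
    (h : ∀ ζ : d.Z, ‖ζ‖ < δ → ∀ᵐ x ∂(volume.restrict d.Ω), field (z + ζ) x ∈ Icc α β) :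
    ∀ᵐ x ∂(volume.restrict d.Ω), field z x ∈ Icc α β := by
  have := h 0 (by simpa using hδ)
  rwa [add_zero] at this

/-- Because of this openness the derivative in `z` at a state of finite energy does not see the
value `+∞` off the domain. -/
theorem isOpen_posField (hd : d.Admissible) : IsOpen {z : d.Z | PosField z} := by
  rw [Metric.isOpen_iff]
  intro z hz
  obtain ⟨α, β, hα, δ, hδ, h⟩ := PosField.exists_ball hd hz
  refine ⟨δ, hδ, fun y hy => ⟨α, hα, ?_⟩⟩
  have := h (y - z) (by rwa [Metric.mem_ball, dist_eq_norm] at hy)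
  rw [add_sub_cancel] at this
  exact this.mono fun x hx => hx.1

theorem Admissible.elast_hasDerivAt (hd : d.Admissible) {s : ℝ} (hs : 0 < s) :
    HasDerivAt d.elast (deriv d.elast s) s :=
  ((hd.elast_smooth.1.contDiffAt (Ici_mem_nhds hs)).differentiableAt (by simp)).hasDerivAt

theorem Admissible.elast_taylor (hd : d.Admissible) {α β : ℝ} (hα : 0 < α) :
    ∃ C : ℝ, 0 ≤ C ∧ ∀ a ∈ Icc α β, ‖d.elast a‖ ≤ C ∧ ‖deriv d.elast a‖ ≤ C ∧ ∀ b ∈ Icc α β,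
      ‖d.elast b - d.elast a‖ ≤ C * |b - a| ∧
      ‖d.elast b - d.elast a - (b - a) • deriv d.elast a‖ ≤ C * |b - a| ^ 2 := by
  exact exists_taylor_bounds_of_locallyLipschitz (E := Sym n →L[ℝ] Sym n) (f := d.elast)
    (fun x hx => hd.elast_hasDerivAt hx) hd.elast_smooth.2 hα

theorem Admissible.W_deriv_contDiffOn (hd : d.Admissible) : ContDiffOn ℝ 1 (deriv d.W) (Ioi 0) :=
  ((contDiffOn_succ_iff_deriv_of_isOpen (n := 1) isOpen_Ioi).1 hd.W_smooth).2.2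

theorem Admissible.W_taylor (hd : d.Admissible) {α β : ℝ} (hα : 0 < α) :
    ∃ C : ℝ, 0 ≤ C ∧ ∀ a ∈ Icc α β, ‖d.W a‖ ≤ C ∧ ‖deriv d.W a‖ ≤ C ∧ ∀ b ∈ Icc α β,
      ‖d.W b - d.W a‖ ≤ C * |b - a| ∧
      ‖d.W b - d.W a - (b - a) • deriv d.W a‖ ≤ C * |b - a| ^ 2 := by
  have hsub : Icc α β ⊆ Ioi (0 : ℝ) := fun x hx => hα.trans_le hx.1
  obtain ⟨L, hL⟩ := (hd.W_deriv_contDiffOn.mono hsub).exists_lipschitzOnWith (by decide)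
    (convex_Icc _ _) isCompact_Icc
  refine exists_taylor_bounds (fun x hx => ?_) hL
  exact ((hd.W_smooth.contDiffAt (Ioi_mem_nhds (hα.trans_le hx.1))).differentiableAt
    (by simp)).hasDerivAt

theorem aestronglyMeasurable_elast (hd : d.Admissible) {z : d.Z} (hz : PosField z) :
    AEStronglyMeasurable (fun x => d.elast (field z x)) (volume.restrict d.Ω) := by
  obtain ⟨c, hc, h⟩ := hz
  exact aestronglyMeasurable_comp_of_le (c := 0) hd.elast_smooth.1.continuousOn
    (Lp.aestronglyMeasurable _) (h.mono fun x hx => hc.le.trans hx)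

theorem aestronglyMeasurable_deriv_elast (hd : d.Admissible) {z : d.Z} (hz : PosField z) :
    AEStronglyMeasurable (fun x => deriv d.elast (field z x)) (volume.restrict d.Ω) := by
  obtain ⟨c, hc, h⟩ := hz
  refine aestronglyMeasurable_comp_of_le (E := Sym n →L[ℝ] Sym n) (f := deriv d.elast) (c := c)
    ?_ (Lp.aestronglyMeasurable _) h
  exact continuousOn_deriv_of_locallyLipschitz (E := Sym n →L[ℝ] Sym n) (f := d.elast)
    hd.elast_smooth.2 hc

theorem aestronglyMeasurable_W (hd : d.Admissible) {z : d.Z} (hz : PosField z) :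
    AEStronglyMeasurable (fun x => d.W (field z x)) (volume.restrict d.Ω) := by
  obtain ⟨c, hc, h⟩ := hz
  exact aestronglyMeasurable_comp_of_le (c := c)
    (hd.W_smooth.continuousOn.mono fun x hx => hc.trans_le hx) (Lp.aestronglyMeasurable _) h

theorem aestronglyMeasurable_deriv_W (hd : d.Admissible) {z : d.Z} (hz : PosField z) :
    AEStronglyMeasurable (fun x => deriv d.W (field z x)) (volume.restrict d.Ω) := by
  obtain ⟨c, hc, h⟩ := hz
  exact aestronglyMeasurable_comp_of_le (c := c)
    (hd.W_deriv_contDiffOn.continuousOn.mono fun x hx => hc.trans_le hx)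
    (Lp.aestronglyMeasurable _) h

end Data

theorem memLp_clm_apply {α E : Type*} [MeasurableSpace α] [NormedAddCommGroup E]
    [InnerProductSpace ℝ E] {μ : Measure α} {A : α → (E →L[ℝ] E)} {C : ℝ}
    (hA : AEStronglyMeasurable A μ) (hC : ∀ᵐ x ∂μ, ‖A x‖ ≤ C) {f : α → E} (hf : MemLp f 2 μ) :
    MemLp (fun x => A x (f x)) 2 μ := by
  refine hf.of_le_mul (c := C) ?_ ?_
  · exact (ContinuousLinearMap.apply ℝ E : E →L[ℝ] (E →L[ℝ] E) →L[ℝ] E).aestronglyMeasurable_comp₂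
      hf.aestronglyMeasurable hA
  · filter_upwards [hC] with x hx
    exact (A x).le_of_opNorm_le hx _

theorem integrable_inner_of_memLp {α E : Type*} [MeasurableSpace α] [NormedAddCommGroup E]
    [InnerProductSpace ℝ E] {μ : Measure α} {f g : α → E} (hf : MemLp f 2 μ) (hg : MemLp g 2 μ) :
    Integrable (fun x => ⟪f x, g x⟫_ℝ) μ := by
  refine (L2.integrable_inner (𝕜 := ℝ) (hf.toLp f) (hg.toLp g)).congr ?_
  filter_upwards [hf.coeFn_toLp, hg.coeFn_toLp] with x h1 h2
  rw [h1, h2]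

/-- The increment minus its linear part splits into a second-order Taylor remainder of the
coefficient, a mixed term and a quadratic term in `ε`. The mixed term is absorbed by `2 k ‖e‖ ‖ε‖ ≤
k² ‖e‖² + ‖ε‖²`. -/
theorem elastic_remainder_le {E : Type*} [NormedAddCommGroup E] [InnerProductSpace ℝ E]
    {A₀ A₁ A' : E →L[ℝ] E} {C s k : ℝ} (hC : 0 ≤ C) (hs : |s| ≤ k)
    (hsym : ∀ ξ η, ⟪A₁ ξ, η⟫_ℝ = ⟪ξ, A₁ η⟫_ℝ) (h1 : ‖A₁‖ ≤ C) (h2 : ‖A₁ - A₀‖ ≤ C * |s|)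
    (h3 : ‖A₁ - A₀ - s • A'‖ ≤ C * |s| ^ 2) (e ε : E) :
    |1 / 2 * ⟪A₁ (e + ε), e + ε⟫_ℝ - 1 / 2 * ⟪A₀ e, e⟫_ℝ - ⟪A₀ e, ε⟫_ℝ - 1 / 2 * ⟪A' e, e⟫_ℝ * s|
      ≤ C * (k ^ 2 * ‖e‖ ^ 2 + ‖ε‖ ^ 2) := by
  have hk : 0 ≤ k := (abs_nonneg s).trans hs
  have key : 1 / 2 * ⟪A₁ (e + ε), e + ε⟫_ℝ - 1 / 2 * ⟪A₀ e, e⟫_ℝ - ⟪A₀ e, ε⟫_ℝ -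
      1 / 2 * ⟪A' e, e⟫_ℝ * s =
      1 / 2 * ⟪(A₁ - A₀ - s • A') e, e⟫_ℝ + ⟪(A₁ - A₀) e, ε⟫_ℝ + 1 / 2 * ⟪A₁ ε, ε⟫_ℝ := by
    have h5 : ⟪A₁ ε, e⟫_ℝ = ⟪A₁ e, ε⟫_ℝ := by rw [hsym, real_inner_comm]
    simp only [map_add, inner_add_left, inner_add_right, sub_apply,
      smul_apply, inner_sub_left, inner_smul_left, conj_trivial]
    rw [h5]
    ring
  rw [key]
  have b : ∀ (B : E →L[ℝ] E) (c : ℝ), ‖B‖ ≤ c → ∀ x y : E, |⟪B x, y⟫_ℝ| ≤ c * ‖x‖ * ‖y‖ := by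
    intro B c hB x y
    refine (abs_real_inner_le_norm _ _).trans ?_
    gcongr
    exact B.le_of_opNorm_le hB x
  have b1 := b _ _ h3 e e
  have b2 := b _ _ h2 e ε
  have b3 := b _ _ h1 ε ε
  have b1' : |⟪(A₁ - A₀ - s • A') e, e⟫_ℝ| ≤ C * k ^ 2 * ‖e‖ * ‖e‖ := b1.trans (by gcongr)
  have b2' : |⟪(A₁ - A₀) e, ε⟫_ℝ| ≤ C * k * ‖e‖ * ‖ε‖ := b2.trans (by gcongr)
  have hsq : 0 ≤ C * (k * ‖e‖ - ‖ε‖) ^ 2 := by positivity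
  rw [abs_le] at b1' b2' b3 ⊢
  constructor <;> nlinarith

theorem integral_sub_sub_sub {α : Type*} [MeasurableSpace α] {μ : Measure α} {a b c e : α → ℝ}
    (ha : Integrable a μ) (hb : Integrable b μ) (hc : Integrable c μ) (he : Integrable e μ) :
    ∫ x, (a x - b x - c x - e x) ∂μ = ∫ x, a x ∂μ - ∫ x, b x ∂μ - ∫ x, c x ∂μ - ∫ x, e x ∂μ := by
  have h1 : Integrable (fun x => a x - b x) μ := ha.sub hb
  have h2 : Integrable (fun x => a x - b x - c x) μ := h1.sub hc
  rw [integral_sub h2 he, integral_sub h1 hc, integral_sub ha hb]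

/-! ### Fréchet derivatives of integral functionals of bounded fields -/

section Nemytskii

variable {Ω E Z : Type*} [MeasurableSpace Ω] {μ : Measure Ω} [NormedAddCommGroup E]
  [InnerProductSpace ℝ E] [NormedAddCommGroup Z] [NormedSpace ℝ Z] {ι : Z →L[ℝ] Lp ℝ 2 μ} {k : ℝ}

theorem clm_add_ae (ι : Z →L[ℝ] Lp ℝ 2 μ) (z ζ : Z) :
    ∀ᵐ x ∂μ, ι (z + ζ) x = ι z x + ι ζ x := by
  rw [map_add]
  exact Lp.coeFn_add _ _

theorem clm_smul_ae (ι : Z →L[ℝ] Lp ℝ 2 μ) (c : ℝ) (z : Z) :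
    ∀ᵐ x ∂μ, ι (c • z) x = c * ι z x := by
  rw [map_smul]
  exact Lp.coeFn_smul _ _

/-- Elements of `Z` act as bounded functions, so an integrable density suffices. This matters for
the density `ℂ'(z) e : e / 2`, which is integrable but need not belong to `L²`. -/
theorem exists_mulFunctional (hemb : ∀ z, ∀ᵐ x ∂μ, |ι z x| ≤ k * ‖z‖) {h : Ω → ℝ}
    (hh : Integrable h μ) : ∃ χ : Z →L[ℝ] ℝ, ∀ η : Z, χ η = ∫ x, h x * ι η x ∂μ := by
  have hint : ∀ η : Z, Integrable (fun x => h x * ι η x) μ := fun η =>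
    hh.mul_bdd (c := k * ‖η‖) (Lp.aestronglyMeasurable _) (hemb η)
  let L : Z →ₗ[ℝ] ℝ :=
    { toFun := fun η => ∫ x, h x * ι η x ∂μ
      map_add' := fun η ζ => by
        rw [← integral_add (hint η) (hint ζ)]
        refine integral_congr_ae ?_
        filter_upwards [clm_add_ae ι η ζ] with x hx
        rw [hx]
        ring
      map_smul' := fun c η => by
        rw [RingHom.id_apply, smul_eq_mul, ← integral_const_mul]
        refine integral_congr_ae ?_
        filter_upwards [clm_smul_ae ι c η] with x hx
        rw [hx]
        ring }
  refine ⟨L.mkContinuous ((∫ x, ‖h x‖ ∂μ) * k) fun η => ?_, fun η => rfl⟩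
  change ‖∫ x, h x * ι η x ∂μ‖ ≤ _
  refine (norm_integral_le_of_norm_le (g := fun x => ‖h x‖ * (k * ‖η‖)) (hh.norm.mul_const _)
    ?_).trans (le_of_eq ?_)
  · filter_upwards [hemb η] with x hx
    rw [norm_mul]
    gcongr
    exact hx
  · rw [integral_mul_const]
    ring

/-- The Fréchet derivative of a quadratic energy with a coefficient depending on a bounded
field. -/
theorem exists_hasFDerivAt_quadraticEnergy (hemb : ∀ z, ∀ᵐ x ∂μ, |ι z x| ≤ k * ‖z‖)
    {A A' : ℝ → (E →L[ℝ] E)} {z : Z} {α β δ C : ℝ} (hδ : 0 < δ) (hC : 0 ≤ C)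
    (hI : ∀ ζ : Z, ‖ζ‖ < δ → ∀ᵐ x ∂μ, ι (z + ζ) x ∈ Icc α β)
    (hT : ∀ a ∈ Icc α β, ‖A a‖ ≤ C ∧ ‖A' a‖ ≤ C ∧ ∀ b ∈ Icc α β,
      ‖A b - A a‖ ≤ C * |b - a| ∧ ‖A b - A a - (b - a) • A' a‖ ≤ C * |b - a| ^ 2)
    (hsym : ∀ a ∈ Icc α β, ∀ ξ η, ⟪A a ξ, η⟫_ℝ = ⟪ξ, A a η⟫_ℝ)
    (hAm : ∀ ζ : Z, ‖ζ‖ < δ → AEStronglyMeasurable (fun x => A (ι (z + ζ) x)) μ)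
    (hA'm : AEStronglyMeasurable (fun x => A' (ι z x)) μ) (e : Lp E 2 μ) :
    ∃ (σ : Lp E 2 μ) (χ : Z →L[ℝ] ℝ) (D : Lp E 2 μ × Z →L[ℝ] ℝ),
      (∀ᵐ x ∂μ, σ x = A (ι z x) (e x)) ∧
      (∀ η : Z, χ η = ∫ x, 1 / 2 * ⟪A' (ι z x) (e x), e x⟫_ℝ * ι η x ∂μ) ∧
      HasFDerivAt (fun y : Lp E 2 μ × Z => (1 / 2) * ∫ x, ⟪A (ι y.2 x) (y.1 x), y.1 x⟫_ℝ ∂μ)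
        D (e, z) ∧ ∀ ε ζ, D (ε, ζ) = ⟪σ, ε⟫_ℝ + χ ζ := by
  set J : Lp E 2 μ × Z → ℝ := fun y => (1 / 2) * ∫ x, ⟪A (ι y.2 x) (y.1 x), y.1 x⟫_ℝ ∂μ with hJ
  have hz0 : ∀ᵐ x ∂μ, ι z x ∈ Icc α β := by
    have := hI 0 (by simpa using hδ)
    rwa [add_zero] at this
  have hAb : ∀ ζ : Z, ‖ζ‖ < δ → ∀ᵐ x ∂μ, ‖A (ι (z + ζ) x)‖ ≤ C := fun ζ hζ =>
    (hI ζ hζ).mono fun x hx => (hT _ hx).1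
  have hσ := memLp_clm_apply (hAm 0 (by simpa using hδ)) (hAb 0 (by simpa using hδ)) (Lp.memLp e)
  rw [add_zero] at hσ
  have hσ' := memLp_clm_apply hA'm (hz0.mono fun x hx => (hT _ hx).2.1) (Lp.memLp e)
  have hh : Integrable (fun x => 1 / 2 * ⟪A' (ι z x) (e x), e x⟫_ℝ)
      μ := (integrable_inner_of_memLp hσ' (Lp.memLp e)).const_mul _
  obtain ⟨χ, hχ⟩ := exists_mulFunctional hemb hh
  refine ⟨hσ.toLp _, χ, (innerSL ℝ (hσ.toLp _)).coprod χ, hσ.coeFn_toLp, hχ, ?_,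
    fun ε ζ => rfl⟩
  -- The pointwise bound `|ζ| ≤ k ‖ζ‖` keeps the term `ζ² |e|²` of the remainder integrable for `e`
  -- merely in `L²`; this gives the factor `k² ‖e‖²` in the constant.
  refine hasFDerivAt_of_quadratic (δ := δ) (C := C * (k ^ 2 * ‖e‖ ^ 2 + 1)) hδ ?_
  rintro ⟨ε, ζ⟩ hy
  have hζ : ‖ζ‖ < δ := (norm_snd_le (ε, ζ)).trans_lt hy
  set N := ‖(ε, ζ)‖ with hN
  have hεN : ‖ε‖ ≤ N := norm_fst_le (ε, ζ)
  have hζN : ‖ζ‖ ≤ N := norm_snd_le (ε, ζ)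
  have hσ1 := memLp_clm_apply (hAm ζ hζ) (hAb ζ hζ) (Lp.memLp (e + ε))
  have i1 : Integrable (fun x => 1 / 2 * ⟪A (ι (z + ζ) x) ((e + ε : Lp E 2 μ) x),
      (e + ε : Lp E 2 μ) x⟫_ℝ) μ :=
    (integrable_inner_of_memLp hσ1 (Lp.memLp (e + ε))).const_mul _
  have i2 : Integrable (fun x => 1 / 2 * ⟪A (ι z x) (e x), e x⟫_ℝ)
      μ := (integrable_inner_of_memLp hσ (Lp.memLp e)).const_mul _
  have i3 : Integrable (fun x => ⟪A (ι z x) (e x), ε x⟫_ℝ) μ :=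
    integrable_inner_of_memLp hσ (Lp.memLp ε)
  have i4 : Integrable (fun x => 1 / 2 * ⟪A' (ι z x) (e x), e x⟫_ℝ * ι ζ x)
      μ := hh.mul_bdd (c := k * ‖ζ‖) (Lp.aestronglyMeasurable _) (hemb ζ)
  have hinner : ⟪hσ.toLp _, ε⟫_ℝ = ∫ x, ⟪A (ι z x) (e x), ε x⟫_ℝ ∂μ := by
    rw [L2.inner_def]
    refine integral_congr_ae ?_
    filter_upwards [hσ.coeFn_toLp] with x hx
    rw [hx]
  have hexp : J ((e, z) + (ε, ζ)) - J (e, z) -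
      ((innerSL ℝ (hσ.toLp _)).coprod χ) (ε, ζ) =
      ∫ x, (1 / 2 * ⟪A (ι (z + ζ) x) ((e + ε : Lp E 2 μ) x),
      (e + ε : Lp E 2 μ) x⟫_ℝ - 1 / 2 * ⟪A (ι z x) (e x), e x⟫_ℝ -
      ⟪A (ι z x) (e x), ε x⟫_ℝ -
      1 / 2 * ⟪A' (ι z x) (e x), e x⟫_ℝ * ι ζ x) ∂μ := by
    rw [integral_sub_sub_sub i1 i2 i3 i4,
      integral_const_mul, integral_const_mul, ContinuousLinearMap.coprod_apply, innerSL_apply_apply,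
      hinner, hχ]
    simp only [hJ, Prod.mk_add_mk]
    ring
  rw [hexp]
  have hbI : Integrable (fun x => C * ((k * ‖ζ‖) ^ 2 * ‖e x‖ ^ 2 + ‖ε x‖ ^ 2))
      μ :=
    ((((Lp.memLp e).integrable_norm_pow (by norm_num)).const_mul _).add
      ((Lp.memLp ε).integrable_norm_pow (by norm_num))).const_mul _
  refine (norm_integral_le_of_norm_le hbI ?_).trans ?_
  · filter_upwards [hz0, hI ζ hζ, hemb ζ, clm_add_ae ι z ζ, Lp.coeFn_add e ε] with x h1 h2 h3 h4 h5
    have h6 := (hT _ h1).2.2 _ h2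
    have h7 : ι (z + ζ) x - ι z x = ι ζ x := by rw [h4]; ring
    rw [h7] at h6
    rw [h5, Pi.add_apply, Real.norm_eq_abs]
    exact elastic_remainder_le hC h3 (hsym _ h2) (hT _ h2).1 h6.1 h6.2 _ _
  · rw [integral_const_mul,
      integral_add (((Lp.memLp e).integrable_norm_pow (by norm_num)).const_mul _)
      ((Lp.memLp ε).integrable_norm_pow (by norm_num)), integral_const_mul, ← norm_sq_L2,
      ← norm_sq_L2, mul_assoc]
    refine mul_le_mul_of_nonneg_left ?_ hC
    have e1 : ‖ζ‖ ^ 2 ≤ N ^ 2 := by gcongr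
    have e2 : ‖ε‖ ^ 2 ≤ N ^ 2 := by gcongr
    have e3 : 0 ≤ k ^ 2 * ‖e‖ ^ 2 := by positivity
    nlinarith

/-- The Fréchet derivative of an integral functional of a bounded field. -/
theorem exists_hasFDerivAt_integral [IsFiniteMeasure μ]
    (hemb : ∀ z, ∀ᵐ x ∂μ, |ι z x| ≤ k * ‖z‖)
    {f f' : ℝ → ℝ} {z : Z} {α β δ C : ℝ} (hδ : 0 < δ) (hC : 0 ≤ C)
    (hI : ∀ ζ : Z, ‖ζ‖ < δ → ∀ᵐ x ∂μ, ι (z + ζ) x ∈ Icc α β)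
    (hT : ∀ a ∈ Icc α β, ‖f a‖ ≤ C ∧ ‖f' a‖ ≤ C ∧ ∀ b ∈ Icc α β,
      ‖f b - f a‖ ≤ C * |b - a| ∧ ‖f b - f a - (b - a) • f' a‖ ≤ C * |b - a| ^ 2)
    (hfm : ∀ ζ : Z, ‖ζ‖ < δ → AEStronglyMeasurable (fun x => f (ι (z + ζ) x)) μ)
    (hf'm : AEStronglyMeasurable (fun x => f' (ι z x)) μ) :
    ∃ χ : Z →L[ℝ] ℝ, (∀ η : Z, χ η = ∫ x, f' (ι z x) * ι η x ∂μ) ∧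
      HasFDerivAt (fun z : Z => ∫ x, f (ι z x) ∂μ) χ z := by
  have hz0 : ∀ᵐ x ∂μ, ι z x ∈ Icc α β := by
    have := hI 0 (by simpa using hδ)
    rwa [add_zero] at this
  have hh : Integrable (fun x => f' (ι z x)) μ :=
    Integrable.of_bound hf'm C (hz0.mono fun x hx => (hT _ hx).2.1)
  have hWI : ∀ ζ : Z, ‖ζ‖ < δ → Integrable (fun x => f (ι (z + ζ) x)) μ := fun ζ hζ =>
    Integrable.of_bound (hfm ζ hζ) C ((hI ζ hζ).mono fun x hx => (hT _ hx).1)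
  have hW0 : Integrable (fun x => f (ι z x)) μ := by
    have := hWI 0 (by simpa using hδ)
    rwa [add_zero] at this
  obtain ⟨χ, hχ⟩ := exists_mulFunctional hemb hh
  refine ⟨χ, hχ, ?_⟩
  refine hasFDerivAt_of_quadratic (δ := δ)
    (C := C * k ^ 2 * μ.real univ) hδ fun ζ hζ => ?_
  have i4 : Integrable (fun x => f' (ι z x) * ι ζ x)
      μ := hh.mul_bdd (c := k * ‖ζ‖) (Lp.aestronglyMeasurable _) (hemb ζ)
  have i5 : Integrable (fun x => f (ι (z + ζ) x) - f (ι z x)) μ := (hWI ζ hζ).sub hW0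
  rw [hχ, ← integral_sub (hWI ζ hζ) hW0, ← integral_sub i5 i4]
  refine (norm_integral_le_of_norm_le (g := fun _ => C * (k * ‖ζ‖) ^ 2) (integrable_const _)
    ?_).trans (le_of_eq ?_)
  · filter_upwards [hz0, hI ζ hζ, hemb ζ, clm_add_ae ι z ζ] with x h1 h2 h3 h4
    have h6 := ((hT _ h1).2.2 _ h2).2
    have h7 : ι (z + ζ) x - ι z x = ι ζ x := by rw [h4]; ring
    rw [h7, smul_eq_mul, mul_comm (ι ζ x)] at h6
    refine h6.trans ?_
    gcongr
  · rw [integral_const, smul_eq_mul]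
    ring

end Nemytskii

/-! ### Partial and time derivatives of an energy with loads -/

section EnergyCalculus

variable {U V Z P Y N : Type*} [NormedAddCommGroup U] [NormedSpace ℝ U]
  [NormedAddCommGroup V] [NormedSpace ℝ V]
  [NormedAddCommGroup Z] [NormedSpace ℝ Z] [NormedAddCommGroup P] [InnerProductSpace ℝ P]
  [NormedAddCommGroup Y] [InnerProductSpace ℝ Y] [NormedAddCommGroup N] [InnerProductSpace ℝ N]

/-- The derivative is taken jointly in all variables, so that a single `D` supplies the partial
derivatives of the energy and the chain rule along curves. -/
theorem exists_hasFDerivAt_storedEnergy {J : Y × Z → ℝ} {f : Z → ℝ} {a : V →L[ℝ] Y} {b : P →L[ℝ] Y}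
    {k : Z →L[ℝ] N} {σ : Y} {χ₁ χ₂ : Z →L[ℝ] ℝ} {D₀ : Y × Z →L[ℝ] ℝ}
    {v : V} {z : Z} {p : P} (μ : ℝ) (hJ : HasFDerivAt J D₀ (a v - b p, z))
    (hD₀ : ∀ ε ζ, D₀ (ε, ζ) = ⟪σ, ε⟫_ℝ + χ₁ ζ) (hf : HasFDerivAt f χ₂ z) :
    ∃ D : V × Z × P →L[ℝ] ℝ,
      (∀ v' z' p', D (v', z', p') =
        ⟪σ, a v' - b p'⟫_ℝ + χ₁ z' + (χ₂ z' + μ * ⟪p, p'⟫_ℝ) + ⟪k z, k z'⟫_ℝ) ∧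
      HasFDerivAt (fun y : V × Z × P => J (a y.1 - b y.2.2, y.2.1) +
        (f y.2.1 + μ / 2 * ‖y.2.2‖ ^ 2) + 1 / 2 * ⟪k y.2.1, k y.2.1⟫_ℝ) D (v, z, p) := by
  let π₁ : V × Z × P →L[ℝ] V := ContinuousLinearMap.fst ℝ V (Z × P)
  let π₂ : V × Z × P →L[ℝ] Z :=
    ContinuousLinearMap.fst ℝ Z P ∘L ContinuousLinearMap.snd ℝ V (Z × P)
  let π₃ : V × Z × P →L[ℝ] P :=
    ContinuousLinearMap.snd ℝ Z P ∘L ContinuousLinearMap.snd ℝ V (Z × P)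
  have h1 : HasFDerivAt (fun y : V × Z × P => J (a y.1 - b y.2.2, y.2.1))
      (D₀ ∘L ((a ∘L π₁ - b ∘L π₃).prod π₂)) (v, z, p) :=
    HasFDerivAt.comp (v, z, p) (g := J) (f := fun y : V × Z × P => (a y.1 - b y.2.2, y.2.1)) hJ
      ((a ∘L π₁ - b ∘L π₃).prod π₂).hasFDerivAt
  have h2 : HasFDerivAt (fun y : V × Z × P => f y.2.1) (χ₂ ∘L π₂) (v, z, p) :=
    HasFDerivAt.comp (v, z, p) (g := f) (f := fun y : V × Z × P => y.2.1) hf π₂.hasFDerivAt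
  have h3 : HasFDerivAt (fun y : V × Z × P => μ / 2 * ‖y.2.2‖ ^ 2) _ (v, z, p) :=
    (π₃.hasFDerivAt (x := (v, z, p))).norm_sq.const_mul (μ / 2)
  have h4 : HasFDerivAt (fun y : V × Z × P => 1 / 2 * ⟪k y.2.1, k y.2.1⟫_ℝ) _ (v, z, p) :=
    (((k ∘L π₂).hasFDerivAt (x := (v, z, p))).inner ℝ
      ((k ∘L π₂).hasFDerivAt (x := (v, z, p)))).const_mul (1 / 2)
  refine ⟨_, fun v' z' p' => ?_, (h1.fun_add (h2.fun_add h3)).fun_add h4⟩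
  simp only [π₁, π₂, π₃, add_apply, smul_apply, ContinuousLinearMap.comp_apply,
    ContinuousLinearMap.prod_apply, sub_apply,
    ContinuousLinearMap.coe_fst', ContinuousLinearMap.coe_snd', hD₀, innerSL_apply_apply,
    fderivInnerCLM_apply, smul_eq_mul, nsmul_eq_mul]
  rw [real_inner_comm (k z)]
  push_cast
  ring

variable {Ψ : V × Z × P → ℝ} {D : V × Z × P →L[ℝ] ℝ} {v : V} {z : Z} {p : P}

theorem hasFDerivAt_partial_fst (i : U →L[ℝ] V) (F : V →L[ℝ] ℝ) {u : U} {w : V}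
    (h : HasFDerivAt Ψ D (i u + w, z, p)) :
    HasFDerivAt (fun u : U => Ψ (i u + w, z, p) - F (i u + w))
      ((D ∘L ContinuousLinearMap.inl ℝ V (Z × P) - F) ∘L i) u := by
  have h0 : HasFDerivAt (fun u : U => i u + w) i u := i.hasFDerivAt.add_const w
  have h1 : HasFDerivAt (fun u : U => (i u + w, z, p)) (i.prod (0 : U →L[ℝ] Z × P)) u :=
    h0.prodMk (hasFDerivAt_const (z, p) u)
  have h2 := (HasFDerivAt.comp u (g := Ψ) (f := fun u : U => (i u + w, z, p)) h h1).fun_sub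
    (F.hasFDerivAt.comp u h0)
  refine h2.congr_fderiv ?_
  ext y
  simp

theorem hasFDerivAt_partial_mid (c : ℝ) (h : HasFDerivAt Ψ D (v, z, p)) :
    HasFDerivAt (fun z : Z => Ψ (v, z, p) - c)
      (D ∘L ContinuousLinearMap.inr ℝ V (Z × P) ∘L ContinuousLinearMap.inl ℝ Z P) z := by
  have h1 : HasFDerivAt (fun z : Z => (v, z, p))
      ((0 : Z →L[ℝ] V).prod ((ContinuousLinearMap.id ℝ Z).prod (0 : Z →L[ℝ] P))) z :=
    (hasFDerivAt_const v z).prodMk ((hasFDerivAt_id z).prodMk (hasFDerivAt_const p z))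
  have h2 := (HasFDerivAt.comp z (g := Ψ) (f := fun z : Z => (v, z, p)) h h1).sub_const c
  refine h2.congr_fderiv ?_
  ext y
  simp

theorem hasFDerivAt_partial_snd (c : ℝ) (h : HasFDerivAt Ψ D (v, z, p)) :
    HasFDerivAt (fun p : P => Ψ (v, z, p) - c)
      (D ∘L ContinuousLinearMap.inr ℝ V (Z × P) ∘L ContinuousLinearMap.inr ℝ Z P) p := by
  have h1 : HasFDerivAt (fun p : P => (v, z, p))
      ((0 : P →L[ℝ] V).prod ((0 : P →L[ℝ] Z).prod (ContinuousLinearMap.id ℝ P))) p :=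
    (hasFDerivAt_const v p).prodMk ((hasFDerivAt_const z p).prodMk (hasFDerivAt_id p))
  have h2 := (HasFDerivAt.comp p (g := Ψ) (f := fun p : P => (v, z, p)) h h1).sub_const c
  refine h2.congr_fderiv ?_
  ext y
  simp

theorem fderiv_partial_fst (i : U →L[ℝ] V) (F : V →L[ℝ] ℝ) {u : U} {w : V}
    (h : HasFDerivAt Ψ D (i u + w, z, p)) {g : U → ℝ}
    (hg : ∀ u, g u = Ψ (i u + w, z, p) - F (i u + w)) (v : U) :
    fderiv ℝ g u v = D (i v, 0, 0) - F (i v) := by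
  rw [funext hg, (hasFDerivAt_partial_fst i F h).fderiv]
  rfl

theorem fderiv_partial_mid {c : ℝ} (h : HasFDerivAt Ψ D (v, z, p)) {g : Z → ℝ}
    (hg : ∀ᶠ z in 𝓝 z, g z = Ψ (v, z, p) - c) (η : Z) : fderiv ℝ g z η = D (0, η, 0) := by
  rw [EventuallyEq.fderiv_eq hg, (hasFDerivAt_partial_mid c h).fderiv]
  rfl

theorem inner_gradient_partial_snd [CompleteSpace P] {c : ℝ} (h : HasFDerivAt Ψ D (v, z, p))
    {g : P → ℝ} (hg : ∀ p, g p = Ψ (v, z, p) - c) (π : P) : ⟪gradient g p, π⟫_ℝ = D (0, 0, π) := by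
  rw [funext hg, gradient, (hasFDerivAt_partial_snd c h).fderiv,
    InnerProductSpace.toDual_symm_apply]
  rfl

/-- The chain rule for an energy driven by time-dependent loads. -/
theorem hasDerivAt_loaded_energy {v : ℝ → V} {z : ℝ → Z} {p : ℝ → P} {F : ℝ → V →L[ℝ] ℝ} {v' : V}
    {z' : Z} {p' : P} {F' : V →L[ℝ] ℝ} {s : ℝ} (h : HasFDerivAt Ψ D (v s, z s, p s))
    (hv : HasDerivAt v v' s) (hz : HasDerivAt z z' s) (hp : HasDerivAt p p' s)
    (hF : HasDerivAt F F' s) :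
    HasDerivAt (fun r => Ψ (v r, z r, p r) - F r (v r))
      (D (v', z', p') - (F' (v s) + F s v')) s :=
  (HasFDerivAt.comp_hasDerivAt s (f := fun r => (v r, z r, p r)) h
    (hv.prodMk (hz.prodMk hp))).fun_sub (hF.clm_apply hv)

theorem deriv_partial_time {w : ℝ → V} {F : ℝ → V →L[ℝ] ℝ} {w' : V} {F' : V →L[ℝ] ℝ} {t : ℝ}
    {u : V} (h : HasFDerivAt Ψ D (u + w t, z, p)) (hw : HasDerivAt w w' t) (hF : HasDerivAt F F' t)
    {g : ℝ → ℝ} (hg : ∀ τ, g τ = Ψ (u + w τ, z, p) - F τ (u + w τ)) :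
    deriv g t = D (w', 0, 0) - (F' (u + w t) + F t w') := by
  rw [funext hg]
  exact (hasDerivAt_loaded_energy (v := fun τ => u + w τ) (z := fun _ => z) (p := fun _ => p) h
    (hw.const_add u) (hasDerivAt_const t z) (hasDerivAt_const t p) hF).deriv

end EnergyCalculus

/-! ### Differentiability of the model energy -/

namespace Data

variable {n : ℕ} {d : Data n}

/-- The derivative of the elasticity tensor. -/
def elastDeriv (d : Data n) : ℝ → (Sym n →L[ℝ] Sym n) := deriv d.elast

theorem Admissible.elastDeriv_taylor (hd : d.Admissible) {α β : ℝ} (hα : 0 < α) :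
    ∃ C : ℝ, 0 ≤ C ∧ ∀ a ∈ Icc α β, ‖d.elast a‖ ≤ C ∧ ‖d.elastDeriv a‖ ≤ C ∧ ∀ b ∈ Icc α β,
      ‖d.elast b - d.elast a‖ ≤ C * |b - a| ∧
      ‖d.elast b - d.elast a - (b - a) • d.elastDeriv a‖ ≤ C * |b - a| ^ 2 :=
  hd.elast_taylor hα

theorem aestronglyMeasurable_elastDeriv (hd : d.Admissible) {z : d.Z} (hz : PosField z) :
    AEStronglyMeasurable (fun x => d.elastDeriv (field z x)) (volume.restrict d.Ω) :=
  aestronglyMeasurable_deriv_elast hd hz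

/-- The elastic energy as a function of the elastic strain and the damage. -/
def elasticEnergy (d : Data n) (y : L2 d.Ω (Sym n) × d.Z) : ℝ :=
  (1 / 2) * ∫ x in d.Ω, ⟪d.elast (field y.2 x) (y.1 x), y.1 x⟫_ℝ

/-- The damage energy. -/
def damageEnergy (d : Data n) (z : d.Z) : ℝ := ∫ x in d.Ω, d.W (field z x)

/-- The stored energy as a function of the total displacement, the damage and the plastic
strain. -/
def storedEnergy (d : Data n) (y : H1 d.Ω × d.Z × d.P) : ℝ :=
  d.elasticEnergy (d.strainL y.1 - d.devInclL y.2.2, y.2.1) +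
  (d.damageEnergy y.2.1 + d.μ / 2 * ‖y.2.2‖ ^ 2) + 1 / 2 * ⟪d.quotL y.2.1, d.quotL y.2.1⟫_ℝ

theorem Admissible.isFiniteMeasure (hd : d.Admissible) : IsFiniteMeasure (volume.restrict d.Ω) :=
  hd.lipschitz.isFiniteMeasure

theorem integrable_W (hd : d.Admissible) {z : d.Z} (hz : PosField z) :
    Integrable (fun x => d.W (field z x)) (volume.restrict d.Ω) := by
  have := hd.isFiniteMeasure
  obtain ⟨α, β, hα, δ, hδ, hI⟩ := PosField.exists_ball hd hz
  obtain ⟨C, hC, hT⟩ := hd.W_taylor (β := β) hα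
  exact Integrable.of_bound (aestronglyMeasurable_W hd hz) C
    ((PosField.ae_mem_Icc hδ hI).mono fun x hx => (hT _ hx).1)

theorem integral_W_add (hd : d.Admissible) {z : d.Z} (hz : PosField z) (p : d.P) :
    ∫ x in d.Ω, (d.W (field z x) + d.μ / 2 * ‖p x‖ ^ 2) =
      (∫ x, d.W (field z x) ∂(volume.restrict d.Ω)) + d.μ / 2 * ‖p‖ ^ 2 := by
  have h1 := (((Lp.memLp p).integrable_norm_pow (p := 2) (by norm_num)).const_mul (d.μ / 2))
  refine (integral_add (integrable_W hd hz) h1).trans ?_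
  rw [integral_const_mul, norm_sq_L2 p]

theorem energyValue_eq (hd : d.Admissible) {z : d.Z} (hz : PosField z) (t : ℝ) (u : d.U)
    (p : d.P) : d.energyValue t u z p =
      d.storedEnergy ((u : H1 d.Ω) + d.w t, z, p) - d.F t ((u : H1 d.Ω) + d.w t) :=
  congrArg (fun c => (1 / 2) * (∫ x in d.Ω, ⟪d.stress t u z p x, d.elasticStrain t u p x⟫_ℝ) + c +
    (1 / 2) * aForm z z - d.F t ((u : H1 d.Ω) + d.w t)) (integral_W_add hd hz p)

theorem energy_toReal_eq (hd : d.Admissible) {z : d.Z} (hz : PosField z) (t : ℝ) (u : d.U)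
    (p : d.P) : (d.energy t (u, z, p)).toReal =
      d.storedEnergy ((u : H1 d.Ω) + d.w t, z, p) - d.F t ((u : H1 d.Ω) + d.w t) := by
  have hz' : d.InDomain (u, z, p) := hz
  have h : (d.energy t (u, z, p)).toReal = d.energyValue t u z p := by
    unfold energy
    rw [if_pos hz']
    rw [EReal.toReal_coe]
  exact h.trans (energyValue_eq hd hz t u p)

/-- `D` is the derivative of the elastic energy, with stress `σ`. -/
def ElasticDerivative (e : L2 d.Ω (Sym n)) (z : d.Z) (σ : L2 d.Ω (Sym n))
    (χ : d.Z →L[ℝ] ℝ) (D : L2 d.Ω (Sym n) × d.Z →L[ℝ] ℝ) : Prop :=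
  (∀ᵐ x ∂(volume.restrict d.Ω), σ x = d.elast (field z x) (e x)) ∧
  (∀ η : d.Z, χ η = ∫ x in d.Ω, 1 / 2 * ⟪d.elastDeriv (field z x) (e x), e x⟫_ℝ * field η x) ∧
  HasFDerivAt d.elasticEnergy D (e, z) ∧ ∀ ε ζ, D (ε, ζ) = ⟪σ, ε⟫_ℝ + χ ζ

/-- `χ` is the derivative of the damage energy. -/
def DamageDerivative (z : d.Z) (χ : d.Z →L[ℝ] ℝ) : Prop :=
  (∀ η : d.Z, χ η = ∫ x in d.Ω, deriv d.W (field z x) * field η x) ∧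
  HasFDerivAt d.damageEnergy χ z

/-- `D` is the derivative of the stored energy, with stress `σ`. -/
def StoredDerivative (v : H1 d.Ω) (z : d.Z) (p : d.P) (σ : L2 d.Ω (Sym n))
    (χ₁ χ₂ : d.Z →L[ℝ] ℝ) (D : H1 d.Ω × d.Z × d.P →L[ℝ] ℝ) : Prop :=
  HasFDerivAt d.storedEnergy D (v, z, p) ∧
  ∀ v' z' p', D (v', z', p') = ⟪σ, d.strainL v' - d.devInclL p'⟫_ℝ + χ₁ z' +
    (χ₂ z' + d.μ * ⟪p, p'⟫_ℝ) + aForm z z'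

set_option maxHeartbeats 1000000 in
theorem exists_elasticDerivative (hd : d.Admissible) (e : L2 d.Ω (Sym n)) {z : d.Z}
    (hz : PosField z) : ∃ σ χ D, ElasticDerivative e z σ χ D := by
  obtain ⟨k, hk, hemb⟩ := hd.exists_field_bound
  obtain ⟨α, β, hα, δ, hδ, hI⟩ := PosField.exists_ball hd hz
  obtain ⟨C₁, hC₁, hT₁⟩ := hd.elastDeriv_taylor (β := β) hα
  have hpos : ∀ ζ : d.Z, ‖ζ‖ < δ → PosField (z + ζ) := fun ζ hζ =>
    ⟨α, hα, (hI ζ hζ).mono fun x hx => hx.1⟩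
  have key := @exists_hasFDerivAt_quadraticEnergy (Vec n) (Sym n) d.Z _ (volume.restrict d.Ω)
    _ _ _ _ d.fieldL k
  simp only [fieldL_apply] at key
  obtain ⟨σ, χ, D, h1, h2, h3, h4⟩ := @key hemb d.elast d.elastDeriv z α β δ C₁ hδ hC₁ hI hT₁
    (fun a ha ξ η => hd.elast_symm a (hα.le.trans ha.1) ξ η)
    (fun ζ hζ => aestronglyMeasurable_elast hd (hpos ζ hζ))
    (aestronglyMeasurable_elastDeriv hd hz) e
  exact ⟨σ, χ, D, h1, h2, h3, h4⟩

theorem exists_damageDerivative (hd : d.Admissible) {z : d.Z} (hz : PosField z) :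
    ∃ χ, DamageDerivative z χ := by
  have := hd.isFiniteMeasure
  obtain ⟨k, hk, hemb⟩ := hd.exists_field_bound
  obtain ⟨α, β, hα, δ, hδ, hI⟩ := PosField.exists_ball hd hz
  obtain ⟨C₂, hC₂, hT₂⟩ := hd.W_taylor (β := β) hα
  have hpos : ∀ ζ : d.Z, ‖ζ‖ < δ → PosField (z + ζ) := fun ζ hζ =>
    ⟨α, hα, (hI ζ hζ).mono fun x hx => hx.1⟩
  have key := @exists_hasFDerivAt_integral (Vec n) d.Z _ (volume.restrict d.Ω) _ _ d.fieldL k _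
  simp only [fieldL_apply] at key
  obtain ⟨χ, h1, h2⟩ := @key hemb d.W (deriv d.W) z α β δ C₂ hδ hC₂ hI hT₂
    (fun ζ hζ => aestronglyMeasurable_W hd (hpos ζ hζ)) (aestronglyMeasurable_deriv_W hd hz)
  exact ⟨χ, h1, h2⟩

set_option maxHeartbeats 1000000 in
/-- The derivative of the stored energy. -/
theorem exists_storedDerivative (v : H1 d.Ω) {z : d.Z} (p : d.P) {σ : L2 d.Ω (Sym n)}
    {χ₁ χ₂ : d.Z →L[ℝ] ℝ} {D₀ : L2 d.Ω (Sym n) × d.Z →L[ℝ] ℝ}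
    (h₁ : ElasticDerivative (d.strainL v - d.devInclL p) z σ χ₁ D₀) (h₂ : DamageDerivative z χ₂) :
    ∃ D, StoredDerivative v z p σ χ₁ χ₂ D := by
  have key := @DamagePlasticity.exists_hasFDerivAt_storedEnergy (H1 d.Ω) d.Z d.P
    (L2 d.Ω (Sym n)) (Lp (Vec n) 2 ((volume.restrict d.Ω).prod (volume.restrict d.Ω)))
    _ _ _ _ _ _ _ _ _ _
  obtain ⟨D, h6, h7⟩ := key (a := d.strainL) (b := d.devInclL) (k := d.quotL) d.μ h₁.2.2.1
    h₁.2.2.2 h₂.2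
  exact ⟨D, h7, h6⟩

/-- The inclusion of the deviatoric matrices and the projection onto them are adjoint to each other;
this is how `σ_D` enters the derivative in `p`. -/
theorem inner_devInclL (σ : L2 d.Ω (Sym n)) (π : d.P) :
    ⟪σ, d.devInclL π⟫_ℝ = ⟪(devPart n).compLp σ, π⟫_ℝ := by
  rw [L2.inner_def, L2.inner_def]
  refine integral_congr_ae ?_
  filter_upwards [(devIncl n).coeFn_compLp π, (devPart n).coeFn_compLp σ] with x h1 h2
  rw [devInclL_apply, h1, h2]
  change ⟪((σ x : Sym n) : Mat n), ((π x : Dev n) : Mat n)⟫_ℝ =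
    ⟪(Dev n).orthogonalProjectionOnto ((σ x : Sym n) : Mat n), π x⟫_ℝ
  exact (Submodule.inner_orthogonalProjectionOnto_eq_of_mem_right (π x)
    ((σ x : Sym n) : Mat n)).symm

section

variable {t : ℝ} {u : d.U} {z : d.Z} {p : d.P} {D : H1 d.Ω × d.Z × d.P →L[ℝ] ℝ}

theorem DuE_apply_of_hasFDerivAt (hd : d.Admissible) (hz : PosField z)
    (h : HasFDerivAt d.storedEnergy D ((u : H1 d.Ω) + d.w t, z, p)) (v : d.U) :
    d.DuE t (u, z, p) v = D ((v : H1 d.Ω), 0, 0) - d.F t (v : H1 d.Ω) := by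
  have key := @fderiv_partial_fst d.U (H1 d.Ω) d.Z d.P _ _ _ _ _ _ _ _
  exact key (H1Dir d.Ω d.Γ).subtypeL (d.F t) h (fun u => energy_toReal_eq hd hz t u p) v

theorem DzE_apply_of_hasFDerivAt (hd : d.Admissible) (hz : PosField z)
    (h : HasFDerivAt d.storedEnergy D ((u : H1 d.Ω) + d.w t, z, p)) (η : d.Z) :
    d.DzE t (u, z, p) η = D (0, η, 0) := by
  have key := @fderiv_partial_mid (H1 d.Ω) d.Z d.P _ _ _ _ _ _
  have e : ∀ᶠ z in 𝓝 z, (d.energy t (u, z, p)).toReal =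
      d.storedEnergy ((u : H1 d.Ω) + d.w t, z, p) - d.F t ((u : H1 d.Ω) + d.w t) := by
    filter_upwards [(isOpen_posField hd).mem_nhds hz] with y hy
    exact energy_toReal_eq hd hy t u p
  exact key h e η

theorem inner_DpE_of_hasFDerivAt (hd : d.Admissible) (hz : PosField z)
    (h : HasFDerivAt d.storedEnergy D ((u : H1 d.Ω) + d.w t, z, p)) (π : d.P) :
    ⟪d.DpE t (u, z, p), π⟫_ℝ = D (0, 0, π) := by
  have key := @inner_gradient_partial_snd (H1 d.Ω) d.Z d.P _ _ _ _ _ _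
  exact key h (fun p => energy_toReal_eq hd hz t u p) π

theorem dtE_of_hasFDerivAt (hd : d.Admissible) (hz : PosField z)
    (h : HasFDerivAt d.storedEnergy D ((u : H1 d.Ω) + d.w t, z, p)) {w' : H1 d.Ω}
    {F' : H1 d.Ω →L[ℝ] ℝ} (hw : HasDerivAt d.w w' t) (hF : HasDerivAt d.F F' t) :
    d.dtE t (u, z, p) = D (w', 0, 0) - (F' ((u : H1 d.Ω) + d.w t) + d.F t w') := by
  have key := @deriv_partial_time (H1 d.Ω) d.Z d.P _ _ _ _ _ _
  exact key h hw hF (fun τ => energy_toReal_eq hd hz τ u p)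

end

end Data

/-! ### Quadratic functionals and equality in the Cauchy-Schwarz inequality -/

section Quadratic

variable {U Y : Type*} [NormedAddCommGroup U] [NormedSpace ℝ U] [NormedAddCommGroup Y]
  [InnerProductSpace ℝ Y]

theorem fderiv_quadratic (s : U →L[ℝ] Y) {T : Y →L[ℝ] Y} (hT : ∀ x y, ⟪T x, y⟫_ℝ = ⟪x, T y⟫_ℝ)
    (c : ℝ) {f : U → ℝ} (hf : ∀ u, f u = c / 2 * ⟪T (s u), s u⟫_ℝ) (u v : U) :
    fderiv ℝ f u v = c * ⟪T (s u), s v⟫_ℝ := by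
  have h : HasFDerivAt (fun u => c / 2 * ⟪T (s u), s u⟫_ℝ) _ u :=
    (((T ∘L s).hasFDerivAt (x := u)).inner ℝ (s.hasFDerivAt (x := u))).const_mul (c / 2)
  rw [funext hf, h.fderiv]
  simp only [smul_apply, ContinuousLinearMap.comp_apply,
    ContinuousLinearMap.prod_apply, fderivInnerCLM_apply, smul_eq_mul]
  rw [hT (s v), real_inner_comm]
  ring

theorem gradient_half_norm_sq [CompleteSpace Y] (c : ℝ) {f : Y → ℝ}
    (hf : ∀ y, f y = c / 2 * ‖y‖ ^ 2) (y : Y) : gradient f y = c • y := by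
  refine ext_inner_right ℝ fun x => ?_
  have h := fderiv_quadratic (ContinuousLinearMap.id ℝ Y) (T := ContinuousLinearMap.id ℝ Y)
    (fun _ _ => rfl) c (f := f) (fun y => by simp [hf]) y x
  rw [gradient, InnerProductSpace.toDual_symm_apply, h, inner_smul_left]
  rfl

/-- Equality in the Cauchy-Schwarz inequality for a semidefinite form. -/
theorem mul_eq_mul_of_sq_le_of_eq {X : Type*} [AddCommGroup X] [Module ℝ X]
    {B : X → X → ℝ} {ℓ : X → ℝ} {c D : ℝ} {x y : X}
    (hB : ∀ s : ℝ, B (x + s • y) (x + s • y) = B x x + 2 * s * B x y + s ^ 2 * B y y)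
    (hℓ : ∀ s : ℝ, ℓ (x + s • y) = ℓ x + s * ℓ y) (hc : 0 ≤ c) (hD : B x x = D ^ 2)
    (hle : ∀ z, ℓ z ^ 2 ≤ c ^ 2 * B z z) (heq : ℓ x = c * D) : c * B x y = D * ℓ y := by
  rcases hc.eq_or_lt with rfl | hc
  · have h : ℓ y ^ 2 ≤ 0 := by simpa using hle y
    have h' : ℓ y = 0 := by nlinarith [sq_nonneg (ℓ y)]
    rw [h']
    ring
  -- The inequality along `x + s y` is an equality at `s = 0`. A nonnegative quadratic polynomial in
  -- `s` without constant term has no linear term.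
  · have key : ∀ s : ℝ, 0 ≤ (c ^ 2 * B y y - ℓ y ^ 2) * (s * s) +
        2 * c * (c * B x y - D * ℓ y) * s + 0 := by
      intro s
      have h := hle (x + s • y)
      rw [hB, hℓ, heq, hD] at h
      nlinarith
    have h := discrim_le_zero key
    rw [discrim] at h
    have h2 : (2 * c * (c * B x y - D * ℓ y)) ^ 2 ≤ 0 := by linarith
    have h3 : 2 * c * (c * B x y - D * ℓ y) = 0 := by
      nlinarith [sq_nonneg (2 * c * (c * B x y - D * ℓ y))]
    rcases mul_eq_zero.1 h3 with h4 | h4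
    · linarith
    · linarith

end Quadratic

/-- A bounded measurable field of operators acts on `L²`. -/
theorem exists_mulOperator {α E : Type*} [MeasurableSpace α] [NormedAddCommGroup E]
    [InnerProductSpace ℝ E] {μ : Measure α} {A : α → (E →L[ℝ] E)} {C : ℝ}
    (hA : AEStronglyMeasurable A μ) (hC : ∀ᵐ x ∂μ, ‖A x‖ ≤ C) :
    ∃ T : Lp E 2 μ →L[ℝ] Lp E 2 μ, ∀ f, T f =ᵐ[μ] fun x => A x (f x) := by
  have hm : ∀ f : Lp E 2 μ, MemLp (fun x => A x (f x)) 2 μ := fun f =>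
    memLp_clm_apply hA hC (Lp.memLp f)
  let L : Lp E 2 μ →ₗ[ℝ] Lp E 2 μ :=
    { toFun := fun f => (hm f).toLp _
      map_add' := fun f g => by
        rw [← MemLp.toLp_add (hm f) (hm g)]
        refine MemLp.toLp_congr _ _ ?_
        filter_upwards [Lp.coeFn_add f g] with x hx
        rw [hx, Pi.add_apply, map_add]
        rfl
      map_smul' := fun c f => by
        rw [RingHom.id_apply, ← MemLp.toLp_const_smul c (hm f)]
        refine MemLp.toLp_congr _ _ ?_
        filter_upwards [Lp.coeFn_smul c f] with x hx
        rw [hx, Pi.smul_apply, map_smul]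
        rfl }
  refine ⟨L.mkContinuous C fun f => ?_, fun f => (hm f).coeFn_toLp⟩
  refine Lp.norm_le_mul_norm_of_ae_le_mul ?_
  filter_upwards [hC, (hm f).coeFn_toLp] with x h1 h2
  change ‖(hm f).toLp _ x‖ ≤ _
  rw [h2]
  exact (A x).le_of_opNorm_le h1 _

/-! ### The support functions of the plastic constraint sets -/

namespace Data

variable {n : ℕ} {d : Data n} {z : ℝ} {π ρ : Dev n}

theorem Admissible.exists_K_bound (hd : d.Admissible) :
    ∃ R : ℝ, 0 < R ∧ ∀ z, 0 ≤ z → ∀ σ ∈ d.K z, ‖σ‖ ≤ R := by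
  obtain ⟨r, R, hr, hrR, h⟩ := hd.K_balls
  refine ⟨R, hr.trans hrR, fun z hz σ hσ => ?_⟩
  have := (h z z hz le_rfl).2.2 hσ
  rw [mem_ball_zero_iff] at this
  exact this.le

theorem Admissible.zero_mem_K (hd : d.Admissible) (hz : 0 ≤ z) : (0 : Dev n) ∈ d.K z := by
  obtain ⟨r, R, hr, hrR, h⟩ := hd.K_balls
  exact (h z z hz le_rfl).1 (Metric.mem_ball_self hr)

theorem inner_le_plastDensity (hd : d.Admissible) (hz : 0 ≤ z) {σ : Dev n} (hσ : σ ∈ d.K z)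
    (π : Dev n) : ⟪σ, π⟫_ℝ ≤ d.plastDensity z π := by
  obtain ⟨R, hR, hb⟩ := hd.exists_K_bound
  refine le_csSup ⟨R * ‖π‖, ?_⟩ (mem_image_of_mem _ hσ)
  rintro _ ⟨τ, hτ, rfl⟩
  exact (real_inner_le_norm _ _).trans (by gcongr; exact hb z hz τ hτ)

theorem plastDensity_le (hd : d.Admissible) (hz : 0 ≤ z) {c : ℝ}
    (h : ∀ σ ∈ d.K z, ⟪σ, π⟫_ℝ ≤ c) : d.plastDensity z π ≤ c := by
  refine csSup_le ⟨_, mem_image_of_mem _ (hd.zero_mem_K hz)⟩ ?_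
  rintro _ ⟨τ, hτ, rfl⟩
  exact h τ hτ

theorem plastDensity_nonneg (hd : d.Admissible) (hz : 0 ≤ z) (π : Dev n) :
    0 ≤ d.plastDensity z π := by
  simpa using inner_le_plastDensity hd hz (hd.zero_mem_K hz) π

theorem plastDensity_zero (hd : d.Admissible) (hz : 0 ≤ z) : d.plastDensity z 0 = 0 :=
  le_antisymm (plastDensity_le hd hz fun σ _ => by simp) (plastDensity_nonneg hd hz 0)

theorem plastDensity_smul_le (hd : d.Admissible) (hz : 0 ≤ z) {c : ℝ} (hc : 0 ≤ c) (π : Dev n) :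
    d.plastDensity z (c • π) ≤ c * d.plastDensity z π := by
  refine plastDensity_le hd hz fun σ hσ => ?_
  refine (real_inner_smul_right σ π c).le.trans ?_
  exact mul_le_mul_of_nonneg_left (inner_le_plastDensity hd hz hσ π) hc

theorem plastDensity_smul (hd : d.Admissible) (hz : 0 ≤ z) {c : ℝ} (hc : 0 ≤ c) (π : Dev n) :
    d.plastDensity z (c • π) = c * d.plastDensity z π := by
  refine le_antisymm (plastDensity_smul_le hd hz hc π) ?_
  rcases hc.eq_or_lt with rfl | hc'
  · simp [plastDensity_zero hd hz]
  · have h := plastDensity_smul_le hd hz (inv_nonneg.2 hc) (c • π)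
    rw [smul_smul, inv_mul_cancel₀ hc'.ne', one_smul, ← div_eq_inv_mul, le_div_iff₀ hc'] at h
    linarith

theorem abs_plastDensity_sub_le {R : ℝ} (hd : d.Admissible)
    (hb : ∀ z, 0 ≤ z → ∀ σ ∈ d.K z, ‖σ‖ ≤ R) (hz : 0 ≤ z) (π ρ : Dev n) :
    |d.plastDensity z π - d.plastDensity z ρ| ≤ R * ‖π - ρ‖ := by
  have key : ∀ π ρ : Dev n, d.plastDensity z π ≤ d.plastDensity z ρ + R * ‖π - ρ‖ := by
    intro π ρ
    refine plastDensity_le hd hz fun σ hσ => ?_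
    have h1 : ⟪σ, π⟫_ℝ = ⟪σ, ρ⟫_ℝ + ⟪σ, π - ρ⟫_ℝ := by rw [inner_sub_right]; ring
    have h2 := inner_le_plastDensity hd hz hσ ρ
    have h3 : ⟪σ, π - ρ⟫_ℝ ≤ R * ‖π - ρ‖ :=
      (real_inner_le_norm _ _).trans (by gcongr; exact hb z hz σ hσ)
    linarith
  have h1 := key π ρ
  have h2 := key ρ π
  rw [norm_sub_rev] at h2
  rw [abs_le]
  constructor <;> linarith

/-- Every `σ ∈ K(z₁)` has a companion `τ ∈ K(z₂)` at nearly the Hausdorff distance, and the two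
pairings with `π` differ by at most that distance times `‖π‖`. -/
theorem exists_abs_plastDensity_sub_le (hd : d.Admissible) :
    ∃ C : ℝ, 0 < C ∧ ∀ z₁ z₂, 0 ≤ z₁ → 0 ≤ z₂ → ∀ π : Dev n,
      |d.plastDensity z₁ π - d.plastDensity z₂ π| ≤ C * |z₁ - z₂| * ‖π‖ := by
  obtain ⟨R, hR, hb⟩ := hd.exists_K_bound
  obtain ⟨C, hC, hL⟩ := hd.K_lipschitz
  have hbd : ∀ z, 0 ≤ z → Bornology.IsBounded (d.K z) := fun z hz =>
    (Metric.isBounded_closedBall (x := (0 : Dev n)) (r := R)).subset fun σ hσ => by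
      simpa using hb z hz σ hσ
  have key : ∀ z₁ z₂, 0 ≤ z₁ → 0 ≤ z₂ → ∀ π : Dev n,
      d.plastDensity z₁ π ≤ d.plastDensity z₂ π + C * |z₁ - z₂| * ‖π‖ := by
    intro z₁ z₂ h₁ h₂ π
    refine plastDensity_le hd h₁ fun σ hσ => ?_
    refine le_of_forall_pos_le_add fun ε hε => ?_
    -- The slack is needed because companions exist only at distances above the Hausdorff distance;
    -- it costs at most `ε` after multiplication by `‖π‖`.
    have hε' : 0 < ε / (‖π‖ + 1) := by positivity
    obtain ⟨τ, hτ, hdist⟩ := Metric.exists_dist_lt_of_hausdorffDist_lt hσ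
      ((hL z₁ z₂ h₁ h₂).trans_lt (lt_add_of_pos_right _ hε'))
      (Metric.hausdorffEDist_ne_top_of_nonempty_of_bounded ⟨_, hd.zero_mem_K h₁⟩
        ⟨_, hd.zero_mem_K h₂⟩ (hbd _ h₁) (hbd _ h₂))
    have h3 := inner_le_plastDensity hd h₂ hτ π
    have h4 : ⟪σ, π⟫_ℝ = ⟪τ, π⟫_ℝ + ⟪σ - τ, π⟫_ℝ := by rw [inner_sub_left]; ring
    have h5 : ⟪σ - τ, π⟫_ℝ ≤ (C * |z₁ - z₂| + ε / (‖π‖ + 1)) * ‖π‖ :=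
      (real_inner_le_norm _ _).trans (by
        gcongr
        rw [← dist_eq_norm]
        exact hdist.le)
    have h6 : ε / (‖π‖ + 1) * ‖π‖ ≤ ε := by
      rw [div_mul_eq_mul_div, div_le_iff₀ (by positivity)]
      nlinarith [norm_nonneg π]
    nlinarith
  refine ⟨C, hC, fun z₁ z₂ h₁ h₂ π => ?_⟩
  have k1 := key z₁ z₂ h₁ h₂ π
  have k2 := key z₂ z₁ h₂ h₁ π
  rw [abs_sub_comm] at k2
  rw [abs_le]
  constructor <;> linarith

/-- The sets are controlled only for `z ≥ 0`; truncating the parameter at `0` gives a function that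
is jointly continuous on the whole space. -/
theorem continuous_plastDensity (hd : d.Admissible) :
    Continuous fun x : ℝ × Dev n => d.plastDensity (max x.1 0) x.2 := by
  obtain ⟨R, hR, hb⟩ := hd.exists_K_bound
  obtain ⟨C, hC, hL⟩ := exists_abs_plastDensity_sub_le hd
  refine continuous_prod_of_continuous_lipschitzWith' _ ⟨R, hR.le⟩ (fun z => ?_) fun π => ?_
  · refine LipschitzWith.of_dist_le_mul fun π ρ => ?_
    rw [Real.dist_eq, dist_eq_norm]
    exact abs_plastDensity_sub_le hd hb (le_max_right _ _) π ρ
  · have h : LipschitzWith ⟨C * ‖π‖, by positivity⟩ fun s : ℝ => d.plastDensity (max s 0) π := by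
      refine LipschitzWith.of_dist_le_mul fun s t => ?_
      rw [Real.dist_eq, Real.dist_eq]
      refine (hL _ _ (le_max_right _ _) (le_max_right _ _) π).trans ?_
      have h1 : |max s 0 - max t 0| ≤ |s - t| := abs_max_sub_max_le_abs _ _ _
      change _ ≤ C * ‖π‖ * |s - t|
      nlinarith [mul_nonneg hC.le (norm_nonneg π)]
    exact h.continuous

end Data

/-- A family of support functions `h z` on `E`, depending continuously on the parameter
`z ∈ [0, ∞)`. -/
structure IsSupportFamily {E : Type*} [NormedAddCommGroup E] [InnerProductSpace ℝ E]
    (h : ℝ → E → ℝ) (R C : ℝ) : Prop where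
  R_nonneg : 0 ≤ R
  C_nonneg : 0 ≤ C
  cont : Continuous fun x : ℝ × E => h (max x.1 0) x.2
  zero : ∀ z, 0 ≤ z → h z 0 = 0
  nonneg : ∀ z, 0 ≤ z → ∀ π, 0 ≤ h z π
  smul : ∀ z, 0 ≤ z → ∀ c, 0 ≤ c → ∀ π, h z (c • π) = c * h z π
  lip : ∀ z, 0 ≤ z → ∀ π ρ, |h z π - h z ρ| ≤ R * ‖π - ρ‖
  lip_param : ∀ z₁ z₂, 0 ≤ z₁ → 0 ≤ z₂ → ∀ π, |h z₁ π - h z₂ π| ≤ C * |z₁ - z₂| * ‖π‖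

namespace IsSupportFamily

variable {Ω E : Type*} [MeasurableSpace Ω] {μ : Measure Ω} [NormedAddCommGroup E]
  [InnerProductSpace ℝ E] {h : ℝ → E → ℝ} {R C : ℝ}

theorem abs_le (hh : IsSupportFamily h R C) {z : ℝ} (hz : 0 ≤ z) (π : E) : |h z π| ≤ R * ‖π‖ := by
  simpa [hh.zero z hz] using hh.lip z hz π 0

theorem continuous (hh : IsSupportFamily h R C) {z : ℝ} (hz : 0 ≤ z) : Continuous (h z) := by
  have := hh.cont.comp (Continuous.prodMk_right z)
  simpa only [Function.comp_def, max_eq_left hz] using this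

theorem aestronglyMeasurable (hh : IsSupportFamily h R C) {f : Ω → ℝ} {π : Ω → E}
    (hf : AEStronglyMeasurable f μ)
    (hf0 : ∀ᵐ x ∂μ, 0 ≤ f x) (hπ : AEStronglyMeasurable π μ) :
    AEStronglyMeasurable (fun x => h (f x) (π x)) μ := by
  refine (hh.cont.comp_aestronglyMeasurable (hf.prodMk hπ)).congr ?_
  filter_upwards [hf0] with x hx
  simp only [max_eq_left hx]

theorem integrable (hh : IsSupportFamily h R C) [IsFiniteMeasure μ] {f : Ω → ℝ}
    {π : Ω → E} (hf : AEStronglyMeasurable f μ)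
    (hf0 : ∀ᵐ x ∂μ, 0 ≤ f x) (hπ : MemLp π 2 μ) : Integrable (fun x => h (f x) (π x)) μ := by
  refine (((hπ.integrable (by norm_num)).norm).const_mul R).mono'
    (hh.aestronglyMeasurable hf hf0 hπ.aestronglyMeasurable) ?_
  filter_upwards [hf0] with x hx
  exact hh.abs_le hx _

theorem integral_nonneg (hh : IsSupportFamily h R C) {f : Ω → ℝ} {π : Ω → E}
    (hf0 : ∀ᵐ x ∂μ, 0 ≤ f x) :
    0 ≤ ∫ x, h (f x) (π x) ∂μ :=
  MeasureTheory.integral_nonneg_of_ae (hf0.mono fun _ hx => hh.nonneg _ hx _)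

theorem integral_zero (hh : IsSupportFamily h R C) {f : Ω → ℝ} (hf0 : ∀ᵐ x ∂μ, 0 ≤ f x) :
    ∫ x, h (f x) ((0 : Lp E 2 μ) x) ∂μ = 0 := by
  refine integral_eq_zero_of_ae ?_
  filter_upwards [hf0, Lp.coeFn_zero E 2 μ] with x hx h0
  rw [h0, Pi.zero_apply, hh.zero _ hx, Pi.zero_apply]

theorem integral_smul (hh : IsSupportFamily h R C) {f : Ω → ℝ} (hf0 : ∀ᵐ x ∂μ, 0 ≤ f x)
    {c : ℝ} (hc : 0 ≤ c) (π : Lp E 2 μ) :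
    ∫ x, h (f x) ((c • π) x) ∂μ = c * ∫ x, h (f x) (π x) ∂μ := by
  rw [← integral_const_mul]
  refine integral_congr_ae ?_
  filter_upwards [hf0, Lp.coeFn_smul c π] with x hx h0
  rw [h0, Pi.smul_apply, hh.smul _ hx c hc]

theorem abs_integral_sub_le (hh : IsSupportFamily h R C) [IsFiniteMeasure μ] {f : Ω → ℝ}
    (hf : AEStronglyMeasurable f μ)
    (hf0 : ∀ᵐ x ∂μ, 0 ≤ f x) (π ρ : Lp E 2 μ) :
    |∫ x, h (f x) (π x) ∂μ - ∫ x, h (f x) (ρ x) ∂μ| ≤ R * √(μ.real univ) * ‖π - ρ‖ := by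
  rw [← MeasureTheory.integral_sub (hh.integrable hf hf0 (Lp.memLp π))
    (hh.integrable hf hf0 (Lp.memLp ρ))]
  have h1 : Integrable (fun x => R * ‖(π - ρ) x‖) μ :=
    (((Lp.memLp (π - ρ)).integrable (by norm_num)).norm).const_mul R
  refine (Real.norm_eq_abs _).symm.le.trans ((norm_integral_le_of_norm_le h1 ?_).trans ?_)
  · filter_upwards [hf0, Lp.coeFn_sub π ρ] with x hx h0
    rw [h0, Pi.sub_apply]
    exact hh.lip _ hx _ _
  · rw [integral_const_mul, mul_assoc]
    refine mul_le_mul_of_nonneg_left ?_ hh.R_nonneg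
    exact (integral_norm_le_sqrt_measure (Lp.memLp (π - ρ))).trans (le_of_eq (by
      rw [Lp.norm_def, mul_comm]))

/-- Lipschitz in `π` uniformly in the field, and for fixed `π` Lipschitz in the field with constant
`C ‖π‖`. The result serves the measurability of the plastic dissipation along curves. -/
theorem continuous_integral (hh : IsSupportFamily h R C) [IsFiniteMeasure μ] :
    Continuous fun y : Lp ℝ 2 μ × Lp E 2 μ => ∫ x, h (max (y.1 x) 0) (y.2 x) ∂μ := by
  have hm : ∀ f : Lp ℝ 2 μ, AEStronglyMeasurable (fun x => max (f x) 0) μ := fun f =>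
    (Lp.aestronglyMeasurable f).sup aestronglyMeasurable_const
  have hp : ∀ f : Lp ℝ 2 μ, ∀ᵐ x ∂μ, 0 ≤ max (f x) 0 :=
    fun f => ae_of_all _ fun _ => le_max_right _ _
  have hR := hh.R_nonneg
  have hC := hh.C_nonneg
  refine continuous_prod_of_continuous_lipschitzWith' _ ⟨R * √(μ.real univ), by positivity⟩
    (fun f => ?_) fun π => ?_
  · refine LipschitzWith.of_dist_le_mul fun π ρ => ?_
    rw [Real.dist_eq, dist_eq_norm]
    exact hh.abs_integral_sub_le (hm f) (hp f) π ρ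
  · have hL : LipschitzWith ⟨C * ‖π‖, by positivity⟩
        fun f : Lp ℝ 2 μ => ∫ x, h (max (f x) 0) (π x) ∂μ := by
      refine LipschitzWith.of_dist_le_mul fun f g => ?_
      rw [Real.dist_eq, dist_eq_norm]
      rw [← MeasureTheory.integral_sub (hh.integrable (hm f) (hp f) (Lp.memLp π))
        (hh.integrable (hm g) (hp g) (Lp.memLp π))]
      have h1 : Integrable (fun x => C * (‖(f - g) x‖ * ‖π x‖)) μ :=
        ((Lp.memLp (f - g)).norm.integrable_mul (Lp.memLp π).norm).const_mul C
      refine (Real.norm_eq_abs _).symm.le.trans ((norm_integral_le_of_norm_le h1 ?_).trans ?_)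
      · filter_upwards [Lp.coeFn_sub f g] with x h0
        rw [h0, Pi.sub_apply, ← mul_assoc]
        refine (hh.lip_param _ _ (le_max_right _ _) (le_max_right _ _) _).trans ?_
        gcongr
        exact abs_max_sub_max_le_abs _ _ _
      · rw [integral_const_mul]
        change _ ≤ C * ‖π‖ * ‖f - g‖
        rw [mul_assoc, mul_comm ‖π‖]
        exact mul_le_mul_of_nonneg_left (integral_norm_mul_norm_le _ _) hC
    exact hL.continuous

/-- The subdifferential of an integral functional consists of the square-integrable selections of
the subdifferentials of the integrand. -/
theorem forall_inner_le_integral_iff (hh : IsSupportFamily h R C) [IsFiniteMeasure μ]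
    [TopologicalSpace.SeparableSpace E] {f : Ω → ℝ}
    (hf : AEStronglyMeasurable f μ) (hf0 : ∀ᵐ x ∂μ, 0 ≤ f x) (om π : Lp E 2 μ) :
    (∀ ρ : Lp E 2 μ, ⟪om, ρ - π⟫_ℝ ≤ ∫ x, h (f x) (ρ x) ∂μ - ∫ x, h (f x) (π x) ∂μ) ↔
      ∀ᵐ x ∂μ, ∀ v : E, ⟪om x, v - π x⟫_ℝ ≤ h (f x) v - h (f x) (π x) := by
  have hint : ∀ ρ : Lp E 2 μ, Integrable (fun x => h (f x) (ρ x)) μ := fun ρ =>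
    hh.integrable hf hf0 (Lp.memLp ρ)
  constructor
  · intro H
    have key : ∀ v : E, ∀ᵐ x ∂μ, 0 ≤ h (f x) v - h (f x) (π x) - ⟪om x, v - π x⟫_ℝ := by
      intro v
      have i1 : Integrable (fun x => h (f x) v) μ := hh.integrable hf hf0 (memLp_const v)
      have i2 : Integrable (fun x => h (f x) v - h (f x) (π x)) μ := i1.sub (hint π)
      have i3 : Integrable (fun x => ⟪om x, v - π x⟫_ℝ) μ :=
        integrable_inner_of_memLp (Lp.memLp om) ((memLp_const v).sub (Lp.memLp π))
      have i4 : Integrable (fun x => h (f x) v - h (f x) (π x) - ⟪om x, v - π x⟫_ℝ) μ := i2.sub i3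
      refine ae_nonneg_of_forall_setIntegral_nonneg i4 fun A hA _ => ?_
      -- The competitor `π + 1_A (v - π)` equals `v` on `A` and `π` elsewhere, so the integral
      -- inequality reduces to one over `A`.
      have hmem : MemLp (fun x => A.indicator (fun x => v - π x) x) 2 μ :=
        ((memLp_const v).sub (Lp.memLp π)).indicator hA
      have hH := H (π + hmem.toLp _)
      rw [add_sub_cancel_left, ← integral_sub (hint _) (hint π), L2.inner_def] at hH
      rw [← integral_indicator hA]
      have e1 : ∫ x, ⟪om x, hmem.toLp _ x⟫_ℝ ∂μ =
          ∫ x, A.indicator (fun x => ⟪om x, v - π x⟫_ℝ) x ∂μ := by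
        refine integral_congr_ae ?_
        filter_upwards [hmem.coeFn_toLp] with x hx
        rw [hx]
        by_cases hxA : x ∈ A <;> simp [hxA]
      have e2 : ∫ x, (h (f x) ((π + hmem.toLp _ : Lp E 2 μ) x) - h (f x) (π x)) ∂μ =
          ∫ x, A.indicator (fun x => h (f x) v - h (f x) (π x)) x ∂μ := by
        refine integral_congr_ae ?_
        filter_upwards [hmem.coeFn_toLp, Lp.coeFn_add π (hmem.toLp _)] with x hx hx'
        rw [hx', Pi.add_apply, hx]
        by_cases hxA : x ∈ A <;> simp [hxA]
      rw [e1, e2] at hH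
      have e3 : ∫ x, A.indicator
          (fun x => h (f x) v - h (f x) (π x) - ⟪om x, v - π x⟫_ℝ) x ∂μ =
          ∫ x, A.indicator (fun x => h (f x) v - h (f x) (π x)) x ∂μ -
            ∫ x, A.indicator (fun x => ⟪om x, v - π x⟫_ℝ) x ∂μ := by
        rw [← integral_sub (i2.indicator hA) (i3.indicator hA)]
        refine integral_congr_ae (ae_of_all _ fun x => ?_)
        by_cases hxA : x ∈ A <;> simp [hxA]
      rw [e3]
      linarith
    -- The exceptional null set depends on `v`. A countable dense set of vectors leaves a single
    -- null set, and continuity of the integrand recovers all `v`.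
    obtain ⟨D, hDc, hDd⟩ := TopologicalSpace.exists_countable_dense E
    have key' : ∀ᵐ x ∂μ, ∀ v ∈ D, 0 ≤ h (f x) v - h (f x) (π x) - ⟪om x, v - π x⟫_ℝ :=
      (ae_ball_iff hDc).2 fun v _ => key v
    filter_upwards [key', hf0] with x hx hx0 v
    have hcl : IsClosed {v : E | 0 ≤ h (f x) v - h (f x) (π x) - ⟪om x, v - π x⟫_ℝ} := by
      refine isClosed_le continuous_const ?_
      have := hh.continuous hx0
      fun_prop
    have hv := (hcl.closure_subset_iff.2 hx) (hDd v)
    have hv' : 0 ≤ h (f x) v - h (f x) (π x) - ⟪om x, v - π x⟫_ℝ := hv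
    linarith
  · intro H ρ
    rw [← integral_sub (hint ρ) (hint π), L2.inner_def]
    refine integral_mono_ae ?_ ((hint ρ).sub (hint π)) ?_
    · exact L2.integrable_inner om (ρ - π)
    · filter_upwards [H, Lp.coeFn_sub ρ π] with x hx hx'
      rw [hx', Pi.sub_apply]
      exact hx _

end IsSupportFamily

/-- The projection onto a closed convex set: a distance attained as a minimum is what splits a
derivative into a subgradient and a residual. -/
theorem exists_infEDist_eq {H : Type*} [NormedAddCommGroup H] [InnerProductSpace ℝ H]
    [CompleteSpace H] {K : Set H} (hne : K.Nonempty) (hcl : IsClosed K) (hconv : Convex ℝ K)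
    (x : H) : ∃ y ∈ K, Metric.infEDist x K = ENNReal.ofReal ‖x - y‖ ∧
      ∀ w ∈ K, ‖x - y‖ ≤ ‖x - w‖ := by
  obtain ⟨y, hy, h⟩ := exists_norm_eq_iInf_of_complete_convex hne hcl.isComplete hconv x
  have hle : ∀ w ∈ K, ‖x - y‖ ≤ ‖x - w‖ := fun w hw => by
    rw [h]
    exact ciInf_le ⟨0, by rintro _ ⟨v, rfl⟩; exact norm_nonneg _⟩ (⟨w, hw⟩ : K)
  refine ⟨y, hy, le_antisymm ?_ ?_, hle⟩
  · refine (Metric.infEDist_le_edist_of_mem hy).trans (le_of_eq ?_)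
    rw [edist_dist, dist_eq_norm]
  · refine Metric.le_infEDist.2 fun w hw => ?_
    rw [edist_dist, dist_eq_norm]
    exact ENNReal.ofReal_le_ofReal (hle w hw)

/-- A rate-independent system with viscous corrections: the viscosity parameter `ν`, the quadratic
form `b`, the embedding `ι`, and the positively one-homogeneous dissipation potentials `R`, `H`. -/
structure RateSystem (U Z L P : Type*) [NormedAddCommGroup U] [NormedSpace ℝ U]
    [NormedAddCommGroup Z] [NormedSpace ℝ Z] [NormedAddCommGroup L] [InnerProductSpace ℝ L]
    [NormedAddCommGroup P] [InnerProductSpace ℝ P] where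
  ν : ℝ
  b : U →ₗ[ℝ] U →ₗ[ℝ] ℝ
  ι : Z →L[ℝ] L
  R : Z → ℝ≥0∞
  H : P → ℝ
  ν_pos : 0 < ν
  b_symm : ∀ u v, b u v = b v u
  b_nonneg : ∀ u, 0 ≤ b u u
  R_smul : ∀ c : ℝ, 0 < c → ∀ ζ, R (c • ζ) = ENNReal.ofReal c * R ζ
  R_of_ι : ∀ ζ, ι ζ = 0 → R ζ = 0
  H_nonneg : ∀ π, 0 ≤ H π
  H_smul : ∀ c : ℝ, 0 ≤ c → ∀ π, H (c • π) = c * H π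

/-! ### Slope, contact potential and inclusions for an abstract rate system -/

namespace RateSystem

variable {U Z L P : Type*} [NormedAddCommGroup U] [NormedSpace ℝ U]
    [NormedAddCommGroup Z] [NormedSpace ℝ Z] [NormedAddCommGroup L] [InnerProductSpace ℝ L]
    [NormedAddCommGroup P] [InnerProductSpace ℝ P] (r : RateSystem U Z L P)

def subR (ζ : Z) : Set (Z →L[ℝ] ℝ) :=
  {χ | ∀ η : Z, ((r.R ζ : ℝ≥0∞) : EReal) + ((χ (η - ζ) : ℝ) : EReal) ≤ (r.R η : EReal)}

def subH (π : P) : Set P := {om | ∀ ρ : P, ⟪om, ρ - π⟫_ℝ ≤ r.H ρ - r.H π}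

def dualNorm (η : U →L[ℝ] ℝ) : ℝ≥0∞ :=
  ⨆ (v : U) (_ : r.b v v ≤ 1), ENNReal.ofReal (η v)

def distR (χ : Z →L[ℝ] ℝ) : ℝ≥0∞ :=
  ⨅ (γ ∈ r.subR 0) (h : L) (_ : ∀ η : Z, χ η - γ η = ⟪h, r.ι η⟫_ℝ), ‖h‖ₑ

/-- `A`, `B` and `G` play the roles of `D_u 𝓔`, `D_z 𝓔` and `D_p 𝓔` at the current state. -/
def slope (A : U →L[ℝ] ℝ) (B : Z →L[ℝ] ℝ) (G : P) : ℝ≥0∞ :=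
  (ENNReal.ofReal r.ν⁻¹ * r.dualNorm (-A) ^ 2 + r.distR (-B) ^ 2
    + ENNReal.ofReal r.ν⁻¹ * Metric.infEDist (-G) (r.subH 0) ^ 2) ^ (1 / 2 : ℝ)

def rate (u : U) (ζ : Z) (π : P) : ℝ :=
  Real.sqrt (r.ν * r.b u u + ‖r.ι ζ‖ ^ 2 + r.ν * ‖π‖ ^ 2)

open Classical in
def contact (A : U →L[ℝ] ℝ) (B : Z →L[ℝ] ℝ) (G : P) (t' : ℝ) (u : U) (ζ : Z) (π : P) : ℝ≥0∞ :=
  r.R ζ + ENNReal.ofReal (r.H π) +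
    if 0 < t' then
      if -A = 0 ∧ -B ∈ r.subR 0 ∧ -G ∈ r.subH 0 then 0 else ⊤
    else
      if r.slope A B G = ⊤ then ⊤ else ENNReal.ofReal (r.rate u ζ π) * r.slope A B G

def Inclusions (l : ℝ) (A : U →L[ℝ] ℝ) (B : Z →L[ℝ] ℝ) (G : P) (u : U) (ζ : Z) (π : P) : Prop :=
  (∀ v, l * (r.ν * r.b u v) + (1 - l) * A v = 0) ∧
  (∃ χ ∈ r.subR ζ, ∀ η, (1 - l) * χ η + l * ⟪r.ι ζ, r.ι η⟫_ℝ + (1 - l) * B η = 0) ∧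
  ∃ om ∈ r.subH π, (1 - l) • om + (l * r.ν) • π + (1 - l) • G = 0

/-! ### Subdifferentials of the one-homogeneous potentials -/

theorem R_zero : r.R 0 = 0 := r.R_of_ι 0 (map_zero _)

theorem H_zero : r.H 0 = 0 := by
  have h := r.H_smul 0 le_rfl 0
  rwa [zero_smul, zero_mul] at h

theorem mem_subH_zero_iff {om : P} : om ∈ r.subH 0 ↔ ∀ ρ : P, ⟪om, ρ⟫_ℝ ≤ r.H ρ := by
  change (∀ ρ : P, ⟪om, ρ - 0⟫_ℝ ≤ r.H ρ - r.H 0) ↔ _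
  simp only [sub_zero, H_zero]

/-- By one-homogeneity, the tests `ρ = 0` and `ρ = 2 π` force `H π = ⟪om, π⟫`; what remains of the
subgradient inequality is the one at zero. -/
theorem mem_subH_iff {om π : P} :
    om ∈ r.subH π ↔ om ∈ r.subH 0 ∧ r.H π = ⟪om, π⟫_ℝ := by
  rw [mem_subH_zero_iff]
  change (∀ ρ : P, ⟪om, ρ - π⟫_ℝ ≤ r.H ρ - r.H π) ↔ _
  constructor
  · intro h
    have h1 := h 0
    have h2 := h ((2 : ℝ) • π)
    rw [r.H_smul _ zero_le_two, two_smul, add_sub_cancel_right] at h2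
    rw [zero_sub, inner_neg_right, r.H_zero] at h1
    have h3 : r.H π = ⟪om, π⟫_ℝ := by linarith
    refine ⟨fun ρ => ?_, h3⟩
    have h4 := h ρ
    rw [inner_sub_right] at h4
    linarith
  · rintro ⟨h, h3⟩ ρ
    rw [inner_sub_right]
    linarith [h ρ]

theorem zero_mem_subH : (0 : P) ∈ r.subH 0 := by
  rw [mem_subH_zero_iff]
  intro ρ
  rw [inner_zero_left]
  exact r.H_nonneg ρ

theorem exists_infEDist_subH_eq [CompleteSpace P] (x : P) :
    ∃ om ∈ r.subH 0, Metric.infEDist x (r.subH 0) = ENNReal.ofReal ‖x - om‖ := by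
  have h0 : r.subH 0 = {om : P | ∀ ρ : P, ⟪om, ρ⟫_ℝ ≤ r.H ρ} :=
    Set.ext fun om => r.mem_subH_zero_iff
  have hcl : IsClosed (r.subH 0) := by
    rw [h0, Set.ofPred_forall]
    exact isClosed_iInter fun ρ => isClosed_le (continuous_id.inner continuous_const)
      continuous_const
  have hconv : Convex ℝ (r.subH 0) := by
    rw [h0]
    intro a ha b hb s t hs ht hst ρ
    have h1 := mul_le_mul_of_nonneg_left (ha ρ) hs
    have h2 := mul_le_mul_of_nonneg_left (hb ρ) ht
    rw [inner_add_left, real_inner_smul_left, real_inner_smul_left]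
    calc s * ⟪a, ρ⟫_ℝ + t * ⟪b, ρ⟫_ℝ ≤ s * r.H ρ + t * r.H ρ := add_le_add h1 h2
      _ = r.H ρ := by rw [← add_mul, hst, one_mul]
  obtain ⟨y, hy, h, -⟩ := exists_infEDist_eq ⟨0, r.zero_mem_subH⟩ hcl hconv x
  exact ⟨y, hy, h⟩

theorem mem_subR_zero_iff {χ : Z →L[ℝ] ℝ} :
    χ ∈ r.subR 0 ↔ ∀ η : Z, r.R η ≠ ⊤ → χ η ≤ (r.R η).toReal := by
  refine forall_congr' fun η => ?_
  rw [R_zero, sub_zero, EReal.coe_ennreal_zero, zero_add]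
  by_cases h : r.R η = ⊤
  · simp [h]
  · lift r.R η to ℝ≥0 using h with x
    simp only [ne_eq, ENNReal.coe_ne_top, not_false_eq_true, ENNReal.coe_toReal, forall_const]
    exact EReal.coe_le_coe_iff

theorem add_le_aux {x y : ℝ≥0∞} (c : ℝ) (h : x ≠ ⊤) :
    (x : EReal) + (c : EReal) ≤ (y : EReal) ↔ (y ≠ ⊤ → x.toReal + c ≤ y.toReal) := by
  by_cases h' : y = ⊤
  · simp [h']
  · lift x to ℝ≥0 using h
    lift y to ℝ≥0 using h'
    simp only [ne_eq, ENNReal.coe_ne_top, not_false_eq_true, ENNReal.coe_toReal, forall_const]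
    exact EReal.coe_le_coe_iff (x := (x : ℝ) + c)

/-- The same homogeneity argument with extended values. The potential is finite at `ζ` because the
inequality is tested against `R 0 = 0`. -/
theorem mem_subR_iff {χ : Z →L[ℝ] ℝ} {ζ : Z} :
    χ ∈ r.subR ζ ↔ χ ∈ r.subR 0 ∧ r.R ζ ≠ ⊤ ∧ (r.R ζ).toReal = χ ζ := by
  rw [mem_subR_zero_iff]
  constructor
  · intro h
    have hfin : r.R ζ ≠ ⊤ := by
      intro htop
      have h0 := h 0
      rw [htop, R_zero] at h0
      simp at h0
    have h1 : ∀ η : Z, r.R η ≠ ⊤ → (r.R ζ).toReal + χ (η - ζ) ≤ (r.R η).toReal := fun η =>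
      (add_le_aux _ hfin).1 (h η)
    have h2 := h1 0 (by rw [R_zero]; exact ENNReal.zero_ne_top)
    have h3 : r.R ((2 : ℝ) • ζ) = ENNReal.ofReal 2 * r.R ζ := r.R_smul 2 two_pos ζ
    have h4 := h1 ((2 : ℝ) • ζ) (by
      rw [h3]
      exact ENNReal.mul_ne_top ENNReal.ofReal_ne_top hfin)
    rw [h3, ENNReal.toReal_mul, ENNReal.toReal_ofReal two_pos.le, two_smul,
      add_sub_cancel_right] at h4
    rw [R_zero, zero_sub, map_neg, ENNReal.toReal_zero] at h2
    have h5 : (r.R ζ).toReal = χ ζ := by linarith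
    refine ⟨fun η hη => ?_, hfin, h5⟩
    have h6 := h1 η hη
    rw [map_sub] at h6
    linarith
  · rintro ⟨h1, hfin, h5⟩ η
    refine (add_le_aux _ hfin).2 fun hη => ?_
    rw [map_sub, h5]
    linarith [h1 η hη]

/-- The potential vanishes at `ζ` and at `-ζ`, so the subgradient is bounded by zero from both
sides. -/
theorem apply_eq_zero_of_mem_subR {χ : Z →L[ℝ] ℝ} (h : χ ∈ r.subR 0) {ζ : Z} (hζ : r.ι ζ = 0) :
    χ ζ = 0 := by
  rw [mem_subR_zero_iff] at h
  have h0 := r.R_of_ι ζ hζ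
  have h0' := r.R_of_ι (-ζ) (by rw [map_neg, hζ, neg_zero])
  have h1 := h ζ (by rw [h0]; exact ENNReal.zero_ne_top)
  have h2 := h (-ζ) (by rw [h0']; exact ENNReal.zero_ne_top)
  rw [h0, ENNReal.toReal_zero] at h1
  rw [h0', ENNReal.toReal_zero, map_neg] at h2
  linarith

theorem distR_le {χ γ : Z →L[ℝ] ℝ} (hγ : γ ∈ r.subR 0) {h : L}
    (hh : ∀ η : Z, χ η - γ η = ⟪h, r.ι η⟫_ℝ) : r.distR χ ≤ ENNReal.ofReal ‖h‖ := by
  rw [ofReal_norm]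
  exact iInf₂_le_of_le γ hγ (iInf₂_le_of_le h hh le_rfl)

/-- The infimum over pairs `(γ, h)` is a minimum-norm problem in `L` alone: `γ` is determined by
`h`, and the admissible `h` form the closed convex set `S`. Completeness of `L` gives an element of
least norm. -/
theorem exists_distR_eq [CompleteSpace L] {χ : Z →L[ℝ] ℝ} (hfin : r.distR χ ≠ ⊤) :
    ∃ γ ∈ r.subR 0, ∃ h : L, (∀ η : Z, χ η - γ η = ⟪h, r.ι η⟫_ℝ) ∧
      r.distR χ = ENNReal.ofReal ‖h‖ := by
  let S : Set L := {h | ∀ η : Z, r.R η ≠ ⊤ → χ η - ⟪h, r.ι η⟫_ℝ ≤ (r.R η).toReal}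
  have hS : ∀ γ ∈ r.subR 0, ∀ h : L, (∀ η : Z, χ η - γ η = ⟪h, r.ι η⟫_ℝ) → h ∈ S := by
    intro γ hγ h hh η hη
    have h1 := r.mem_subR_zero_iff.1 hγ η hη
    rw [← hh]
    linarith
  have hne : S.Nonempty := by
    by_contra hemp
    refine hfin (iInf₂_eq_top.2 fun γ hγ => iInf₂_eq_top.2 fun h hh => ?_)
    exact absurd ⟨h, hS γ hγ h hh⟩ hemp
  have hcl : IsClosed S := by
    simp only [S, Set.ofPred_forall]
    exact isClosed_iInter fun η => isClosed_iInter fun _ =>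
      isClosed_le (continuous_const.sub (continuous_id.inner continuous_const)) continuous_const
  have hconv : Convex ℝ S := by
    intro a ha b hb s t hs ht hst η hη
    have h1 := mul_le_mul_of_nonneg_left (ha η hη) hs
    have h2 := mul_le_mul_of_nonneg_left (hb η hη) ht
    rw [inner_add_left, real_inner_smul_left, real_inner_smul_left]
    have e : χ η - (s * ⟪a, r.ι η⟫_ℝ + t * ⟪b, r.ι η⟫_ℝ) =
        s * (χ η - ⟪a, r.ι η⟫_ℝ) + t * (χ η - ⟪b, r.ι η⟫_ℝ) := by
      have : t = 1 - s := by linarith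
      subst this
      ring
    rw [e]
    calc _ ≤ s * (r.R η).toReal + t * (r.R η).toReal := add_le_add h1 h2
      _ = (r.R η).toReal := by rw [← add_mul, hst, one_mul]
  obtain ⟨h, hhS, -, hmin⟩ := exists_infEDist_eq hne hcl hconv 0
  let γ : Z →L[ℝ] ℝ := χ - (innerSL ℝ h) ∘L r.ι
  have hγ : γ ∈ r.subR 0 := r.mem_subR_zero_iff.2 fun η hη => hhS η hη
  have hrep : ∀ η : Z, χ η - γ η = ⟪h, r.ι η⟫_ℝ := fun η => by
    change χ η - (χ η - ⟪h, r.ι η⟫_ℝ) = _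
    ring
  refine ⟨γ, hγ, h, hrep, le_antisymm (r.distR_le hγ hrep) ?_⟩
  refine le_iInf₂ fun γ' hγ' => le_iInf₂ fun h' hh' => ?_
  rw [← ofReal_norm]
  have := hmin h' (hS γ' hγ' h' hh')
  rw [zero_sub, zero_sub, norm_neg, norm_neg] at this
  exact ENNReal.ofReal_le_ofReal this

/-! ### The dual norm -/

theorem b_mul_le (u v : U) : r.b u v ≤ √(r.b u u) * √(r.b v v) := by
  have key : ∀ s : ℝ, 0 ≤ r.b v v * (s * s) + 2 * r.b u v * s + r.b u u := by
    intro s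
    have h := r.b_nonneg (u + s • v)
    have h1 := r.b_symm v u
    simp only [map_add, map_smul, LinearMap.add_apply, LinearMap.smul_apply, smul_eq_mul, h1] at h
    nlinarith
  have h := discrim_le_zero key
  rw [discrim] at h
  rw [← Real.sqrt_mul (r.b_nonneg u)]
  exact Real.le_sqrt_of_sq_le (by nlinarith)

theorem dualNorm_le {η : U →L[ℝ] ℝ} {a : ℝ} (ha : 0 ≤ a) (h : ∀ v, η v ≤ a * √(r.b v v)) :
    r.dualNorm η ≤ ENNReal.ofReal a := by
  refine iSup₂_le fun v hv => ENNReal.ofReal_le_ofReal ((h v).trans ?_)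
  have : √(r.b v v) ≤ 1 := Real.sqrt_le_one.2 hv
  nlinarith

/-- The bound on the unit ball extends by scaling when `b v v > 0`. The form is only semidefinite
(if no boundary condition is imposed, rigid motions have zero strain), so the case `b v v = 0` needs
its own argument. -/
theorem apply_le_of_dualNorm_ne_top {η : U →L[ℝ] ℝ} (h : r.dualNorm η ≠ ⊤) (v : U) :
    η v ≤ (r.dualNorm η).toReal * √(r.b v v) := by
  have hle : ∀ v, r.b v v ≤ 1 → η v ≤ (r.dualNorm η).toReal := fun v hv => by
    have h1 : ENNReal.ofReal (η v) ≤ r.dualNorm η :=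
      le_iSup₂ (f := fun (v : U) (_ : r.b v v ≤ 1) => ENNReal.ofReal (η v)) v hv
    exact (ENNReal.ofReal_le_iff_le_toReal h).1 h1
  have hsc : ∀ s : ℝ, r.b (s • v) (s • v) = s ^ 2 * r.b v v := fun s => by
    simp only [map_smul, LinearMap.smul_apply, smul_eq_mul]
    ring
  rcases (r.b_nonneg v).eq_or_lt with h0 | h0
  · rw [← h0, Real.sqrt_zero, mul_zero]
    by_contra! hc
    -- All multiples of `v` lie in the unit ball; on this one `η` would exceed its dual norm by one.
    have h2 := hle ((((r.dualNorm η).toReal + 1) / η v) • v) (by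
      rw [hsc, ← h0, mul_zero]
      exact zero_le_one)
    rw [map_smul, smul_eq_mul, div_mul_cancel₀ _ hc.ne'] at h2
    linarith
  · have hs := Real.sqrt_pos.2 h0
    have h2 := hle ((√(r.b v v))⁻¹ • v) (by
      rw [hsc, inv_pow, Real.sq_sqrt h0.le, inv_mul_cancel₀ h0.ne'])
    rw [map_smul, smul_eq_mul] at h2
    calc η v = ((√(r.b v v))⁻¹ * η v) * √(r.b v v) := by field_simp
      _ ≤ _ := mul_le_mul_of_nonneg_right h2 hs.le

/-! ### The slope -/

theorem rpow_half_aux {a β g ν : ℝ} (hν : 0 < ν) (ha : 0 ≤ a) (hβ : 0 ≤ β) (hg : 0 ≤ g) :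
    (ENNReal.ofReal ν⁻¹ * ENNReal.ofReal a ^ 2 + ENNReal.ofReal β ^ 2
      + ENNReal.ofReal ν⁻¹ * ENNReal.ofReal g ^ 2) ^ (1 / 2 : ℝ)
      = ENNReal.ofReal √(ν⁻¹ * a ^ 2 + β ^ 2 + ν⁻¹ * g ^ 2) := by
  rw [← ENNReal.ofReal_pow ha, ← ENNReal.ofReal_pow hβ, ← ENNReal.ofReal_pow hg,
    ← ENNReal.ofReal_mul (by positivity), ← ENNReal.ofReal_mul (by positivity),
    ← ENNReal.ofReal_add (by positivity) (by positivity),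
    ← ENNReal.ofReal_add (by positivity) (by positivity),
    ENNReal.ofReal_rpow_of_nonneg (by positivity) (by norm_num), Real.sqrt_eq_rpow]

theorem slope_le {A : U →L[ℝ] ℝ} {B γ : Z →L[ℝ] ℝ} {G om : P} {h : L} {a : ℝ} (ha : 0 ≤ a)
    (hA : ∀ v, -A v ≤ a * √(r.b v v)) (hγ : γ ∈ r.subR 0) (hB : ∀ η, -B η - γ η = ⟪h, r.ι η⟫_ℝ)
    (hom : om ∈ r.subH 0) :
    r.slope A B G ≤ ENNReal.ofReal √(r.ν⁻¹ * a ^ 2 + ‖h‖ ^ 2 + r.ν⁻¹ * ‖-G - om‖ ^ 2) := by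
  rw [← rpow_half_aux r.ν_pos ha (norm_nonneg h) (norm_nonneg (-G - om)), slope]
  have h1 : r.dualNorm (-A) ≤ ENNReal.ofReal a := r.dualNorm_le ha hA
  have h2 : r.distR (-B) ≤ ENNReal.ofReal ‖h‖ := r.distR_le hγ hB
  have h3 : Metric.infEDist (-G) (r.subH 0) ≤ ENNReal.ofReal ‖-G - om‖ := by
    rw [← dist_eq_norm, ← edist_dist]
    exact Metric.infEDist_le_edist_of_mem hom
  gcongr

/-- Finiteness of the slope yields finiteness of the dual norm and of the distance of `-B`; the
distance of `-G` is finite anyway. The distances are attained, so the later estimates can be carried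
out with real numbers and actual subgradients. -/
theorem exists_slope_eq [CompleteSpace L] [CompleteSpace P] {A : U →L[ℝ] ℝ} {B : Z →L[ℝ] ℝ}
    {G : P} (hfin : r.slope A B G ≠ ⊤) :
    ∃ a : ℝ, 0 ≤ a ∧ (∀ v, -A v ≤ a * √(r.b v v)) ∧ ∃ γ ∈ r.subR 0, ∃ h : L,
      (∀ η, -B η - γ η = ⟪h, r.ι η⟫_ℝ) ∧ ∃ om ∈ r.subH 0,
      r.slope A B G = ENNReal.ofReal √(r.ν⁻¹ * a ^ 2 + ‖h‖ ^ 2 + r.ν⁻¹ * ‖-G - om‖ ^ 2) := by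
  have hν : ENNReal.ofReal r.ν⁻¹ ≠ 0 := by
    have := r.ν_pos
    rw [ne_eq, ENNReal.ofReal_eq_zero, not_le]
    positivity
  have hfin' : ENNReal.ofReal r.ν⁻¹ * r.dualNorm (-A) ^ 2 + r.distR (-B) ^ 2
      + ENNReal.ofReal r.ν⁻¹ * Metric.infEDist (-G) (r.subH 0) ^ 2 ≠ ⊤ := fun hc => by
    rw [slope, hc] at hfin
    exact hfin (ENNReal.top_rpow_of_pos (by norm_num))
  rw [ENNReal.add_ne_top, ENNReal.add_ne_top] at hfin'
  have hd1 : r.dualNorm (-A) ≠ ⊤ := fun hc => hfin'.1.1 (by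
    rw [hc, ENNReal.top_pow two_ne_zero, ENNReal.mul_top hν])
  have hd2 : r.distR (-B) ≠ ⊤ := fun hc => hfin'.1.2 (by rw [hc, ENNReal.top_pow two_ne_zero])
  obtain ⟨γ, hγ, h, hB, hR⟩ := r.exists_distR_eq hd2
  obtain ⟨om, hom, hH⟩ := r.exists_infEDist_subH_eq (-G)
  refine ⟨(r.dualNorm (-A)).toReal, ENNReal.toReal_nonneg, r.apply_le_of_dualNorm_ne_top hd1, γ, hγ,
    h, hB, om, hom, ?_⟩
  rw [← rpow_half_aux r.ν_pos ENNReal.toReal_nonneg (norm_nonneg h) (norm_nonneg (-G - om)),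
    ENNReal.ofReal_toReal hd1, ← hR, ← hH, slope]

theorem rate_nonneg (u : U) (ζ : Z) (π : P) : 0 ≤ r.rate u ζ π := Real.sqrt_nonneg _

theorem rate_sq (u : U) (ζ : Z) (π : P) :
    r.rate u ζ π ^ 2 = r.ν * r.b u u + ‖r.ι ζ‖ ^ 2 + r.ν * ‖π‖ ^ 2 := by
  have := r.ν_pos
  have := r.b_nonneg u
  exact Real.sq_sqrt (by positivity)

theorem rate_eq_zero_iff {u : U} {ζ : Z} {π : P} :
    r.rate u ζ π = 0 ↔ r.b u u = 0 ∧ r.ι ζ = 0 ∧ π = 0 := by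
  have hν := r.ν_pos
  have hb := r.b_nonneg u
  have h := r.rate_sq u ζ π
  constructor
  · intro h0
    rw [h0] at h
    have h1 : 0 ≤ r.ν * r.b u u := by positivity
    have h2 : 0 ≤ r.ν * ‖π‖ ^ 2 := by positivity
    have h3 := sq_nonneg ‖r.ι ζ‖
    refine ⟨?_, ?_, ?_⟩
    · have : r.ν * r.b u u = 0 := by linarith
      exact (mul_eq_zero.1 this).resolve_left hν.ne'
    · have : ‖r.ι ζ‖ ^ 2 = 0 := by linarith
      simpa using this
    · have : r.ν * ‖π‖ ^ 2 = 0 := by linarith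
      simpa using (mul_eq_zero.1 this).resolve_left hν.ne'
  · rintro ⟨h1, h2, h3⟩
    rw [rate, h1, h2, h3]
    simp

/-- The Cauchy-Schwarz inequality for the weighted norms. -/
theorem sq_le_aux {x₁ x₂ x₃ a β g B N M ν : ℝ} (hν : 0 < ν) (hB : 0 ≤ B)
    (h₁ : |x₁| ≤ a * √B) (h₂ : |x₂| ≤ β * N) (h₃ : |x₃| ≤ g * M) :
    (x₁ + x₂ + x₃) ^ 2 ≤ (ν⁻¹ * a ^ 2 + β ^ 2 + ν⁻¹ * g ^ 2) * (ν * B + N ^ 2 + ν * M ^ 2) := by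
  have hs : ∃ s, 0 ≤ s ∧ s ^ 2 = B ∧ √B = s := ⟨√B, Real.sqrt_nonneg _, Real.sq_sqrt hB, rfl⟩
  obtain ⟨s, hs0, rfl, hs2⟩ := hs
  rw [hs2] at h₁
  have hk : ∃ k, 0 < k ∧ k ^ 2 = ν := ⟨√ν, Real.sqrt_pos.2 hν, Real.sq_sqrt hν.le⟩
  obtain ⟨k, hk0, rfl⟩ := hk
  have h1 : |x₁ + x₂ + x₃| ≤ a * s + β * N + g * M :=
    (abs_add_three _ _ _).trans (by linarith)
  have h2 : (x₁ + x₂ + x₃) ^ 2 ≤ (a * s + β * N + g * M) ^ 2 := by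
    rw [← sq_abs (x₁ + x₂ + x₃)]
    exact pow_le_pow_left₀ (abs_nonneg _) h1 2
  refine h2.trans ?_
  -- Lagrange's identity for the vectors `(a / k, β, g / k)` and `(k s, N, k M)`, where `k = √ν` and
  -- `s = √B`.
  have e : ((k ^ 2)⁻¹ * a ^ 2 + β ^ 2 + (k ^ 2)⁻¹ * g ^ 2) * (k ^ 2 * s ^ 2 + N ^ 2 + k ^ 2 * M ^ 2)
      - (a * s + β * N + g * M) ^ 2
      = (k⁻¹ * a * N - β * (k * s)) ^ 2 + (k⁻¹ * a * (k * M) - k⁻¹ * g * (k * s)) ^ 2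
        + (β * (k * M) - k⁻¹ * g * N) ^ 2 := by
    field_simp
    ring
  have : 0 ≤ (k⁻¹ * a * N - β * (k * s)) ^ 2 + (k⁻¹ * a * (k * M) - k⁻¹ * g * (k * s)) ^ 2
        + (β * (k * M) - k⁻¹ * g * N) ^ 2 := by positivity
  linarith

theorem abs_apply_le {A : U →L[ℝ] ℝ} {a : ℝ} (hA : ∀ v, -A v ≤ a * √(r.b v v)) (v : U) :
    |(-A v)| ≤ a * √(r.b v v) := by
  refine abs_le.2 ⟨?_, hA v⟩
  have h := hA (-v)
  simp only [map_neg, LinearMap.neg_apply, neg_neg] at h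
  linarith

theorem sq_le_slope {A : U →L[ℝ] ℝ} {a : ℝ} (hA : ∀ v, -A v ≤ a * √(r.b v v))
    (h k : L) (ξ π : P) (v : U) :
    (-A v + ⟪h, k⟫_ℝ + ⟪ξ, π⟫_ℝ) ^ 2 ≤
      √(r.ν⁻¹ * a ^ 2 + ‖h‖ ^ 2 + r.ν⁻¹ * ‖ξ‖ ^ 2) ^ 2
        * (r.ν * r.b v v + ‖k‖ ^ 2 + r.ν * ‖π‖ ^ 2) := by
  have hν := r.ν_pos
  rw [Real.sq_sqrt (by positivity)]
  exact sq_le_aux hν (r.b_nonneg v) (r.abs_apply_le hA v) (abs_real_inner_le_norm h k)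
    (abs_real_inner_le_norm ξ π)

/-! ### The contact potential -/

theorem contact_of_pos {A : U →L[ℝ] ℝ} {B : Z →L[ℝ] ℝ} {G : P} {t' : ℝ} (ht : 0 < t')
    {u : U} {ζ : Z} {π : P} (hfin : r.contact A B G t' u ζ π ≠ ⊤) :
    -A = 0 ∧ -B ∈ r.subR 0 ∧ -G ∈ r.subH 0 ∧ r.R ζ ≠ ⊤ ∧
      (r.contact A B G t' u ζ π).toReal = (r.R ζ).toReal + r.H π := by
  rw [contact, if_pos ht] at hfin ⊢
  split_ifs at hfin ⊢ with hc
  · rw [add_zero] at hfin ⊢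
    have hR := (ENNReal.add_ne_top.1 hfin).1
    refine ⟨hc.1, hc.2.1, hc.2.2, hR, ?_⟩
    rw [ENNReal.toReal_add hR ENNReal.ofReal_ne_top, ENNReal.toReal_ofReal (r.H_nonneg _)]
  · simp at hfin

theorem contact_of_not_pos {A : U →L[ℝ] ℝ} {B : Z →L[ℝ] ℝ} {G : P} {t' : ℝ} (ht : ¬ 0 < t')
    {u : U} {ζ : Z} {π : P} (hfin : r.contact A B G t' u ζ π ≠ ⊤) :
    r.slope A B G ≠ ⊤ ∧ r.R ζ ≠ ⊤ ∧ (r.contact A B G t' u ζ π).toReal =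
      (r.R ζ).toReal + r.H π + r.rate u ζ π * (r.slope A B G).toReal := by
  rw [contact, if_neg ht] at hfin ⊢
  split_ifs at hfin ⊢ with hc
  · simp at hfin
  · have hR := (ENNReal.add_ne_top.1 (ENNReal.add_ne_top.1 hfin).1).1
    refine ⟨hc, hR, ?_⟩
    rw [ENNReal.toReal_add (ENNReal.add_ne_top.1 hfin).1 (ENNReal.add_ne_top.1 hfin).2,
      ENNReal.toReal_add hR ENNReal.ofReal_ne_top, ENNReal.toReal_ofReal (r.H_nonneg _),
      ENNReal.toReal_mul, ENNReal.toReal_ofReal (r.rate_nonneg _ _ _)]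

variable [CompleteSpace L] [CompleteSpace P]

/-- Write `-B = γ + ⟪h, ι ·⟫` and `-G = om + ξ` with the optimal residuals. The subgradients are
bounded by the potentials, and the rest by rate times slope through Cauchy-Schwarz. -/
theorem le_add_rate_mul_slope {A : U →L[ℝ] ℝ} {B : Z →L[ℝ] ℝ} {G : P} {u : U} {ζ : Z} {π : P}
    (hR : r.R ζ ≠ ⊤) (hs : r.slope A B G ≠ ⊤) :
    -A u - B ζ - ⟪G, π⟫_ℝ ≤ (r.R ζ).toReal + r.H π + r.rate u ζ π * (r.slope A B G).toReal := by
  obtain ⟨a, ha, hA, γ, hγ, h, hB, om, hom, hsl⟩ := r.exists_slope_eq hs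
  have h1 := r.sq_le_slope hA h (r.ι ζ) (-G - om) π u
  rw [← r.rate_sq, ← mul_pow] at h1
  have h2 := (le_abs_self _).trans
    (abs_le_of_sq_le_sq h1 (mul_nonneg (Real.sqrt_nonneg _) (r.rate_nonneg _ _ _)))
  rw [hsl, ENNReal.toReal_ofReal (Real.sqrt_nonneg _)]
  have h3 := r.mem_subR_zero_iff.1 hγ ζ hR
  have h4 := r.mem_subH_zero_iff.1 hom π
  have h5 := hB ζ
  have h6 : ⟪-G - om, π⟫_ℝ = -⟪G, π⟫_ℝ - ⟪om, π⟫_ℝ := by rw [inner_sub_left, inner_neg_left]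
  rw [h6] at h2
  linarith

/-- The chain-rule inequality. -/
theorem le_contact {A : U →L[ℝ] ℝ} {B : Z →L[ℝ] ℝ} {G : P} {t' : ℝ} {u : U} {ζ : Z} {π : P}
    (hfin : r.contact A B G t' u ζ π ≠ ⊤) :
    -A u - B ζ - ⟪G, π⟫_ℝ ≤ (r.contact A B G t' u ζ π).toReal := by
  by_cases ht : 0 < t'
  · obtain ⟨hA, hB, hG, hR, he⟩ := r.contact_of_pos ht hfin
    rw [he]
    have h1 : -A u = 0 := congrArg (fun f : U →L[ℝ] ℝ => f u) hA
    have h2 : -B ζ ≤ _ := r.mem_subR_zero_iff.1 hB ζ hR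
    have h3 := r.mem_subH_zero_iff.1 hG π
    rw [inner_neg_left] at h3
    linarith
  · obtain ⟨hs, hR, he⟩ := r.contact_of_not_pos ht hfin
    rw [he]
    exact r.le_add_rate_mul_slope hR hs

/-- The switching coefficient. -/
def coeff (A : U →L[ℝ] ℝ) (B : Z →L[ℝ] ℝ) (G : P) (t' : ℝ) (u : U) (ζ : Z) (π : P) : ℝ :=
  if 0 < t' then 0 else if r.rate u ζ π = 0 then 1 else
    (r.slope A B G).toReal / (r.rate u ζ π + (r.slope A B G).toReal)

/-- With `λ = 1` only the viscous terms survive, and they vanish with the rate. The finite slope is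
used to produce an element of the damage subdifferential, which must still be nonempty. -/
theorem inclusions_of_rate_eq_zero {A : U →L[ℝ] ℝ} {B : Z →L[ℝ] ℝ} {G : P} {u : U} {ζ : Z} {π : P}
    (hs : r.slope A B G ≠ ⊤) (h0 : r.rate u ζ π = 0) : r.Inclusions 1 A B G u ζ π := by
  obtain ⟨a, ha, hA, γ, hγ, h, hB, om, hom, hsl⟩ := r.exists_slope_eq hs
  obtain ⟨h1, h2, rfl⟩ := r.rate_eq_zero_iff.1 h0
  refine ⟨fun v => ?_, ⟨γ, ?_, fun η => ?_⟩, 0, r.zero_mem_subH, by simp⟩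
  · have e1 := r.b_mul_le u v
    have e2 := r.b_mul_le u (-v)
    rw [h1, Real.sqrt_zero, zero_mul] at e1 e2
    rw [map_neg] at e2
    have : r.b u v = 0 := by linarith
    rw [this]
    ring
  · refine r.mem_subR_iff.2 ⟨hγ, ?_, ?_⟩
    · rw [r.R_of_ι ζ h2]
      exact ENNReal.zero_ne_top
    · rw [r.R_of_ι ζ h2, r.apply_eq_zero_of_mem_subR hγ h2, ENNReal.toReal_zero]
  · rw [h2, inner_zero_left]
    ring

/-- For `t' > 0` a finite potential means that the state is stable, and equality upgrades the
subgradients at zero to subgradients at the rates. For `t' = 0` equality must hold in each of the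
estimates behind the chain-rule inequality; in Cauchy-Schwarz this means `c · rate = D · residual`,
which divided by `D + c` is the system with `λ = c / (D + c)` and `1 - λ = D / (D + c)`. -/
theorem inclusions_of_contact_eq {A : U →L[ℝ] ℝ} {B : Z →L[ℝ] ℝ} {G : P} {t' : ℝ} {u : U} {ζ : Z}
    {π : P} (hfin : r.contact A B G t' u ζ π ≠ ⊤)
    (heq : (r.contact A B G t' u ζ π).toReal = -A u - B ζ - ⟪G, π⟫_ℝ) :
    r.Inclusions (r.coeff A B G t' u ζ π) A B G u ζ π := by
  by_cases ht : 0 < t'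
  · obtain ⟨hA, hB, hG, hR, he⟩ := r.contact_of_pos ht hfin
    rw [he] at heq
    have h1 : ∀ v, -A v = 0 := fun v => congrArg (fun f : U →L[ℝ] ℝ => f v) hA
    have h2 : -B ζ ≤ _ := r.mem_subR_zero_iff.1 hB ζ hR
    have h3 := r.mem_subH_zero_iff.1 hG π
    rw [inner_neg_left] at h3
    have h1u := h1 u
    rw [coeff, if_pos ht]
    refine ⟨fun v => by linarith [h1 v], ⟨-B, r.mem_subR_iff.2 ⟨hB, hR, ?_⟩, fun η => ?_⟩, -G,
      r.mem_subH_iff.2 ⟨hG, ?_⟩, by simp⟩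
    · change _ = -B ζ
      linarith
    · change (1 - 0) * -B η + 0 * _ + (1 - 0) * B η = 0
      ring
    · rw [inner_neg_left]
      linarith
  · obtain ⟨hs, hR, he⟩ := r.contact_of_not_pos ht hfin
    rw [coeff, if_neg ht]
    split_ifs with h0
    · exact r.inclusions_of_rate_eq_zero hs h0
    rw [he] at heq
    obtain ⟨a, ha, hA, γ, hγ, h, hB, om, hom, hsl⟩ := r.exists_slope_eq hs
    have hDs : (r.slope A B G).toReal = √(r.ν⁻¹ * a ^ 2 + ‖h‖ ^ 2 + r.ν⁻¹ * ‖-G - om‖ ^ 2) := by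
      rw [hsl, ENNReal.toReal_ofReal (Real.sqrt_nonneg _)]
    set c := (r.slope A B G).toReal with hcdef
    have hc : 0 ≤ c := ENNReal.toReal_nonneg
    set D := r.rate u ζ π with hD
    have hDpos : 0 < D := lt_of_le_of_ne (r.rate_nonneg _ _ _) (Ne.symm h0)
    have hsq : ∀ x : U × L × P, (-A x.1 + ⟪h, x.2.1⟫_ℝ + ⟪-G - om, x.2.2⟫_ℝ) ^ 2 ≤
        c ^ 2 * (r.ν * r.b x.1 x.1 + ⟪x.2.1, x.2.1⟫_ℝ + r.ν * ⟪x.2.2, x.2.2⟫_ℝ) := fun x => by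
      have := r.sq_le_slope hA h x.2.1 (-G - om) x.2.2 x.1
      rw [← hDs] at this
      rwa [real_inner_self_eq_norm_sq, real_inner_self_eq_norm_sq]
    have h1 := hsq (u, r.ι ζ, π)
    simp only [real_inner_self_eq_norm_sq] at h1
    rw [← r.rate_sq, ← mul_pow] at h1
    have h2 := (le_abs_self _).trans (abs_le_of_sq_le_sq h1 (mul_nonneg hc hDpos.le))
    have h3 := r.mem_subR_zero_iff.1 hγ ζ hR
    have h4 := r.mem_subH_zero_iff.1 hom π
    have h5 := hB ζ
    have h6 : ⟪-G - om, π⟫_ℝ = -⟪G, π⟫_ℝ - ⟪om, π⟫_ℝ := by rw [inner_sub_left, inner_neg_left]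
    rw [h6] at h2
    -- Proportionality of rate and residual as functionals on the product; testing with one nonzero
    -- component at a time gives the three lines of the system.
    have key : ∀ y : U × L × P,
        c * (r.ν * r.b u y.1 + ⟪r.ι ζ, y.2.1⟫_ℝ + r.ν * ⟪π, y.2.2⟫_ℝ) =
          D * (-A y.1 + ⟪h, y.2.1⟫_ℝ + ⟪-G - om, y.2.2⟫_ℝ) := fun y => by
      refine mul_eq_mul_of_sq_le_of_eq
        (B := fun x y : U × L × P => r.ν * r.b x.1 y.1 + ⟪x.2.1, y.2.1⟫_ℝ + r.ν * ⟪x.2.2, y.2.2⟫_ℝ)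
        (ℓ := fun x : U × L × P => -A x.1 + ⟪h, x.2.1⟫_ℝ + ⟪-G - om, x.2.2⟫_ℝ)
        (x := (u, r.ι ζ, π)) (fun s => ?_) (fun s => ?_) hc ?_ hsq ?_
      · simp only [Prod.fst_add, Prod.snd_add, Prod.smul_fst, Prod.smul_snd, map_add, map_smul,
          LinearMap.add_apply, LinearMap.smul_apply, smul_eq_mul, inner_add_left, inner_add_right,
          real_inner_smul_left, real_inner_smul_right]
        rw [r.b_symm y.1 u, real_inner_comm (r.ι ζ) y.2.1, real_inner_comm π y.2.2]
        ring
      · simp only [Prod.fst_add, Prod.snd_add, Prod.smul_fst, Prod.smul_snd, map_add, map_smul,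
          smul_eq_mul, inner_add_right, real_inner_smul_right]
        ring
      · simp only [real_inner_self_eq_norm_sq]
        exact (r.rate_sq u ζ π).symm
      · simp only [h6]
        linarith
    have hsum : 0 < D + c := by linarith
    have hl : 1 - c / (D + c) = D / (D + c) := by
      field_simp
      ring
    rw [Inclusions, hl]
    refine ⟨fun v => ?_, ⟨γ, r.mem_subR_iff.2 ⟨hγ, hR, by linarith⟩, fun η => ?_⟩, om,
      r.mem_subH_iff.2 ⟨hom, by linarith⟩, ?_⟩
    · have := key (v, 0, 0)
      simp only [inner_zero_right, mul_zero, add_zero] at this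
      have e : c / (D + c) * (r.ν * r.b u v) + D / (D + c) * A v =
        (c * (r.ν * r.b u v) + D * A v) / (D + c) := by ring
      rw [e, this]
      ring
    · have := key (0, r.ι η, 0)
      simp only [inner_zero_right, mul_zero, add_zero, map_zero, neg_zero, zero_add] at this
      have e : D / (D + c) * γ η + c / (D + c) * ⟪r.ι ζ, r.ι η⟫_ℝ + D / (D + c) * B η =
        (D * γ η + c * ⟪r.ι ζ, r.ι η⟫_ℝ + D * B η) / (D + c) := by ring
      rw [e, this, ← hB η]
      ring
    · have : (c * r.ν) • π = D • (-G - om) := by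
        refine ext_inner_right ℝ fun ρ => ?_
        have := key (0, 0, ρ)
        simp only [inner_zero_right, mul_zero, add_zero, map_zero, neg_zero, zero_add] at this
        rw [real_inner_smul_left, real_inner_smul_left, ← this, mul_assoc]
      have e : (D / (D + c)) • om + (c / (D + c) * r.ν) • π + (D / (D + c)) • G =
          (D + c)⁻¹ • (D • om + (c * r.ν) • π + D • G) := by
        simp only [smul_add, smul_smul]
        congr 2
        · congr 1
          rw [div_eq_inv_mul]
        · congr 1
          rw [div_eq_inv_mul, mul_assoc]
        · rw [div_eq_inv_mul]
      rw [e, this, smul_sub, smul_neg]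
      abel_nf
      simp

/-- For `λ < 1` the system says that the residuals are `c = λ / (1 - λ)` times the viscous rates.
These residuals are competitors in the slope and bound it by `c D`, while pairing with the rate
gives `-⟨D𝓔, q'⟩ = R + H + c D²`; together with the chain-rule inequality this is equality. For `λ =
1` the rate `D` vanishes, and the product with the slope is zero only because the slope is assumed
finite. -/
theorem contact_eq_of_inclusions {A : U →L[ℝ] ℝ} {B : Z →L[ℝ] ℝ} {G : P} {t' l : ℝ} {u : U} {ζ : Z}
    {π : P} (hl : l ∈ Icc (0 : ℝ) 1) (ht : t' * l = 0) (hinc : r.Inclusions l A B G u ζ π)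
    (hs : ¬ 0 < t' → r.rate u ζ π = 0 → r.slope A B G ≠ ⊤) :
    r.contact A B G t' u ζ π ≠ ⊤ ∧
      (r.contact A B G t' u ζ π).toReal = -A u - B ζ - ⟪G, π⟫_ℝ := by
  obtain ⟨hu, ⟨χ, hχ, hz⟩, om, hom, hp⟩ := hinc
  obtain ⟨hχ0, hR, hRe⟩ := r.mem_subR_iff.1 hχ
  obtain ⟨hom0, hHe⟩ := r.mem_subH_iff.1 hom
  have hν := r.ν_pos
  have fin : ¬ 0 < t' → r.slope A B G ≠ ⊤ → r.contact A B G t' u ζ π ≠ ⊤ := fun h1 h2 => by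
    rw [contact, if_neg h1, if_neg h2]
    exact ENNReal.add_ne_top.2 ⟨ENNReal.add_ne_top.2 ⟨hR, ENNReal.ofReal_ne_top⟩,
      ENNReal.mul_ne_top ENNReal.ofReal_ne_top h2⟩
  rcases hl.2.eq_or_lt with rfl | hl1
  · have ht' : ¬ 0 < t' := by
      intro h
      linarith
    have hb : r.b u u = 0 := by
      have := hu u
      have h2 : r.ν * r.b u u = 0 := by linarith
      exact (mul_eq_zero.1 h2).resolve_left hν.ne'
    have hι : r.ι ζ = 0 := by
      have := hz ζ
      have h2 : ⟪r.ι ζ, r.ι ζ⟫_ℝ = 0 := by linarith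
      exact inner_self_eq_zero.1 h2
    have hπ : π = 0 := by
      simp only [sub_self, zero_smul, zero_add, add_zero, one_mul] at hp
      exact (smul_eq_zero.1 hp).resolve_left hν.ne'
    have hrate : r.rate u ζ π = 0 := r.rate_eq_zero_iff.2 ⟨hb, hι, hπ⟩
    have hsl := hs ht' hrate
    have hfin := fin ht' hsl
    refine ⟨hfin, ?_⟩
    obtain ⟨-, -, he⟩ := r.contact_of_not_pos ht' hfin
    obtain ⟨a, ha, hA, γ, hγ, h, hB, om', hom', -⟩ := r.exists_slope_eq hsl
    have h1 := r.abs_apply_le hA u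
    rw [hb, Real.sqrt_zero, mul_zero] at h1
    have h2 := abs_nonpos_iff.1 h1
    have h3 := hB ζ
    rw [hι, inner_zero_right, r.apply_eq_zero_of_mem_subR hγ hι] at h3
    rw [he, hrate, r.R_of_ι ζ hι, hπ, r.H_zero, inner_zero_right, ENNReal.toReal_zero]
    linarith
  · have hl0 : 0 < 1 - l := by linarith
    set c := l / (1 - l) with hc
    have hc0 : 0 ≤ c := div_nonneg hl.1 hl0.le
    have hcl : c * (1 - l) = l := div_mul_cancel₀ _ hl0.ne'
    have hu' : ∀ v, -A v = c * (r.ν * r.b u v) := fun v => by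
      have h2 : (1 - l) * (c * (r.ν * r.b u v) + A v) = 0 := by
        linear_combination hu v + (r.ν * r.b u v) * hcl
      linarith [(mul_eq_zero.1 h2).resolve_left hl0.ne']
    have hz' : ∀ η, -B η - χ η = ⟪c • r.ι ζ, r.ι η⟫_ℝ := fun η => by
      have := hz η
      rw [real_inner_smul_left]
      have h2 : (1 - l) * (χ η + c * ⟪r.ι ζ, r.ι η⟫_ℝ + B η) = 0 := by
        linear_combination this + ⟪r.ι ζ, r.ι η⟫_ℝ * hcl
      linarith [(mul_eq_zero.1 h2).resolve_left hl0.ne']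
    have hp' : -G - om = (c * r.ν) • π := by
      have h2 : (1 - l) • (om + (c * r.ν) • π + G) = 0 := by
        rw [smul_add, smul_add, smul_smul, ← mul_assoc, mul_comm (1 - l) c, hcl]
        exact hp
      have h3 := (smul_eq_zero.1 h2).resolve_left hl0.ne'
      rw [sub_eq_iff_eq_add, neg_eq_iff_add_eq_zero, ← h3]
      abel
    have hX : -A u - B ζ - ⟪G, π⟫_ℝ = c * r.rate u ζ π ^ 2 + (r.R ζ).toReal + r.H π := by
      have h1 := hu' u
      have h2 := hz' ζ
      have h3 : ⟪-G - om, π⟫_ℝ = -⟪G, π⟫_ℝ - ⟪om, π⟫_ℝ := by rw [inner_sub_left, inner_neg_left]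
      rw [hp', real_inner_smul_left, real_inner_self_eq_norm_sq] at h3
      rw [real_inner_smul_left, real_inner_self_eq_norm_sq] at h2
      rw [r.rate_sq, hRe, hHe]
      linear_combination h1 + h2 + -h3
    have hslope : r.slope A B G ≤ ENNReal.ofReal (c * r.rate u ζ π) := by
      have hb := r.b_nonneg u
      have h1 := r.slope_le (A := A) (B := B) (G := G) (a := c * r.ν * √(r.b u u)) (by positivity)
        (fun v => by
          rw [hu']
          have := r.b_mul_le u v
          have h2 := mul_le_mul_of_nonneg_left this (mul_nonneg hc0 hν.le)
          linarith) hχ0 hz' hom0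
      refine h1.trans (ENNReal.ofReal_le_ofReal (le_of_eq ?_))
      rw [Real.sqrt_eq_iff_eq_sq (by positivity) (mul_nonneg hc0 (r.rate_nonneg _ _ _)),
        mul_pow c (r.rate u ζ π), r.rate_sq, hp', norm_smul, norm_smul, Real.norm_of_nonneg hc0,
        Real.norm_of_nonneg (mul_nonneg hc0 hν.le), mul_pow, mul_pow, mul_pow,
        Real.sq_sqrt hb]
      field_simp
    -- For `t' > 0` the switching condition gives `λ = 0`, hence `c = 0`: the residuals vanish and
    -- the state is stable.
    by_cases ht' : 0 < t'
    · have hl' : l = 0 := (mul_eq_zero.1 ht).resolve_left ht'.ne'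
      have hc' : c = 0 := by rw [hc, hl', zero_div]
      rw [hc', zero_mul, zero_add] at hX
      have c1 : -A = 0 := by
        ext v
        change -A v = 0
        rw [hu', hc', zero_mul]
      have c2 : -B ∈ r.subR 0 := by
        have : -B = χ := by
          ext η
          have := hz' η
          rw [hc', zero_smul, inner_zero_left] at this
          change -B η = χ η
          linarith
        rwa [this]
      have c3 : -G ∈ r.subH 0 := by
        rw [hc', zero_mul, zero_smul, sub_eq_zero] at hp'
        rwa [hp']
      have hfin : r.contact A B G t' u ζ π ≠ ⊤ := by
        rw [contact, if_pos ht', if_pos ⟨c1, c2, c3⟩, add_zero]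
        exact ENNReal.add_ne_top.2 ⟨hR, ENNReal.ofReal_ne_top⟩
      refine ⟨hfin, ?_⟩
      rw [(r.contact_of_pos ht' hfin).2.2.2.2, hX]
    · have hsl : r.slope A B G ≠ ⊤ := ne_top_of_le_ne_top ENNReal.ofReal_ne_top hslope
      have hfin := fin ht' hsl
      refine ⟨hfin, le_antisymm ?_ (r.le_contact hfin)⟩
      rw [(r.contact_of_not_pos ht' hfin).2.2, hX]
      have h1 : (r.slope A B G).toReal ≤ c * r.rate u ζ π :=
        ENNReal.toReal_le_of_le_ofReal (mul_nonneg hc0 (r.rate_nonneg _ _ _)) hslope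
      have h2 := mul_le_mul_of_nonneg_left h1 (r.rate_nonneg u ζ π)
      linarith

end RateSystem

/-! ### Multiplication operators on `L²` -/

section MulOperator

variable {α E : Type*} [MeasurableSpace α] [NormedAddCommGroup E] [InnerProductSpace ℝ E]
  {μ : Measure α} {A : α → (E →L[ℝ] E)} {T : Lp E 2 μ →L[ℝ] Lp E 2 μ}

theorem mulOperator_inner (hT : ∀ f, T f =ᵐ[μ] fun x => A x (f x)) (f g : Lp E 2 μ) :
    ⟪T f, g⟫_ℝ = ∫ x, ⟪A x (f x), g x⟫_ℝ ∂μ := by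
  rw [L2.inner_def]
  refine integral_congr_ae ?_
  filter_upwards [hT f] with x hx
  rw [hx]

theorem mulOperator_symm (hT : ∀ f, T f =ᵐ[μ] fun x => A x (f x))
    (hA : ∀ᵐ x ∂μ, ∀ ξ η, ⟪A x ξ, η⟫_ℝ = ⟪ξ, A x η⟫_ℝ) (f g : Lp E 2 μ) :
    ⟪T f, g⟫_ℝ = ⟪f, T g⟫_ℝ := by
  rw [real_inner_comm (T g) f, mulOperator_inner hT, mulOperator_inner hT]
  refine integral_congr_ae ?_
  filter_upwards [hA] with x hx
  rw [hx, real_inner_comm]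

theorem mulOperator_nonneg (hT : ∀ f, T f =ᵐ[μ] fun x => A x (f x))
    (hA : ∀ᵐ x ∂μ, ∀ ξ, 0 ≤ ⟪A x ξ, ξ⟫_ℝ) (f : Lp E 2 μ) : 0 ≤ ⟪T f, f⟫_ℝ := by
  rw [mulOperator_inner hT]
  refine integral_nonneg_of_ae ?_
  filter_upwards [hA] with x hx
  exact hx _

theorem inner_L2_real (h k : Lp ℝ 2 μ) : ⟪h, k⟫_ℝ = ∫ x, h x * k x ∂μ := by
  rw [L2.inner_def]
  refine integral_congr_ae (ae_of_all _ fun x => ?_)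
  simp [mul_comm]

end MulOperator

/-- The bilinear form `(u, v) ↦ ⟪T (s u), s v⟫`. -/
def pullbackForm {U Y : Type*} [NormedAddCommGroup U] [NormedSpace ℝ U] [NormedAddCommGroup Y]
    [InnerProductSpace ℝ Y] (s : U →L[ℝ] Y) (T : Y →L[ℝ] Y) : U →ₗ[ℝ] U →ₗ[ℝ] ℝ :=
  LinearMap.mk₂ ℝ (fun u v => ⟪T (s u), s v⟫_ℝ) (fun _ _ _ => by simp [inner_add_left])
    (fun _ _ _ => by simp [inner_smul_left]) (fun _ _ _ => by simp [inner_add_right])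
    (fun _ _ _ => by simp [inner_smul_right])

theorem pullbackForm_symm {U Y : Type*} [NormedAddCommGroup U] [NormedSpace ℝ U]
    [NormedAddCommGroup Y] [InnerProductSpace ℝ Y] (s : U →L[ℝ] Y) {T : Y →L[ℝ] Y}
    (hT : ∀ f g, ⟪T f, g⟫_ℝ = ⟪f, T g⟫_ℝ) (u v : U) : pullbackForm s T u v = pullbackForm s T v u :=
  (hT (s u) (s v)).trans (real_inner_comm _ _)

theorem fderiv_half_norm_sq {Z L : Type*} [NormedAddCommGroup Z] [NormedSpace ℝ Z]
    [NormedAddCommGroup L] [InnerProductSpace ℝ L] (ι : Z →L[ℝ] L) {f : Z → ℝ}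
    (hf : ∀ z, f z = 1 / 2 * ‖ι z‖ ^ 2) (ζ η : Z) : fderiv ℝ f ζ η = ⟪ι ζ, ι η⟫_ℝ := by
  have h := fderiv_quadratic ι (T := ContinuousLinearMap.id ℝ L) (fun _ _ => rfl) 1 (f := f)
    (fun z => by simp [hf]) ζ η
  rw [h, one_mul]
  rfl

namespace Data

variable {n : ℕ} {d : Data n}

/-! ### The plastic dissipation -/

theorem Admissible.exists_isSupportFamily (hd : d.Admissible) :
    ∃ R C : ℝ, IsSupportFamily d.plastDensity R C := by
  obtain ⟨R, hR, hb⟩ := hd.exists_K_bound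
  obtain ⟨C, hC, hL⟩ := exists_abs_plastDensity_sub_le hd
  exact ⟨R, C, hR.le, hC.le, continuous_plastDensity hd, fun z hz => plastDensity_zero hd hz,
    fun z hz => plastDensity_nonneg hd hz, fun z hz c hc => plastDensity_smul hd hz hc,
    fun z hz => abs_plastDensity_sub_le hd hb hz, hL⟩

theorem PosField.nonneg {z : d.Z} (hz : PosField z) :
    ∀ᵐ x ∂(volume.restrict d.Ω), 0 ≤ field z x := by
  obtain ⟨c, hc, h⟩ := hz
  exact h.mono fun x hx => hc.le.trans hx

theorem plastDiss_nonneg (hd : d.Admissible) {z : d.Z} (hz : PosField z) (π : d.P) :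
    0 ≤ d.plastDiss z π := by
  obtain ⟨R, C, hh⟩ := hd.exists_isSupportFamily
  exact hh.integral_nonneg hz.nonneg

theorem plastDiss_smul (hd : d.Admissible) {z : d.Z} (hz : PosField z) {c : ℝ} (hc : 0 ≤ c)
    (π : d.P) : d.plastDiss z (c • π) = c * d.plastDiss z π := by
  obtain ⟨R, C, hh⟩ := hd.exists_isSupportFamily
  exact hh.integral_smul hz.nonneg hc π

theorem mem_plastSubdiff_iff_ae (hd : d.Admissible) {z : d.Z} (hz : PosField z) (om π : d.P) :
    om ∈ d.plastSubdiff z π ↔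
      ∀ᵐ x ∂(volume.restrict d.Ω), om x ∈ d.plastDensitySubdiff (field z x) (π x) := by
  have := hd.isFiniteMeasure
  obtain ⟨R, C, hh⟩ := hd.exists_isSupportFamily
  exact hh.forall_inner_le_integral_iff (Lp.aestronglyMeasurable (field z)) hz.nonneg om π

/-! ### The damage dissipation -/

theorem damageDiss_of_field_eq_zero {ζ : d.Z} (h : field ζ = 0) : d.damageDiss ζ = 0 := by
  have h1 : ∀ᵐ x ∂(volume.restrict d.Ω), d.rDensity (field ζ x) = 0 := by
    rw [h]
    filter_upwards [Lp.coeFn_zero ℝ 2 (volume.restrict d.Ω)] with x hx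
    rw [hx, Pi.zero_apply, rDensity, if_pos le_rfl, mul_zero, ENNReal.ofReal_zero]
  rw [damageDiss, lintegral_congr_ae h1, lintegral_zero]

theorem rDensity_mul {c : ℝ} (hc : 0 < c) (s : ℝ) :
    d.rDensity (c * s) = ENNReal.ofReal c * d.rDensity s := by
  rw [rDensity, rDensity]
  by_cases h : s ≤ 0
  · rw [if_pos h, if_pos (mul_nonpos_of_nonneg_of_nonpos hc.le h), ← ENNReal.ofReal_mul hc.le]
    congr 1
    ring
  · rw [if_neg h, if_neg (by push Not at h ⊢; positivity), ENNReal.mul_top]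
    simpa using hc

theorem damageDiss_smul {c : ℝ} (hc : 0 < c) (ζ : d.Z) :
    d.damageDiss (c • ζ) = ENNReal.ofReal c * d.damageDiss ζ := by
  rw [damageDiss, damageDiss, ← lintegral_const_mul' _ _ ENNReal.ofReal_ne_top]
  refine lintegral_congr_ae ?_
  filter_upwards [field_smul_ae c ζ] with x hx
  rw [hx]
  exact rDensity_mul hc _

theorem measurable_rDensity : Measurable d.rDensity :=
  Measurable.ite measurableSet_Iic (by fun_prop) measurable_const

/-- Where it is finite, the damage dissipation is linear. -/
theorem damageDiss_eq_of_ne_top (hd : d.Admissible) {ζ : d.Z} (h : d.damageDiss ζ ≠ ⊤) :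
    d.damageDiss ζ = ENNReal.ofReal (-d.κ * ∫ x in d.Ω, field ζ x) := by
  have := hd.isFiniteMeasure
  have hm : AEMeasurable (fun x => d.rDensity (field ζ x)) (volume.restrict d.Ω) :=
    measurable_rDensity.comp_aemeasurable (Lp.aestronglyMeasurable (field ζ)).aemeasurable
  have h1 := ae_lt_top' hm h
  have h2 : ∀ᵐ x ∂(volume.restrict d.Ω), field ζ x ≤ 0 := by
    filter_upwards [h1] with x hx
    by_contra hc
    rw [rDensity, if_neg hc] at hx
    exact lt_irrefl _ hx
  have hint : Integrable (fun x => -d.κ * field ζ x) (volume.restrict d.Ω) :=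
    ((Lp.memLp (field ζ)).integrable (by norm_num)).const_mul _
  rw [← integral_const_mul, ofReal_integral_eq_lintegral_ofReal hint, damageDiss]
  · refine lintegral_congr_ae ?_
    filter_upwards [h2] with x hx
    rw [rDensity, if_pos hx]
  · filter_upwards [h2] with x hx
    have := hd.pos_κ
    simp only [Pi.zero_apply]
    nlinarith

/-! ### The viscosity form -/

/-- `T` is the multiplication by the viscosity tensor. -/
def IsViscOperator (d : Data n) (T : L2 d.Ω (Sym n) →L[ℝ] L2 d.Ω (Sym n)) : Prop :=
  ∀ f, T f =ᵐ[volume.restrict d.Ω] fun x => d.visc x (f x)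

theorem Admissible.exists_viscOperator (hd : d.Admissible) :
    ∃ T : L2 d.Ω (Sym n) →L[ℝ] L2 d.Ω (Sym n), d.IsViscOperator T := by
  have hms : MeasurableSet d.Ω := hd.lipschitz.isOpen.measurableSet
  have hcpt : IsCompact (closure d.Ω) := hd.lipschitz.bounded.isCompact_closure
  obtain ⟨C, hC⟩ := IsCompact.exists_bound_of_continuousOn (E := Sym n →L[ℝ] Sym n)
    (f := d.visc) hcpt
    hd.visc_cont
  exact exists_mulOperator
    ((hd.visc_cont.mono subset_closure).aestronglyMeasurable hms)
    ((ae_restrict_mem hms).mono fun x hx => hC x (subset_closure hx))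

theorem IsViscOperator.symm {T : L2 d.Ω (Sym n) →L[ℝ] L2 d.Ω (Sym n)} (hT : d.IsViscOperator T)
    (hd : d.Admissible) (f g : L2 d.Ω (Sym n)) : ⟪T f, g⟫_ℝ = ⟪f, T g⟫_ℝ :=
  mulOperator_symm hT ((ae_restrict_mem hd.lipschitz.isOpen.measurableSet).mono fun x hx =>
    hd.visc_symm x (subset_closure hx)) f g

theorem IsViscOperator.nonneg {T : L2 d.Ω (Sym n) →L[ℝ] L2 d.Ω (Sym n)} (hT : d.IsViscOperator T)
    (hd : d.Admissible) (f : L2 d.Ω (Sym n)) : 0 ≤ ⟪T f, f⟫_ℝ := by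
  obtain ⟨δ₁, δ₂, h1, h2, h⟩ := hd.visc_bounds
  refine mulOperator_nonneg hT ((ae_restrict_mem hd.lipschitz.isOpen.measurableSet).mono
    fun x hx ξ => le_trans ?_ (h x hx ξ).1) f
  positivity

/-- The strain as an operator on `H¹_Dir`. -/
def strainU (d : Data n) : d.U →L[ℝ] L2 d.Ω (Sym n) := d.strainL ∘L d.U.subtypeL

def viscForm (d : Data n) (T : L2 d.Ω (Sym n) →L[ℝ] L2 d.Ω (Sym n)) : d.U →ₗ[ℝ] d.U →ₗ[ℝ] ℝ :=
  @pullbackForm d.U (L2 d.Ω (Sym n)) _ _ _ _ d.strainU T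

theorem viscForm_symm (hd : d.Admissible) {T : L2 d.Ω (Sym n) →L[ℝ] L2 d.Ω (Sym n)}
    (hT : d.IsViscOperator T) (u v : d.U) : d.viscForm T u v = d.viscForm T v u := by
  have key := @pullbackForm_symm d.U (L2 d.Ω (Sym n)) _ _ _ _ d.strainU T
  exact key (hT.symm hd) u v

theorem viscSq_eq {T : L2 d.Ω (Sym n) →L[ℝ] L2 d.Ω (Sym n)} (hT : d.IsViscOperator T) (u : d.U) :
    d.viscSq u = d.viscForm T u u :=
  (mulOperator_inner hT (d.strainU u) (d.strainU u)).symm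

theorem fderiv_V2 (hd : d.Admissible) {T : L2 d.Ω (Sym n) →L[ℝ] L2 d.Ω (Sym n)}
    (hT : d.IsViscOperator T) (u v : d.U) : fderiv ℝ d.V2 u v = d.ν * d.viscForm T u v := by
  have key := @fderiv_quadratic d.U (L2 d.Ω (Sym n)) _ _ _ _ d.strainU T (hT.symm hd) d.ν d.V2
  exact key (fun u => congrArg (fun c => d.ν / 2 * c) (viscSq_eq hT u)) u v

theorem fderiv_R2 (ζ η : d.Z) : fderiv ℝ d.R2 ζ η = ⟪d.fieldL ζ, d.fieldL η⟫_ℝ := by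
  have key := @fderiv_half_norm_sq d.Z (L2 d.Ω ℝ) _ _ _ _ d.fieldL d.R2
  exact key (fun _ => rfl) ζ η

theorem gradient_H2 (π : d.P) : gradient d.H2 π = d.ν • π := by
  have key := @gradient_half_norm_sq d.P _ _ _ d.ν d.H2
  exact key (fun _ => rfl) π

/-! ### The rate system -/

/-- The dissipation of the model at a fixed damage state. -/
def rateSystem (hd : d.Admissible) {T : L2 d.Ω (Sym n) →L[ℝ] L2 d.Ω (Sym n)}
    (hT : d.IsViscOperator T) {z : d.Z} (hz : PosField z) :
    RateSystem d.U d.Z (L2 d.Ω ℝ) d.P where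
  ν := d.ν
  b := d.viscForm T
  ι := d.fieldL
  R := d.damageDiss
  H := d.plastDiss z
  ν_pos := hd.pos_ν
  b_symm u v := viscForm_symm hd hT u v
  b_nonneg u := hT.nonneg hd (d.strainU u)
  R_smul _ hc ζ := damageDiss_smul hc ζ
  R_of_ι _ h := damageDiss_of_field_eq_zero h
  H_nonneg := plastDiss_nonneg hd hz
  H_smul _ hc π := plastDiss_smul hd hz hc π

end Data

/-- The switching coefficient in terms of `t'`, the rate `D` and the reduced contact potential
`m`. -/
def switchCoeff (t' D m : ℝ) : ℝ := if 0 < t' then 0 else if D = 0 then 1 else m / (D ^ 2 + m)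

/-! ### Comparison of the abstract quantities with those of the model -/

namespace RateSystem

variable {U Z L P : Type*} [NormedAddCommGroup U] [NormedSpace ℝ U]
    [NormedAddCommGroup Z] [NormedSpace ℝ Z] [NormedAddCommGroup L] [InnerProductSpace ℝ L]
    [NormedAddCommGroup P] [InnerProductSpace ℝ P] (r : RateSystem U Z L P)

theorem dualNorm_eq {N : U → ℝ} (hN : ∀ u, N u = r.b u u) (η : U →L[ℝ] ℝ) :
    r.dualNorm η = ⨆ (v : U) (_ : N v ≤ 1), ENNReal.ofReal (η v) := by
  simp only [dualNorm, hN]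

theorem distR_eq {j : L → Z → ℝ} (hj : ∀ h η, j h η = ⟪h, r.ι η⟫_ℝ) (χ : Z →L[ℝ] ℝ) :
    r.distR χ = ⨅ (γ ∈ r.subR 0) (h : L) (_ : ∀ η : Z, χ η - γ η = j h η), ‖h‖ₑ := by
  simp only [distR, hj]

open Classical in
theorem contact_eq {A : U →L[ℝ] ℝ} {B : Z →L[ℝ] ℝ} {G : P} {t' : ℝ} {u : U} {ζ : Z} {π : P}
    {s : ℝ≥0∞} {D : ℝ} (hs : r.slope A B G = s) (hD : r.rate u ζ π = D) :
    r.contact A B G t' u ζ π = r.R ζ + ENNReal.ofReal (r.H π) +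
      if 0 < t' then
        if -A = 0 ∧ -B ∈ r.subR 0 ∧ -G ∈ r.subH 0 then 0 else ⊤
      else if s = ⊤ then ⊤ else ENNReal.ofReal D * s := by
  subst hs hD
  rfl

theorem inclusions_iff [CompleteSpace P] {V : U → ℝ} {K : Z → ℝ} {H : P → ℝ} {l : ℝ} {A : U →L[ℝ] ℝ}
    {B : Z →L[ℝ] ℝ} {G : P} {u : U} {ζ : Z} {π : P}
    (hV : ∀ v, fderiv ℝ V u v = r.ν * r.b u v) (hK : ∀ η, fderiv ℝ K ζ η = ⟪r.ι ζ, r.ι η⟫_ℝ)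
    (hH : gradient H π = r.ν • π) :
    r.Inclusions l A B G u ζ π ↔ l • fderiv ℝ V u + (1 - l) • A = 0 ∧
      (∃ χ ∈ r.subR ζ, (1 - l) • χ + l • fderiv ℝ K ζ + (1 - l) • B = 0) ∧
      ∃ om ∈ r.subH π, (1 - l) • om + l • gradient H π + (1 - l) • G = 0 := by
  rw [hH]
  refine and_congr ?_ (and_congr (exists_congr fun χ => and_congr Iff.rfl ?_)
    (exists_congr fun om => and_congr Iff.rfl ?_))
  · rw [ContinuousLinearMap.ext_iff]
    refine forall_congr' fun v => ?_
    rw [← hV]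
    rfl
  · rw [ContinuousLinearMap.ext_iff]
    refine forall_congr' fun v => ?_
    rw [← hK]
    rfl
  · rw [smul_smul]

/-- The switching coefficient in terms of the rate `D` and of the reduced contact potential `m`. -/
theorem coeff_eq {A : U →L[ℝ] ℝ} {B : Z →L[ℝ] ℝ} {G : P} {t' : ℝ} {u : U} {ζ : Z} {π : P}
    {D M a b : ℝ} (hD : r.rate u ζ π = D) (hfin : r.contact A B G t' u ζ π ≠ ⊤)
    (hM : (r.contact A B G t' u ζ π).toReal = M) (ha : (r.R ζ).toReal = a) (hb : r.H π = b) :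
    r.coeff A B G t' u ζ π = switchCoeff t' D (M - a - b) := by
  subst hD hM ha hb
  rw [coeff, switchCoeff]
  split_ifs with h1 h2
  · rfl
  · rfl
  · rw [(r.contact_of_not_pos h1 hfin).2.2]
    have h3 : 0 < r.rate u ζ π := lt_of_le_of_ne (r.rate_nonneg _ _ _) (Ne.symm h2)
    have h4 : 0 ≤ (r.slope A B G).toReal := ENNReal.toReal_nonneg
    have h5 : 0 < r.rate u ζ π + (r.slope A B G).toReal := by linarith
    have e : (r.R ζ).toReal + r.H π + r.rate u ζ π * (r.slope A B G).toReal - (r.R ζ).toReal - r.H π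
        = r.rate u ζ π * (r.slope A B G).toReal := by ring
    rw [e, sq, ← mul_add, mul_div_mul_left _ _ h3.ne']

end RateSystem

namespace Data

variable {n : ℕ} {d : Data n}

set_option maxHeartbeats 2000000 in
-- Carries the abstract results over to the model: chain-rule inequality, equality implies the
-- system, the system implies equality. The viscosity form and the `L²` pairing have to be
-- rewritten; the remaining identifications hold by definition.
theorem contact_properties (hd : d.Admissible) {z : d.Z} (hz : PosField z)
    (t : ℝ) (u : d.U) (p : d.P) (t' : ℝ) (u' : d.U) (z' : d.Z) (p' : d.P) {X : ℝ}
    (hX : X = -d.DuE t (u, z, p) u' - d.DzE t (u, z, p) z' - ⟪d.DpE t (u, z, p), p'⟫_ℝ) :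
    (d.contact t (u, z, p) t' (u', z', p') ≠ ⊤ →
      X ≤ (d.contact t (u, z, p) t' (u', z', p')).toReal) ∧
    (d.contact t (u, z, p) t' (u', z', p') ≠ ⊤ →
      (d.contact t (u, z, p) t' (u', z', p')).toReal = X →
      d.Inclusions (switchCoeff t' (d.slopeRate (u', z', p'))
        (X - (d.damageDiss z').toReal - d.plastDiss z p')) t (u, z, p) (u', z', p')) ∧
    (∀ l ∈ Icc (0 : ℝ) 1, t' * l = 0 → d.Inclusions l t (u, z, p) (u', z', p') →
      (¬ 0 < t' → d.slopeRate (u', z', p') = 0 → d.slope t (u, z, p) ≠ ⊤) →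
      d.contact t (u, z, p) t' (u', z', p') ≠ ⊤ ∧
        (d.contact t (u, z, p) t' (u', z', p')).toReal = X) := by
  obtain ⟨T, hT⟩ := hd.exists_viscOperator
  have hN : (rateSystem hd hT hz).dualNorm (-d.DuE t (u, z, p)) = d.dualNorm (-d.DuE t (u, z, p)) :=
    (rateSystem hd hT hz).dualNorm_eq (viscSq_eq hT) _
  have hR : (rateSystem hd hT hz).distR (-d.DzE t (u, z, p)) = d.damageDist (-d.DzE t (u, z, p)) :=
    (rateSystem hd hT hz).distR_eq (fun h η => (inner_L2_real h (field η)).symm) _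
  have hrate : (rateSystem hd hT hz).rate u' z' p' = d.slopeRate (u', z', p') :=
    congrArg (fun c => √(d.ν * c + ‖field z'‖ ^ 2 + d.ν * ‖p'‖ ^ 2)) (viscSq_eq hT u').symm
  have hslope : (rateSystem hd hT hz).slope (d.DuE t (u, z, p)) (d.DzE t (u, z, p))
      (d.DpE t (u, z, p)) = d.slope t (u, z, p) :=
    congrArg₂ (fun a b : ℝ≥0∞ => (ENNReal.ofReal d.ν⁻¹ * a ^ 2 + b ^ 2 + ENNReal.ofReal d.ν⁻¹ *
      Metric.infEDist (-d.DpE t (u, z, p)) (d.plastSubdiff z 0) ^ 2) ^ (1 / 2 : ℝ)) hN hR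
  have hinc : ∀ l, (rateSystem hd hT hz).Inclusions l (d.DuE t (u, z, p)) (d.DzE t (u, z, p))
      (d.DpE t (u, z, p)) u' z' p' ↔ d.Inclusions l t (u, z, p) (u', z', p') := fun l => by
    have key := (rateSystem hd hT hz).inclusions_iff (l := l) (A := d.DuE t (u, z, p))
      (B := d.DzE t (u, z, p)) (G := d.DpE t (u, z, p)) (fderiv_V2 hd hT u') (fderiv_R2 z')
      (gradient_H2 p')
    exact key.trans ⟨fun h => ⟨h.1, h.2.1, h.2.2⟩, fun h => ⟨h.1, h.2, h.3⟩⟩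
  have hcon : (rateSystem hd hT hz).contact (d.DuE t (u, z, p)) (d.DzE t (u, z, p))
      (d.DpE t (u, z, p)) t' u' z' p' = d.contact t (u, z, p) t' (u', z', p') := by
    have key := (rateSystem hd hT hz).contact_eq (t' := t') hslope hrate
    exact key
  have : CompleteSpace (L2 d.Ω ℝ) := inferInstance
  have : CompleteSpace d.P := inferInstance
  rw [← hcon, hX]
  refine ⟨fun h => (rateSystem hd hT hz).le_contact h, fun h1 h2 => (hinc _).1 ?_,
    fun l hl ht hi hs => ?_⟩
  · have h3 := (rateSystem hd hT hz).coeff_eq hrate h1 h2 rfl rfl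
    have h4 := (rateSystem hd hT hz).inclusions_of_contact_eq h1 h2
    rw [h3] at h4
    exact h4
  · refine (rateSystem hd hT hz).contact_eq_of_inclusions hl ht ((hinc l).2 hi) fun h1 h2 => ?_
    rw [hslope]
    rw [hrate] at h2
    exact hs h1 h2

end Data

/-! ### Equivalence of the abstract and the concrete systems -/

theorem combination_eq_zero_iff_ae {α E : Type*} [MeasurableSpace α] [NormedAddCommGroup E]
    [NormedSpace ℝ E] {μ : Measure α} (a b c : ℝ) (f g h : Lp E 2 μ) :
    a • f + b • g + c • h = 0 ↔ ∀ᵐ x ∂μ, a • f x + b • g x + c • h x = 0 := by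
  rw [Lp.ext_iff]
  have e : (a • f + b • g + c • h : Lp E 2 μ) =ᵐ[μ] fun x => a • f x + b • g x + c • h x := by
    filter_upwards [Lp.coeFn_add (a • f + b • g) (c • h), Lp.coeFn_add (a • f) (b • g),
      Lp.coeFn_smul a f, Lp.coeFn_smul b g, Lp.coeFn_smul c h] with x h1 h2 h3 h4 h5
    rw [h1, Pi.add_apply, h2, Pi.add_apply, h3, h4, h5]
    rfl
  constructor
  · intro H
    filter_upwards [H, e, Lp.coeFn_zero E 2 μ] with x h1 h2 h3
    rw [← h2, h1, h3]
    rfl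
  · intro H
    filter_upwards [H, e, Lp.coeFn_zero E 2 μ] with x h1 h2 h3
    rw [h2, h1, h3]
    rfl

theorem integral_inner_smul_mulOperator {α E : Type*} [MeasurableSpace α] [NormedAddCommGroup E]
    [InnerProductSpace ℝ E] {μ : Measure α} {A : α → (E →L[ℝ] E)} {T : Lp E 2 μ →L[ℝ] Lp E 2 μ}
    (hT : ∀ f, T f =ᵐ[μ] fun x => A x (f x)) (c : ℝ) (f g : Lp E 2 μ) :
    ∫ x, ⟪c • A x (f x), g x⟫_ℝ ∂μ = c * ⟪T f, g⟫_ℝ := by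
  simp only [real_inner_smul_left]
  rw [integral_const_mul, mulOperator_inner hT]

theorem integral_inner_congr {α E : Type*} [MeasurableSpace α] [NormedAddCommGroup E]
    [InnerProductSpace ℝ E] {μ : Measure α} {f : α → E} {σ : Lp E 2 μ} (h : σ =ᵐ[μ] f)
    (g : Lp E 2 μ) : ∫ x, ⟪f x, g x⟫_ℝ ∂μ = ⟪σ, g⟫_ℝ := by
  rw [L2.inner_def]
  exact integral_congr_ae (h.mono fun x hx => by simp only [hx])

section

variable {V K : Type*} [NormedAddCommGroup V] [NormedSpace ℝ V] [NormedAddCommGroup K]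
  [InnerProductSpace ℝ K]

theorem partial_formulas {Y P : Type*} [NormedAddCommGroup Y] [InnerProductSpace ℝ Y]
    [NormedAddCommGroup P] [InnerProductSpace ℝ P] {X : Type*} [NormedAddCommGroup X]
    [NormedSpace ℝ X] {D : X × V × P → ℝ} (s : X →L[ℝ] Y) (b : P →L[ℝ] Y) (k : V →L[ℝ] K)
    {χ₁ χ₂ : V →L[ℝ] ℝ} {c : ℝ} {σ : Y} {z : V} {p : P}
    (hD : ∀ v' z' p', D (v', z', p') = ⟪σ, s v' - b p'⟫_ℝ + χ₁ z' + (χ₂ z' + c * ⟪p, p'⟫_ℝ) +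
      ⟪k z, k z'⟫_ℝ) :
    (∀ v, D (v, 0, 0) = ⟪σ, s v⟫_ℝ) ∧ (∀ η, D (0, η, 0) = ⟪k z, k η⟫_ℝ + χ₂ η + χ₁ η) ∧
      ∀ π, D (0, 0, π) = c * ⟪p, π⟫_ℝ - ⟪σ, b π⟫_ℝ := by
  refine ⟨fun v => ?_, fun η => ?_, fun π => ?_⟩
  · simp [hD]
  · simp only [hD, map_zero, sub_zero, inner_zero_right]
    ring
  · simp only [hD, map_zero, zero_sub, inner_zero_right, inner_neg_right]
    ring

theorem eq_smul_sub_of_inner_eq {P : Type*} [NormedAddCommGroup P] [InnerProductSpace ℝ P]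
    {c : ℝ} {g p s : P} (h : ∀ π, ⟪g, π⟫_ℝ = c * ⟪p, π⟫_ℝ - ⟪s, π⟫_ℝ) : g = c • p - s :=
  ext_inner_right ℝ fun π => by rw [h, inner_sub_left, real_inner_smul_left]

theorem combination_eq_zero_iff₂ (a b : ℝ) (f g : V →L[ℝ] ℝ) :
    a • f + b • g = 0 ↔ ∀ v, a * f v + b * g v = 0 := ContinuousLinearMap.ext_iff

theorem combination_eq_zero_iff₃ (a b c : ℝ) (f g h : V →L[ℝ] ℝ) :
    a • f + b • g + c • h = 0 ↔ ∀ v, a * f v + b * g v + c * h v = 0 := ContinuousLinearMap.ext_iff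

end

theorem add_smul_add_eq {P : Type*} [NormedAddCommGroup P] [NormedSpace ℝ P] (a b c ν : ℝ)
    {g π : P} (h : g = ν • π) (x y : P) :
    a • x + b • g + c • y = a • x + (b * ν) • π + c • y := by
  rw [h, smul_smul]

/-- For a coefficient `l < 1`, an almost everywhere selection is automatically square
integrable. -/
theorem exists_selection_iff {α E : Type*} [MeasurableSpace α] [NormedAddCommGroup E]
    [NormedSpace ℝ E] {μ : Measure α} {S : Set (Lp E 2 μ)} {s : α → Set E}
    (hS : ∀ om : Lp E 2 μ, om ∈ S ↔ ∀ᵐ x ∂μ, om x ∈ s x) {l ν : ℝ} (hν : 0 < ν) {π g : Lp E 2 μ}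
    (h0 : π = 0 → (0 : Lp E 2 μ) ∈ S) :
    (∃ om ∈ S, (1 - l) • om + (l * ν) • π + (1 - l) • g = 0) ↔
      ∀ᵐ x ∂μ, ∃ om ∈ s x, (1 - l) • om + (l * ν) • π x + (1 - l) • g x = 0 := by
  constructor
  · rintro ⟨om, hom, h⟩
    filter_upwards [(hS om).1 hom, (combination_eq_zero_iff_ae _ _ _ _ _ _).1 h] with x h1 h2
    exact ⟨om x, h1, h2⟩
  · intro H
    -- For `l = 1` the selection drops out, the equation forces `π = 0`, and `0` is an admissible
    -- element. Otherwise the equation determines the selection as a combination of `L²` functions.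
    by_cases hl : 1 - l = 0
    · have hl1 : l = 1 := by linarith
      subst hl1
      have hπ : π = 0 := by
        rw [Lp.ext_iff]
        filter_upwards [H, Lp.coeFn_zero E 2 μ] with x ⟨om, _, h2⟩ h3
        rw [sub_self, zero_smul, zero_smul, one_mul, zero_add, add_zero] at h2
        rw [(smul_eq_zero.1 h2).resolve_left hν.ne', h3]
        rfl
      exact ⟨0, h0 hπ, by simp [hπ]⟩
    · have e : (1 - l) • ((-(l * ν) / (1 - l)) • π - g) + (l * ν) • π + (1 - l) • g = 0 := by
        rw [smul_sub, smul_smul, mul_div_cancel₀ _ hl, neg_smul]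
        abel
      refine ⟨(-(l * ν) / (1 - l)) • π - g, (hS _).2 ?_, e⟩
      filter_upwards [H, (combination_eq_zero_iff_ae _ _ _ _ _ _).1 e] with x ⟨om, h1, h2⟩ h3
      have h4 : (1 - l) • (om - ((-(l * ν) / (1 - l)) • π - g : Lp E 2 μ) x) = 0 := by
        rw [smul_sub]
        have := h2.trans h3.symm
        have h5 := add_right_cancel (add_right_cancel this)
        rw [h5, sub_self]
      rw [← sub_eq_zero.1 ((smul_eq_zero.1 h4).resolve_left hl)]
      exact h1

namespace Data

variable {n : ℕ} {d : Data n}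

theorem plastDiss_zero (hd : d.Admissible) {z : d.Z} (hz : PosField z) : d.plastDiss z 0 = 0 := by
  obtain ⟨R, C, hh⟩ := hd.exists_isSupportFamily
  exact hh.integral_zero hz.nonneg

/-- The partial derivatives of the energy, in terms of the stress `σ`. -/
def EnergyDerivatives (d : Data n) (t : ℝ) (u : d.U) (z : d.Z) (p : d.P) (σ : L2 d.Ω (Sym n)) :
    Prop :=
  σ =ᵐ[volume.restrict d.Ω] d.stress t u z p ∧
  (∀ v : d.U, d.DuE t (u, z, p) v = ⟪σ, d.strainU v⟫_ℝ - d.F t (v : H1 d.Ω)) ∧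
  (∀ η : d.Z, d.DzE t (u, z, p) η = aForm z η + (∫ x in d.Ω, deriv d.W (field z x) * field η x)
    + ∫ x in d.Ω, 1 / 2 * ⟪deriv d.elast (field z x) (d.elasticStrain t u p x),
        d.elasticStrain t u p x⟫_ℝ * field η x) ∧
  d.DpE t (u, z, p) = d.μ • p - (devPart n).compLp σ

/-- The derivative of the stored energy along a curve of states. -/
def StateDerivative (d : Data n) (t : ℝ) (u : d.U) (z : d.Z) (p : d.P) (σ : L2 d.Ω (Sym n))
    (D : H1 d.Ω × d.Z × d.P →L[ℝ] ℝ) : Prop :=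
  HasFDerivAt d.storedEnergy D ((u : H1 d.Ω) + d.w t, z, p) ∧ d.EnergyDerivatives t u z p σ ∧
    ∀ v : H1 d.Ω, D (v, 0, 0) = ⟪σ, d.strainL v⟫_ℝ

set_option maxHeartbeats 1000000 in
theorem exists_stateDerivative (hd : d.Admissible) {z : d.Z} (hz : PosField z) (t : ℝ) (u : d.U)
    (p : d.P) : ∃ σ D, d.StateDerivative t u z p σ D := by
  obtain ⟨σ, χ₁, D₀, h₁⟩ := exists_elasticDerivative hd
    (d.strainL ((u : H1 d.Ω) + d.w t) - d.devInclL p) hz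
  obtain ⟨χ₂, h₂⟩ := exists_damageDerivative hd hz
  obtain ⟨D, hD⟩ := exists_storedDerivative ((u : H1 d.Ω) + d.w t) p h₁ h₂
  have key := @partial_formulas d.Z
    (Lp (Vec n) 2 ((volume.restrict d.Ω).prod (volume.restrict d.Ω))) _ _ _ _ (L2 d.Ω (Sym n)) d.P
    _ _ _ _ (H1 d.Ω) _ _
  obtain ⟨k1, k2, k3⟩ := @key (fun y => D y) d.strainL d.devInclL d.quotL χ₁ χ₂ d.μ σ z p
    (fun v' z' p' => hD.2 v' z' p')
  refine ⟨σ, D, hD.1, ⟨h₁.1, fun v => ?_, fun η => ?_, ?_⟩, k1⟩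
  · exact (DuE_apply_of_hasFDerivAt hd hz hD.1 v).trans
      (congrArg (fun c => c - d.F t (v : H1 d.Ω)) (k1 (v : H1 d.Ω)))
  · exact (DzE_apply_of_hasFDerivAt hd hz hD.1 η).trans ((k2 η).trans
      (congrArg₂ (fun a b => aForm z η + a + b) (h₂.1 η) (h₁.2.1 η)))
  · have key := @eq_smul_sub_of_inner_eq d.P _ _
    refine key fun π => ?_
    rw [← inner_devInclL]
    exact (inner_DpE_of_hasFDerivAt hd hz hD.1 π).trans (k3 π)

set_option maxHeartbeats 2000000 in
-- The first two lines are equations between functionals, compared on each test function by means of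
-- the explicit derivatives. The third rests on the localization of the plastic subdifferential.
theorem inclusions_iff_concreteInclusions (hd : d.Admissible) (l t : ℝ) (u : d.U) {z : d.Z}
    (hz : PosField z) (p : d.P) (u' : d.U) (z' : d.Z) (p' : d.P) :
    d.Inclusions l t (u, z, p) (u', z', p') ↔ d.ConcreteInclusions l t (u, z, p) (u', z', p') := by
  obtain ⟨T, hT⟩ := hd.exists_viscOperator
  obtain ⟨σ, D, hD⟩ := exists_stateDerivative hd hz t u p
  have hσ := hD.2.1.1
  have hu := hD.2.1.2.1
  have hz₁ := hD.2.1.2.2.1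
  have hp := hD.2.1.2.2.2
  have h1 : l • fderiv ℝ d.V2 u' + (1 - l) • d.DuE t (u, z, p) = 0 ↔ ∀ v : d.U,
      l * (∫ x in d.Ω, ⟪d.ν • d.visc x (strain (u' : H1 d.Ω) x), strain (v : H1 d.Ω) x⟫_ℝ)
      + (1 - l) * ((∫ x in d.Ω, ⟪d.stress t u z p x, strain (v : H1 d.Ω) x⟫_ℝ)
        - d.F t (v : H1 d.Ω)) = 0 := by
    have key := @combination_eq_zero_iff₂ d.U _ _
    refine (key l (1 - l) (fderiv ℝ d.V2 u') (d.DuE t (u, z, p))).trans (forall_congr' fun v => ?_)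
    have e1 : ∫ x in d.Ω, ⟪d.ν • d.visc x (strain (u' : H1 d.Ω) x), strain (v : H1 d.Ω) x⟫_ℝ =
        fderiv ℝ d.V2 u' v :=
      (integral_inner_smul_mulOperator hT d.ν (d.strainU u') (d.strainU v)).trans
        (fderiv_V2 hd hT u' v).symm
    have e2 : ∫ x in d.Ω, ⟪d.stress t u z p x, strain (v : H1 d.Ω) x⟫_ℝ = ⟪σ, d.strainU v⟫_ℝ :=
      integral_inner_congr hσ (d.strainU v)
    exact Iff.of_eq (congrArg (fun c => c = (0 : ℝ))
      (congrArg₂ (fun a b => l * a + (1 - l) * b) e1.symm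
        ((hu v).trans (congrArg (fun c => c - d.F t (v : H1 d.Ω)) e2.symm))))
  have h2 : ∀ χ : d.Z →L[ℝ] ℝ,
      (1 - l) • χ + l • fderiv ℝ d.R2 z' + (1 - l) • d.DzE t (u, z, p) = 0 ↔ ∀ η : d.Z,
      (1 - l) * χ η + l * (∫ x in d.Ω, field z' x * field η x)
        + (1 - l) * (aForm z η + (∫ x in d.Ω, deriv d.W (field z x) * field η x)
        + (∫ x in d.Ω, 1 / 2 * ⟪deriv d.elast (field z x) (d.elasticStrain t u p x),
            d.elasticStrain t u p x⟫_ℝ * field η x)) = 0 := fun χ => by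
    have key := @combination_eq_zero_iff₃ d.Z _ _
    refine (key (1 - l) l (1 - l) χ (fderiv ℝ d.R2 z') (d.DzE t (u, z, p))).trans
      (forall_congr' fun η => ?_)
    have e1 : ∫ x in d.Ω, field z' x * field η x = fderiv ℝ d.R2 z' η :=
      (inner_L2_real _ _).symm.trans (fderiv_R2 z' η).symm
    exact Iff.of_eq (congrArg (fun c => c = (0 : ℝ))
      (congrArg₂ (fun a b => (1 - l) * χ η + l * a + (1 - l) * b) e1.symm (hz₁ η)))
  have h3 : (∃ om ∈ d.plastSubdiff z p',
      (1 - l) • om + l • gradient d.H2 p' + (1 - l) • d.DpE t (u, z, p) = 0) ↔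
      ∀ᵐ x ∂(volume.restrict d.Ω), ∃ om ∈ d.plastDensitySubdiff (field z x) (p' x),
        (1 - l) • om + (l * d.ν) • p' x
          + (1 - l) • (d.μ • p x - devPart n (d.stress t u z p x)) = 0 := by
    have key := exists_selection_iff (S := d.plastSubdiff z p') (l := l) (π := p')
      (g := d.DpE t (u, z, p)) (fun om => mem_plastSubdiff_iff_ae hd hz om p') hd.pos_ν
      (fun h0 ρ => by
        have k0 : ⟪(0 : d.P), ρ - p'⟫_ℝ = 0 := by
          have key := @inner_zero_left ℝ d.P _ _ _
          exact key (ρ - p')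
        rw [k0, h0, plastDiss_zero hd hz, sub_zero]
        exact plastDiss_nonneg hd hz ρ)
    have e1 : ∀ om : d.P, (1 - l) • om + l • gradient d.H2 p' + (1 - l) • d.DpE t (u, z, p) =
        (1 - l) • om + (l * d.ν) • p' + (1 - l) • d.DpE t (u, z, p) := fun om => by
      have key := @add_smul_add_eq d.P _ _
      exact key (1 - l) l (1 - l) d.ν (gradient_H2 p') om (d.DpE t (u, z, p))
    have e2 : ∀ᵐ x ∂(volume.restrict d.Ω),
        d.DpE t (u, z, p) x = d.μ • p x - devPart n (d.stress t u z p x) := by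
      rw [hp]
      filter_upwards [Lp.coeFn_sub (d.μ • p) ((devPart n).compLp σ), Lp.coeFn_smul d.μ p,
        (devPart n).coeFn_compLp σ, hσ] with x k1 k2 k3 k4
      rw [k1, Pi.sub_apply, k2, k3, k4]
      rfl
    simp only [e1]
    refine key.trans (eventually_congr ?_)
    filter_upwards [e2] with x hx
    rw [hx]
  refine ⟨fun h => ⟨?_, ?_, ?_⟩, fun h => ⟨?_, ?_, ?_⟩⟩
  · exact h1.1 h.u_eq
  · exact h.z_incl.imp fun χ k => ⟨k.1, (h2 χ).1 k.2⟩
  · exact h3.1 h.p_incl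
  · exact h1.2 h.u_eq
  · exact h.z_incl.imp fun χ k => ⟨k.1, (h2 χ).2 k.2⟩
  · exact h3.2 h.p_incl

end Data

/-! ### The chain rule along absolutely continuous curves -/

/-- The difference is split as `(A₁ - A₀) e₁ + A₀ (e₁ - e₀)`. This form serves the continuity of the
stress along a curve. -/
theorem norm_sub_le_of_mul {α E : Type*} [MeasurableSpace α] [NormedAddCommGroup E]
    [InnerProductSpace ℝ E] {μ : Measure α} {A₀ A₁ : α → (E →L[ℝ] E)} {C c : ℝ}
    {σ₀ σ₁ e₀ e₁ : Lp E 2 μ} (hA₀ : AEStronglyMeasurable A₀ μ) (hC : ∀ᵐ x ∂μ, ‖A₀ x‖ ≤ C)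
    (hc : ∀ᵐ x ∂μ, ‖A₁ x - A₀ x‖ ≤ c) (h₀ : σ₀ =ᵐ[μ] fun x => A₀ x (e₀ x))
    (h₁ : σ₁ =ᵐ[μ] fun x => A₁ x (e₁ x)) : ‖σ₁ - σ₀‖ ≤ c * ‖e₁‖ + C * ‖e₁ - e₀‖ := by
  obtain ⟨T, hT⟩ := exists_mulOperator hA₀ hC
  have hσ : σ₀ = T e₀ := Lp.ext (h₀.trans (hT e₀).symm)
  have e : σ₁ - σ₀ = (σ₁ - T e₁) + T (e₁ - e₀) := by
    rw [hσ, map_sub]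
    abel
  rw [e]
  refine (norm_add_le _ _).trans (add_le_add ?_ ?_)
  · refine Lp.norm_le_mul_norm_of_ae_le_mul ?_
    filter_upwards [hc, h₁, hT e₁, Lp.coeFn_sub σ₁ (T e₁)] with x k1 k2 k3 k4
    rw [k4, Pi.sub_apply, k2, k3]
    exact (A₁ x - A₀ x).le_of_opNorm_le k1 _
  · refine Lp.norm_le_mul_norm_of_ae_le_mul ?_
    filter_upwards [hC, hT (e₁ - e₀)] with x k1 k2
    rw [k2]
    exact (A₀ x).le_of_opNorm_le k1 _

theorem integrableOn_bilinear {X Y : Type*} [NormedAddCommGroup X] [NormedSpace ℝ X]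
    [NormedAddCommGroup Y] [NormedSpace ℝ Y] (B : X →L[ℝ] Y →L[ℝ] ℝ) {f : ℝ → X} {g : ℝ → Y}
    {a b : ℝ} (hf : IntegrableOn f (Ioo a b)) (hg : ContinuousOn g (Icc a b)) :
    IntegrableOn (fun s => B (f s) (g s)) (Ioo a b) := by
  obtain ⟨M, hM⟩ := isCompact_Icc.exists_bound_of_continuousOn hg
  have hgm : AEStronglyMeasurable g (volume.restrict (Ioo a b)) :=
    (hg.mono Ioo_subset_Icc_self).aestronglyMeasurable measurableSet_Ioo
  refine Integrable.mono' (g := fun s => ‖B‖ * M * ‖f s‖) (hf.norm.const_mul _)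
    (B.aestronglyMeasurable_comp₂ hf.aestronglyMeasurable hgm) ?_
  filter_upwards [ae_restrict_mem measurableSet_Ioo] with s hs
  calc ‖B (f s) (g s)‖ ≤ ‖B‖ * ‖f s‖ * ‖g s‖ := B.le_opNorm₂ _ _
    _ ≤ ‖B‖ * ‖f s‖ * M := by
      gcongr
      exact hM s (Ioo_subset_Icc_self hs)
    _ = ‖B‖ * M * ‖f s‖ := by ring

theorem absolutelyContinuous_continuousOn {X : Type*} [NormedAddCommGroup X]
    [InnerProductSpace ℝ X] [CompleteSpace X] [SecondCountableTopology X] {f : ℝ → X} {a b : ℝ}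
    (hab : a < b) (hf : AbsolutelyContinuousOnInterval f a b) : ContinuousOn f (Icc a b) := by
  have h := hf.continuousOn
  rwa [uIcc_of_le hab.le] at h

/-- The real inner product as a continuous bilinear map. -/
def realInner (V : Type*) [NormedAddCommGroup V] [InnerProductSpace ℝ V] : V →L[ℝ] V →L[ℝ] ℝ :=
  (innerₗ V).mkContinuous₂ 1 fun x y => by
    rw [one_mul]
    exact norm_inner_le_norm x y

section

variable {U V Z P Y : Type*} [NormedAddCommGroup U] [InnerProductSpace ℝ U] [CompleteSpace U]
  [SecondCountableTopology U] [NormedAddCommGroup V] [InnerProductSpace ℝ V] [CompleteSpace V]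
  [SecondCountableTopology V] [NormedAddCommGroup Z] [InnerProductSpace ℝ Z] [CompleteSpace Z]
  [SecondCountableTopology Z] [NormedAddCommGroup P] [InnerProductSpace ℝ P] [CompleteSpace P]
  [SecondCountableTopology P] [NormedAddCommGroup Y] [InnerProductSpace ℝ Y]

/-- The chain rule for a curve of functionals composed with a change of variables. -/
theorem ae_hasDerivAt_comp_timeChange_dual {S T : ℝ} {t : ℝ → ℝ} {F : ℝ → V →L[ℝ] ℝ} (hS : 0 < S)
    (hT : 0 < T) (hac : AbsolutelyContinuousOnInterval t 0 S) (hmono : MonotoneOn t (Icc 0 S))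
    (hrange : ∀ s ∈ Icc 0 S, t s ∈ Icc 0 T) (hF : AbsolutelyContinuousOnInterval F 0 T) :
    ∃ f : ℝ → V →L[ℝ] ℝ, IntegrableOn f (Ioo 0 S) ∧
      (∀ᵐ s ∂(volume.restrict (Ioo 0 S)), HasDerivAt (fun s => F (t s)) (f s) s) ∧
      ∀ᵐ s ∂(volume.restrict (Ioo 0 S)), (deriv t s = 0 → f s = 0) ∧
        (deriv t s ≠ 0 → ∃ F', HasDerivAt F F' (t s) ∧ f s = deriv t s • F') := by
  -- The Riesz isomorphism moves the curve of functionals into `V`, where the result for separable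
  -- Hilbert spaces applies.
  let J : (V →L[ℝ] ℝ) →L[ℝ] V := LinearMap.mkContinuous
    { toFun := (InnerProductSpace.toDual ℝ V).symm
      map_add' := map_add _
      map_smul' := fun c x => by simp } 1 fun x => by simp
  let J' : V →L[ℝ] (V →L[ℝ] ℝ) := realInner V
  have hJ : ∀ G, J' (J G) = G := fun G => by
    ext v
    exact InnerProductSpace.toDual_symm_apply
  have hG : AbsolutelyContinuousOnInterval (fun r => J (F r)) 0 T :=
    absolutelyContinuous_lipschitz_comp J.lipschitz hF
  obtain ⟨h1, h2, h3⟩ := ae_hasDerivAt_comp_timeChange hS hT hac hmono hrange hG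
  refine ⟨fun s => J' (deriv t s • deriv (fun r => J (F r)) (t s)), J'.integrable_comp h1, ?_, ?_⟩
  · filter_upwards [h2] with s hs
    have := J'.hasFDerivAt.comp_hasDerivAt s hs
    refine this.congr_of_eventuallyEq (Eventually.of_forall fun r => ?_)
    exact (hJ _).symm
  · filter_upwards [h3] with s hs
    refine ⟨fun h => by rw [h, zero_smul, map_zero], fun h => ⟨J' (deriv (fun r => J (F r)) (t s)),
      ?_, map_smul J' _ _⟩⟩
    have := J'.hasFDerivAt.comp_hasDerivAt (t s) (hs h).hasDerivAt
    refine this.congr_of_eventuallyEq (Eventually.of_forall fun r => ?_)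
    exact (hJ _).symm

/-- `A`, `B`, `G` and `π` are the partial derivatives of the energy
`(t, u, z, p) ↦ Ψ (i u + w t, z, p) - F t (i u + w t)`, and `σ` is the stress. -/
def PartialDerivatives (Ψ : V × Z × P → ℝ) (i : U →L[ℝ] V) (L : V →L[ℝ] Y) (w : ℝ → V)
    (F : ℝ → V →L[ℝ] ℝ) (t : ℝ) (u : U) (z : Z) (p : P) (σ : Y) (A : U →L[ℝ] ℝ) (B : Z →L[ℝ] ℝ)
    (G : P) (π : ℝ) : Prop :=
  ∃ D : V × Z × P →L[ℝ] ℝ, HasFDerivAt Ψ D (i u + w t, z, p) ∧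
    (∀ v, D (v, 0, 0) = ⟪σ, L v⟫_ℝ) ∧ (∀ v, A v = D (i v, 0, 0) - F t (i v)) ∧
    (∀ η, B η = D (0, η, 0)) ∧ (∀ ρ, ⟪G, ρ⟫_ℝ = D (0, 0, ρ)) ∧
    ∀ w' F', HasDerivAt w w' t → HasDerivAt F F' t → π = D (w', 0, 0) - (F' (i u + w t) + F t w')

/-- For almost every `s` the components of the curve and the loads composed with `t` are
differentiable at `s`, and the stored energy has a joint Fréchet derivative at the current state.
The power `π t'` is rewritten by means of the stress and of the derivatives of the composed loads,
so no measurability of `π` itself is required. -/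
theorem energy_chain_rule {Ψ : V × Z × P → ℝ} {i : U →L[ℝ] V} {L : V →L[ℝ] Y} {w : ℝ → V}
    {F : ℝ → V →L[ℝ] ℝ} {S T : ℝ} {t : ℝ → ℝ} {u : ℝ → U} {z : ℝ → Z} {p : ℝ → P} {σ : ℝ → Y}
    {A : ℝ → U →L[ℝ] ℝ} {B : ℝ → Z →L[ℝ] ℝ} {G : ℝ → P} {π : ℝ → ℝ} {φ : ℝ → ℝ} (hS : 0 < S)
    (hT : 0 < T) (hac : AbsolutelyContinuousOnInterval t 0 S) (hmono : MonotoneOn t (Icc 0 S))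
    (hrange : ∀ s ∈ Icc 0 S, t s ∈ Icc 0 T) (hw : AbsolutelyContinuousOnInterval w 0 T)
    (hF : AbsolutelyContinuousOnInterval F 0 T) (hu : AbsolutelyContinuousOnInterval u 0 S)
    (hz : AbsolutelyContinuousOnInterval z 0 S) (hp : AbsolutelyContinuousOnInterval p 0 S)
    (hσ : ContinuousOn σ (Icc 0 S))
    (hφ : ∀ s ∈ Icc 0 S, φ s = Ψ (i (u s) + w (t s), z s, p s) - F (t s) (i (u s) + w (t s)))
    (hD : ∀ s ∈ Icc 0 S, PartialDerivatives Ψ i L w F (t s) (u s) (z s) (p s) (σ s) (A s) (B s)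
      (G s) (π s)) :
    IntegrableOn (fun s => π s * deriv t s) (Ioo 0 S) ∧ ∀ᵐ s ∂(volume.restrict (Ioo 0 S)),
      HasDerivAt φ
        (A s (deriv u s) + B s (deriv z s) + ⟪G s, deriv p s⟫_ℝ + π s * deriv t s) s := by
  obtain ⟨w1, w2, w3⟩ := ae_hasDerivAt_comp_timeChange hS hT hac hmono hrange hw
  obtain ⟨f, f1, f2, f3⟩ := ae_hasDerivAt_comp_timeChange_dual hS hT hac hmono hrange hF
  -- Where `t' = 0` both sides vanish, whatever default value `π` has there. Where `t' ≠ 0` the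
  -- loads are, for almost every such `s`, differentiable at `t s`, and `π` is given by its formula.
  have hpow : ∀ᵐ s ∂(volume.restrict (Ioo 0 S)), π s * deriv t s =
      ⟪σ s, L (deriv t s • deriv w (t s))⟫_ℝ - (f s (i (u s) + w (t s)) +
        F (t s) (deriv t s • deriv w (t s))) := by
    filter_upwards [w3, f3, ae_restrict_mem measurableSet_Ioo] with s h1 h2 hs
    by_cases h0 : deriv t s = 0
    · rw [h2.1 h0, h0]
      simp
    · obtain ⟨F', hF', hf⟩ := h2.2 h0
      obtain ⟨D, -, hD1, -, -, -, hD2⟩ := hD s (Ioo_subset_Icc_self hs)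
      rw [hD2 _ _ (h1 h0).hasDerivAt hF', hD1, hf]
      simp only [map_smul, inner_smul_right, smul_eq_mul, smul_apply]
      ring
  have ht : ContinuousOn t (Icc 0 S) := absolutelyContinuous_continuousOn hS hac
  have hwc : ContinuousOn (fun s => w (t s)) (Icc 0 S) :=
    (absolutelyContinuous_continuousOn hT hw).comp ht hrange
  have hFc' : ContinuousOn F (Icc 0 T) := by
    have h := hF.continuousOn
    rwa [uIcc_of_le hT.le] at h
  have hFc : ContinuousOn (fun s => F (t s)) (Icc 0 S) := hFc'.comp ht hrange
  have hvc : ContinuousOn (fun s => i (u s) + w (t s)) (Icc 0 S) :=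
    (i.continuous.comp_continuousOn (absolutelyContinuous_continuousOn hS hu)).add hwc
  refine ⟨?_, ?_⟩
  · have i1 := integrableOn_bilinear ((realInner Y).flip.comp L) w1 hσ
    have i2 := integrableOn_bilinear (ContinuousLinearMap.id ℝ (V →L[ℝ] ℝ)) f1 hvc
    have i3 := integrableOn_bilinear (ContinuousLinearMap.id ℝ (V →L[ℝ] ℝ)).flip w1 hFc
    refine IntegrableOn.congr_fun_ae ((i1.sub (i2.add i3))) ?_
    filter_upwards [hpow] with s hs
    rw [hs]
    rfl
  · filter_upwards [hpow, w2, f2, (absolutelyContinuous_hilbert hS hu).1,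
      (absolutelyContinuous_hilbert hS hz).1, (absolutelyContinuous_hilbert hS hp).1,
      ae_restrict_mem measurableSet_Ioo] with s h1 h2 h3 hu' hz' hp' hs
    obtain ⟨D, hDd, hD1, hA, hB, hG, -⟩ := hD s (Ioo_subset_Icc_self hs)
    have hv : HasDerivAt (fun r => i (u r) + w (t r))
        (i (deriv u s) + deriv t s • deriv w (t s)) s :=
      (i.hasFDerivAt.comp_hasDerivAt s hu'.hasDerivAt).add h2
    have h := hasDerivAt_loaded_energy (v := fun r => i (u r) + w (t r)) (F := fun r => F (t r))
      hDd hv hz'.hasDerivAt hp'.hasDerivAt h3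
    have e : D (i (deriv u s) + deriv t s • deriv w (t s), deriv z s, deriv p s) =
        D (i (deriv u s), 0, 0) + D (deriv t s • deriv w (t s), 0, 0) + D (0, deriv z s, 0) +
          D (0, 0, deriv p s) := by
      rw [← map_add, ← map_add, ← map_add]
      simp
    have e2 : A s (deriv u s) + B s (deriv z s) + ⟪G s, deriv p s⟫_ℝ + π s * deriv t s =
        D (i (deriv u s) + deriv t s • deriv w (t s), deriv z s, deriv p s) -
          (f s (i (u s) + w (t s)) + F (t s) (i (deriv u s) + deriv t s • deriv w (t s))) := by
      rw [e, hA, hB, hG, h1, hD1 (deriv t s • deriv w (t s)), map_add (F (t s))]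
      ring
    rw [e2]
    refine h.congr_of_eventuallyEq ?_
    filter_upwards [Icc_mem_nhds hs.1 hs.2] with r hr
    exact hφ r hr

end

theorem absolutelyContinuous_fst {X Y : Type*} [PseudoMetricSpace X] [PseudoMetricSpace Y]
    {f : ℝ → X × Y} {a b : ℝ} (h : AbsolutelyContinuousOnInterval f a b) :
    AbsolutelyContinuousOnInterval (fun s => (f s).1) a b :=
  absolutelyContinuous_lipschitz_comp (g := Prod.fst) LipschitzWith.prod_fst h

theorem absolutelyContinuous_snd {X Y : Type*} [PseudoMetricSpace X] [PseudoMetricSpace Y]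
    {f : ℝ → X × Y} {a b : ℝ} (h : AbsolutelyContinuousOnInterval f a b) :
    AbsolutelyContinuousOnInterval (fun s => (f s).2) a b :=
  absolutelyContinuous_lipschitz_comp (g := Prod.snd) LipschitzWith.prod_snd h

theorem absolutelyContinuous_components {U Z P : Type*} [PseudoMetricSpace U] [PseudoMetricSpace Z]
    [PseudoMetricSpace P] {a b : ℝ} {t : ℝ → ℝ} {q : ℝ → U × Z × P}
    (h : AbsolutelyContinuousOnInterval (fun s => (t s, q s)) a b) :
    AbsolutelyContinuousOnInterval t a b ∧ AbsolutelyContinuousOnInterval (fun s => (q s).1) a b ∧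
      AbsolutelyContinuousOnInterval (fun s => (q s).2.1) a b ∧
      AbsolutelyContinuousOnInterval (fun s => (q s).2.2) a b := by
  have hq := absolutelyContinuous_snd h
  have hq2 := absolutelyContinuous_snd hq
  exact ⟨absolutelyContinuous_fst h, absolutelyContinuous_fst hq, absolutelyContinuous_fst hq2,
    absolutelyContinuous_snd hq2⟩

section

variable {U Z P : Type*} [NormedAddCommGroup U] [InnerProductSpace ℝ U] [CompleteSpace U]
  [SecondCountableTopology U] [NormedAddCommGroup Z] [InnerProductSpace ℝ Z] [CompleteSpace Z]
  [SecondCountableTopology Z] [NormedAddCommGroup P] [InnerProductSpace ℝ P] [CompleteSpace P]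
  [SecondCountableTopology P]

/-- The product carries the maximum norm and is not a Hilbert space, so differentiability of the
curve is obtained from its components. -/
theorem ae_deriv_prod {a b : ℝ} (hab : a < b) {q : ℝ → U × Z × P}
    (hu : AbsolutelyContinuousOnInterval (fun s => (q s).1) a b)
    (hz : AbsolutelyContinuousOnInterval (fun s => (q s).2.1) a b)
    (hp : AbsolutelyContinuousOnInterval (fun s => (q s).2.2) a b) :
    (∀ᵐ s ∂(volume.restrict (Ioo a b)), deriv (fun s => (q s).1) s = (deriv q s).1 ∧
      deriv (fun s => (q s).2.1) s = (deriv q s).2.1 ∧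
      deriv (fun s => (q s).2.2) s = (deriv q s).2.2) ∧
    AEStronglyMeasurable (fun s => (deriv q s).1) (volume.restrict (Ioo a b)) ∧
    AEStronglyMeasurable (fun s => (deriv q s).2.1) (volume.restrict (Ioo a b)) ∧
    AEStronglyMeasurable (fun s => (deriv q s).2.2) (volume.restrict (Ioo a b)) := by
  obtain ⟨u1, u2, -⟩ := absolutelyContinuous_hilbert hab hu
  obtain ⟨z1, z2, -⟩ := absolutelyContinuous_hilbert hab hz
  obtain ⟨p1, p2, -⟩ := absolutelyContinuous_hilbert hab hp
  have h : ∀ᵐ s ∂(volume.restrict (Ioo a b)), deriv (fun s => (q s).1) s = (deriv q s).1 ∧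
      deriv (fun s => (q s).2.1) s = (deriv q s).2.1 ∧
      deriv (fun s => (q s).2.2) s = (deriv q s).2.2 := by
    filter_upwards [u1, z1, p1] with s h1 h2 h3
    have h4 : HasDerivAt q (deriv (fun s => (q s).1) s, deriv (fun s => (q s).2.1) s,
      deriv (fun s => (q s).2.2) s) s := h1.hasDerivAt.prodMk (h2.hasDerivAt.prodMk h3.hasDerivAt)
    rw [h4.deriv]
    exact ⟨rfl, rfl, rfl⟩
  exact ⟨h, u2.aestronglyMeasurable.congr (h.mono fun s hs => hs.1),
    z2.aestronglyMeasurable.congr (h.mono fun s hs => hs.2.1),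
    p2.aestronglyMeasurable.congr (h.mono fun s hs => hs.2.2)⟩

end

theorem sum_eq_sub_neg_sum {a a' b b' c c' r : ℝ} (ha : a = a') (hb : b = b') (hc : c = c') :
    a + b + c + r = r - (-a' - b' - c') := by
  rw [ha, hb, hc]
  ring

theorem continuousOn_of_norm_sub_le {Z Y : Type*} [NormedAddCommGroup Z] [NormedAddCommGroup Y]
    {I : Set ℝ} {z : ℝ → Z} {e σ : ℝ → Y} (hz : ContinuousOn z I) (he : ContinuousOn e I)
    (h : ∀ s₀ ∈ I, ∃ c C δ : ℝ, 0 < δ ∧ ∀ s ∈ I, ‖z s - z s₀‖ < δ →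
      ‖σ s - σ s₀‖ ≤ c * ‖z s - z s₀‖ * ‖e s‖ + C * ‖e s - e s₀‖) : ContinuousOn σ I := by
  intro s₀ hs₀
  obtain ⟨c, C, δ, hδ, hle⟩ := h s₀ hs₀
  have h1 : Tendsto (fun s => ‖z s - z s₀‖) (𝓝[I] s₀) (𝓝 0) := by
    have := ((hz s₀ hs₀).tendsto.sub_const (z s₀)).norm
    rwa [sub_self, norm_zero] at this
  have h2 : Tendsto (fun s => ‖e s - e s₀‖) (𝓝[I] s₀) (𝓝 0) := by
    have := ((he s₀ hs₀).tendsto.sub_const (e s₀)).norm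
    rwa [sub_self, norm_zero] at this
  have h3 := ((h1.const_mul c).mul (he s₀ hs₀).tendsto.norm).add (h2.const_mul C)
  rw [mul_zero, zero_mul, mul_zero, add_zero] at h3
  refine tendsto_iff_norm_sub_tendsto_zero.2 (squeeze_zero' (Eventually.of_forall fun s =>
    norm_nonneg _) ?_ h3)
  filter_upwards [h1.eventually (gt_mem_nhds hδ), self_mem_nhdsWithin] with s hs hsI
  exact hle s hsI hs

namespace Data

variable {n : ℕ} {d : Data n}

set_option maxHeartbeats 1000000 in
-- Convergence of the damage in `H^m` is uniform convergence of the fields, so `elast(z)` converges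
-- uniformly and the stress in `L²`. Continuity makes the pairing of the stress with the integrable
-- rate of the load integrable.
theorem continuousOn_stress (hd : d.Admissible) {I : Set ℝ} {z : ℝ → d.Z}
    {e σ : ℝ → L2 d.Ω (Sym n)} (hz : ∀ s ∈ I, PosField (z s)) (hzc : ContinuousOn z I)
    (hec : ContinuousOn e I)
    (hσ : ∀ s ∈ I, σ s =ᵐ[volume.restrict d.Ω] fun x => d.elast (field (z s) x) (e s x)) :
    ContinuousOn σ I := by
  have key := @continuousOn_of_norm_sub_le d.Z (L2 d.Ω (Sym n)) _ _
  refine key hzc hec fun s₀ hs₀ => ?_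
  obtain ⟨k, hk, hemb⟩ := hd.exists_field_bound
  obtain ⟨α, β, hα, δ, hδ, hI⟩ := PosField.exists_ball hd (hz s₀ hs₀)
  obtain ⟨C, hC, hT⟩ := hd.elastDeriv_taylor (β := β) hα
  have h0 := PosField.ae_mem_Icc hδ hI
  refine ⟨C * k, C, δ, hδ, fun s hsI hs => ?_⟩
  have key := @norm_sub_le_of_mul (Vec n) (Sym n) _ _ _ (volume.restrict d.Ω)
  refine key (aestronglyMeasurable_elast hd (hz s₀ hs₀))
    (h0.mono fun x hx => (hT _ hx).1) ?_ (hσ s₀ hs₀) (hσ s hsI)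
  have h4 := hI _ hs
  rw [add_sub_cancel] at h4
  filter_upwards [h0, h4, hemb (z s - z s₀), field_add_ae (z s₀) (z s - z s₀)] with x k1 k2 k3 k4
  rw [add_sub_cancel] at k4
  rw [mul_assoc]
  refine ((hT _ k1).2.2 _ k2).1.trans (mul_le_mul_of_nonneg_left ?_ hC)
  rw [k4, add_sub_cancel_left]
  exact k3

/-- The rate at which the energy decreases along a rate `q'` at fixed time. -/
def energyRate (d : Data n) (t : ℝ) (q q' : d.Q) : ℝ :=
  -d.DuE t q q'.1 - d.DzE t q q'.2.1 - ⟪d.DpE t q, q'.2.2⟫_ℝ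

/-- The chain rule for the energy along a curve, with the measurability of its rate. -/
def CurveChainRule (d : Data n) (S : ℝ) (t : ℝ → ℝ) (q : ℝ → d.Q) : Prop :=
  IntegrableOn (fun s => d.dtE (t s) (q s) * deriv t s) (Ioo 0 S) ∧
  (∀ᵐ s ∂(volume.restrict (Ioo 0 S)), HasDerivAt (fun r => (d.energy (t r) (q r)).toReal)
    (d.dtE (t s) (q s) * deriv t s - d.energyRate (t s) (q s) (deriv q s)) s) ∧
  AEStronglyMeasurable (fun s => (deriv q s).1) (volume.restrict (Ioo 0 S)) ∧
  AEStronglyMeasurable (fun s => (deriv q s).2.1) (volume.restrict (Ioo 0 S)) ∧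
  AEStronglyMeasurable (fun s => (deriv q s).2.2) (volume.restrict (Ioo 0 S)) ∧
  AEStronglyMeasurable (fun s => (q s).2.1) (volume.restrict (Ioo 0 S))

set_option maxHeartbeats 2000000 in
theorem IsParamCurve.chainRule (hd : d.Admissible) {S : ℝ} (hS : 0 < S) {t : ℝ → ℝ} {q : ℝ → d.Q}
    (hc : d.IsParamCurve S t q) (hdom : ∀ s ∈ Icc 0 S, PosField (q s).2.1) :
    d.CurveChainRule S t q := by
  have := hd.completeSpace_Z
  have key := @absolutelyContinuous_components d.U d.Z d.P _ _ _
  obtain ⟨hat, hau, haz, hap⟩ := key hc.ac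
  have key := @ae_deriv_prod d.U d.Z d.P _ _ _ _ _ _ _ _ _ _ _ _
  obtain ⟨hdq, hmu, hmz, hmp⟩ := key hS hau haz hap
  -- Outside `[0, S]` the state may leave the domain of the energy; the stress is set to `0` there.
  have hex : ∀ s, ∃ σ, s ∈ Icc 0 S → ∃ D, d.StateDerivative (t s) (q s).1 (q s).2.1 (q s).2.2 σ D :=
    fun s => by
      by_cases hs : s ∈ Icc 0 S
      · exact (exists_stateDerivative hd (hdom s hs) (t s) (q s).1 (q s).2.2).imp fun σ h _ => h
      · exact ⟨0, fun h => absurd h hs⟩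
  choose σ hσ using hex
  have key := @absolutelyContinuous_continuousOn (H1 d.Ω) _ _ _ _
  have hwc : ContinuousOn d.w (Icc 0 d.T) := key hd.pos_T hd.w_ac
  have key := @absolutelyContinuous_continuousOn d.U _ _ _ _
  have huc : ContinuousOn (fun s => (q s).1) (Icc 0 S) := key hS hau
  have key := @absolutelyContinuous_continuousOn d.Z _ _ _ _
  have hzc : ContinuousOn (fun s => (q s).2.1) (Icc 0 S) := key hS haz
  have key := @absolutelyContinuous_continuousOn d.P _ _ _ _
  have hpc : ContinuousOn (fun s => (q s).2.2) (Icc 0 S) := key hS hap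
  have htc : ContinuousOn t (Icc 0 S) := absolutelyContinuous_continuousOn hS hat
  have hvc : ContinuousOn (fun s => ((q s).1 : H1 d.Ω) + d.w (t s)) (Icc 0 S) :=
    ((H1Dir d.Ω d.Γ).subtypeL.continuous.comp_continuousOn huc).add (hwc.comp htc hc.range)
  have hec : ContinuousOn (fun s => d.strainL (((q s).1 : H1 d.Ω) + d.w (t s)) -
      d.devInclL (q s).2.2) (Icc 0 S) :=
    (d.strainL.continuous.comp_continuousOn hvc).sub (d.devInclL.continuous.comp_continuousOn hpc)
  have hσc : ContinuousOn σ (Icc 0 S) := continuousOn_stress hd hdom hzc hec fun s hs => by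
    obtain ⟨D, hD⟩ := hσ s hs
    exact hD.2.1.1
  have key := @energy_chain_rule d.U (H1 d.Ω) d.Z d.P (L2 d.Ω (Sym n)) _ _ _ _ _ _ _ _ _ _ _ _ _ _
    _ _ _ _
  have main := @key d.storedEnergy (H1Dir d.Ω d.Γ).subtypeL d.strainL d.w d.F S d.T t
    (fun s => (q s).1) (fun s => (q s).2.1) (fun s => (q s).2.2) σ (fun s => d.DuE (t s) (q s))
    (fun s => d.DzE (t s) (q s)) (fun s => d.DpE (t s) (q s)) (fun s => d.dtE (t s) (q s))
    (fun s => (d.energy (t s) (q s)).toReal) hS hd.pos_T hat hc.mono hc.range hd.w_ac hd.F_ac hau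
    haz hap hσc (fun s hs => energy_toReal_eq hd (hdom s hs) (t s) (q s).1 (q s).2.2)
    (fun s hs => by
      obtain ⟨D, hD⟩ := hσ s hs
      exact ⟨D, hD.1, hD.2.2, DuE_apply_of_hasFDerivAt hd (hdom s hs) hD.1,
        DzE_apply_of_hasFDerivAt hd (hdom s hs) hD.1, inner_DpE_of_hasFDerivAt hd (hdom s hs) hD.1,
        fun w' F' hw hF => dtE_of_hasFDerivAt hd (hdom s hs) hD.1 hw hF⟩)
  refine ⟨main.1, ?_, hmu, hmz, hmp, (hzc.mono Ioo_subset_Icc_self).aestronglyMeasurable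
    measurableSet_Ioo⟩
  filter_upwards [main.2, hdq] with s h1 h2
  exact h1.congr_deriv (sum_eq_sub_neg_sum (congrArg (fun v => d.DuE (t s) (q s) v) h2.1)
    (congrArg (fun η => d.DzE (t s) (q s) η) h2.2.1)
    (congrArg (fun ρ => ⟪d.DpE (t s) (q s), ρ⟫_ℝ) h2.2.2))

end Data

/-! ### The energy-dissipation balance in differential form -/

/-- The balance at the final point makes the total dissipation finite, so the contact potential is
finite almost everywhere and integrable, and the energy is an indefinite integral. -/
theorem ae_hasDerivAt_of_balance {φ P : ℝ → ℝ} {c : ℝ → ℝ≥0∞} {S : ℝ} (hS : 0 < S)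
    (hc : AEMeasurable c (volume.restrict (Ioo 0 S))) (hP : IntegrableOn P (Ioo 0 S))
    (hbal : ∀ s ∈ Icc 0 S, (φ s : EReal) + ((∫⁻ r in Ioo 0 s, c r : ℝ≥0∞) : EReal) =
      (φ 0 : EReal) + ((∫ r in Ioo 0 s, P r : ℝ) : EReal)) :
    ∀ᵐ s ∂(volume.restrict (Ioo 0 S)), c s ≠ ⊤ ∧ HasDerivAt φ (P s - (c s).toReal) s := by
  have hfin : ∫⁻ r in Ioo 0 S, c r ≠ ⊤ := by
    intro h
    have := hbal S ⟨hS.le, le_rfl⟩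
    rw [h, EReal.coe_ennreal_top, EReal.coe_add_top, ← EReal.coe_add] at this
    exact EReal.coe_ne_top _ this.symm
  have hM : IntegrableOn (fun s => (c s).toReal) (Ioo 0 S) :=
    integrable_toReal_of_lintegral_ne_top hc hfin
  have hlt := ae_lt_top' hc hfin
  have hφ : ∀ s ∈ Icc 0 S, φ s = φ 0 + ∫ r in Ioo 0 s, (P r - (c r).toReal) := by
    intro s hs
    have hsub : Ioo 0 s ⊆ Ioo 0 S := Ioo_subset_Ioo_right hs.2
    have h1 := hbal s hs
    have h2 : ∫⁻ r in Ioo 0 s, c r ≠ ⊤ := ne_top_of_le_ne_top hfin (lintegral_mono_set hsub)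
    have h3 : ∫ r in Ioo 0 s, (c r).toReal = (∫⁻ r in Ioo 0 s, c r).toReal :=
      integral_toReal (hc.mono_measure (Measure.restrict_mono hsub le_rfl))
        (ae_restrict_of_ae_restrict_of_subset hsub hlt)
    rw [integral_sub (hP.mono_set hsub) (hM.mono_set hsub), h3]
    rw [← ENNReal.ofReal_toReal h2, EReal.coe_ennreal_ofReal, max_eq_left ENNReal.toReal_nonneg,
      ← EReal.coe_add, ← EReal.coe_add, EReal.coe_eq_coe_iff] at h1
    linarith
  filter_upwards [ae_hasDerivAt_of_eq_integral hS (hP.sub hM) hφ, hlt] with s h1 h2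
  exact ⟨h2.ne, h1⟩

/-- The pointwise identity is integrated by means of the absolute continuity of `φ`. Measurability
of `c` need not be assumed: almost everywhere `c` is the measurable function `P - φ'`. -/
theorem balance_of_ae_hasDerivAt {φ P : ℝ → ℝ} {c : ℝ → ℝ≥0∞} {S : ℝ} (hS : 0 < S)
    (hφ : AbsolutelyContinuousOnInterval φ 0 S) (hP : IntegrableOn P (Ioo 0 S))
    (hder : ∀ᵐ s ∂(volume.restrict (Ioo 0 S)), c s ≠ ⊤ ∧
      HasDerivAt φ (P s - (c s).toReal) s) :
    AEMeasurable c (volume.restrict (Ioo 0 S)) ∧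
    ∀ s ∈ Icc 0 S, (φ s : EReal) + ((∫⁻ r in Ioo 0 s, c r : ℝ≥0∞) : EReal) =
      (φ 0 : EReal) + ((∫ r in Ioo 0 s, P r : ℝ) : EReal) := by
  obtain ⟨-, h1, h2⟩ := absolutelyContinuous_hilbert hS hφ
  have hc : c =ᵐ[volume.restrict (Ioo 0 S)] fun s => ENNReal.ofReal (P s - deriv φ s) := by
    filter_upwards [hder] with s hs
    rw [hs.2.deriv, sub_sub_cancel, ENNReal.ofReal_toReal hs.1]
  have hnn : ∀ᵐ s ∂(volume.restrict (Ioo 0 S)), 0 ≤ P s - deriv φ s := by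
    filter_upwards [hder] with s hs
    rw [hs.2.deriv, sub_sub_cancel]
    exact ENNReal.toReal_nonneg
  refine ⟨(hP.sub h1).aestronglyMeasurable.aemeasurable.ennreal_ofReal.congr hc.symm,
    fun s hs => ?_⟩
  have hsub : Ioo 0 s ⊆ Ioo 0 S := Ioo_subset_Ioo_right hs.2
  have h3 : ∫⁻ r in Ioo 0 s, c r = ENNReal.ofReal (∫ r in Ioo 0 s, (P r - deriv φ r)) := by
    have hI : Integrable (fun r => P r - deriv φ r) (volume.restrict (Ioo 0 s)) :=
      (hP.sub h1).mono_set hsub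
    exact (lintegral_congr_ae (ae_restrict_of_ae_restrict_of_subset hsub hc)).trans
      (ofReal_integral_eq_lintegral_ofReal hI
        (ae_restrict_of_ae_restrict_of_subset hsub hnn)).symm
  have h4 := integral_nonneg_of_ae (ae_restrict_of_ae_restrict_of_subset hsub hnn)
  rw [h3, EReal.coe_ennreal_ofReal, max_eq_left h4, ← EReal.coe_add, ← EReal.coe_add,
    EReal.coe_eq_coe_iff, integral_sub (hP.mono_set hsub) (h1.mono_set hsub),
    ← h2 0 ⟨le_rfl, hS.le⟩ s hs hs.1]
  ring

/-! ### The switching coefficient -/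

theorem measurable_switchCoeff :
    Measurable fun x : ℝ × ℝ × ℝ => switchCoeff x.1 x.2.1 x.2.2 := by
  unfold switchCoeff
  refine Measurable.ite (measurableSet_lt measurable_const measurable_fst) measurable_const
    (Measurable.ite (measurableSet_eq_fun measurable_snd.fst measurable_const) measurable_const ?_)
  exact measurable_snd.snd.div ((measurable_snd.fst.pow_const 2).add measurable_snd.snd)

theorem switchCoeff_mem_Icc (t' D : ℝ) {m : ℝ} (hm : 0 ≤ m) :
    switchCoeff t' D m ∈ Icc (0 : ℝ) 1 := by
  unfold switchCoeff
  split_ifs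
  · exact ⟨le_rfl, zero_le_one⟩
  · exact ⟨zero_le_one, le_rfl⟩
  · exact ⟨by positivity, div_le_one_of_le₀ (by linarith [sq_nonneg D]) (by positivity)⟩

theorem mul_switchCoeff {t' : ℝ} (ht : 0 ≤ t') (D m : ℝ) : t' * switchCoeff t' D m = 0 := by
  rcases ht.eq_or_lt with h | h
  · rw [← h, zero_mul]
  · rw [switchCoeff, if_pos h, mul_zero]

/-- The coefficient is only almost everywhere measurable and almost everywhere in `[0, 1]`; a
truncated measurable representative has both properties everywhere. -/
theorem exists_measurable_clamp {α : Type*} [MeasurableSpace α] {μ : Measure α} {f : α → ℝ}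
    (hf : AEMeasurable f μ) (h : ∀ᵐ x ∂μ, f x ∈ Icc (0 : ℝ) 1) :
    ∃ l : α → ℝ, Measurable l ∧ (∀ x, l x ∈ Icc (0 : ℝ) 1) ∧ l =ᵐ[μ] f := by
  refine ⟨fun x => max 0 (min 1 (hf.mk f x)),
    measurable_const.max (measurable_const.min hf.measurable_mk),
    fun x => ⟨le_max_left _ _, max_le zero_le_one (min_le_left _ _)⟩, ?_⟩
  filter_upwards [h, hf.ae_eq_mk] with x h1 h2
  rw [← h2, min_eq_right h1.2, max_eq_right h1.1]

/-! ### Measurability of the dissipation rates along curves -/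

theorem aemeasurable_rate {α U Y Z L P : Type*} [MeasurableSpace α] {μ : Measure α}
    [NormedAddCommGroup U] [NormedSpace ℝ U] [NormedAddCommGroup Y] [InnerProductSpace ℝ Y]
    [NormedAddCommGroup Z] [NormedSpace ℝ Z] [NormedAddCommGroup L] [NormedSpace ℝ L]
    [NormedAddCommGroup P] (s : U →L[ℝ] Y) (T : Y →L[ℝ] Y) (ι : Z →L[ℝ] L) (c : ℝ)
    {u : α → U} {z : α → Z} {p : α → P} (hu : AEStronglyMeasurable u μ)
    (hz : AEStronglyMeasurable z μ) (hp : AEStronglyMeasurable p μ) :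
    AEMeasurable (fun x => √(c * ⟪T (s (u x)), s (u x)⟫_ℝ + ‖ι (z x)‖ ^ 2 + c * ‖p x‖ ^ 2)) μ := by
  have h1 : Continuous fun v : U => ⟪T (s v), s v⟫_ℝ :=
    (T.continuous.comp s.continuous).inner s.continuous
  have h2 : Continuous fun v : Z => ‖ι v‖ ^ 2 := ι.continuous.norm.pow 2
  have h3 : Continuous fun v : P => ‖v‖ ^ 2 := continuous_norm.pow 2
  exact ((((h1.comp_aestronglyMeasurable hu).aemeasurable.const_mul c).add
    (h2.comp_aestronglyMeasurable hz).aemeasurable).add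
    ((h3.comp_aestronglyMeasurable hp).aemeasurable.const_mul c)).sqrt

theorem continuous_integral_L2 {α : Type*} [MeasurableSpace α] {μ : Measure α}
    [IsFiniteMeasure μ] : Continuous fun f : Lp ℝ 2 μ => ∫ x, f x ∂μ := by
  have h : (fun f : Lp ℝ 2 μ => ∫ x, f x ∂μ) = fun f =>
      ⟪indicatorConstLp 2 MeasurableSet.univ (measure_ne_top μ univ) (1 : ℝ), f⟫_ℝ := by
    funext f
    rw [L2.inner_indicatorConstLp_one, setIntegral_univ]
  rw [h]
  exact continuous_const.inner continuous_id

theorem aemeasurable_integral_comp {α Z : Type*} {β : Type*} [MeasurableSpace α]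
    {μ : Measure α} [IsFiniteMeasure μ] [MeasurableSpace β] {ρ : Measure β} [NormedAddCommGroup Z]
    [NormedSpace ℝ Z] (ι : Z →L[ℝ] Lp ℝ 2 μ) {z : β → Z} (hz : AEStronglyMeasurable z ρ) :
    AEMeasurable (fun s => ∫ x, (ι (z s)) x ∂μ) ρ :=
  ((continuous_integral_L2.comp ι.continuous).comp_aestronglyMeasurable hz).aemeasurable

theorem aemeasurable_comp_prod {β Z L P : Type*} [MeasurableSpace β] {ρ : Measure β}
    [NormedAddCommGroup Z] [NormedSpace ℝ Z] [NormedAddCommGroup L] [NormedSpace ℝ L]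
    [NormedAddCommGroup P] (ι : Z →L[ℝ] L) {Φ : L × P → ℝ} (hΦ : Continuous Φ) {z : β → Z}
    {p : β → P} (hz : AEStronglyMeasurable z ρ) (hp : AEStronglyMeasurable p ρ) :
    AEMeasurable (fun s => Φ (ι (z s), p s)) ρ :=
  (hΦ.comp_aestronglyMeasurable
    ((ι.continuous.comp_aestronglyMeasurable hz).prodMk hp)).aemeasurable

theorem toReal_add_le_of_eq {a m c : ℝ≥0∞} {h : ℝ} (hh : 0 ≤ h)
    (hc : c = a + ENNReal.ofReal h + m) (hfin : c ≠ ⊤) : a ≠ ⊤ ∧ 0 ≤ c.toReal - a.toReal - h := by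
  subst hc
  have h1 : a + ENNReal.ofReal h ≠ ⊤ := ne_top_of_le_ne_top hfin le_self_add
  have h2 : a ≠ ⊤ := ne_top_of_le_ne_top h1 le_self_add
  have h3 : a.toReal + h ≤ (a + ENNReal.ofReal h + m).toReal := by
    rw [← ENNReal.toReal_ofReal hh, ← ENNReal.toReal_add h2 ENNReal.ofReal_ne_top,
      ENNReal.toReal_ofReal hh]
    exact ENNReal.toReal_mono hfin le_self_add
  exact ⟨h2, by linarith⟩

/-! ### Passage between solutions and the system along curves -/

namespace Data

variable {n : ℕ} {d : Data n}

theorem inDomain_of_energy_ne_top {t : ℝ} {q : d.Q} (h : d.energy t q ≠ ⊤) : d.InDomain q := by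
  by_contra hc
  exact h (if_neg hc)

theorem energy_eq_coe_toReal {t : ℝ} {q : d.Q} (h : d.InDomain q) :
    d.energy t q = ((d.energy t q).toReal : EReal) := by
  rw [energy, if_pos h, EReal.toReal_coe]

theorem aemeasurable_slopeRate (hd : d.Admissible) {α : Type*} [MeasurableSpace α] {ρ : Measure α}
    {q' : α → d.Q} (hu : AEStronglyMeasurable (fun s => (q' s).1) ρ)
    (hz : AEStronglyMeasurable (fun s => (q' s).2.1) ρ)
    (hp : AEStronglyMeasurable (fun s => (q' s).2.2) ρ) :
    AEMeasurable (fun s => d.slopeRate (q' s)) ρ := by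
  obtain ⟨T, hT⟩ := hd.exists_viscOperator
  have key := @aemeasurable_rate α d.U (L2 d.Ω (Sym n)) d.Z (L2 d.Ω ℝ) d.P _ ρ _ _ _ _ _ _ _ _ _
  have h := key d.strainU T d.fieldL d.ν hu hz hp
  have e : (fun s => d.slopeRate (q' s)) = fun s => √(d.ν * ⟪T (d.strainU (q' s).1),
      d.strainU (q' s).1⟫_ℝ + ‖d.fieldL (q' s).2.1‖ ^ 2 + d.ν * ‖(q' s).2.2‖ ^ 2) :=
    funext fun s => congrArg (fun c => √(d.ν * c + ‖field (q' s).2.1‖ ^ 2 + d.ν * ‖(q' s).2.2‖ ^ 2))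
      (viscSq_eq hT (q' s).1)
  rw [e]
  exact h

/-- Where it is finite the potential is a continuous linear functional of the rate, so measurability
of the curve of rates is enough. -/
theorem aemeasurable_damageDiss_toReal (hd : d.Admissible) {α : Type*} [MeasurableSpace α]
    {ρ : Measure α} {ζ : α → d.Z} (hζ : AEStronglyMeasurable ζ ρ)
    (hfin : ∀ᵐ s ∂ρ, d.damageDiss (ζ s) ≠ ⊤) :
    AEMeasurable (fun s => (d.damageDiss (ζ s)).toReal) ρ := by
  have := hd.isFiniteMeasure
  have key := @aemeasurable_integral_comp (Vec n) d.Z α _ (volume.restrict d.Ω) _ _ ρ _ _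
  refine (((key d.fieldL hζ).const_mul (-d.κ)).ennreal_ofReal.ennreal_toReal).congr ?_
  filter_upwards [hfin] with s hs
  exact congrArg ENNReal.toReal (damageDiss_eq_of_ne_top hd hs).symm

theorem aemeasurable_plastDiss (hd : d.Admissible) {α : Type*} [MeasurableSpace α]
    {ρ : Measure α} {z : α → d.Z} {π : α → d.P} (hz : AEStronglyMeasurable z ρ)
    (hπ : AEStronglyMeasurable π ρ) (hpos : ∀ᵐ s ∂ρ, PosField (z s)) :
    AEMeasurable (fun s => d.plastDiss (z s) (π s)) ρ := by
  have := hd.isFiniteMeasure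
  obtain ⟨R, C, hh⟩ := hd.exists_isSupportFamily
  have hc := hh.continuous_integral (μ := volume.restrict d.Ω)
  have key := @aemeasurable_comp_prod α d.Z (L2 d.Ω ℝ) d.P _ ρ _ _ _ _ _
  refine (key d.fieldL hc hz hπ).congr ?_
  filter_upwards [hpos] with s hs
  refine integral_congr_ae ?_
  filter_upwards [hs.nonneg] with x hx
  exact congrArg (fun c => d.plastDensity c (π s x)) (max_eq_left hx)

set_option maxHeartbeats 2000000 in
-- Balance and chain rule give two expressions for the derivative of the energy. Their comparison is
-- the equality case of the chain-rule inequality at almost every `s`.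
theorem IsBVSolution.exists_switching (hd : d.Admissible) {S : ℝ} (hS : 0 < S) {t : ℝ → ℝ}
    {q : ℝ → d.Q} (h : d.IsBVSolution S t q) :
    ∃ l, IsSwitching S t l ∧
      ∀ᵐ s ∂(volume.restrict (Ioo 0 S)), d.Inclusions (l s) (t s) (q s) (deriv q s) := by
  have hdom : ∀ s ∈ Icc 0 S, PosField (q s).2.1 := fun s hs =>
    inDomain_of_energy_ne_top (h.energy_finite s hs)
  have hchain := h.curve.chainRule hd hS hdom
  have hbal := ae_hasDerivAt_of_balance (φ := fun s => (d.energy (t s) (q s)).toReal) hS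
    h.contact_meas h.power_int fun s hs => by
      have h0 := h.balance s hs
      rw [energy_eq_coe_toReal (hdom s hs), energy_eq_coe_toReal (hdom 0 ⟨le_rfl, hS.le⟩)] at h0
      exact h0
  have hI : ∀ᵐ s ∂(volume.restrict (Ioo 0 S)), s ∈ Ioo 0 S := ae_restrict_mem measurableSet_Ioo
  have hpos : ∀ᵐ s ∂(volume.restrict (Ioo 0 S)), PosField (q s).2.1 :=
    hI.mono fun s hs => hdom s (Ioo_subset_Icc_self hs)
  have hrate : ∀ᵐ s ∂(volume.restrict (Ioo 0 S)),
      d.contact (t s) (q s) (deriv t s) (deriv q s) ≠ ⊤ ∧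
      (d.contact (t s) (q s) (deriv t s) (deriv q s)).toReal =
        d.energyRate (t s) (q s) (deriv q s) := by
    filter_upwards [hbal, hchain.2.1] with s h1 h2
    exact ⟨h1.1, sub_right_injective (h1.2.unique h2)⟩
  have hsplit : ∀ᵐ s ∂(volume.restrict (Ioo 0 S)), d.damageDiss (deriv q s).2.1 ≠ ⊤ ∧
      0 ≤ (d.contact (t s) (q s) (deriv t s) (deriv q s)).toReal -
        (d.damageDiss (deriv q s).2.1).toReal - d.plastDiss (q s).2.1 (deriv q s).2.2 := by
    filter_upwards [hrate, hpos] with s h1 h2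
    exact toReal_add_le_of_eq (plastDiss_nonneg hd h2 _) rfl h1.1
  -- The coefficient is expressed through the contact potential, whose measurability belongs to the
  -- notion of solution, and not through the slope. The same expression is recovered from the rate
  -- of the energy when the pointwise result is applied.
  have hmeas : AEMeasurable (fun s => switchCoeff (deriv t s) (d.slopeRate (deriv q s))
      ((d.contact (t s) (q s) (deriv t s) (deriv q s)).toReal -
        (d.damageDiss (deriv q s).2.1).toReal - d.plastDiss (q s).2.1 (deriv q s).2.2))
      (volume.restrict (Ioo 0 S)) := by
    refine measurable_switchCoeff.comp_aemeasurable ((measurable_deriv t).aemeasurable.prodMk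
      ((aemeasurable_slopeRate hd hchain.2.2.1 hchain.2.2.2.1 hchain.2.2.2.2.1).prodMk ?_))
    exact (h.contact_meas.ennreal_toReal.sub (aemeasurable_damageDiss_toReal hd hchain.2.2.2.1
      (hsplit.mono fun s hs => hs.1))).sub
      (aemeasurable_plastDiss hd hchain.2.2.2.2.2 hchain.2.2.2.2.1 hpos)
  obtain ⟨l, hl, hl01, hleq⟩ := exists_measurable_clamp hmeas
    (hsplit.mono fun s hs => switchCoeff_mem_Icc _ _ hs.2)
  refine ⟨l, ⟨hl, fun s _ => hl01 s, ?_⟩, ?_⟩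
  · filter_upwards [hleq, ae_deriv_nonneg h.curve.mono] with s h1 h2
    rw [h1]
    exact mul_switchCoeff h2 _ _
  · filter_upwards [hleq, hrate, hpos] with s h1 h2 h3
    rw [h1]
    exact (contact_properties hd h3 (t s) (q s).1 (q s).2.2 (deriv t s) (deriv q s).1
      (deriv q s).2.1 (deriv q s).2.2 h2.2).2.1 h2.1 rfl

set_option maxHeartbeats 2000000 in
-- The system turns the rate of the energy in the chain rule into the contact potential; absolute
-- continuity of the energy then allows integration to the balance.
theorem IsParamCurve.isBVSolution (hd : d.Admissible) {S : ℝ} (hS : 0 < S) {t : ℝ → ℝ}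
    {q : ℝ → d.Q} {l : ℝ → ℝ} (hc : d.IsParamCurve S t q) (hl : IsSwitching S t l)
    (hinc : ∀ᵐ s ∂(volume.restrict (Ioo 0 S)), d.Inclusions (l s) (t s) (q s) (deriv q s))
    {φ : ℝ → ℝ} (hφ : AbsolutelyContinuousOnInterval φ 0 S)
    (hen : ∀ s ∈ Icc 0 S, d.energy (t s) (q s) = (φ s : EReal))
    (hslope : ∀ᵐ s ∂(volume.restrict (Ioo 0 S)), deriv t s = 0 → d.slopeRate (deriv q s) = 0 →
      d.slope (t s) (q s) ≠ ⊤) : d.IsBVSolution S t q := by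
  have hne : ∀ s ∈ Icc 0 S, d.energy (t s) (q s) ≠ ⊤ := fun s hs => by
    rw [hen s hs]
    exact EReal.coe_ne_top _
  have hdom : ∀ s ∈ Icc 0 S, PosField (q s).2.1 := fun s hs => inDomain_of_energy_ne_top (hne s hs)
  have hchain := hc.chainRule hd hS hdom
  have hI : ∀ᵐ s ∂(volume.restrict (Ioo 0 S)), s ∈ Ioo 0 S := ae_restrict_mem measurableSet_Ioo
  have hder : ∀ᵐ s ∂(volume.restrict (Ioo 0 S)),
      d.contact (t s) (q s) (deriv t s) (deriv q s) ≠ ⊤ ∧ HasDerivAt φ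
        (d.dtE (t s) (q s) * deriv t s -
          (d.contact (t s) (q s) (deriv t s) (deriv q s)).toReal) s := by
    filter_upwards [hI, hinc, hslope, hchain.2.1, hl.switch, ae_deriv_nonneg hc.mono]
      with s hs h1 h2 h3 h4 h5
    have hs' := Ioo_subset_Icc_self hs
    have h6 := (contact_properties hd (hdom s hs') (t s) (q s).1 (q s).2.2 (deriv t s)
      (deriv q s).1 (deriv q s).2.1 (deriv q s).2.2 rfl).2.2 (l s) (hl.range s hs') h4 h1
      fun h => h2 (le_antisymm (not_lt.1 h) h5)
    refine ⟨h6.1, ?_⟩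
    have h7 : HasDerivAt φ (d.dtE (t s) (q s) * deriv t s -
        d.energyRate (t s) (q s) (deriv q s)) s := by
      refine h3.congr_of_eventuallyEq ?_
      filter_upwards [Icc_mem_nhds hs.1 hs.2] with r hr
      rw [hen r hr, EReal.toReal_coe]
    exact h7.congr_deriv (congrArg (fun x => d.dtE (t s) (q s) * deriv t s - x) h6.2.symm)
  have hb := balance_of_ae_hasDerivAt hS hφ hchain.1 hder
  refine ⟨hc, hne, hb.1, hchain.1, fun s hs => ?_⟩
  rw [hen s hs, hen 0 ⟨le_rfl, hS.le⟩]
  exact hb.2 s hs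

end Data

end DamagePlasticity

end

theorem proposition6 {n : ℕ} (d : DamagePlasticity.Data n) (hd : d.Admissible) :
    -- BV solutions satisfy the system with a switching function
    (∀ (S : ℝ) (t : ℝ → ℝ) (q : ℝ → d.Q), 0 < S → d.IsBVSolution S t q →
      ∃ l : ℝ → ℝ, DamagePlasticity.Data.IsSwitching S t l ∧
        ∀ᵐ s ∂(MeasureTheory.volume.restrict (Set.Ioo 0 S)),
          d.Inclusions (l s) (t s) (q s) (deriv q s)) ∧
    -- the abstract and the concrete form of the system are equivalent
    (∀ (l t : ℝ) (q q' : d.Q), l ∈ Set.Icc (0 : ℝ) 1 → t ∈ Set.Icc 0 d.T → d.InDomain q →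
      (d.Inclusions l t q q' ↔ d.ConcreteInclusions l t q q')) ∧
    -- the converse
    (∀ (S : ℝ) (t : ℝ → ℝ) (q : ℝ → d.Q) (l : ℝ → ℝ), 0 < S → d.IsParamCurve S t q →
      DamagePlasticity.Data.IsSwitching S t l →
      (∀ᵐ s ∂(MeasureTheory.volume.restrict (Set.Ioo 0 S)),
        d.Inclusions (l s) (t s) (q s) (deriv q s)) →
      (∃ φ : ℝ → ℝ, AbsolutelyContinuousOnInterval φ 0 S ∧
        ∀ s ∈ Set.Icc 0 S, d.energy (t s) (q s) = (φ s : EReal)) →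
      (∀ᵐ s ∂(MeasureTheory.volume.restrict (Set.Ioo 0 S)),
        deriv t s = 0 → d.slopeRate (deriv q s) = 0 → d.slope (t s) (q s) ≠ ⊤) →
      d.IsBVSolution S t q) := by
  exact ⟨fun S t q hS h => h.exists_switching hd hS,
    fun l t q q' _ _ hq => DamagePlasticity.Data.inclusions_iff_concreteInclusions hd l t q.1 hq
      q.2.2 q'.1 q'.2.1 q'.2.2,
    fun S t q l hS hc hl hinc ⟨φ, hφ, hen⟩ hslope => hc.isBVSolution hd hS hl hinc hφ hen hslope⟩
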